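/- Let $n\ge 3$, let $z_1,\dots,z_n\in\mathbb{C}$ be pairwise distinct, let $j_1,\dots,j_n\in-\tfrac12+\mathrm{i}\mathbb{R}$, and let $E_1,\dots,E_n\in\mathbb{C}$. Put $\delta_r=-j_r(j_r+1)$ and $$t(y)=\sum_{r=1}^n\Big(\frac{\delta_r}{(y-z_r)^2}+\frac{E_r}{y-z_r}\Big),$$ and assume that $\partial_y^2+t(y)$ is an oper on $\mathbb{P}^1\setminus\{z_1,\dots,z_n\}$, i.e. that $\lim_{y\to\infty}y^4t(y)$ exists and is finite. Let $\chi$ be a smooth single-valued function on $\mathbb{C}\setminus\{z_1,\dots,z_n\}$ with $$(\partial_y^2+t(y))\chi=0,\qquad (\partial_{\bar y}^2+\overline{t(y)})\chi=0 .$$ For $i\in\{0,1\}$ let $\Theta^{(n,i)}_\chi$ be defined by the integral $$\Theta^{(n,i)}_\chi(x_1,\dots,x_n)=\frac1{\pi^n}\int\prod_{r=1}^n\frac{d^2k_r\,e^{2\mathrm{i}\,\mathrm{Im}(k_rx_r)}}{|k_r|^{2j_r+2}}\;\prod_{a=0}^i\delta^{(2)}\Big(\sum_{r=1}^nz_r^ak_r\Big)\;|\hat\rho_i(\boldsymbol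 k)|^2\prod_{l=1}^{n-2-i}\chi\big(y_l(\boldsymbol k)\big)$$ in the sense of distributions, where $\hat\rho_i(\boldsymbol k)=\sum_{r=1}^nz_r^{1+i}k_r$ and where $y_1(\boldsymbol k),\dots,y_{n-2-i}(\boldsymbol k)$ are defined, up to permutations and on the support of the delta-distributions with $\hat\rho_i(\boldsymbol k)\neq0$, by $$k_r=\hat\rho_i(\boldsymbol k)\,\frac{\prod_{l=1}^{n-2-i}(z_r-y_l(\boldsymbol k))}{\prod_{s\ne r}(z_r-z_s)},\qquad r=1,\dots,n .$$ Define the differential operators $$\mathcal D_r^+=\partial_{x_r},\qquad \mathcal D_r^0=x_r\partial_{x_r}-j_r,\qquad \mathcal D_r^-=x_r^2\partial_{x_r}-2j_rx_r,\qquad \mathcal D^a=\sum_{r=1}^n\mathcal D_r^a,\qquad \widehat{\mathcal D}^+=\sum_{r=1}^nz_r\partial_{x_r},$$ $$\mathsf H_r=-2\sum_{s\neq r}\frac{\mathcal D_r^0\mathcal D_s^0-\frac12\big(\mathcal D_r^+\mathcal D_s^-+\mathcal D_r^-\mathcal D_s^+\big)}{z_r-z_s},\qquad r=1,\dots,n .$$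 Then, after pairing with any Schwartz function of $x\in\mathbb{C}^n$, the integral over $\boldsymbol k$ converges absolutely, $\Theta^{(n,i)}_\chi$ is a tempered distribution on $\mathbb{C}^n$, and in the sense of distributions, for $i\in\{0,1\}$ and $r=1,\dots,n$, $$\mathsf H_r\Theta^{(n,i)}_\chi=E_r\Theta^{(n,i)}_\chi,\qquad \mathcal D^+\Theta^{(n,i)}_\chi=0,\qquad \mathcal D^0\Theta^{(n,i)}_\chi=i\,\Theta^{(n,i)}_\chi\quad(\text{the factor }i\in\{0,1\}),$$ $$\mathcal D^-\Theta^{(n,0)}_\chi=0,\qquad \widehat{\mathcal D}^+\Theta^{(n,1)}_\chi=0 .$$ -/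

import Mathlib

open MeasureTheory Filter Topology
open scoped SchwartzMap LineDeriv ContDiff

noncomputable section

namespace Gaudin

/-! ### Opers on the punctured sphere and their single-valued solutions -/

/-- The Wirtinger derivative `∂_y f = (∂_1 f - i ∂_i f) / 2` of a function of one complex variable. -/
def wirtinger (f : ℂ → ℂ) (y : ℂ) : ℂ :=
  (1 / 2) * (fderiv ℝ f y 1 - Complex.I * fderiv ℝ f y Complex.I)

/-- The Wirtinger derivative `∂_ȳ f = (∂_1 f + i ∂_i f) / 2` of a function of one complex variable. -/
def wirtingerBar (f : ℂ → ℂ) (y : ℂ) : ℂ :=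
  (1 / 2) * (fderiv ℝ f y 1 + Complex.I * fderiv ℝ f y Complex.I)

variable {n : ℕ}

/-- The potential `t(y) = ∑_r (δ_r / (y - z_r)² + E_r / (y - z_r))`, where `δ_r = -j_r (j_r + 1)`, so
that the solutions of `u'' + t u = 0` have the exponents `j_r + 1` and `-j_r` at `z_r`. -/
def operPotential (z j E : Fin n → ℂ) (y : ℂ) : ℂ :=
  ∑ r, (-(j r * (j r + 1)) / (y - z r) ^ 2 + E r / (y - z r))

/-- `∂_y² + t(y)` is an oper on `ℙ¹ \ {z_1, …, z_n}`: the limit of `y⁴ t(y)` for `y → ∞` exists in `ℂ`. -/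
def IsOper (z j E : Fin n → ℂ) : Prop :=
  ∃ L : ℂ, Tendsto (fun y : ℂ => y ^ 4 * operPotential z j E y) (Bornology.cobounded ℂ) (𝓝 L)

/-- `χ` is a smooth single-valued function on `ℂ \ {z_1, …, z_n}` that satisfies
`(∂_y² + t(y)) χ = 0` and the complex conjugate equation `(∂_ȳ² + conj t(y)) χ = 0`. -/
structure IsOperSolution (z j E : Fin n → ℂ) (χ : ℂ → ℂ) : Prop where
  smooth : ContDiffOn ℝ ∞ χ (Set.range z)ᶜ
  holo_eq : ∀ y ∉ Set.range z,
    wirtinger (wirtinger χ) y + operPotential z j E y * χ y = 0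
  antiholo_eq : ∀ y ∉ Set.range z,
    wirtingerBar (wirtingerBar χ) y + (starRingEnd ℂ) (operPotential z j E y) * χ y = 0

/-! ### The integrals `Θ` -/

/-- `ρ̂_i(k) = ∑_r z_r^{1+i} k_r`. -/
def rhoHat (i : ℕ) (z k : Fin n → ℂ) : ℂ := ∑ r, z r ^ (1 + i) * k r

/-- The variables `y_1(k), …, y_{n-2-i}(k)`, unique up to permutations if `ρ̂_i(k) ≠ 0`, that satisfy
`k_r = ρ̂_i(k) ∏_l (z_r - y_l(k)) / ∏_{s ≠ r} (z_r - z_s)` for all `r`. -/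
def sepVars (i : ℕ) (z k : Fin n → ℂ) : Fin (n - 2 - i) → ℂ :=
  Classical.epsilon fun y => ∀ r,
    k r = rhoHat i z k * (∏ l, (z r - y l)) / ∏ s ∈ Finset.univ.erase r, (z r - z s)

/-- The point `k` with the prescribed moments `∑_r z_r^a k_r = c_a`, `a = 0, …, n - 1`, see
`moment_ofMoments`. -/
def ofMoments (z c : Fin n → ℂ) : Fin n → ℂ := Matrix.vecMul c (Matrix.vandermonde z)⁻¹

theorem moment_ofMoments {z : Fin n → ℂ} (hz : Function.Injective z) (c : Fin n → ℂ) (a : Fin n) :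
    ∑ r, z r ^ (a : ℕ) * ofMoments z c r = c a := by
  have hu : IsUnit (Matrix.vandermonde z).det :=
    isUnit_iff_ne_zero.mpr (Matrix.det_vandermonde_ne_zero_iff.mpr hz)
  have h : Matrix.vecMul (ofMoments z c) (Matrix.vandermonde z) = c := by
    rw [ofMoments, Matrix.vecMul_vecMul, Matrix.nonsing_inv_mul _ hu, Matrix.vecMul_one]
  have h' := congrFun h a
  simp only [Matrix.vecMul, dotProduct, Matrix.vandermonde_apply] at h'
  rw [← h']
  exact Finset.sum_congr rfl fun r _ => mul_comm _ _

/-- The vector of moments whose first `i + 1` entries vanish, and whose other entries are `c`. -/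
def extendMoments (i : ℕ) (c : Fin (n - (i + 1)) → ℂ) : Fin n → ℂ := fun a =>
  if h : i + 1 ≤ (a : ℕ) then c ⟨a - (i + 1), by omega⟩ else 0

/-- The measure `∏_{a=0}^{i} δ²(∑_r z_r^a k_r) d²k_1 ⋯ d²k_n` on `ℂⁿ`. In the coordinates
`c_a = ∑_r z_r^a k_r` Lebesgue measure is `|det (z_r^a)|⁻² d²c_0 ⋯ d²c_{n-1}`, and the
delta-distributions set `c_0, …, c_i` to zero. -/
def deltaMeasure (i : ℕ) (z : Fin n → ℂ) : Measure (Fin n → ℂ) :=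
  ENNReal.ofReal ((‖(Matrix.vandermonde z).det‖ ^ 2)⁻¹) •
    Measure.map (fun c : Fin (n - (i + 1)) → ℂ => ofMoments z (extendMoments i c)) volume

/-- The amplitude `π⁻ⁿ ∏_r |k_r|^{-2 j_r - 2} |ρ̂_i(k)|² ∏_l χ(y_l(k))`. -/
def amplitude (i : ℕ) (z j : Fin n → ℂ) (χ : ℂ → ℂ) (k : Fin n → ℂ) : ℂ :=
  1 / (Real.pi : ℂ) ^ n * (∏ r, (‖k r‖ : ℂ) ^ (-(2 * j r + 2))) *
    (‖rhoHat i z k‖ : ℂ) ^ 2 * ∏ l, χ (sepVars i z k l)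

/-- `∫ φ(x) e^{2 i Im(∑_r k_r x_r)} d²x_1 ⋯ d²x_n`. -/
def planeWavePairing (φ : 𝓢(Fin n → ℂ, ℂ)) (k : Fin n → ℂ) : ℂ :=
  ∫ x : Fin n → ℂ, φ x * Complex.exp (2 * Complex.I * ((∑ r, k r * x r).im : ℂ))

/-- `Θ` is the tempered distribution in the variables `x_1, …, x_n` that is represented by
`Θ(x) = π⁻ⁿ ∫ ∏_r d²k_r e^{2 i Im(k_r x_r)} |k_r|^{-2 j_r - 2} ∏_{a ≤ i} δ²(∑_r z_r^a k_r)
  |ρ̂_i(k)|² ∏_l χ(y_l(k))`: after pairing with any Schwartz function, the integral over `k` converges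
absolutely and gives the value of `Θ`. -/
def IsTheta (i : ℕ) (z j : Fin n → ℂ) (χ : ℂ → ℂ) (Θ : 𝓢'(Fin n → ℂ, ℂ)) : Prop :=
  ∀ φ : 𝓢(Fin n → ℂ, ℂ),
    Integrable (fun k => amplitude i z j χ k * planeWavePairing φ k) (deltaMeasure i z) ∧
      Θ φ = ∫ k, amplitude i z j χ k * planeWavePairing φ k ∂(deltaMeasure i z)

/-! ### Differential operators on distributions -/

/-- Continuous linear operators on tempered distributions in `n` complex variables. -/
abbrev Op (n : ℕ) := 𝓢'(Fin n → ℂ, ℂ) →L[ℂ] 𝓢'(Fin n → ℂ, ℂ)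

theorem hasTemperateGrowth_coord (r : Fin n) :
    Function.HasTemperateGrowth (fun x : Fin n → ℂ => x r) :=
  (ContinuousLinearMap.proj (R := ℝ) (φ := fun _ : Fin n => ℂ) r).hasTemperateGrowth

/-- Multiplication by the coordinate `x_r`. -/
def mulX (r : Fin n) : Op n := TemperedDistribution.smulLeftCLM ℂ (fun x : Fin n → ℂ => x r)

/-- The holomorphic partial derivative `∂/∂x_r = (∂/∂ Re x_r - i ∂/∂ Im x_r) / 2`. -/
def partialX (r : Fin n) : Op n :=
  (1 / 2 : ℂ) • (LineDeriv.lineDerivOpCLM ℂ 𝓢'(Fin n → ℂ, ℂ) (Pi.single r (1 : ℂ) : Fin n → ℂ) -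
    Complex.I •
      LineDeriv.lineDerivOpCLM ℂ 𝓢'(Fin n → ℂ, ℂ) (Pi.single r Complex.I : Fin n → ℂ))

/-- `D_r⁺ = ∂_{x_r}`. -/
def localPlus (r : Fin n) : Op n := partialX r

/-- `D_r⁰ = x_r ∂_{x_r} - j_r`. -/
def localZero (j : Fin n → ℂ) (r : Fin n) : Op n := mulX r * partialX r - j r • (1 : Op n)

/-- `D_r⁻ = x_r² ∂_{x_r} - 2 j_r x_r`. -/
def localMinus (j : Fin n → ℂ) (r : Fin n) : Op n :=
  mulX r * mulX r * partialX r - (2 * j r) • mulX r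

/-- `∑_{a,b} η_{ab} D_r^a D_s^b = D_r⁰ D_s⁰ - (D_r⁺ D_s⁻ + D_r⁻ D_s⁺) / 2`. -/
def casimir (j : Fin n → ℂ) (r s : Fin n) : Op n :=
  localZero j r * localZero j s -
    (1 / 2 : ℂ) • (localPlus r * localMinus j s + localMinus j r * localPlus s)

/-- The Gaudin Hamiltonian `H_r = -2 ∑_{s ≠ r} (∑_{a,b} η_{ab} D_r^a D_s^b) / (z_r - z_s)`. -/
def hamiltonian (z j : Fin n → ℂ) (r : Fin n) : Op n :=
  (-2 : ℂ) • ∑ s ∈ Finset.univ.erase r, (1 / (z r - z s)) • casimir j r s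

/-- `D⁺ = ∑_r ∂_{x_r}`. -/
def totalPlus (n : ℕ) : Op n := ∑ r, localPlus r

/-- `D⁰ = ∑_r (x_r ∂_{x_r} - j_r)`. -/
def totalZero (j : Fin n → ℂ) : Op n := ∑ r, localZero j r

/-- `D⁻ = ∑_r (x_r² ∂_{x_r} - 2 j_r x_r)`. -/
def totalMinus (j : Fin n → ℂ) : Op n := ∑ r, localMinus j r

/-- `D̂⁺ = ∑_r z_r ∂_{x_r}`. -/
def hatPlus (z : Fin n → ℂ) : Op n := ∑ r, z r • localPlus r

end Gaudin

end

/-! Paired with a test function φ, everything moves to momentum space. Let W be the plane wave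
pairing of φ. The operators ∂_{x_r} and x_r become multiplication by k_r and ∂/∂k_r, acting on W
through their transposes. In the coordinates (ρ, y_1, …, y_m), m = n - 2 - i, the measure becomes
|ρ|^γ ∏_l u(y_l) ∏_{a≠b}|y_a - y_b| up to a constant, with u(y) = χ(y) ∏_r |y - z_r|^{-2j_r-2} and
Re γ = m - i (`exists_integral_deltaMeasure`, `amplitude_sepPoint`). The theorem says that integrals
of transformed W against this density vanish.

The mechanism is separation of variables. Write h_s for H_s - E_s acting on W. Since ∑ h_s = 0, N(v)
= ∏(v - z_r) ∑ h_s/(v - z_s) is a polynomial of degree at most n - 2. With ρ and the other roots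
fixed, k runs over a complex line as y_l varies, and ∑ h_s/(y_l - z_s) is, up to sign, a conjugated
oper ∂² + t applied to W along that line (`sum_hamSymbol_div`). Two integrations by parts move it
onto χ, where it vanishes (`IsOperSolution.integral_oper_eq_zero`). The Vandermonde factor does not
interfere: |y_l - y_a|² divided by y_l - y_a is antiholomorphic in y_l (`discAbs_mul_prod_div`). So
N(y_l) integrates to zero (`IsOperSolution.integral_sepDensity_slice`).

Interpolation at the y_l recovers h_r from the N(y_l) and the top coefficients of N. For i = 0 the
coefficient ∑ z_s h_s is enough, and the next coefficient gives the equation for D⁻; for i = 1 both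
coefficients are needed. With J = ∑ j_r and 𝓔 = ∑ k_r ∂/∂k_r, the number ∑ z_s h_s is -(𝓔 - J)(𝓔 - J
- 1)W, and ∑ z_s² h_s is -2(𝓔 - J - 1) applied to the symbol of ∑ z_r D_r⁰, plus (∑ z_r k_r) times
the symbol of D⁻. Such terms vanish by integration by parts in ρ, because the constant matches the
exponent γ (`integral_norm_cpow_euler`). The same argument gives D⁰Θ = iΘ, while D⁺ and D̂⁺ are the
vanishing moments of k.

All this needs bounds for χ. In logarithmic radial time χ, ∂χ, ∂̄χ, ∂∂̄χ form a linear system with a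
nearly conserved quadratic energy (`hasDerivAt_quadratic_energy`), which gives χ = O(|y -
z_r|^{1/2}) at the nodes and O(|y|²) at infinity. Together with the rapid decay of W this gives
absolute convergence and temperedness.

For D⁻, and for H_r with i = 1, terms of the form y_l/ρ occur whose integrals diverge
logarithmically when y_l → ∞ with ρ y_l bounded. The density is therefore regularized by |ρ|^η.
Integration by parts in ρ then leaves η/2 times the regularized integral, which could have a finite
limit, an anomaly. It tends to zero: (y_l, ρ) ↦ (i y_l, -i ρ) reverses the sign of y_l/ρ and
asymptotically preserves k and the density, since χ/|y|² is asymptotically invariant under rotation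
by a right angle (`IsOperSolution.tendsto_rotate_sub`, `IsOperSolution.tendsto_anomaly`). -/

open scoped ComplexConjugate

noncomputable section

namespace Gaudin

/-! ### Fourier side: test functions paired with plane waves, and their decay. -/

section PlaneWaves

variable {n : ℕ}

/-! ### Plane wave pairings of Schwartz functions -/

/-- Multiplication of Schwartz functions by the coordinate `x_r`. -/
def coordMul (r : Fin n) : 𝓢(Fin n → ℂ, ℂ) →L[ℂ] 𝓢(Fin n → ℂ, ℂ) :=
  SchwartzMap.smulLeftCLM ℂ (fun x : Fin n → ℂ => x r)

/-- Multiplication of Schwartz functions by `-conj x_r`. -/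
def conjCoordMul (r : Fin n) : 𝓢(Fin n → ℂ, ℂ) →L[ℂ] 𝓢(Fin n → ℂ, ℂ) :=
  SchwartzMap.smulLeftCLM ℂ (fun x : Fin n → ℂ => -(starRingEnd ℂ) (x r))

/-- The holomorphic partial derivative of Schwartz functions. -/
def coordDeriv (r : Fin n) : 𝓢(Fin n → ℂ, ℂ) →L[ℂ] 𝓢(Fin n → ℂ, ℂ) :=
  (1 / 2 : ℂ) • (LineDeriv.lineDerivOpCLM ℂ 𝓢(Fin n → ℂ, ℂ) (Pi.single r (1 : ℂ) : Fin n → ℂ) -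
    Complex.I • LineDeriv.lineDerivOpCLM ℂ 𝓢(Fin n → ℂ, ℂ) (Pi.single r Complex.I : Fin n → ℂ))

theorem hasTemperateGrowth_neg_conj_coord (r : Fin n) :
    Function.HasTemperateGrowth (fun x : Fin n → ℂ => -(starRingEnd ℂ) (x r)) :=
  (-(Complex.conjCLE : ℂ →L[ℝ] ℂ).comp
    (ContinuousLinearMap.proj (R := ℝ) (φ := fun _ : Fin n => ℂ) r)).hasTemperateGrowth

@[simp] theorem coordMul_apply (r : Fin n) (φ : 𝓢(Fin n → ℂ, ℂ)) (x : Fin n → ℂ) :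
    coordMul r φ x = x r * φ x := by
  simp [coordMul, SchwartzMap.smulLeftCLM_apply_apply (hasTemperateGrowth_coord r)]

@[simp] theorem conjCoordMul_apply (r : Fin n) (φ : 𝓢(Fin n → ℂ, ℂ)) (x : Fin n → ℂ) :
    conjCoordMul r φ x = -(starRingEnd ℂ) (x r) * φ x := by
  simp [conjCoordMul, SchwartzMap.smulLeftCLM_apply_apply (hasTemperateGrowth_neg_conj_coord r)]

theorem coordDeriv_apply (r : Fin n) (φ : 𝓢(Fin n → ℂ, ℂ)) (x : Fin n → ℂ) :
    coordDeriv r φ x = (1 / 2) * (fderiv ℝ φ x (Pi.single r 1) -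
      Complex.I * fderiv ℝ φ x (Pi.single r Complex.I)) := by
  simp [coordDeriv, SchwartzMap.lineDerivOp_apply_eq_fderiv]

theorem coordMul_comm (r s : Fin n) (φ : 𝓢(Fin n → ℂ, ℂ)) :
    coordMul r (coordMul s φ) = coordMul s (coordMul r φ) := by
  ext x
  simp only [coordMul_apply]
  ring

theorem coordMul_coordDeriv {r s : Fin n} (h : r ≠ s) (φ : 𝓢(Fin n → ℂ, ℂ)) :
    coordMul r (coordDeriv s φ) = coordDeriv s (coordMul r φ) := by
  ext x
  have h1 : HasFDerivAt (coordMul r φ : (Fin n → ℂ) → ℂ)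
      (x r • fderiv ℝ φ x + φ x • (ContinuousLinearMap.proj (R := ℝ) (φ := fun _ : Fin n => ℂ) r)) x := by
    have : (coordMul r φ : (Fin n → ℂ) → ℂ) = fun x => x r * φ x := by
      funext y; simp
    rw [this]
    exact ((ContinuousLinearMap.proj (R := ℝ) (φ := fun _ : Fin n => ℂ) r).hasFDerivAt).mul
      (φ.hasFDerivAt x)
  simp only [coordDeriv_apply, coordMul_apply, h1.fderiv]
  simp [h]
  ring

/-- The phase of the plane waves as a bilinear form. -/
def phaseForm (n : ℕ) : (Fin n → ℂ) →L[ℝ] (Fin n → ℂ) →L[ℝ] ℝ :=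
  -- The constant compensates the 2π of `Real.fourierChar` and the sign convention of
  -- `VectorFourier.fourierIntegral`, so that the character is exp(2 i Im ∑ k_r x_r).
  (-(1 / Real.pi)) • ∑ r, (ContinuousLinearMap.compL ℝ (Fin n → ℂ) ℂ ℝ Complex.imCLM).comp
    ((ContinuousLinearMap.mul ℝ ℂ).bilinearComp
      (ContinuousLinearMap.proj (R := ℝ) (φ := fun _ : Fin n => ℂ) r)
      (ContinuousLinearMap.proj (R := ℝ) (φ := fun _ : Fin n => ℂ) r))

theorem phaseForm_apply (x k : Fin n → ℂ) :
    phaseForm n x k = -(1 / Real.pi) * (∑ r, k r * x r).im := by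
  simp only [phaseForm, smul_apply, sum_apply,
    ContinuousLinearMap.comp_apply, ContinuousLinearMap.compL_apply,
    ContinuousLinearMap.bilinearComp_apply, ContinuousLinearMap.mul_apply',
    ContinuousLinearMap.proj_apply, Complex.imCLM_apply, smul_eq_mul, Complex.im_sum]
  simp [mul_comm]

theorem fourierChar_phaseForm (x k : Fin n → ℂ) :
    (Real.fourierChar (-(phaseForm n x k)) : ℂ) =
      Complex.exp (2 * Complex.I * ((∑ r, k r * x r).im : ℂ)) := by
  rw [Real.fourierChar_apply, phaseForm_apply]
  congr 1
  push_cast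
  field_simp

theorem planeWavePairing_eq_fourierIntegral (φ : 𝓢(Fin n → ℂ, ℂ)) :
    planeWavePairing φ = VectorFourier.fourierIntegral Real.fourierChar volume
      (phaseForm n).toLinearMap₁₂ φ := by
  funext k
  rw [planeWavePairing, VectorFourier.fourierIntegral]
  refine integral_congr_ae (.of_forall fun x => ?_)
  beta_reduce
  rw [← fourierChar_phaseForm, mul_comm]
  rfl

theorem norm_wave (x k : Fin n → ℂ) :
    ‖Complex.exp (2 * Complex.I * ((∑ r, k r * x r).im : ℂ))‖ = 1 := by
  rw [← fourierChar_phaseForm]; exact Circle.norm_coe _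

theorem integrable_mul_wave (φ : 𝓢(Fin n → ℂ, ℂ)) (k : Fin n → ℂ) :
    Integrable (fun x => φ x * Complex.exp (2 * Complex.I * ((∑ r, k r * x r).im : ℂ))) := by
  refine φ.integrable.mul_bdd (c := 1) ?_ (.of_forall fun x => (norm_wave x k).le)
  exact Continuous.aestronglyMeasurable (by fun_prop)

theorem norm_planeWavePairing_le (φ : 𝓢(Fin n → ℂ, ℂ)) (k : Fin n → ℂ) :
    ‖planeWavePairing φ k‖ ≤ ∫ x, ‖φ x‖ := by
  refine (norm_integral_le_integral_norm _).trans (le_of_eq ?_)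
  simp only [norm_mul, norm_wave, mul_one]

theorem planeWavePairing_add (φ φ' : 𝓢(Fin n → ℂ, ℂ)) (k : Fin n → ℂ) :
    planeWavePairing (φ + φ') k = planeWavePairing φ k + planeWavePairing φ' k := by
  simp only [planeWavePairing, add_apply, add_mul]
  exact integral_add (integrable_mul_wave φ k) (integrable_mul_wave φ' k)

theorem planeWavePairing_smul (c : ℂ) (φ : 𝓢(Fin n → ℂ, ℂ)) (k : Fin n → ℂ) :
    planeWavePairing (c • φ) k = c * planeWavePairing φ k := by
  simp only [planeWavePairing, smul_apply, smul_eq_mul, mul_assoc]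
  exact integral_const_mul _ _

/-- The plane wave pairing at `k` as a linear functional. -/
def waveLM (k : Fin n → ℂ) : 𝓢(Fin n → ℂ, ℂ) →ₗ[ℂ] ℂ where
  toFun φ := planeWavePairing φ k
  map_add' φ φ' := planeWavePairing_add φ φ' k
  map_smul' c φ := planeWavePairing_smul c φ k

theorem waveLM_apply (k : Fin n → ℂ) (φ : 𝓢(Fin n → ℂ, ℂ)) : waveLM k φ = planeWavePairing φ k := rfl

/-- Since 2 i Im(k x) = k x - conj(k x), a factor x_r is dual to ∂/∂k_r and a factor -conj x_r to
the antiholomorphic derivative. The test functions `coordMul r φ` and `conjCoordMul r φ` are thus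
the two Wirtinger gradients in momentum space. -/
theorem hasFDerivAt_planeWavePairing (φ : 𝓢(Fin n → ℂ, ℂ)) (k : Fin n → ℂ) :
    ∃ D : (Fin n → ℂ) →L[ℝ] ℂ, HasFDerivAt (planeWavePairing φ) D k ∧
      ∀ v, D v = ∑ r, (v r * planeWavePairing (coordMul r φ) k +
        (starRingEnd ℂ) (v r) * planeWavePairing (conjCoordMul r φ) k) := by
  have h1 := VectorFourier.hasFDerivAt_fourierIntegral (phaseForm n) (f := φ) φ.integrable
    (by simpa using φ.integrable_pow_mul volume 1) k
  rw [← planeWavePairing_eq_fourierIntegral] at h1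
  refine ⟨_, h1, fun v => ?_⟩
  have h2 : ∑ r, (v r * planeWavePairing (coordMul r φ) k +
        (starRingEnd ℂ) (v r) * planeWavePairing (conjCoordMul r φ) k) =
      planeWavePairing (∑ r, (v r • coordMul r φ + (starRingEnd ℂ) (v r) • conjCoordMul r φ)) k := by
    simp only [← waveLM_apply, map_sum, map_add, map_smul, smul_eq_mul]
  rw [h2, VectorFourier.fourierIntegral, ContinuousLinearMap.integral_apply]
  · rw [planeWavePairing]
    refine integral_congr_ae (.of_forall fun x => ?_)
    have h3 : (∑ r, (v r • coordMul r φ + (starRingEnd ℂ) (v r) • conjCoordMul r φ)) x =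
        (2 * Complex.I * ((∑ r, v r * x r).im : ℂ)) * φ x := by
      simp only [sum_apply, add_apply, smul_apply, coordMul_apply, conjCoordMul_apply,
        smul_eq_mul, Complex.im_sum, Complex.ofReal_sum, Finset.mul_sum, Finset.sum_mul]
      refine Finset.sum_congr rfl fun r _ => ?_
      have : (2 * Complex.I * ((v r * x r).im : ℂ)) =
          v r * x r - (starRingEnd ℂ) (v r) * (starRingEnd ℂ) (x r) := by
        apply Complex.ext <;> simp <;> ring
      rw [this]
      ring
    beta_reduce
    rw [h3, ← fourierChar_phaseForm]
    change (Real.fourierChar (-(phaseForm n x k)) : ℂ) * (-(2 * Real.pi * Complex.I) *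
      ((phaseForm n x v : ℝ) • φ x)) = _
    rw [phaseForm_apply x v, Complex.real_smul]
    have : (Real.pi : ℂ) ≠ 0 := by exact_mod_cast Real.pi_ne_zero
    push_cast
    field_simp
  · refine (VectorFourier.fourierIntegral_convergent_iff (L := (phaseForm n).toLinearMap₁₂)
      Real.continuous_fourierChar ?_ k).2 ?_
    · exact (phaseForm n).continuous₂
    · refine Integrable.mono' (g := fun x => (2 * Real.pi * ‖phaseForm n‖) * (‖x‖ ^ 1 * ‖φ x‖))
        ((φ.integrable_pow_mul volume 1).const_mul _) ?_ (.of_forall fun x => ?_)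
      · exact (φ.continuous.aestronglyMeasurable).fourierSMulRight (L := phaseForm n)
      · refine (VectorFourier.norm_fourierSMulRight_le (phaseForm n) φ x).trans (le_of_eq ?_)
        ring

theorem integral_fderiv_mul_wave (φ : 𝓢(Fin n → ℂ, ℂ)) (v k : Fin n → ℂ) :
    ∫ x, fderiv ℝ φ x v * Complex.exp (2 * Complex.I * ((∑ r, k r * x r).im : ℂ)) =
      -(2 * Complex.I * ((∑ r, k r * v r).im : ℂ)) * planeWavePairing φ k := by
  set M : (Fin n → ℂ) →L[ℝ] ℂ := (2 * Complex.I) • (Complex.ofRealCLM.comp (Complex.imCLM.comp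
    (∑ r, k r • (ContinuousLinearMap.proj (R := ℝ) (φ := fun _ : Fin n => ℂ) r)))) with hM
  have hMx (x : Fin n → ℂ) : M x = 2 * Complex.I * ((∑ r, k r * x r).im : ℂ) := by
    simp [hM, Complex.im_sum]
  have hw (x : Fin n → ℂ) : HasFDerivAt (fun x => Complex.exp (M x)) (Complex.exp (M x) • M) x :=
    M.hasFDerivAt.cexp
  have hwi (x : Fin n → ℂ) : ‖Complex.exp (M x)‖ = 1 := by rw [hMx]; exact norm_wave x k
  have hc : Continuous (fun x => Complex.exp (M x)) := by fun_prop
  have hφ' : Integrable (fun x => fderiv ℝ φ x v) :=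
    (LineDeriv.lineDerivOp v φ).integrable.congr
      (.of_forall fun x => by simp [SchwartzMap.lineDerivOp_apply_eq_fderiv])
  have h := integral_bilinear_hasLineDerivAt_right_eq_neg_left_of_integrable (μ := volume) (v := v)
    (B := ContinuousLinearMap.mul ℝ ℂ) (f := fun x => Complex.exp (M x)) (g := φ)
    (f' := fun x => Complex.exp (M x) * M v) (g' := fun x => fderiv ℝ φ x v) ?_ ?_ ?_
    (fun x _ => by simpa using (hw x).hasLineDerivAt v)
    (fun x _ => (φ.hasFDerivAt x).hasLineDerivAt v)
  · simp only [ContinuousLinearMap.mul_apply'] at h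
    simp only [← hMx, planeWavePairing, ← integral_const_mul, mul_comm (fderiv ℝ φ _ v)]
    rw [h, ← integral_neg]
    refine integral_congr_ae (.of_forall fun x => ?_)
    beta_reduce
    ring
  · have : Integrable (fun x => (φ x * M v) * Complex.exp (M x)) :=
      (φ.integrable.mul_const _).mul_bdd (c := 1) hc.aestronglyMeasurable
        (.of_forall fun x => (hwi x).le)
    refine this.congr (.of_forall fun x => ?_)
    simp only [ContinuousLinearMap.mul_apply']
    ring
  · refine (hφ'.mul_bdd (c := 1) hc.aestronglyMeasurable
        (.of_forall fun x => (hwi x).le)).congr (.of_forall fun x => ?_)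
    simp [mul_comm]
  · refine (φ.integrable.mul_bdd (c := 1) hc.aestronglyMeasurable
        (.of_forall fun x => (hwi x).le)).congr (.of_forall fun x => ?_)
    simp [mul_comm]

/-- The holomorphic derivative of exp(2 i Im(k x)) brings down k_r alone, the antiholomorphic half
of the phase being killed; the sign comes from integration by parts. -/
theorem planeWavePairing_coordDeriv (r : Fin n) (φ : 𝓢(Fin n → ℂ, ℂ)) (k : Fin n → ℂ) :
    planeWavePairing (coordDeriv r φ) k = -(k r) * planeWavePairing φ k := by
  have h (v : Fin n → ℂ) : planeWavePairing (LineDeriv.lineDerivOp v φ) k =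
      -(2 * Complex.I * ((∑ r, k r * v r).im : ℂ)) * planeWavePairing φ k := by
    rw [← integral_fderiv_mul_wave]
    simp [planeWavePairing, SchwartzMap.lineDerivOp_apply_eq_fderiv]
  simp only [coordDeriv, smul_apply, sub_apply,
    LineDeriv.lineDerivOpCLM_apply]
  simp only [← waveLM_apply, map_smul, map_sub] 
  simp only [waveLM_apply, h]
  simp [Pi.single_apply]
  apply Complex.ext <;> simp <;> ring

theorem norm_pow_mul_planeWavePairing_le (φ : 𝓢(Fin n → ℂ, ℂ)) (r : Fin n) (K : ℕ) (k : Fin n → ℂ) :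
    ‖k r‖ ^ K * ‖planeWavePairing φ k‖ ≤ ∫ x, ‖((coordDeriv r)^[K] φ) x‖ := by
  have h : ∀ K : ℕ, planeWavePairing ((coordDeriv r)^[K] φ) k = (-(k r)) ^ K * planeWavePairing φ k := by
    intro K
    induction K with
    | zero => simp
    | succ K ih => rw [Function.iterate_succ_apply', planeWavePairing_coordDeriv, ih]; ring
  have h1 := norm_planeWavePairing_le ((coordDeriv r)^[K] φ) k
  rwa [h K, norm_mul, norm_pow, norm_neg] at h1

/-- A continuous gauge of Schwartz functions that controls the decay of their plane wave pairings. -/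
def waveGauge (K : ℕ) (φ : 𝓢(Fin n → ℂ, ℂ)) : ℝ :=
  2 ^ K * ((∫ x, ‖φ x‖) + ∑ r, ∫ x, ‖((coordDeriv r)^[K] φ) x‖)

theorem continuous_waveGauge (K : ℕ) : Continuous (waveGauge (n := n) K) := by
  have h : Continuous fun φ : 𝓢(Fin n → ℂ, ℂ) => ∫ x, ‖φ x‖ := by
    have := (SchwartzMap.continuous_toLp (E := Fin n → ℂ) (F := ℂ) (p := 1)
      (μ := volume)).norm
    refine this.congr fun φ => ?_
    rw [SchwartzMap.norm_toLp_one]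
  have h2 : Continuous fun φ : 𝓢(Fin n → ℂ, ℂ) => ∑ r, ∫ x, ‖((coordDeriv r)^[K] φ) x‖ :=
    continuous_finsetSum _ fun r _ => h.comp ((coordDeriv r).continuous.iterate K)
  exact continuous_const.mul (h.add h2)

theorem waveGauge_zero (K : ℕ) : waveGauge (n := n) K 0 = 0 := by
  have h (r : Fin n) : (coordDeriv r)^[K] 0 = 0 := Function.iterate_fixed (map_zero _) K
  simp [waveGauge, h]

theorem waveGauge_nonneg (K : ℕ) (φ : 𝓢(Fin n → ℂ, ℂ)) : 0 ≤ waveGauge K φ := by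
  unfold waveGauge; positivity

theorem pow_mul_norm_planeWavePairing_le (K : ℕ) (φ : 𝓢(Fin n → ℂ, ℂ)) (k : Fin n → ℂ) :
    (1 + ‖k‖) ^ K * ‖planeWavePairing φ k‖ ≤ waveGauge K φ := by
  have h0 := norm_planeWavePairing_le φ k
  have h1 : ‖k‖ ^ K * ‖planeWavePairing φ k‖ ≤
      (∫ x, ‖φ x‖) + ∑ r, ∫ x, ‖((coordDeriv r)^[K] φ) x‖ := by
    rcases isEmpty_or_nonempty (Fin n) with hn | hn
    · have : ‖k‖ = 0 := by rw [Subsingleton.elim k 0, norm_zero]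
      have h2 : 0 ≤ ∑ r, ∫ x, ‖((coordDeriv r)^[K] φ) x‖ := by positivity
      have h3 : (0 : ℝ) ^ K ≤ 1 := pow_le_one₀ le_rfl zero_le_one
      rw [this]
      nlinarith [norm_nonneg (planeWavePairing φ k)]
    -- The sup norm is attained at a single coordinate, so `K` derivatives in that coordinate give
    -- all the decay.
    · obtain ⟨r, hr⟩ : ∃ r, ‖k r‖ = ‖k‖ := by
        obtain ⟨r, -, hr⟩ := Finset.exists_mem_eq_sup' Finset.univ_nonempty fun r => ‖k r‖
        refine ⟨r, le_antisymm (norm_le_pi_norm k r) ?_⟩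
        rw [← hr]
        exact (pi_norm_le_iff_of_nonempty _).2 fun i =>
          Finset.le_sup' (fun r => ‖k r‖) (Finset.mem_univ i)
      rw [← hr]
      refine (norm_pow_mul_planeWavePairing_le φ r K k).trans ?_
      have := Finset.single_le_sum (f := fun r => ∫ x, ‖((coordDeriv r)^[K] φ) x‖)
        (fun _ _ => by positivity) (Finset.mem_univ r)
      have h4 : 0 ≤ ∫ x, ‖φ x‖ := by positivity
      linarith
  have h5 : ‖planeWavePairing φ k‖ ≤ (∫ x, ‖φ x‖) + ∑ r, ∫ x, ‖((coordDeriv r)^[K] φ) x‖ := by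
    have h2 : 0 ≤ ∑ r, ∫ x, ‖((coordDeriv r)^[K] φ) x‖ := by positivity
    linarith
  have h6 : (1 + ‖k‖) ^ K ≤ 2 ^ K * max 1 (‖k‖ ^ K) := by
    rcases le_total ‖k‖ 1 with h | h
    · calc (1 + ‖k‖) ^ K ≤ 2 ^ K := by gcongr; linarith
        _ ≤ _ := le_mul_of_one_le_right (by positivity) (le_max_left _ _)
    · calc (1 + ‖k‖) ^ K ≤ (2 * ‖k‖) ^ K := by gcongr; linarith
        _ = 2 ^ K * ‖k‖ ^ K := mul_pow _ _ _
        _ ≤ _ := by gcongr; exact le_max_right _ _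
  calc (1 + ‖k‖) ^ K * ‖planeWavePairing φ k‖
      ≤ (2 ^ K * max 1 (‖k‖ ^ K)) * ‖planeWavePairing φ k‖ := by gcongr
    _ = 2 ^ K * max ‖planeWavePairing φ k‖ (‖k‖ ^ K * ‖planeWavePairing φ k‖) := by
        rw [mul_assoc, max_mul_of_nonneg _ _ (norm_nonneg _), one_mul]
    _ ≤ _ := by
        unfold waveGauge
        gcongr
        exact max_le h5 h1

theorem norm_planeWavePairing_le_div (K : ℕ) (φ : 𝓢(Fin n → ℂ, ℂ)) (k : Fin n → ℂ) :
    ‖planeWavePairing φ k‖ ≤ waveGauge K φ / (1 + ‖k‖) ^ K := by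
  rw [le_div_iff₀ (by positivity), mul_comm]
  exact pow_mul_norm_planeWavePairing_le K φ k

theorem continuous_planeWavePairing (φ : 𝓢(Fin n → ℂ, ℂ)) : Continuous (planeWavePairing φ) :=
  continuous_iff_continuousAt.2 fun k => by
    obtain ⟨D, hD, -⟩ := hasFDerivAt_planeWavePairing φ k
    exact hD.continuousAt

end PlaneWaves

/-! ### Single-valued solutions of the oper: differential system and growth. -/

section Wirtinger

variable {n : ℕ}

/-! ### Wirtinger calculus -/

/-- `f` is real differentiable at `y` with Wirtinger derivatives `∂f = p` and `∂̄f = q`. -/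
def HasWirtingerAt (f : ℂ → ℂ) (p q y : ℂ) : Prop :=
  HasFDerivAt f (p • (1 : ℂ →L[ℝ] ℂ) + q • (Complex.conjCLE : ℂ →L[ℝ] ℂ)) y

theorem wirtinger_clm_ext {L : ℂ →L[ℝ] ℂ} {p q : ℂ} (h1 : L 1 = p + q)
    (hI : L Complex.I = p * Complex.I - q * Complex.I) :
    L = p • (1 : ℂ →L[ℝ] ℂ) + q • (Complex.conjCLE : ℂ →L[ℝ] ℂ) := by
  ext v
  have hv : v = v.re • (1 : ℂ) + v.im • Complex.I := by simp
  conv_lhs => rw [hv]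
  rw [map_add, map_smul, map_smul, h1, hI]
  simp only [add_apply, smul_apply, one_apply_eq_self, smul_eq_mul, Complex.real_smul,
    ContinuousLinearEquiv.coe_coe, Complex.conjCLE_apply]
  have h3 : v = v.re + v.im * Complex.I := (Complex.re_add_im v).symm
  have h4 : conj v = v.re - v.im * Complex.I := by
    apply Complex.ext <;> simp
  rw [h4]
  linear_combination (-p) * h3

namespace HasWirtingerAt

variable {f g : ℂ → ℂ} {p q p' q' y : ℂ}

theorem of_clm {L : ℂ →L[ℝ] ℂ} (h : HasFDerivAt f L y) (h1 : L 1 = p + q)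
    (hI : L Complex.I = p * Complex.I - q * Complex.I) : HasWirtingerAt f p q y := by
  rw [HasWirtingerAt, ← wirtinger_clm_ext h1 hI]; exact h

theorem of_differentiableAt (h : DifferentiableAt ℝ f y) :
    HasWirtingerAt f (wirtinger f y) (wirtingerBar f y) y := by
  refine of_clm h.hasFDerivAt ?_ ?_
  · simp only [wirtinger, wirtingerBar]; ring
  · simp only [wirtinger, wirtingerBar]; ring_nf; simp

theorem continuousAt (h : HasWirtingerAt f p q y) : ContinuousAt f y :=
  HasFDerivAt.continuousAt h

theorem fderiv_apply (h : HasWirtingerAt f p q y) (v : ℂ) :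
    fderiv ℝ f y v = p * v + q * conj v := by
  rw [HasFDerivAt.fderiv h]; simp

theorem wirtinger_eq (h : HasWirtingerAt f p q y) : wirtinger f y = p := by
  rw [wirtinger, h.fderiv_apply, h.fderiv_apply]
  simp
  ring_nf
  simp
  ring

theorem wirtingerBar_eq (h : HasWirtingerAt f p q y) : wirtingerBar f y = q := by
  rw [wirtingerBar, h.fderiv_apply, h.fderiv_apply]
  simp
  ring_nf
  simp
  ring

theorem congr_deriv (h : HasWirtingerAt f p q y) (hp : p = p') (hq : q = q') :
    HasWirtingerAt f p' q' y := hp ▸ hq ▸ h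

theorem congr_of_eventuallyEq (h : HasWirtingerAt f p q y) (hg : g =ᶠ[𝓝 y] f) :
    HasWirtingerAt g p q y :=
  HasFDerivAt.congr_of_eventuallyEq h hg

theorem of_hasDerivAt (h : HasDerivAt f p y) : HasWirtingerAt f p 0 y := by
  refine of_clm (h.hasFDerivAt.restrictScalars ℝ) ?_ ?_ <;> simp [mul_comm]

theorem const (c : ℂ) : HasWirtingerAt (fun _ => c) 0 0 y := of_hasDerivAt (hasDerivAt_const y c)

theorem add (hf : HasWirtingerAt f p q y) (hg : HasWirtingerAt g p' q' y) :
    HasWirtingerAt (fun x => f x + g x) (p + p') (q + q') y := by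
  refine of_clm (HasFDerivAt.add hf hg) ?_ ?_ <;> simp <;> ring

theorem mul (hf : HasWirtingerAt f p q y) (hg : HasWirtingerAt g p' q' y) :
    HasWirtingerAt (fun x => f x * g x) (p * g y + f y * p') (q * g y + f y * q') y := by
  refine of_clm (HasFDerivAt.mul hf hg) ?_ ?_ <;> simp <;> ring

theorem const_mul (c : ℂ) (hf : HasWirtingerAt f p q y) :
    HasWirtingerAt (fun x => c * f x) (c * p) (c * q) y :=
  ((const c).mul hf).congr_deriv (by ring) (by ring)

theorem neg (hf : HasWirtingerAt f p q y) : HasWirtingerAt (fun x => -f x) (-p) (-q) y := by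
  simpa using hf.const_mul (-1)

theorem sub (hf : HasWirtingerAt f p q y) (hg : HasWirtingerAt g p' q' y) :
    HasWirtingerAt (fun x => f x - g x) (p - p') (q - q') y := by
  simpa [sub_eq_add_neg] using hf.add hg.neg

theorem sum {ι : Type*} {s : Finset ι} {F : ι → ℂ → ℂ} {P Q : ι → ℂ}
    (h : ∀ i ∈ s, HasWirtingerAt (F i) (P i) (Q i) y) :
    HasWirtingerAt (fun x => ∑ i ∈ s, F i x) (∑ i ∈ s, P i) (∑ i ∈ s, Q i) y := by
  classical
  induction s using Finset.induction_on with
  | empty => simpa using const (y := y) 0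
  | insert a s ha ih =>
    simp only [Finset.sum_insert ha]
    exact (h a (by simp)).add (ih fun i hi => h i (by simp [hi]))

theorem star (hf : HasWirtingerAt f p q y) :
    HasWirtingerAt (fun x => conj (f x)) (conj q) (conj p) y := by
  refine of_clm ((Complex.conjCLE : ℂ →L[ℝ] ℂ).hasFDerivAt.comp y hf) ?_ ?_ <;> simp <;> ring

/-- Chain rule along a real line. -/
theorem hasDerivAt_line (w θ : ℂ) (r : ℝ) (hf : HasWirtingerAt f p q (w + r * θ)) :
    HasDerivAt (fun r : ℝ => f (w + r * θ)) (p * θ + q * conj θ) r := by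
  have h1 : HasDerivAt (fun r : ℝ => w + (r : ℂ) * θ) θ r := by
    simpa using ((Complex.ofRealCLM.hasDerivAt (x := r)).mul_const θ).const_add w
  have := HasFDerivAt.comp_hasDerivAt (f := fun r : ℝ => w + (r : ℂ) * θ) r hf h1
  exact this.congr_deriv (by simp)

end HasWirtingerAt

theorem wirtinger_wirtingerBar_comm {f : ℂ → ℂ} {y : ℂ} (hf : ContDiffAt ℝ 2 f y) :
    wirtinger (wirtingerBar f) y = wirtingerBar (wirtinger f) y := by
  have h1 : DifferentiableAt ℝ (fderiv ℝ f) y :=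
    (hf.fderiv_right (m := 1) (by norm_num)).differentiableAt (by norm_num)
  have hs : IsSymmSndFDerivAt ℝ f y := hf.isSymmSndFDerivAt (by simp)
  have happ (v : ℂ) : HasFDerivAt (fun x => fderiv ℝ f x v)
      ((fderiv ℝ (fderiv ℝ f) y).flip v) y := by
    simpa using h1.hasFDerivAt.clm_apply (hasFDerivAt_const v y)
  have hb : HasFDerivAt (wirtingerBar f) ((1 / 2 : ℂ) • ((fderiv ℝ (fderiv ℝ f) y).flip 1 +
      Complex.I • (fderiv ℝ (fderiv ℝ f) y).flip Complex.I)) y :=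
    ((happ 1).add ((happ Complex.I).const_smul Complex.I)).const_smul (1 / 2 : ℂ)
  have ha : HasFDerivAt (wirtinger f) ((1 / 2 : ℂ) • ((fderiv ℝ (fderiv ℝ f) y).flip 1 -
      Complex.I • (fderiv ℝ (fderiv ℝ f) y).flip Complex.I)) y :=
    ((happ 1).sub ((happ Complex.I).const_smul Complex.I)).const_smul (1 / 2 : ℂ)
  rw [wirtinger, wirtingerBar, hb.fderiv, ha.fderiv]
  have := hs 1 Complex.I
  simp only [smul_apply, add_apply, sub_apply, ContinuousLinearMap.flip_apply, smul_eq_mul, this]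
  ring

/-! ### The closed first order system -/

/-- The first order system satisfied by `χ`, `∂χ`, `∂̄χ` and `∂∂̄χ`. -/
structure WirtingerSystem (t χ χ₁ χ₂ χ₃ : ℂ → ℂ) (y : ℂ) : Prop where
  d0 : HasWirtingerAt χ (χ₁ y) (χ₂ y) y
  d1 : HasWirtingerAt χ₁ (-(t y * χ y)) (χ₃ y) y
  d2 : HasWirtingerAt χ₂ (χ₃ y) (-(conj (t y) * χ y)) y
  d3 : HasWirtingerAt χ₃ (-(t y * χ₂ y)) (-(conj (t y) * χ₁ y)) y

theorem hasDerivAt_operPotential {z j E : Fin n → ℂ} {y : ℂ} (hy : y ∉ Set.range z) :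
    ∃ t', HasDerivAt (operPotential z j E) t' y := by
  have : DifferentiableAt ℂ (operPotential z j E) y := by
    unfold operPotential
    refine DifferentiableAt.fun_sum fun r _ => ?_
    have h : y - z r ≠ 0 := sub_ne_zero.2 fun h => hy ⟨r, h.symm⟩
    have h2 : (y - z r) ^ 2 ≠ 0 := pow_ne_zero 2 h
    fun_prop (disch := assumption)
  exact ⟨_, this.hasDerivAt⟩

theorem isOpen_compl_range (z : Fin n → ℂ) : IsOpen (Set.range z)ᶜ :=
  (Set.finite_range z).isClosed.isOpen_compl

theorem IsOperSolution.contDiffAt {z j E : Fin n → ℂ} {χ : ℂ → ℂ} (h : IsOperSolution z j E χ) {y : ℂ}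
    (hy : y ∉ Set.range z) : ContDiffAt ℝ ∞ χ y :=
  h.smooth.contDiffAt ((isOpen_compl_range z).mem_nhds hy)

theorem contDiffAt_wirtinger {f : ℂ → ℂ} {y : ℂ} (hf : ContDiffAt ℝ ∞ f y) :
    ContDiffAt ℝ ∞ (wirtinger f) y := by
  have h1 : ContDiffAt ℝ ∞ (fderiv ℝ f) y := hf.fderiv_right (by simp)
  unfold wirtinger
  fun_prop

theorem contDiffAt_wirtingerBar {f : ℂ → ℂ} {y : ℂ} (hf : ContDiffAt ℝ ∞ f y) :
    ContDiffAt ℝ ∞ (wirtingerBar f) y := by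
  have h1 : ContDiffAt ℝ ∞ (fderiv ℝ f) y := hf.fderiv_right (by simp)
  unfold wirtingerBar
  fun_prop

/-- The system closes at the fourth function because `t` is holomorphic: ∂∂∂̄χ = ∂̄(-tχ) = -t ∂̄χ,
and likewise ∂̄∂∂̄χ = ∂(-conj t · χ) = -conj t · ∂χ. -/
theorem IsOperSolution.wirtingerSystem {z j E : Fin n → ℂ} {χ : ℂ → ℂ} (h : IsOperSolution z j E χ)
    {y : ℂ} (hy : y ∉ Set.range z) :
    WirtingerSystem (operPotential z j E) χ (wirtinger χ) (wirtingerBar χ)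
      (wirtingerBar (wirtinger χ)) y := by
  set t := operPotential z j E
  have hU : ∀ᶠ x in 𝓝 y, x ∉ Set.range z := (isOpen_compl_range z).mem_nhds hy
  have hne : (∞ : WithTop ℕ∞) ≠ 0 := by simp
  have key : ∀ x ∉ Set.range z, HasWirtingerAt χ (wirtinger χ x) (wirtingerBar χ x) x ∧
      HasWirtingerAt (wirtinger χ) (-(t x * χ x)) (wirtingerBar (wirtinger χ) x) x ∧
      HasWirtingerAt (wirtingerBar χ) (wirtingerBar (wirtinger χ) x) (-(conj (t x) * χ x)) x := by
    intro x hx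
    have hc := h.contDiffAt hx
    refine ⟨.of_differentiableAt (hc.differentiableAt hne),
      (HasWirtingerAt.of_differentiableAt
        ((contDiffAt_wirtinger hc).differentiableAt hne)).congr_deriv ?_ rfl,
      (HasWirtingerAt.of_differentiableAt
        ((contDiffAt_wirtingerBar hc).differentiableAt hne)).congr_deriv ?_ ?_⟩
    · exact eq_neg_of_add_eq_zero_left (h.holo_eq x hx)
    · exact wirtinger_wirtingerBar_comm (hc.of_le (by norm_cast))
    · exact eq_neg_of_add_eq_zero_left (h.antiholo_eq x hx)
  obtain ⟨k0, k1, k2⟩ := key y hy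
  obtain ⟨t', ht'⟩ := hasDerivAt_operPotential (j := j) (E := E) hy
  have htw := HasWirtingerAt.of_hasDerivAt ht'
  have hc := h.contDiffAt hy
  have h2 : (2 : WithTop ℕ∞) ≤ ∞ := by norm_cast
  refine ⟨k0, k1, k2, (HasWirtingerAt.of_differentiableAt ((contDiffAt_wirtingerBar
    (contDiffAt_wirtinger hc)).differentiableAt hne)).congr_deriv ?_ ?_⟩
  · rw [wirtinger_wirtingerBar_comm ((contDiffAt_wirtinger hc).of_le h2)]
    have e1 : wirtinger (wirtinger χ) =ᶠ[𝓝 y] fun x => -(t x * χ x) :=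
      hU.mono fun x hx => (key x hx).2.1.wirtinger_eq
    have := ((htw.mul k0).neg.congr_of_eventuallyEq e1).wirtingerBar_eq
    rw [this]; ring
  · have e1 : wirtingerBar (wirtinger χ) =ᶠ[𝓝 y] wirtinger (wirtingerBar χ) :=
      hU.mono fun x hx => (key x hx).2.2.wirtinger_eq.symm
    have e2 : wirtingerBar (wirtingerBar (wirtinger χ)) y =
        wirtingerBar (wirtinger (wirtingerBar χ)) y := by
      rw [wirtingerBar, e1.fderiv_eq]; rfl
    rw [e2, ← wirtinger_wirtingerBar_comm ((contDiffAt_wirtingerBar hc).of_le h2)]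
    have e3 : wirtingerBar (wirtingerBar χ) =ᶠ[𝓝 y] fun x => -(conj (t x) * χ x) :=
      hU.mono fun x hx => (key x hx).2.2.wirtingerBar_eq
    have := ((htw.star.mul k0).neg.congr_of_eventuallyEq e3).wirtinger_eq
    rw [this]; simp [t]

end Wirtinger

section Growth

variable {n : ℕ}

/-! ### Energy estimates along rays -/

/-- In logarithmic time r d/dr the system is the identity plus two commuting copies of the
oscillator matrix ((0, 1), (l, 0)), one with l and one with conj l. For l = -κ² both oscillators
conserve the weighted norm, so only the growth rate 2 of the identity remains. For other l the
defect l + κ² enters linearly and costs at most 2|l + κ²|/κ. -/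
theorem hasDerivAt_quadratic_energy {A B C D : ℝ → ℂ} {κ r : ℝ} {l : ℂ} (hκ : 0 < κ) (hr : 0 < r)
    (hA : HasDerivAt A ((A r + B r + C r) / r) r)
    (hB : HasDerivAt B ((B r + D r + l * A r) / r) r)
    (hC : HasDerivAt C ((C r + D r + conj l * A r) / r) r)
    (hD : HasDerivAt D ((D r + l * C r + conj l * B r) / r) r) :
    ∃ e, HasDerivAt (fun x => κ ^ 4 * ‖A x‖ ^ 2 + κ ^ 2 * ‖B x‖ ^ 2 + κ ^ 2 * ‖C x‖ ^ 2 +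
        ‖D x‖ ^ 2) e r ∧
      |r * e - 2 * (κ ^ 4 * ‖A r‖ ^ 2 + κ ^ 2 * ‖B r‖ ^ 2 + κ ^ 2 * ‖C r‖ ^ 2 + ‖D r‖ ^ 2)| ≤
        2 * (‖l + κ ^ 2‖ / κ) *
          (κ ^ 4 * ‖A r‖ ^ 2 + κ ^ 2 * ‖B r‖ ^ 2 + κ ^ 2 * ‖C r‖ ^ 2 + ‖D r‖ ^ 2) := by
  refine ⟨_, (((hA.norm_sq.const_mul (κ ^ 4)).add (hB.norm_sq.const_mul (κ ^ 2))).add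
    (hC.norm_sq.const_mul (κ ^ 2))).add hD.norm_sq, ?_⟩
  generalize A r = a, B r = b, C r = c, D r = d
  set m : ℂ := l + κ ^ 2 with hm
  have hl : l = m - (κ : ℂ) ^ 2 := by rw [hm]; ring
  have key : r * (κ ^ 4 * (2 * inner ℝ a ((a + b + c) / r)) +
      κ ^ 2 * (2 * inner ℝ b ((b + d + l * a) / r)) +
      κ ^ 2 * (2 * inner ℝ c ((c + d + conj l * a) / r)) +
      2 * inner ℝ d ((d + l * c + conj l * b) / r)) -
      2 * (κ ^ 4 * ‖a‖ ^ 2 + κ ^ 2 * ‖b‖ ^ 2 + κ ^ 2 * ‖c‖ ^ 2 + ‖d‖ ^ 2) =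
      2 * (κ ^ 2 * (conj b * a * m).re + κ ^ 2 * (conj c * a * conj m).re +
        (conj d * c * m).re + (conj d * b * conj m).re) := by
    have h1 (v w : ℂ) : inner ℝ v (w / (r : ℂ)) = (conj v * w).re / r := by
      rw [Complex.inner, div_mul_eq_mul_div, Complex.div_ofReal_re, mul_comm]
    simp only [h1, hl, ← Complex.normSq_eq_norm_sq, Complex.normSq_apply]
    field_simp
    simp [← Complex.ofReal_pow]
    ring
  rw [key]
  have hre (u v w : ℂ) : |(conj u * v * w).re| ≤ ‖u‖ * ‖v‖ * ‖w‖ := by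
    refine (Complex.abs_re_le_norm _).trans (by simp)
  have e1 := hre b a m
  have e2 := hre c a (conj m)
  have e3 := hre d c m
  have e4 := hre d b (conj m)
  rw [RCLike.norm_conj] at e2 e4
  have hk2 : 0 < κ ^ 2 := by positivity
  have t1 : |2 * (κ ^ 2 * (conj b * a * m).re + κ ^ 2 * (conj c * a * conj m).re +
        (conj d * c * m).re + (conj d * b * conj m).re)| ≤
      2 * (κ ^ 2 * (‖b‖ * ‖a‖ * ‖m‖) + κ ^ 2 * (‖c‖ * ‖a‖ * ‖m‖) + ‖d‖ * ‖c‖ * ‖m‖ +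
        ‖d‖ * ‖b‖ * ‖m‖) := by
    rw [abs_le] at *
    constructor <;> nlinarith
  refine t1.trans ?_
  have t2 : κ ^ 2 * (‖b‖ * ‖a‖) + κ ^ 2 * (‖c‖ * ‖a‖) + ‖d‖ * ‖c‖ + ‖d‖ * ‖b‖ ≤
      (κ ^ 4 * ‖a‖ ^ 2 + κ ^ 2 * ‖b‖ ^ 2 + κ ^ 2 * ‖c‖ ^ 2 + ‖d‖ ^ 2) / κ := by
    rw [le_div_iff₀ hκ]
    nlinarith [sq_nonneg (κ ^ 2 * ‖a‖ - κ * ‖b‖), sq_nonneg (κ ^ 2 * ‖a‖ - κ * ‖c‖),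
      sq_nonneg (‖d‖ - κ * ‖c‖), sq_nonneg (‖d‖ - κ * ‖b‖)]
  calc _ = 2 * ‖m‖ * (κ ^ 2 * (‖b‖ * ‖a‖) + κ ^ 2 * (‖c‖ * ‖a‖) + ‖d‖ * ‖c‖ + ‖d‖ * ‖b‖) := by ring
    _ ≤ 2 * ‖m‖ * ((κ ^ 4 * ‖a‖ ^ 2 + κ ^ 2 * ‖b‖ ^ 2 + κ ^ 2 * ‖c‖ ^ 2 + ‖d‖ ^ 2) / κ) := by
        gcongr
    _ = _ := by ring

/-- The energy of a solution of the first order system, centred at `w`. -/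
def systemEnergy (κ : ℝ) (w : ℂ) (χ χ₁ χ₂ χ₃ : ℂ → ℂ) (y : ℂ) : ℝ :=
  κ ^ 4 * ‖χ y‖ ^ 2 + κ ^ 2 * ‖(y - w) * χ₁ y - χ y / 2‖ ^ 2 +
    κ ^ 2 * ‖conj (y - w) * χ₂ y - χ y / 2‖ ^ 2 +
    ‖(y - w) * conj (y - w) * χ₃ y - ((y - w) * χ₁ y + conj (y - w) * χ₂ y) / 2 + χ y / 4‖ ^ 2

variable {t χ χ₁ χ₂ χ₃ : ℂ → ℂ}

theorem systemEnergy_nonneg (κ : ℝ) (w y : ℂ) : 0 ≤ systemEnergy κ w χ χ₁ χ₂ χ₃ y := by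
  unfold systemEnergy; positivity

theorem WirtingerSystem.continuousAt_systemEnergy {y : ℂ} (h : WirtingerSystem t χ χ₁ χ₂ χ₃ y)
    (κ : ℝ) (w : ℂ) : ContinuousAt (systemEnergy κ w χ χ₁ χ₂ χ₃) y := by
  have h0 := h.d0.continuousAt
  have h1 := h.d1.continuousAt
  have h2 := h.d2.continuousAt
  have h3 := h.d3.continuousAt
  have hc : Continuous (fun y : ℂ => conj (y - w)) := by fun_prop
  have hc := hc.continuousAt (x := y)
  unfold systemEnergy
  fun_prop

/-- With D = (y - w)∂ one has D(D - 1) = (y - w)²∂², hence (D - 1/2)²χ = (1/4 - t (y - w)²)χ, which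
is l χ. The shift by 1/2 centres the exponents 1/2 ± i s at ± i s, and the energy is built from χ,
(D - 1/2)χ, its antiholomorphic counterpart and the mixed expression. -/
theorem WirtingerSystem.hasDerivAt_systemEnergy {κ : ℝ} (hκ : 0 < κ) {w θ : ℂ} {r : ℝ} (hr : 0 < r)
    (h : WirtingerSystem t χ χ₁ χ₂ χ₃ (w + r * θ)) :
    ∃ e, HasDerivAt (fun x : ℝ => systemEnergy κ w χ χ₁ χ₂ χ₃ (w + x * θ)) e r ∧
      |r * e - 2 * systemEnergy κ w χ χ₁ χ₂ χ₃ (w + r * θ)| ≤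
        2 * (‖1 / 4 - t (w + r * θ) * (r * θ) ^ 2 + κ ^ 2‖ / κ) *
          systemEnergy κ w χ χ₁ χ₂ χ₃ (w + r * θ) := by
  have hr' : (r : ℂ) ≠ 0 := by exact_mod_cast hr.ne'
  have h0 := h.d0.hasDerivAt_line
  have h1 := h.d1.hasDerivAt_line
  have h2 := h.d2.hasDerivAt_line
  have h3 := h.d3.hasDerivAt_line
  have hz : HasDerivAt (fun x : ℝ => (x : ℂ) * θ) θ r := by
    simpa using (Complex.ofRealCLM.hasDerivAt (x := r)).mul_const θ
  have hzc : HasDerivAt (fun x : ℝ => (x : ℂ) * conj θ) (conj θ) r := by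
    simpa using (Complex.ofRealCLM.hasDerivAt (x := r)).mul_const (conj θ)
  have hB := (hz.mul h1).sub (h0.div_const 2)
  have hC := (hzc.mul h2).sub (h0.div_const 2)
  have hD := (((hz.mul hzc).mul h3).sub (((hz.mul h1).add (hzc.mul h2)).div_const 2)).add
    (h0.div_const 4)
  have := hasDerivAt_quadratic_energy hκ hr (l := 1 / 4 - t (w + r * θ) * (r * θ) ^ 2)
    (A := fun x : ℝ => χ (w + x * θ))
    (B := fun x : ℝ => (x * θ) * χ₁ (w + x * θ) - χ (w + x * θ) / 2)
    (C := fun x : ℝ => (x * conj θ) * χ₂ (w + x * θ) - χ (w + x * θ) / 2)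
    (D := fun x : ℝ => (x * θ) * (x * conj θ) * χ₃ (w + x * θ) -
      ((x * θ) * χ₁ (w + x * θ) + (x * conj θ) * χ₂ (w + x * θ)) / 2 + χ (w + x * θ) / 4)
    (h0.congr_deriv ?_) (hB.congr_deriv ?_) (hC.congr_deriv ?_) (hD.congr_deriv ?_)
  · simpa [systemEnergy] using this
  · field_simp; ring
  · field_simp; ring
  · simp only [map_sub, map_mul, map_div₀, map_one, map_ofNat, map_pow, Complex.conj_ofReal]
    field_simp
    ring
  · simp only [map_sub, map_mul, map_div₀, map_one, map_ofNat, map_pow, Complex.conj_ofReal, Pi.mul_apply]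
    field_simp
    ring

theorem norm_le_of_systemEnergy_le {κ M : ℝ} (hκ : 0 < κ) (hM : 0 ≤ M) {w y : ℂ}
    (h : systemEnergy κ w χ χ₁ χ₂ χ₃ y ≤ M ^ 2) :
    ‖χ y‖ ≤ (1 / κ + 1 / κ ^ 2 + 1) * M ∧ ‖y - w‖ * ‖χ₁ y‖ ≤ (1 / κ + 1 / κ ^ 2 + 1) * M ∧
      ‖y - w‖ * ‖χ₂ y‖ ≤ (1 / κ + 1 / κ ^ 2 + 1) * M ∧
      ‖y - w‖ ^ 2 * ‖χ₃ y‖ ≤ (1 / κ + 1 / κ ^ 2 + 1) * M := by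
  unfold systemEnergy at h
  set a := χ y
  set b := (y - w) * χ₁ y - a / 2 with hb
  set c := conj (y - w) * χ₂ y - a / 2 with hc
  set d := (y - w) * conj (y - w) * χ₃ y - ((y - w) * χ₁ y + conj (y - w) * χ₂ y) / 2 + a / 4 with hd
  have p1 : 0 ≤ κ ^ 4 * ‖a‖ ^ 2 := by positivity
  have p2 : 0 ≤ κ ^ 2 * ‖b‖ ^ 2 := by positivity
  have p3 : 0 ≤ κ ^ 2 * ‖c‖ ^ 2 := by positivity
  have p4 : 0 ≤ ‖d‖ ^ 2 := by positivity
  have ha' : ‖a‖ ≤ 1 / κ ^ 2 * M := by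
    rw [one_div, ← div_eq_inv_mul, le_div_iff₀ (by positivity)]
    exact abs_le_of_sq_le_sq' (by nlinarith) hM |>.2
  have hb' : ‖b‖ ≤ 1 / κ * M := by
    rw [one_div, ← div_eq_inv_mul, le_div_iff₀ (by positivity)]
    exact abs_le_of_sq_le_sq' (by nlinarith) hM |>.2
  have hc' : ‖c‖ ≤ 1 / κ * M := by
    rw [one_div, ← div_eq_inv_mul, le_div_iff₀ (by positivity)]
    exact abs_le_of_sq_le_sq' (by nlinarith) hM |>.2
  have hd' : ‖d‖ ≤ M := abs_le_of_sq_le_sq' (by nlinarith) hM |>.2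
  have q1 : 0 ≤ 1 / κ * M := by positivity
  have q2 : 0 ≤ 1 / κ ^ 2 * M := by positivity
  have n2 : ‖a / 2‖ = ‖a‖ / 2 := by simp
  have n4 : ‖a / 4‖ = ‖a‖ / 4 := by simp
  refine ⟨by linarith, ?_, ?_, ?_⟩
  · rw [← norm_mul, show (y - w) * χ₁ y = b + a / 2 by rw [hb]; ring]
    have := norm_add_le b (a / 2)
    linarith
  · rw [← RCLike.norm_conj, ← norm_mul, show conj (y - w) * χ₂ y = c + a / 2 by rw [hc]; ring]
    have := norm_add_le c (a / 2)
    linarith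
  · have e : (y - w) * conj (y - w) * χ₃ y = d + (b / 2 + c / 2) + a / 4 := by
      rw [hd, hb, hc]; ring
    have n : ‖y - w‖ ^ 2 * ‖χ₃ y‖ = ‖d + (b / 2 + c / 2) + a / 4‖ := by
      rw [← e, norm_mul, norm_mul, RCLike.norm_conj]; ring
    rw [n]
    have m1 := norm_add_le (d + (b / 2 + c / 2)) (a / 4)
    have m2 := norm_add_le d (b / 2 + c / 2)
    have m3 := norm_add_le (b / 2) (c / 2)
    have m4 : ‖b / 2‖ = ‖b‖ / 2 := by simp
    have m5 : ‖c / 2‖ = ‖c‖ / 2 := by simp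
    linarith

/-- Near a regular singular point with exponents `1/2 ± i s`, the energy is `O(|y - w|)`. -/
theorem exists_systemEnergy_le_near {w : ℂ} {s R : ℝ} (hR : 0 < R)
    (h : ∀ y, 0 < ‖y - w‖ → ‖y - w‖ < R → WirtingerSystem t χ χ₁ χ₂ χ₃ y)
    (ht : Tendsto (fun y => t y * (y - w) ^ 2) (𝓝[≠] w) (𝓝 (1 / 4 + s ^ 2))) :
    ∃ κ C r₀ : ℝ, 0 < κ ∧ 0 ≤ C ∧ 0 < r₀ ∧ ∀ y, 0 < ‖y - w‖ → ‖y - w‖ ≤ r₀ →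
      systemEnergy κ w χ χ₁ χ₂ χ₃ y ≤ C * ‖y - w‖ := by
  obtain ⟨r₁, hr₁, hr₁'⟩ := Metric.mem_nhdsWithin_iff.1
    (ht (Metric.ball_mem_nhds _ (show (0 : ℝ) < 1 / 16 by norm_num)))
  set r₀ := min (r₁ / 2) (R / 2) with hr₀
  have hr₀p : 0 < r₀ := by positivity
  have hr₀1 : r₀ < r₁ := (min_le_left _ _).trans_lt (by linarith)
  have hr₀R : r₀ < R := (min_le_right _ _).trans_lt (by linarith)
  -- The shift 1/16 keeps κ ≥ 1/4 even for s = 0, where κ = |s| would degenerate. With |t (y - w)² -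
  -- 1/4 - s²| < 1/16 the defect l + κ² is at most 1/8 in modulus, so the error rate 2|l + κ²|/κ is
  -- at most 1.
  set κ := √(s ^ 2 + 1 / 16) with hκd
  have hκ2 : κ ^ 2 = s ^ 2 + 1 / 16 := Real.sq_sqrt (by positivity)
  have hκ : 1 / 4 ≤ κ := Real.le_sqrt_of_sq_le (by nlinarith [sq_nonneg s])
  have hκp : 0 < κ := by linarith
  have hl (y : ℂ) (h0 : 0 < ‖y - w‖) (h1 : ‖y - w‖ ≤ r₀) :
      2 * (‖1 / 4 - t y * (y - w) ^ 2 + κ ^ 2‖ / κ) ≤ 1 := by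
    have hm : y ∈ Metric.ball w r₁ ∩ {w}ᶜ :=
      ⟨by rw [Metric.mem_ball, dist_eq_norm]; linarith, by
        rintro rfl; simp at h0⟩
    have := hr₁' hm
    rw [Set.mem_preimage, Metric.mem_ball, dist_eq_norm] at this
    have e : 1 / 4 - t y * (y - w) ^ 2 + (κ : ℂ) ^ 2 =
        -(t y * (y - w) ^ 2 - (1 / 4 + s ^ 2)) + ((1 / 16 : ℝ) : ℂ) := by
      have : (κ : ℂ) ^ 2 = s ^ 2 + 1 / 16 := by
        have := congrArg (fun x : ℝ => (x : ℂ)) hκ2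
        push_cast at this
        exact this
      rw [this]; push_cast; ring
    have h2 : ‖1 / 4 - t y * (y - w) ^ 2 + (κ : ℂ) ^ 2‖ ≤ 1 / 8 := by
      rw [e]
      refine (norm_add_le _ _).trans ?_
      rw [norm_neg, Complex.norm_real]
      norm_num
      linarith
    rw [mul_div_assoc', div_le_one hκp]
    linarith
  have hcomp : IsCompact (Metric.sphere w r₀) := isCompact_sphere w r₀
  obtain ⟨M, hM⟩ := hcomp.exists_bound_of_continuousOn (f := systemEnergy κ w χ χ₁ χ₂ χ₃)
    (fun y hy => by
      rw [mem_sphere_iff_norm] at hy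
      exact ((h y (by rw [hy]; exact hr₀p) (by rw [hy]; exact hr₀R)).continuousAt_systemEnergy
        κ w).continuousWithinAt)
  refine ⟨κ, |M| / r₀, r₀, hκp, by positivity, hr₀p, fun y h0 h1 => ?_⟩
  set θ := (y - w) / ‖y - w‖ with hθ
  have hyw : y - w ≠ 0 := norm_pos_iff.1 h0
  have hn0 : (‖y - w‖ : ℂ) ≠ 0 := by exact_mod_cast h0.ne'
  have hθ1 : ‖θ‖ = 1 := by rw [hθ, norm_div]; simp [h0.ne']
  have hnorm (r : ℝ) (hr : 0 < r) : ‖(w + r * θ) - w‖ = r := by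
    simp [hθ1, abs_of_pos hr]
  -- The growth rate of the energy is at least 2 - 1 = 1, so energy over r is nondecreasing along a
  -- ray and is bounded by its values on the circle of radius `r₀`.
  set f : ℝ → ℝ := fun r => systemEnergy κ w χ χ₁ χ₂ χ₃ (w + r * θ) / r
  have hf (r : ℝ) (hr : 0 < r) (hr' : r ≤ r₀) : ∃ e, HasDerivAt f e r ∧ 0 ≤ e := by
    obtain ⟨e, he, he'⟩ := (h (w + r * θ) (by rw [hnorm r hr]; exact hr)
      (by rw [hnorm r hr]; linarith)).hasDerivAt_systemEnergy hκp hr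
    have h3 := hl (w + r * θ) (by rw [hnorm r hr]; exact hr) (by rw [hnorm r hr]; exact hr')
    rw [add_sub_cancel_left] at h3
    refine ⟨_, he.div (hasDerivAt_id r) hr.ne', ?_⟩
    have hp := systemEnergy_nonneg (χ := χ) (χ₁ := χ₁) (χ₂ := χ₂) (χ₃ := χ₃) κ w (w + r * θ)
    have h4 := (abs_le.1 he').1
    have h5 := mul_le_mul_of_nonneg_right h3 hp
    apply div_nonneg _ (by positivity)
    linarith
  have hmono : MonotoneOn f (Set.Icc ‖y - w‖ r₀) := by
    refine monotoneOn_of_deriv_nonneg (convex_Icc _ _) (fun r hr => ?_) (fun r hr => ?_)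
      (fun r hr => ?_)
    · obtain ⟨e, he, -⟩ := hf r (h0.trans_le hr.1) hr.2
      exact he.continuousAt.continuousWithinAt
    · rw [interior_Icc] at hr
      obtain ⟨e, he, -⟩ := hf r (h0.trans hr.1) hr.2.le
      exact he.differentiableAt.differentiableWithinAt
    · rw [interior_Icc] at hr
      obtain ⟨e, he, he'⟩ := hf r (h0.trans hr.1) hr.2.le
      rwa [he.deriv]
  have h6 := hmono ⟨le_rfl, h1⟩ ⟨h1, le_rfl⟩ h1
  have hy : w + (‖y - w‖ : ℂ) * θ = y := by rw [hθ]; field_simp; ring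
  simp only [f, hy] at h6
  have h7 := hM (w + r₀ * θ) (by rw [mem_sphere_iff_norm, hnorm r₀ hr₀p])
  rw [div_le_iff₀ h0] at h6
  refine h6.trans ?_
  gcongr
  exact (le_abs_self _).trans (h7.trans (le_abs_self M))

/-- If `y⁴ t(y)` is bounded at infinity, the energy is `O(|y|⁴)`. -/
theorem exists_systemEnergy_le_far {R T : ℝ} (hR : 0 < R)
    (h : ∀ y, R ≤ ‖y‖ → WirtingerSystem t χ χ₁ χ₂ χ₃ y)
    (ht : ∀ y, R ≤ ‖y‖ → ‖t y‖ * ‖y‖ ^ 4 ≤ T) :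
    ∃ C : ℝ, 0 ≤ C ∧ ∀ y, R ≤ ‖y‖ → systemEnergy (1 / 2) 0 χ χ₁ χ₂ χ₃ y ≤ (C * ‖y‖ ^ 2) ^ 2 := by
  have hcomp : IsCompact (Metric.sphere (0 : ℂ) R) := isCompact_sphere 0 R
  obtain ⟨M, hM⟩ := hcomp.exists_bound_of_continuousOn (f := systemEnergy (1 / 2) 0 χ χ₁ χ₂ χ₃)
    (fun y hy => by
      rw [mem_sphere_zero_iff_norm] at hy
      exact ((h y hy.ge).continuousAt_systemEnergy (1 / 2) 0).continuousWithinAt)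
  set B := |M| * R⁻¹ ^ 4 * Real.exp (2 * T * R⁻¹ ^ 2) with hB
  have hT : 0 ≤ T := by
    have := ht R (by simp [abs_of_pos hR])
    exact le_trans (by positivity) this
  refine ⟨√B, Real.sqrt_nonneg _, fun y hy => ?_⟩
  rw [mul_pow, Real.sq_sqrt (by positivity)]
  have h0 : 0 < ‖y‖ := hR.trans_le hy
  set θ := y / ‖y‖ with hθ
  have hn0 : (‖y‖ : ℂ) ≠ 0 := by exact_mod_cast h0.ne'
  have hθ1 : ‖θ‖ = 1 := by rw [hθ, norm_div]; simp [h0.ne']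
  have hnorm (r : ℝ) (hr : 0 < r) : ‖(0 + r * θ)‖ = r := by
    simp [hθ1, abs_of_pos hr]
  -- For κ = 1/2 the defect l + κ² = 1/2 - t y² has modulus at most 1/2 + T r⁻², so r e ≤ (4 + 4 T
  -- r⁻²) times the energy; r⁻⁴ exp(2 T r⁻²) is the exact integrating factor of this inequality.
  set f : ℝ → ℝ := fun r => systemEnergy (1 / 2) 0 χ χ₁ χ₂ χ₃ (0 + r * θ) * r⁻¹ ^ 4 *
    Real.exp (2 * T * r⁻¹ ^ 2)
  have hf (r : ℝ) (hr : R ≤ r) : ∃ e, HasDerivAt f e r ∧ e ≤ 0 := by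
    have hrp : 0 < r := hR.trans_le hr
    have hrn : R ≤ ‖(0 + r * θ)‖ := by rw [hnorm r hrp]; exact hr
    obtain ⟨e, he, he'⟩ := (h _ hrn).hasDerivAt_systemEnergy (κ := 1 / 2) (by norm_num) hrp
    have hi := hasDerivAt_inv hrp.ne'
    refine ⟨_, (he.mul (hi.pow 4)).mul ((hi.pow 2).const_mul (2 * T)).exp, ?_⟩
    have hp := systemEnergy_nonneg (χ := χ) (χ₁ := χ₁) (χ₂ := χ₂) (χ₃ := χ₃) (1 / 2) 0 (0 + r * θ)
    have ht' := ht _ hrn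
    rw [hnorm r hrp] at ht'
    have h3 : ‖1 / 4 - t (0 + r * θ) * (r * θ) ^ 2 + ((1 / 2 : ℝ) : ℂ) ^ 2‖ ≤ 1 / 2 + T * r⁻¹ ^ 2 := by
      have e1 : 1 / 4 - t (0 + r * θ) * (r * θ) ^ 2 + ((1 / 2 : ℝ) : ℂ) ^ 2 =
          ((1 / 2 : ℝ) : ℂ) - t (0 + r * θ) * (r * θ) ^ 2 := by push_cast; ring
      rw [e1]
      refine (norm_sub_le _ _).trans ?_
      have e2 : ‖t (0 + r * θ) * (r * θ) ^ 2‖ = ‖t (0 + r * θ)‖ * r ^ 2 := by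
        simp [hθ1]
      rw [e2, Complex.norm_real]
      have : ‖t (0 + r * θ)‖ * r ^ 2 ≤ T * r⁻¹ ^ 2 := by
        rw [inv_pow, ← div_eq_mul_inv, le_div_iff₀ (by positivity)]
        linarith
      norm_num at this ⊢
      linarith
    set ee := systemEnergy (1 / 2) 0 χ χ₁ χ₂ χ₃ (0 + r * θ)
    have h5 : r * e ≤ (4 + 4 * T * r⁻¹ ^ 2) * ee := by
      have h4 := (abs_le.1 he').2
      have h6 : 2 * (‖1 / 4 - t (0 + r * θ) * (r * θ) ^ 2 + ((1 / 2 : ℝ) : ℂ) ^ 2‖ / (1 / 2)) * ee ≤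
          (2 + 4 * T * r⁻¹ ^ 2) * ee := by
        gcongr
        linarith
      linarith
    have h7 : e * r⁻¹ ^ 4 * Real.exp (2 * T * r⁻¹ ^ 2) ≤
        (4 + 4 * T * r⁻¹ ^ 2) * ee * r⁻¹ * r⁻¹ ^ 4 * Real.exp (2 * T * r⁻¹ ^ 2) := by
      gcongr
      rw [← div_eq_mul_inv, le_div_iff₀ hrp]
      linarith
    have h8 : (4 + 4 * T * r⁻¹ ^ 2) * ee * r⁻¹ * r⁻¹ ^ 4 * Real.exp (2 * T * r⁻¹ ^ 2) =
        -(ee * (4 * r⁻¹ ^ 3 * (-(r ^ 2)⁻¹)) * Real.exp (2 * T * r⁻¹ ^ 2) + ee * r⁻¹ ^ 4 *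
          (Real.exp (2 * T * r⁻¹ ^ 2) * (2 * T * (2 * r⁻¹ * (-(r ^ 2)⁻¹))))) := by
      field_simp
      ring
    have hee : systemEnergy (1 / 2) 0 χ χ₁ χ₂ χ₃ (r * θ) = ee := by simp [ee]
    norm_num at h7 h8 ⊢
    rw [hee]
    linarith
  have hmono : AntitoneOn f (Set.Icc R ‖y‖) := by
    refine antitoneOn_of_deriv_nonpos (convex_Icc _ _) (fun r hr => ?_) (fun r hr => ?_)
      (fun r hr => ?_)
    · obtain ⟨e, he, -⟩ := hf r hr.1
      exact he.continuousAt.continuousWithinAt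
    · rw [interior_Icc] at hr
      obtain ⟨e, he, -⟩ := hf r hr.1.le
      exact he.differentiableAt.differentiableWithinAt
    · rw [interior_Icc] at hr
      obtain ⟨e, he, he'⟩ := hf r hr.1.le
      rwa [he.deriv]
  have h6 := hmono ⟨le_rfl, hy⟩ ⟨hy, le_rfl⟩ hy
  have hyy : 0 + (‖y‖ : ℂ) * θ = y := by rw [hθ]; field_simp; ring
  simp only [f, hyy] at h6
  have h7 := hM (0 + R * θ) (by rw [mem_sphere_zero_iff_norm, hnorm R hR])
  have h8 : systemEnergy (1 / 2) 0 χ χ₁ χ₂ χ₃ y * ‖y‖⁻¹ ^ 4 ≤ B := by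
    have hp := systemEnergy_nonneg (χ := χ) (χ₁ := χ₁) (χ₂ := χ₂) (χ₃ := χ₃) (1 / 2) 0 y
    calc _ ≤ systemEnergy (1 / 2) 0 χ χ₁ χ₂ χ₃ y * ‖y‖⁻¹ ^ 4 * Real.exp (2 * T * ‖y‖⁻¹ ^ 2) :=
          le_mul_of_one_le_right (by positivity) (Real.one_le_exp (by positivity))
      _ ≤ _ := h6
      _ ≤ B := by
        rw [hB]
        gcongr
        exact (le_abs_self _).trans (h7.trans (le_abs_self M))
  rw [inv_pow, ← div_eq_mul_inv, div_le_iff₀ (by positivity)] at h8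
  calc _ ≤ B * ‖y‖ ^ 4 := h8
    _ = _ := by ring

end Growth

section Oper

variable {n : ℕ}

/-! ### Asymptotics of the potential -/

theorem tendsto_inv_sub_cobounded (a : ℂ) :
    Tendsto (fun y : ℂ => (y - a)⁻¹) (Bornology.cobounded ℂ) (𝓝 0) :=
  tendsto_inv₀_cobounded.comp (tendsto_sub_const_cobounded a)

theorem tendsto_div_sub_cobounded (a : ℂ) :
    Tendsto (fun y : ℂ => y / (y - a)) (Bornology.cobounded ℂ) (𝓝 1) := by
  have h : Tendsto (fun y : ℂ => 1 + a * (y - a)⁻¹) (Bornology.cobounded ℂ) (𝓝 (1 + a * 0)) :=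
    ((tendsto_inv_sub_cobounded a).const_mul a).const_add 1
  rw [mul_zero, add_zero] at h
  refine h.congr' ?_
  filter_upwards [Bornology.eventually_ne_cobounded a] with y hy
  have : y - a ≠ 0 := sub_ne_zero.2 hy
  field_simp
  ring

variable {z j E : Fin n → ℂ}

theorem eventually_ne_cobounded_fin (z : Fin n → ℂ) :
    ∀ᶠ y in Bornology.cobounded ℂ, ∀ r, y - z r ≠ 0 :=
  eventually_all.2 fun r => (Bornology.eventually_ne_cobounded (z r)).mono fun _ h => sub_ne_zero.2 h

theorem IsOper.tendsto_pow_mul (h : IsOper z j E) {k : ℕ} (hk : k < 4) :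
    Tendsto (fun y : ℂ => y ^ k * operPotential z j E y) (Bornology.cobounded ℂ) (𝓝 0) := by
  obtain ⟨L, hL⟩ := h
  have h1 : Tendsto (fun y : ℂ => (y⁻¹) ^ (4 - k) * (y ^ 4 * operPotential z j E y))
      (Bornology.cobounded ℂ) (𝓝 (0 ^ (4 - k) * L)) :=
    (tendsto_inv₀_cobounded.pow (4 - k)).mul hL
  rw [zero_pow (by omega), zero_mul] at h1
  refine h1.congr' ?_
  filter_upwards [Bornology.eventually_ne_cobounded (0 : ℂ)] with y hy
  have : y ^ 4 = y ^ (4 - k) * y ^ k := by rw [← pow_add]; congr 1; omega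
  rw [this, inv_pow]
  field_simp

/-- This and the next two identities state that the coefficients of y⁻¹, y⁻² and y⁻³ in the
expansion of `t` at infinity vanish. -/
theorem IsOper.sum_eq_zero (h : IsOper z j E) : ∑ r, E r = 0 := by
  refine tendsto_nhds_unique ?_ (h.tendsto_pow_mul (k := 1) (by norm_num))
  have h1 : Tendsto (fun y : ℂ => ∑ r, (-(j r * (j r + 1)) * (y / (y - z r) * (y - z r)⁻¹) +
      E r * (y / (y - z r)))) (Bornology.cobounded ℂ)
      (𝓝 (∑ r, (-(j r * (j r + 1)) * (1 * 0) + E r * 1))) :=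
    tendsto_finsetSum _ fun r _ => (((tendsto_div_sub_cobounded (z r)).mul
      (tendsto_inv_sub_cobounded (z r))).const_mul _).add
        ((tendsto_div_sub_cobounded (z r)).const_mul _)
  simp only [mul_zero, zero_add, mul_one] at h1
  refine h1.congr' ?_
  filter_upwards [eventually_ne_cobounded_fin z] with y hy
  rw [operPotential, Finset.mul_sum]
  refine Finset.sum_congr rfl fun r _ => ?_
  have := hy r
  field_simp

theorem IsOper.sum_mul_eq (h : IsOper z j E) : ∑ r, z r * E r = ∑ r, j r * (j r + 1) := by
  have h0 : ∑ r, (-(j r * (j r + 1)) + z r * E r) = 0 := by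
    refine tendsto_nhds_unique ?_ (h.tendsto_pow_mul (k := 2) (by norm_num))
    have h1 : Tendsto (fun y : ℂ => ∑ r, (-(j r * (j r + 1)) * (y / (y - z r)) ^ 2 +
        z r * E r * (y / (y - z r)))) (Bornology.cobounded ℂ)
        (𝓝 (∑ r, (-(j r * (j r + 1)) * 1 ^ 2 + z r * E r * 1))) :=
      tendsto_finsetSum _ fun r _ => (((tendsto_div_sub_cobounded (z r)).pow 2).const_mul _).add
          ((tendsto_div_sub_cobounded (z r)).const_mul _)
    simp only [one_pow, mul_one] at h1
    refine h1.congr' ?_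
    filter_upwards [eventually_ne_cobounded_fin z] with y hy
    -- A multiple of the preceding identity is subtracted, so that every summand has a finite limit
    -- by itself.
    have e : y ^ 2 * operPotential z j E y = y ^ 2 * operPotential z j E y - y * ∑ r, E r := by
      rw [h.sum_eq_zero]; ring
    rw [e, operPotential, Finset.mul_sum, Finset.mul_sum, ← Finset.sum_sub_distrib]
    refine Finset.sum_congr rfl fun r _ => ?_
    have := hy r
    field_simp
    ring
  rw [Finset.sum_add_distrib, Finset.sum_neg_distrib] at h0
  linear_combination h0

theorem IsOper.sum_sq_mul_eq (h : IsOper z j E) :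
    ∑ r, z r ^ 2 * E r = 2 * ∑ r, z r * (j r * (j r + 1)) := by
  have h0 : ∑ r, (-(j r * (j r + 1)) * (2 * z r) + z r ^ 2 * E r) = 0 := by
    refine tendsto_nhds_unique ?_ (h.tendsto_pow_mul (k := 3) (by norm_num))
    have h1 : Tendsto (fun y : ℂ => ∑ r, (-(j r * (j r + 1)) * (2 * z r * (y / (y - z r)) ^ 2 -
        z r ^ 2 * (y / (y - z r) * (y - z r)⁻¹)) + z r ^ 2 * E r * (y / (y - z r))))
        (Bornology.cobounded ℂ) (𝓝 (∑ r, (-(j r * (j r + 1)) * (2 * z r * 1 ^ 2 -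
          z r ^ 2 * (1 * 0)) + z r ^ 2 * E r * 1))) :=
      tendsto_finsetSum _ fun r _ => (((((tendsto_div_sub_cobounded (z r)).pow 2).const_mul _).sub
        (((tendsto_div_sub_cobounded (z r)).mul (tendsto_inv_sub_cobounded (z r))).const_mul
          _)).const_mul _).add ((tendsto_div_sub_cobounded (z r)).const_mul _)
    simp only [one_pow, mul_one, mul_zero, sub_zero] at h1
    refine h1.congr' ?_
    filter_upwards [eventually_ne_cobounded_fin z] with y hy
    have e : y ^ 3 * operPotential z j E y = y ^ 3 * operPotential z j E y -
        (y * ∑ r, (-(j r * (j r + 1)) + z r * E r) + y ^ 2 * ∑ r, E r) := by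
      rw [h.sum_eq_zero, Finset.sum_add_distrib, Finset.sum_neg_distrib, h.sum_mul_eq]; ring
    rw [e, operPotential, Finset.mul_sum, Finset.mul_sum, Finset.mul_sum,
      ← Finset.sum_add_distrib, ← Finset.sum_sub_distrib]
    refine Finset.sum_congr rfl fun r _ => ?_
    have := hy r
    field_simp
    ring
  rw [Finset.sum_add_distrib] at h0
  rw [Finset.mul_sum, ← sub_eq_zero, ← h0, sub_eq_iff_eq_add, add_assoc, eq_comm, add_comm,
    add_assoc, add_eq_left, ← Finset.sum_add_distrib]
  exact Finset.sum_eq_zero fun r _ => by ring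

/-- For j = -1/2 + i s one has -j(j + 1) = 1/4 + s² with s real. Both exponents 1/2 ± i s then have
real part 1/2, which is what the energy estimate at a node needs. -/
theorem tendsto_operPotential_near (hz : Function.Injective z) (hj : ∀ r, (j r).re = -1 / 2)
    (r : Fin n) : Tendsto (fun y => operPotential z j E y * (y - z r) ^ 2) (𝓝[≠] (z r))
      (𝓝 (1 / 4 + ((j r).im : ℂ) ^ 2)) := by
  have hjr : j r = -1 / 2 + (j r).im * Complex.I := by
    conv_lhs => rw [← Complex.re_add_im (j r), hj r]
    push_cast; ring
  set g : ℂ → ℂ := fun y => -(j r * (j r + 1)) + E r * (y - z r) + (y - z r) ^ 2 *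
    ∑ s ∈ Finset.univ.erase r, (-(j s * (j s + 1)) / (y - z s) ^ 2 + E s / (y - z s)) with hg
  have hc : ContinuousAt g (z r) := by
    have h1 : ContinuousAt (fun y => ∑ s ∈ Finset.univ.erase r,
        (-(j s * (j s + 1)) / (y - z s) ^ 2 + E s / (y - z s))) (z r) := by
      refine tendsto_finsetSum _ fun s hs => ?_
      have h2 : z r - z s ≠ 0 := sub_ne_zero.2 (hz.ne (Finset.ne_of_mem_erase hs).symm)
      have h3 : (z r - z s) ^ 2 ≠ 0 := pow_ne_zero 2 h2
      change ContinuousAt (fun y => -(j s * (j s + 1)) / (y - z s) ^ 2 + E s / (y - z s)) (z r)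
      fun_prop (disch := assumption)
    rw [hg]
    fun_prop
  have h0 : g (z r) = 1 / 4 + ((j r).im : ℂ) ^ 2 := by
    simp only [hg, sub_self]
    rw [hjr]
    simp
    ring_nf
    simp
  rw [← h0]
  refine (hc.tendsto.mono_left nhdsWithin_le_nhds).congr' ?_
  filter_upwards [self_mem_nhdsWithin] with y hy
  have : y - z r ≠ 0 := sub_ne_zero.2 hy
  rw [operPotential, ← Finset.add_sum_erase _ _ (Finset.mem_univ r)]
  simp only [hg]
  field_simp

/-! ### Weights -/

/-- `∏_r |y - z_r|`. -/
def nodeDist (z : Fin n → ℂ) (y : ℂ) : ℝ := ∏ r, ‖y - z r‖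

theorem nodeDist_nonneg (z : Fin n → ℂ) (y : ℂ) : 0 ≤ nodeDist z y :=
  Finset.prod_nonneg fun _ _ => norm_nonneg _

theorem nodeDist_pos {y : ℂ} (hy : y ∉ Set.range z) : 0 < nodeDist z y :=
  Finset.prod_pos fun r _ => norm_pos_iff.2 (sub_ne_zero.2 fun h => hy ⟨r, h.symm⟩)

theorem continuous_nodeDist (z : Fin n → ℂ) : Continuous (nodeDist z) := by
  unfold nodeDist; fun_prop

theorem tendsto_norm_sub_div (a : ℂ) :
    Tendsto (fun y : ℂ => ‖y - a‖ / (1 + ‖y‖)) (Bornology.cobounded ℂ) (𝓝 1) := by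
  have h1 : Tendsto (fun y : ℂ => (‖y‖ / (1 + ‖y‖)) / ‖y / (y - a)‖) (Bornology.cobounded ℂ)
      (𝓝 (1 / ‖(1 : ℂ)‖)) := by
    refine Tendsto.div ?_ (tendsto_div_sub_cobounded a).norm (by simp)
    have h2 : Tendsto (fun y : ℂ => 1 - (1 + ‖y‖)⁻¹) (Bornology.cobounded ℂ) (𝓝 (1 - 0)) := by
      refine tendsto_const_nhds.sub (tendsto_inv_atTop_zero.comp ?_)
      exact tendsto_atTop_add_const_left _ _ tendsto_norm_cobounded_atTop
    rw [sub_zero] at h2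
    refine h2.congr fun y => ?_
    have : 1 + ‖y‖ ≠ 0 := by positivity
    field_simp
    ring
  rw [norm_one, div_one] at h1
  refine h1.congr' ?_
  filter_upwards [Bornology.eventually_ne_cobounded (0 : ℂ), Bornology.eventually_ne_cobounded a]
    with y hy hya
  have h3 : ‖y‖ ≠ 0 := norm_ne_zero_iff.2 hy
  have h4 : ‖y - a‖ ≠ 0 := norm_ne_zero_iff.2 (sub_ne_zero.2 hya)
  rw [norm_div]
  field_simp

theorem tendsto_nodeDist_div (z : Fin n → ℂ) :
    Tendsto (fun y : ℂ => nodeDist z y / (1 + ‖y‖) ^ n) (Bornology.cobounded ℂ) (𝓝 1) := by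
  have h := tendsto_finsetProd (Finset.univ : Finset (Fin n))
    fun r _ => tendsto_norm_sub_div (z r)
  simp only [Finset.prod_const_one] at h
  refine h.congr fun y => ?_
  rw [nodeDist, Finset.prod_div_distrib]
  simp

theorem exists_bound_off_finite {Z : Set ℂ} {g : ℂ → ℝ}
    (h : ∀ x, ∃ C, ∀ᶠ y in 𝓝 x, y ∉ Z → g y ≤ C)
    (hfar : ∃ C, ∀ᶠ y in Bornology.cobounded ℂ, g y ≤ C) : ∃ C, 0 ≤ C ∧ ∀ y ∉ Z, g y ≤ C := by
  obtain ⟨C₁, hC₁⟩ := hfar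
  obtain ⟨R, -, hR⟩ := (hasBasis_cobounded_norm (E := ℂ)).eventually_iff.1 hC₁
  obtain ⟨C₂, hC₂⟩ : ∃ C, ∀ y ∈ Metric.closedBall (0 : ℂ) R, y ∉ Z → g y ≤ C := by
    refine (isCompact_closedBall (0 : ℂ) R).induction_on (p := fun s => ∃ C, ∀ y ∈ s, y ∉ Z → g y ≤ C)
      ⟨0, by simp⟩ (fun s t hst ⟨C, hC⟩ => ⟨C, fun y hy => hC y (hst hy)⟩)
      (fun s t ⟨C, hC⟩ ⟨D, hD⟩ => ⟨max C D, fun y hy hyZ => ?_⟩) fun x _ => ?_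
    · rcases hy with hy | hy
      · exact (hC y hy hyZ).trans (le_max_left _ _)
      · exact (hD y hy hyZ).trans (le_max_right _ _)
    · obtain ⟨C, hC⟩ := h x
      exact ⟨_, nhdsWithin_le_nhds hC, C, fun y hy => hy⟩
  refine ⟨max 0 (max C₁ C₂), le_max_left _ _, fun y hy => ?_⟩
  by_cases hyR : R ≤ ‖y‖
  · exact (hR hyR).trans ((le_max_left _ _).trans (le_max_right _ _))
  · exact (hC₂ y (by simpa using (not_le.1 hyR).le) hy).trans ((le_max_right _ _).trans (le_max_right _ _))

/-- Order a at each node and order K at infinity combine into one global weight; since `nodeDist`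
grows like |y|^n, the factor `nodeDist ^ a` has to be corrected by the power K - n a of 1 + |y|. -/
theorem exists_weight_bound (hz : Function.Injective z) {f : ℂ → ℂ} {a K : ℝ}
    (hf : ∀ y ∉ Set.range z, ContinuousAt f y)
    (hnear : ∀ r, ∃ C, ∀ᶠ y in 𝓝[≠] (z r), ‖f y‖ ≤ C * ‖y - z r‖ ^ a)
    (hfar : ∃ C, ∀ᶠ y in Bornology.cobounded ℂ, ‖f y‖ ≤ C * ‖y‖ ^ K) :
    ∃ C, 0 ≤ C ∧ ∀ y ∉ Set.range z, ‖f y‖ ≤ C * (nodeDist z y ^ a * (1 + ‖y‖) ^ (K - n * a)) := by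
  set w : ℂ → ℝ := fun y => nodeDist z y ^ a * (1 + ‖y‖) ^ (K - n * a) with hw
  have hwp (y : ℂ) (hy : y ∉ Set.range z) : 0 < w y :=
    mul_pos (Real.rpow_pos_of_pos (nodeDist_pos hy) _) (Real.rpow_pos_of_pos (by positivity) _)
  suffices h : ∃ C, 0 ≤ C ∧ ∀ y ∉ Set.range z, ‖f y‖ / w y ≤ C by
    obtain ⟨C, hC0, hC⟩ := h
    exact ⟨C, hC0, fun y hy => (div_le_iff₀ (hwp y hy)).1 (hC y hy)⟩
  refine exists_bound_off_finite ?_ ?_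
  · intro x
    have hb {g : ℂ → ℝ} (hg : ContinuousAt g x) : ∃ C, ∀ᶠ y in 𝓝 x, g y ≤ C :=
      ⟨g x + 1, (hg.eventually_lt_const (by linarith)).mono fun y hy => hy.le⟩
    have hjb : ContinuousAt (fun y : ℂ => (1 + ‖y‖) ^ (K - n * a)) x :=
      (by fun_prop : ContinuousAt (fun y : ℂ => 1 + ‖y‖) x).rpow_const (.inl (by positivity))
    by_cases hx : x ∈ Set.range z
    · obtain ⟨r, rfl⟩ := hx
      obtain ⟨C, hC⟩ := hnear r
      have hc : ContinuousAt (fun y => |C| * ((∏ s ∈ Finset.univ.erase r, ‖y - z s‖) ^ a *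
          (1 + ‖y‖) ^ (K - n * a))⁻¹) (z r) := by
        have h1 : (∏ s ∈ Finset.univ.erase r, ‖z r - z s‖) ≠ 0 :=
          Finset.prod_ne_zero_iff.2 fun s hs => norm_ne_zero_iff.2
            (sub_ne_zero.2 (hz.ne (Finset.ne_of_mem_erase hs).symm))
        have h2 : ContinuousAt (fun y => (∏ s ∈ Finset.univ.erase r, ‖y - z s‖) ^ a) (z r) :=
          (by fun_prop : ContinuousAt (fun y => ∏ s ∈ Finset.univ.erase r, ‖y - z s‖)
            (z r)).rpow_const (.inl h1)
        refine continuousAt_const.mul ((h2.mul hjb).inv₀ (mul_ne_zero ?_ ?_))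
        · refine (Real.rpow_pos_of_pos (lt_of_le_of_ne ?_ h1.symm) _).ne'
          exact Finset.prod_nonneg fun _ _ => norm_nonneg _
        · exact (Real.rpow_pos_of_pos (by positivity) _).ne'
      obtain ⟨D, hD⟩ := hb hc
      refine ⟨D, ?_⟩
      rw [eventually_nhdsWithin_iff] at hC
      filter_upwards [hC, hD] with y hy1 hy2 hyZ
      have hne : y ≠ z r := fun h => hyZ ⟨r, h.symm⟩
      have hp : 0 < ‖y - z r‖ := norm_pos_iff.2 (sub_ne_zero.2 hne)
      refine le_trans ?_ hy2
      have e : w y = ‖y - z r‖ ^ a * ((∏ s ∈ Finset.univ.erase r, ‖y - z s‖) ^ a *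
          (1 + ‖y‖) ^ (K - n * a)) := by
        simp only [hw, nodeDist]
        rw [← Finset.mul_prod_erase _ _ (Finset.mem_univ r),
          Real.mul_rpow hp.le (Finset.prod_nonneg fun _ _ => norm_nonneg _), mul_assoc]
      have hpa := Real.rpow_pos_of_pos hp a
      rw [div_le_iff₀ (hwp y hyZ)]
      refine (hy1 hne).trans ?_
      have h3 := hwp y hyZ
      rw [e] at h3 ⊢
      have h4 := (pos_iff_pos_of_mul_pos h3).1 hpa
      rw [mul_comm (‖y - z r‖ ^ a), ← mul_assoc, mul_assoc |C|, inv_mul_cancel₀ h4.ne', mul_one]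
      gcongr
      exact le_abs_self C
    · have hwc : ContinuousAt w x :=
        ((continuous_nodeDist z).continuousAt.rpow_const (.inl (nodeDist_pos hx).ne')).mul hjb
      obtain ⟨C, hC⟩ := hb ((hf x hx).norm.div hwc (hwp x hx).ne')
      exact ⟨C, hC.mono fun y hy _ => hy⟩
  · obtain ⟨C, hC⟩ := hfar
    refine ⟨|C| * 2, ?_⟩
    have h1 : Tendsto (fun y : ℂ => (‖y - 0‖ / (1 + ‖y‖)) ^ K * (nodeDist z y / (1 + ‖y‖) ^ n) ^ (-a))
        (Bornology.cobounded ℂ) (𝓝 (1 ^ K * 1 ^ (-a))) :=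
      ((tendsto_norm_sub_div 0).rpow_const (.inl one_ne_zero)).mul
        ((tendsto_nodeDist_div z).rpow_const (.inl one_ne_zero))
    simp only [Real.one_rpow, mul_one, sub_zero] at h1
    filter_upwards [hC, h1.eventually_lt_const (show (1 : ℝ) < 2 by norm_num),
      eventually_ne_cobounded_fin z] with y hy1 hy2 hy3
    have hyZ : y ∉ Set.range z := fun ⟨r, hr⟩ => hy3 r (sub_eq_zero.2 hr.symm)
    have hjp : 0 < 1 + ‖y‖ := by positivity
    rw [div_le_iff₀ (hwp y hyZ)]
    have e : ‖y‖ ^ K = (‖y‖ / (1 + ‖y‖)) ^ K * (nodeDist z y / (1 + ‖y‖) ^ n) ^ (-a) * w y := by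
      have hn := nodeDist_pos hyZ
      simp only [hw]
      rw [Real.div_rpow (norm_nonneg y) hjp.le, Real.div_rpow hn.le (by positivity),
        Real.rpow_neg hn.le, Real.rpow_neg (by positivity), ← Real.rpow_natCast, ← Real.rpow_mul hjp.le,
        Real.rpow_sub hjp]
      have e1 := Real.rpow_pos_of_pos hn a
      have e2 := Real.rpow_pos_of_pos hjp K
      have e3 := Real.rpow_pos_of_pos hjp (n * a)
      field_simp
    refine hy1.trans ?_
    rw [e, ← mul_assoc]
    have h0 := (hwp y hyZ).le
    have h5 := nodeDist_nonneg z y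
    gcongr
    exact le_abs_self C

end Oper

section SolutionBounds

variable {n : ℕ}

/-! ### Bounds for single-valued solutions -/

variable {z j E : Fin n → ℂ} {χ : ℂ → ℂ}

theorem eventually_notMem_range_cobounded (z : Fin n → ℂ) :
    ∃ R, 0 < R ∧ ∀ y : ℂ, R ≤ ‖y‖ → y ∉ Set.range z := by
  refine ⟨1 + ∑ r, ‖z r‖, by positivity, ?_⟩
  rintro y hy ⟨r, rfl⟩
  have := Finset.single_le_sum (f := fun r => ‖z r‖) (fun _ _ => norm_nonneg _) (Finset.mem_univ r)
  linarith

/-- The energy is O(|y - z_r|), so the quantities that it controls are of order 1/2. This suffices: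
every singular weight below stays above the order -2 at which local integrability in the plane is
lost. -/
theorem IsOperSolution.exists_bounds_near (h : IsOperSolution z j E χ) (hz : Function.Injective z)
    (hj : ∀ r, (j r).re = -1 / 2) (r : Fin n) :
    ∃ C, ∀ᶠ y in 𝓝[≠] (z r), ‖χ y‖ ≤ C * √‖y - z r‖ ∧
      ‖y - z r‖ * ‖wirtinger χ y‖ ≤ C * √‖y - z r‖ ∧
      ‖y - z r‖ * ‖wirtingerBar χ y‖ ≤ C * √‖y - z r‖ ∧
      ‖y - z r‖ ^ 2 * ‖wirtingerBar (wirtinger χ) y‖ ≤ C * √‖y - z r‖ := by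
  have hnear : ∀ᶠ y in 𝓝[≠] (z r), y ∉ Set.range z := by
    have h1 : ∀ᶠ y in 𝓝 (z r), y ∉ Set.range z \ {z r} :=
      ((Set.finite_range z).subset Set.sdiff_subset).isClosed.isOpen_compl.mem_nhds (by simp)
    rw [eventually_nhdsWithin_iff]
    filter_upwards [h1] with y hy hne hmem
    exact hy ⟨hmem, hne⟩
  obtain ⟨R, hR, hR'⟩ := Metric.mem_nhdsWithin_iff.1 hnear
  obtain ⟨κ, C, r₀, hκ, hC, hr₀, hE⟩ := exists_systemEnergy_le_near (w := z r) (s := (j r).im)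
    hR (fun y h0 h1 => h.wirtingerSystem (hR' ⟨by rwa [Metric.mem_ball, dist_eq_norm], by
      rintro rfl; simp at h0⟩)) (tendsto_operPotential_near hz hj r)
  refine ⟨(1 / κ + 1 / κ ^ 2 + 1) * √C, ?_⟩
  rw [eventually_nhdsWithin_iff]
  filter_upwards [Metric.ball_mem_nhds (z r) hr₀] with y hy hne
  rw [Metric.mem_ball, dist_eq_norm] at hy
  have h1 := hE y (norm_pos_iff.2 (sub_ne_zero.2 hne)) hy.le
  have h2 := norm_le_of_systemEnergy_le (M := √C * √‖y - z r‖) hκ (by positivity)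
    (h1.trans_eq (by rw [mul_pow, Real.sq_sqrt hC, Real.sq_sqrt (norm_nonneg _)]))
  simpa only [mul_assoc] using h2

theorem IsOper.exists_bound_far (h : IsOper z j E) :
    ∃ R T : ℝ, 0 < R ∧ ∀ y : ℂ, R ≤ ‖y‖ → y ∉ Set.range z ∧ ‖operPotential z j E y‖ * ‖y‖ ^ 4 ≤ T := by
  obtain ⟨L, hL⟩ := h
  obtain ⟨R₁, hR₁, hR₁'⟩ := eventually_notMem_range_cobounded z
  obtain ⟨R₂, -, hR₂⟩ := (hasBasis_cobounded_norm (E := ℂ)).eventually_iff.1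
    (hL.norm.eventually_lt_const (lt_add_one ‖L‖))
  refine ⟨max R₁ R₂, ‖L‖ + 1, lt_max_of_lt_left hR₁, fun y hy =>
    ⟨hR₁' y ((le_max_left _ _).trans hy), ?_⟩⟩
  have := hR₂ (show R₂ ≤ ‖y‖ from (le_max_right _ _).trans hy)
  rw [norm_mul, norm_pow] at this
  linarith

theorem IsOperSolution.exists_bounds_far (h : IsOperSolution z j E χ) (ho : IsOper z j E) :
    ∃ R C : ℝ, 0 < R ∧ ∀ y : ℂ, R ≤ ‖y‖ → ‖χ y‖ ≤ C * ‖y‖ ^ 2 ∧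
      ‖y‖ * ‖wirtinger χ y‖ ≤ C * ‖y‖ ^ 2 ∧ ‖y‖ * ‖wirtingerBar χ y‖ ≤ C * ‖y‖ ^ 2 ∧
      ‖y‖ ^ 2 * ‖wirtingerBar (wirtinger χ) y‖ ≤ C * ‖y‖ ^ 2 := by
  obtain ⟨R, T, hR, hRT⟩ := ho.exists_bound_far
  obtain ⟨C, hC, hE⟩ := exists_systemEnergy_le_far hR
    (fun y hy => h.wirtingerSystem (hRT y hy).1) (fun y hy => (hRT y hy).2)
  refine ⟨R, (1 / (1 / 2) + 1 / (1 / 2) ^ 2 + 1) * C, hR, fun y hy => ?_⟩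
  have h2 := norm_le_of_systemEnergy_le (M := C * ‖y‖ ^ 2) (by norm_num) (by positivity) (hE y hy)
  simpa only [mul_assoc, sub_zero] using h2

theorem IsOperSolution.exists_global_bounds (h : IsOperSolution z j E χ) (ho : IsOper z j E)
    (hz : Function.Injective z) (hj : ∀ r, (j r).re = -1 / 2) :
    ∃ C, 0 ≤ C ∧ ∀ y ∉ Set.range z,
      ‖χ y‖ ≤ C * (nodeDist z y ^ (1 / 2 : ℝ) * (1 + ‖y‖) ^ (2 - n * (1 / 2) : ℝ)) ∧
      ‖wirtinger χ y‖ ≤ C * (nodeDist z y ^ (-1 / 2 : ℝ) * (1 + ‖y‖) ^ (1 - n * (-1 / 2) : ℝ)) ∧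
      ‖wirtingerBar χ y‖ ≤ C * (nodeDist z y ^ (-1 / 2 : ℝ) * (1 + ‖y‖) ^ (1 - n * (-1 / 2) : ℝ)) ∧
      ‖wirtingerBar (wirtinger χ) y‖ ≤
        C * (nodeDist z y ^ (-3 / 2 : ℝ) * (1 + ‖y‖) ^ (0 - n * (-3 / 2) : ℝ)) := by
  obtain ⟨R, D, hR, hfar⟩ := h.exists_bounds_far ho
  have hfar' : ∀ᶠ y in Bornology.cobounded ℂ, R ≤ ‖y‖ :=
    (hasBasis_cobounded_norm (E := ℂ)).mem_of_mem trivial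
  have hnear := h.exists_bounds_near hz hj
  have hpos (r : Fin n) : ∀ᶠ y in 𝓝[≠] (z r), 0 < ‖y - z r‖ := by
    filter_upwards [self_mem_nhdsWithin] with y hy using norm_pos_iff.2 (sub_ne_zero.2 hy)
  have e1 {x : ℝ} (hx : 0 < x) : x ^ (-1 / 2 : ℝ) * x = √x := by
    rw [Real.sqrt_eq_rpow, show (1 / 2 : ℝ) = -1 / 2 + 1 by norm_num, Real.rpow_add hx, Real.rpow_one]
  have e3 {x : ℝ} (hx : 0 < x) : x ^ (-3 / 2 : ℝ) * x ^ 2 = √x := by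
    rw [Real.sqrt_eq_rpow, show (1 / 2 : ℝ) = -3 / 2 + (2 : ℕ) by norm_num, Real.rpow_add hx,
      Real.rpow_natCast]
  obtain ⟨C0, hC0, b0⟩ := exists_weight_bound (f := χ) (a := 1 / 2) (K := 2) hz
    (fun y hy => (h.wirtingerSystem hy).d0.continuousAt)
    (fun r => by
      obtain ⟨C, hC⟩ := hnear r
      exact ⟨C, hC.mono fun y hy => by rw [← Real.sqrt_eq_rpow]; exact hy.1⟩)
    ⟨D, hfar'.mono fun y hy => by
      have := (hfar y hy).1
      rwa [Real.rpow_two]⟩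
  obtain ⟨C1, hC1, b1⟩ := exists_weight_bound (f := wirtinger χ) (a := -1 / 2) (K := 1) hz
    (fun y hy => (h.wirtingerSystem hy).d1.continuousAt)
    (fun r => by
      obtain ⟨C, hC⟩ := hnear r
      refine ⟨C, ?_⟩
      filter_upwards [hC, hpos r] with y hy hp
      have := hy.2.1
      rw [← e1 hp, ← mul_assoc, mul_comm] at this
      exact le_of_mul_le_mul_right this hp)
    ⟨D, hfar'.mono fun y hy => by
      have := (hfar y hy).2.1
      have hp := hR.trans_le hy
      rw [pow_two, ← mul_assoc, mul_comm] at this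
      rw [Real.rpow_one]
      exact le_of_mul_le_mul_right this hp⟩
  obtain ⟨C2, hC2, b2⟩ := exists_weight_bound (f := wirtingerBar χ) (a := -1 / 2) (K := 1) hz
    (fun y hy => (h.wirtingerSystem hy).d2.continuousAt)
    (fun r => by
      obtain ⟨C, hC⟩ := hnear r
      refine ⟨C, ?_⟩
      filter_upwards [hC, hpos r] with y hy hp
      have := hy.2.2.1
      rw [← e1 hp, ← mul_assoc, mul_comm] at this
      exact le_of_mul_le_mul_right this hp)
    ⟨D, hfar'.mono fun y hy => by
      have := (hfar y hy).2.2.1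
      have hp := hR.trans_le hy
      rw [pow_two, ← mul_assoc, mul_comm] at this
      rw [Real.rpow_one]
      exact le_of_mul_le_mul_right this hp⟩
  obtain ⟨C3, hC3, b3⟩ := exists_weight_bound (f := wirtingerBar (wirtinger χ)) (a := -3 / 2) (K := 0) hz
    (fun y hy => (h.wirtingerSystem hy).d3.continuousAt)
    (fun r => by
      obtain ⟨C, hC⟩ := hnear r
      refine ⟨C, ?_⟩
      filter_upwards [hC, hpos r] with y hy hp
      have := hy.2.2.2
      rw [← e3 hp, ← mul_assoc, mul_comm] at this
      exact le_of_mul_le_mul_right this (pow_pos hp 2))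
    ⟨D, hfar'.mono fun y hy => by
      have := (hfar y hy).2.2.2
      have hp := hR.trans_le hy
      rw [mul_comm] at this
      rw [Real.rpow_zero, mul_one]
      exact le_of_mul_le_mul_right this (pow_pos hp 2)⟩
  refine ⟨C0 + C1 + C2 + C3, by positivity, fun y hy => ?_⟩
  have hn := nodeDist_nonneg z y
  refine ⟨(b0 y hy).trans ?_, (b1 y hy).trans ?_, (b2 y hy).trans ?_, (b3 y hy).trans ?_⟩ <;>
    gcongr <;> linarith

/-- Radial integration of a bound for the gradient. -/
theorem norm_le_of_gradient_le {F p q : ℂ → ℂ} {R : ℝ} (hR : 0 < R)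
    (hF : ∀ y, R ≤ ‖y‖ → HasWirtingerAt F (p y) (q y) y) {B B' : ℝ → ℝ}
    (hB : ∀ r, R ≤ r → HasDerivAt B (B' r) r) (hR0 : ∀ y, ‖y‖ = R → ‖F y‖ ≤ B R)
    (hb : ∀ y, R ≤ ‖y‖ → ‖p y‖ + ‖q y‖ ≤ B' ‖y‖) (y : ℂ) (hy : R ≤ ‖y‖) : ‖F y‖ ≤ B ‖y‖ := by
  have h0 : 0 < ‖y‖ := hR.trans_le hy
  set θ := y / ‖y‖ with hθ
  have hn0 : (‖y‖ : ℂ) ≠ 0 := by exact_mod_cast h0.ne'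
  have hθ1 : ‖θ‖ = 1 := by rw [hθ, norm_div]; simp [h0.ne']
  have hnorm (r : ℝ) (hr : 0 < r) : ‖(0 + r * θ)‖ = r := by
    simp [hθ1, abs_of_pos hr]
  have hd (r : ℝ) (hr : R ≤ r) : HasDerivAt (fun r : ℝ => F (0 + r * θ))
      (p (0 + r * θ) * θ + q (0 + r * θ) * conj θ) r :=
    (hF _ (by rw [hnorm r (hR.trans_le hr)]; exact hr)).hasDerivAt_line 0 θ r
  have := image_norm_le_of_norm_deriv_right_le_deriv_boundary' (a := R) (b := ‖y‖)
    (f := fun r : ℝ => F (0 + r * θ)) (B := B) (B' := B')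
    (fun r hr => (hd r hr.1).continuousAt.continuousWithinAt)
    (fun r hr => (hd r hr.1).hasDerivWithinAt) (hR0 _ (hnorm R hR))
    (fun r hr => (hB r hr.1).continuousAt.continuousWithinAt)
    (fun r hr => (hB r hr.1).hasDerivWithinAt) (fun r hr => ?_) ⟨hy, le_rfl⟩
  · have hyy : 0 + (‖y‖ : ℂ) * θ = y := by rw [hθ]; field_simp; ring
    simpa only [hyy] using this
  · have hrp := hR.trans_le hr.1
    have h1 := hb (0 + r * θ) (by rw [hnorm r hrp]; exact hr.1)
    rw [hnorm r hrp] at h1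
    refine (norm_add_le _ _).trans ?_
    rwa [norm_mul, norm_mul, RCLike.norm_conj, hθ1, mul_one, mul_one]

/-- Complex conjugation exchanges ∂χ and ∂̄χ, so every estimate for χ - y ∂χ also gives one for χ -
conj y · ∂̄χ. -/
theorem WirtingerSystem.conj {t χ χ₁ χ₂ χ₃ : ℂ → ℂ} {y : ℂ} (h : WirtingerSystem t χ χ₁ χ₂ χ₃ y) :
    WirtingerSystem t (fun y => conj (χ y)) (fun y => conj (χ₂ y)) (fun y => conj (χ₁ y))
      (fun y => conj (χ₃ y)) y :=
  ⟨h.d0.star, h.d2.star.congr_deriv (by simp) rfl, h.d1.star.congr_deriv rfl (by simp),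
    h.d3.star.congr_deriv (by simp) (by simp)⟩

/-- Far away, `χ - y ∂χ` grows at most linearly. -/
theorem exists_norm_sub_mul_le {t χ χ₁ χ₂ χ₃ : ℂ → ℂ} {R T C : ℝ} (hR : 0 < R)
    (h : ∀ y, R ≤ ‖y‖ → WirtingerSystem t χ χ₁ χ₂ χ₃ y)
    (ht : ∀ y, R ≤ ‖y‖ → ‖t y‖ * ‖y‖ ^ 4 ≤ T) (h0 : ∀ y, R ≤ ‖y‖ → ‖χ y‖ ≤ C * ‖y‖ ^ 2)
    (h1 : ∀ y, R ≤ ‖y‖ → ‖χ₁ y‖ ≤ C * ‖y‖) (h2 : ∀ y, R ≤ ‖y‖ → ‖χ₂ y‖ ≤ C * ‖y‖) :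
    ∃ M, 0 ≤ M ∧ ∀ y, R ≤ ‖y‖ → ‖χ y - y * χ₁ y‖ ≤ M * ‖y‖ := by
  have hC : 0 ≤ C := by
    have := h1 R (by simp [abs_of_pos hR])
    have h3 : ‖(R : ℂ)‖ = R := by simp [abs_of_pos hR]
    rw [h3] at this
    exact nonneg_of_mul_nonneg_left ((norm_nonneg _).trans this) hR
  have hT : 0 ≤ T := by
    have := ht R (by simp [abs_of_pos hR])
    exact le_trans (by positivity) this
  have htb (y : ℂ) (hy : R ≤ ‖y‖) : ‖t y‖ ≤ T * (‖y‖⁻¹) ^ 4 := by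
    have hp : 0 < ‖y‖ := hR.trans_le hy
    rw [inv_pow, ← div_eq_mul_inv, le_div_iff₀ (by positivity)]
    exact ht y hy
  have hid (y : ℂ) : HasWirtingerAt (fun y => y) 1 0 y := .of_hasDerivAt (hasDerivAt_id y)
  have hbound {f : ℂ → ℂ} (hf : ∀ y, R ≤ ‖y‖ → ContinuousAt f y) :
      ∃ M, ∀ y, ‖y‖ = R → ‖f y‖ ≤ M := by
    obtain ⟨M, hM⟩ := (isCompact_sphere (0 : ℂ) R).exists_bound_of_continuousOn (f := f)
      fun y hy => (hf y (by rw [mem_sphere_zero_iff_norm] at hy; exact hy.ge)).continuousWithinAt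
    exact ⟨M, fun y hy => hM y (by rw [mem_sphere_zero_iff_norm]; exact hy)⟩
  -- This function is ∂̄(χ - y ∂χ). Its gradient contains a factor t or conj t and is O(|y|⁻²),
  -- hence integrable along rays, so the function stays bounded.
  have he (y : ℂ) (hy : R ≤ ‖y‖) : HasWirtingerAt (fun y => χ₂ y - y * χ₃ y)
      (y * (t y * χ₂ y)) (y * (conj (t y) * χ₁ y) - conj (t y) * χ y) y :=
    ((h y hy).d2.sub ((hid y).mul (h y hy).d3)).congr_deriv (by ring) (by ring)
  obtain ⟨M₁, hM₁⟩ := hbound fun y hy => (he y hy).continuousAt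
  have e1 := norm_le_of_gradient_le (B := fun r => (M₁ + 3 * T * C * R⁻¹) - 3 * T * C * r⁻¹)
    (B' := fun r => 3 * T * C * (r ^ 2)⁻¹) hR he
    (fun r hr => by
      have := ((hasDerivAt_inv (hR.trans_le hr).ne').const_mul (3 * T * C)).const_sub
        (M₁ + 3 * T * C * R⁻¹)
      exact this.congr_deriv (by ring))
    (fun y hy => by linarith [hM₁ y hy]) (fun y hy => by
      have hp : 0 < ‖y‖ := hR.trans_le hy
      have g1 : ‖y * (t y * χ₂ y)‖ ≤ ‖y‖ * (T * (‖y‖⁻¹) ^ 4 * (C * ‖y‖)) := by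
        rw [norm_mul, norm_mul]
        gcongr
        exacts [htb y hy, h2 y hy]
      have g2 : ‖y * (conj (t y) * χ₁ y)‖ ≤ ‖y‖ * (T * (‖y‖⁻¹) ^ 4 * (C * ‖y‖)) := by
        rw [norm_mul, norm_mul, RCLike.norm_conj]
        gcongr
        exacts [htb y hy, h1 y hy]
      have g3 : ‖conj (t y) * χ y‖ ≤ T * (‖y‖⁻¹) ^ 4 * (C * ‖y‖ ^ 2) := by
        rw [norm_mul, RCLike.norm_conj]
        gcongr
        exacts [htb y hy, h0 y hy]
      have g4 := norm_sub_le (y * (conj (t y) * χ₁ y)) (conj (t y) * χ y)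
      have g5 : ‖y‖ * (T * (‖y‖⁻¹) ^ 4 * (C * ‖y‖)) = T * C * (‖y‖ ^ 2)⁻¹ := by field_simp
      have g6 : T * (‖y‖⁻¹) ^ 4 * (C * ‖y‖ ^ 2) = T * C * (‖y‖ ^ 2)⁻¹ := by field_simp
      linarith)
  have hM₁0 : 0 ≤ M₁ := by
    have := hM₁ R (by simp [abs_of_pos hR])
    exact (norm_nonneg _).trans this
  -- The holomorphic derivative y t χ is O(|y|⁻¹) and the antiholomorphic one is bounded by the
  -- previous step, so χ - y ∂χ grows at most linearly.
  have hf (y : ℂ) (hy : R ≤ ‖y‖) : HasWirtingerAt (fun y => χ y - y * χ₁ y)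
      (y * (t y * χ y)) (χ₂ y - y * χ₃ y) y :=
    ((h y hy).d0.sub ((hid y).mul (h y hy).d1)).congr_deriv (by ring) (by ring)
  obtain ⟨M₂, hM₂⟩ := hbound fun y hy => (hf y hy).continuousAt
  set S := T * C * R⁻¹ + (M₁ + 3 * T * C * R⁻¹) with hS
  have hS0 : 0 ≤ S := by positivity
  have e2 := norm_le_of_gradient_le (B := fun r => |M₂| + S * r) (B' := fun _ => S) hR hf
    (fun r hr => by simpa using ((hasDerivAt_id r).const_mul S).const_add |M₂|)
    (fun y hy => (hM₂ y hy).trans ((le_abs_self _).trans (le_add_of_nonneg_right (by positivity))))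
    (fun y hy => by
      have hp : 0 < ‖y‖ := hR.trans_le hy
      have g1 : ‖y * (t y * χ y)‖ ≤ ‖y‖ * (T * (‖y‖⁻¹) ^ 4 * (C * ‖y‖ ^ 2)) := by
        rw [norm_mul, norm_mul]
        gcongr
        exacts [htb y hy, h0 y hy]
      have g2 : ‖y‖ * (T * (‖y‖⁻¹) ^ 4 * (C * ‖y‖ ^ 2)) = T * C * ‖y‖⁻¹ := by field_simp
      have g3 : ‖y‖⁻¹ ≤ R⁻¹ := inv_anti₀ hR hy
      have g4 : T * C * ‖y‖⁻¹ ≤ T * C * R⁻¹ := by gcongr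
      have g5 := e1 y hy
      have g6 : 0 ≤ 3 * T * C * ‖y‖⁻¹ := by positivity
      linarith)
  refine ⟨|M₂| * R⁻¹ + S, by positivity, fun y hy => (e2 y hy).trans ?_⟩
  have : 1 ≤ R⁻¹ * ‖y‖ := by rwa [inv_mul_eq_div, le_div_iff₀ hR, one_mul]
  have := mul_le_mul_of_nonneg_left this (abs_nonneg M₂)
  linarith

/-- `χ / |y|²` is asymptotically invariant under rotation by a right angle. -/
theorem IsOperSolution.tendsto_rotate_sub (h : IsOperSolution z j E χ) (ho : IsOper z j E) :
    Tendsto (fun y : ℂ => χ (Complex.I * y) / ‖y‖ ^ 2 - χ y / ‖y‖ ^ 2)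
      (Bornology.cobounded ℂ) (𝓝 0) := by
  obtain ⟨R₁, T, hR₁, hT⟩ := ho.exists_bound_far
  obtain ⟨R₂, C, hR₂, hC⟩ := h.exists_bounds_far ho
  set R := max R₁ R₂
  have hR : 0 < R := lt_max_of_lt_left hR₁
  have hsys (y : ℂ) (hy : R ≤ ‖y‖) := h.wirtingerSystem (hT y ((le_max_left _ _).trans hy)).1
  have ht (y : ℂ) (hy : R ≤ ‖y‖) := (hT y ((le_max_left _ _).trans hy)).2
  have hC' (y : ℂ) (hy : R ≤ ‖y‖) := hC y ((le_max_right _ _).trans hy)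
  have hc1 (y : ℂ) (hy : R ≤ ‖y‖) : ‖wirtinger χ y‖ ≤ C * ‖y‖ := by
    have := (hC' y hy).2.1
    rw [pow_two, ← mul_assoc, mul_comm] at this
    exact le_of_mul_le_mul_right this (hR.trans_le hy)
  have hc2 (y : ℂ) (hy : R ≤ ‖y‖) : ‖wirtingerBar χ y‖ ≤ C * ‖y‖ := by
    have := (hC' y hy).2.2.1
    rw [pow_two, ← mul_assoc, mul_comm] at this
    exact le_of_mul_le_mul_right this (hR.trans_le hy)
  obtain ⟨M₁, hM₁, b1⟩ := exists_norm_sub_mul_le hR hsys ht (fun y hy => (hC' y hy).1) hc1 hc2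
  obtain ⟨M₂, hM₂, b2⟩ := exists_norm_sub_mul_le hR (fun y hy => (hsys y hy).conj) ht
    (fun y hy => by rw [RCLike.norm_conj]; exact (hC' y hy).1)
    (fun y hy => by rw [RCLike.norm_conj]; exact hc2 y hy)
    (fun y hy => by rw [RCLike.norm_conj]; exact hc1 y hy)
  -- The gradient of χ/|y|² contains exactly χ - y ∂χ and χ - conj y · ∂̄χ over |y|³, hence is
  -- O(|y|⁻²).
  have hG (y : ℂ) (hy : R ≤ ‖y‖) : HasWirtingerAt (fun y => χ y * (y⁻¹ * conj (y⁻¹)))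
      (-((χ y - y * wirtinger χ y) * (y⁻¹ ^ 2 * conj (y⁻¹))))
      (-((χ y - conj y * wirtingerBar χ y) * (y⁻¹ * conj (y⁻¹) ^ 2))) y := by
    have hy0 : y ≠ 0 := norm_pos_iff.1 (hR.trans_le hy)
    have hyc : conj y ≠ 0 := by simpa using hy0
    have hi := HasWirtingerAt.of_hasDerivAt (hasDerivAt_inv hy0)
    refine ((hsys y hy).d0.mul (hi.mul hi.star)).congr_deriv ?_ ?_
    · simp only [map_inv₀, map_zero]
      field_simp
      ring
    · simp only [map_neg, map_inv₀, map_pow]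
      field_simp
      ring
  have hGb (y : ℂ) (hy : R ≤ ‖y‖) :
      ‖-((χ y - y * wirtinger χ y) * (y⁻¹ ^ 2 * conj (y⁻¹)))‖ +
      ‖-((χ y - conj y * wirtingerBar χ y) * (y⁻¹ * conj (y⁻¹) ^ 2))‖ ≤ (M₁ + M₂) * (‖y‖⁻¹) ^ 2 := by
    have hp : 0 < ‖y‖ := hR.trans_le hy
    have h1 := b1 y hy
    have h2 := b2 y hy
    rw [← RCLike.norm_conj] at h2
    simp only [map_sub, map_mul, Complex.conj_conj] at h2
    simp only [norm_neg, norm_mul, norm_pow, norm_inv, RCLike.norm_conj]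
    calc _ ≤ (M₁ * ‖y‖) * (‖y‖⁻¹ ^ 2 * ‖y‖⁻¹) + (M₂ * ‖y‖) * (‖y‖⁻¹ * ‖y‖⁻¹ ^ 2) := by gcongr
      _ = _ := by field_simp
  have hlim : Tendsto (fun y : ℂ => (M₁ + M₂) * 8 * ‖y‖⁻¹) (Bornology.cobounded ℂ) (𝓝 0) := by
    have := (tendsto_inv_atTop_zero.comp (tendsto_norm_cobounded_atTop (E := ℂ))).const_mul
      ((M₁ + M₂) * 8)
    rwa [mul_zero] at this
  refine squeeze_zero_norm' ?_ hlim
  have hfar : ∀ᶠ y in Bornology.cobounded ℂ, 2 * R ≤ ‖y‖ :=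
    (hasBasis_cobounded_norm (E := ℂ)).mem_of_mem trivial
  filter_upwards [hfar] with y hy
  have hp : 0 < ‖y‖ := lt_of_lt_of_le (by positivity) hy
  -- The chord from y to i y keeps a distance of at least |y|/2 from the origin and has length at
  -- most 2|y|; a gradient O(|y|⁻²) then changes χ/|y|² by O(|y|⁻¹) only.
  have hlow (s : ℝ) : ‖y‖ / 2 ≤ ‖y + s * ((Complex.I - 1) * y)‖ := by
    have e : y + s * ((Complex.I - 1) * y) = (((1 - s : ℝ) : ℂ) + (s : ℝ) * Complex.I) * y := by
      push_cast; ring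
    have e2 : (1 / 2 : ℝ) ≤ ‖((1 - s : ℝ) : ℂ) + (s : ℝ) * Complex.I‖ := by
      refine le_of_sq_le_sq ?_ (norm_nonneg _)
      rw [← Complex.normSq_eq_norm_sq, Complex.normSq_add_mul_I]
      nlinarith [sq_nonneg (2 * s - 1)]
    rw [e, norm_mul]
    calc ‖y‖ / 2 = 1 / 2 * ‖y‖ := by ring
      _ ≤ _ := by gcongr
  have hlow' (s : ℝ) : R ≤ ‖y + s * ((Complex.I - 1) * y)‖ := by linarith [hlow s]
  have hd (s : ℝ) := (hG _ (hlow' s)).hasDerivAt_line y ((Complex.I - 1) * y) s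
  have hn2 : ‖(Complex.I - 1) * y‖ ≤ 2 * ‖y‖ := by
    rw [norm_mul]
    gcongr
    refine (norm_sub_le _ _).trans ?_
    norm_num
  have hfin := norm_image_sub_le_of_norm_deriv_le_segment_01' (C := (M₁ + M₂) * 8 * ‖y‖⁻¹)
    (fun s _ => (hd s).hasDerivWithinAt) (fun s _ => ?_)
  · have hy0 : y ≠ 0 := norm_pos_iff.1 hp
    have e (w : ℂ) : χ w * (w⁻¹ * conj (w⁻¹)) = χ w / ‖w‖ ^ 2 := by
      rw [Complex.mul_conj, Complex.normSq_eq_norm_sq, norm_inv]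
      push_cast
      rw [inv_pow, div_eq_mul_inv]
    have e1 : y + ((1 : ℝ) : ℂ) * ((Complex.I - 1) * y) = Complex.I * y := by push_cast; ring
    have e0 : y + ((0 : ℝ) : ℂ) * ((Complex.I - 1) * y) = y := by push_cast; ring
    simp only [e1, e0, e, norm_mul, Complex.norm_I, one_mul] at hfin
    exact hfin
  · set w := y + s * ((Complex.I - 1) * y) with hw
    have hwp : 0 < ‖w‖ := hR.trans_le (hlow' s)
    have h2 : ‖w‖⁻¹ ≤ 2 * ‖y‖⁻¹ := by
      rw [← div_eq_mul_inv, inv_le_comm₀ hwp (by positivity), inv_div]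
      exact hlow s
    refine (norm_add_le _ _).trans ?_
    rw [norm_mul _ ((Complex.I - 1) * y), norm_mul _ (conj ((Complex.I - 1) * y)), RCLike.norm_conj,
      ← add_mul]
    calc _ ≤ (M₁ + M₂) * (‖w‖⁻¹) ^ 2 * (2 * ‖y‖) := mul_le_mul (hGb w (hlow' s)) hn2 (by positivity) (by positivity)
      _ ≤ (M₁ + M₂) * (2 * ‖y‖⁻¹) ^ 2 * (2 * ‖y‖) := by gcongr
      _ = _ := by field_simp; ring

end SolutionBounds

/-! ### The measure in separated variables: coefficients, values and roots of polynomials. -/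

section RootMap

variable {n : ℕ}

/-! ### The change of variables from polynomials to their roots -/

/-- `∏_{a ≠ b} |y_a - y_b|`, the absolute value of the squared Vandermonde determinant. -/
def discAbs {m : ℕ} (y : Fin m → ℂ) : ℝ := ∏ a, ∏ b, if a = b then 1 else ‖y a - y b‖

variable {m : ℕ}

theorem discAbs_nonneg (y : Fin m → ℂ) : 0 ≤ discAbs y :=
  Finset.prod_nonneg fun a _ => Finset.prod_nonneg fun b _ => by split_ifs <;> positivity

theorem discAbs_pos {y : Fin m → ℂ} (hy : Function.Injective y) : 0 < discAbs y :=
  Finset.prod_pos fun a _ => Finset.prod_pos fun b _ => by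
    split_ifs with h
    · exact one_pos
    · exact norm_pos_iff.2 (sub_ne_zero.2 fun e => h (hy e))

theorem continuous_discAbs : Continuous (discAbs (m := m)) := by
  unfold discAbs
  refine continuous_finsetProd _ fun a _ => continuous_finsetProd _ fun b _ => ?_
  split_ifs <;> fun_prop

theorem discAbs_comp_equiv (y : Fin m → ℂ) (σ : Equiv.Perm (Fin m)) :
    discAbs (y ∘ σ) = discAbs y := by
  unfold discAbs
  rw [← Equiv.prod_comp σ fun a => ∏ b, if a = b then 1 else ‖y a - y b‖]
  refine Finset.prod_congr rfl fun a _ => ?_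
  rw [← Equiv.prod_comp σ fun b => if σ a = b then 1 else ‖y (σ a) - y b‖]
  simp

theorem prod_prod_erase_eq_discAbs (y : Fin m → ℂ) :
    ∏ a, ∏ b ∈ Finset.univ.erase a, ‖y a - y b‖ = discAbs y := by
  refine Finset.prod_congr rfl fun a _ => ?_
  rw [← Finset.mul_prod_erase _ _ (Finset.mem_univ a), if_pos rfl, one_mul]
  exact Finset.prod_congr rfl fun b hb => (if_neg (Finset.ne_of_mem_erase hb).symm).symm

theorem norm_det_vandermonde_sq (y : Fin m → ℂ) :
    ‖(Matrix.vandermonde y).det‖ ^ 2 = discAbs y := by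
  rw [← prod_prod_erase_eq_discAbs, Matrix.det_vandermonde, norm_prod, ← Finset.prod_pow]
  have := Finset.prod_prod_Ioi_mul_eq_prod_prod_off_diag (fun i j : Fin m => ‖y j - y i‖)
  simp only [Finset.compl_singleton] at this
  rw [← this]
  refine Finset.prod_congr rfl fun a _ => ?_
  rw [norm_prod, ← Finset.prod_pow]
  refine Finset.prod_congr rfl fun b _ => ?_
  rw [norm_sub_rev (y a), pow_two]

/-- The matrix is the Vandermonde matrix of ζ times the coefficient matrix K of the polynomials
∏_{l'≠l}(Y - y_{l'}). For ζ = y the product is diagonal with determinant of modulus `discAbs y`,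
which gives |det K|² = `discAbs y`; the general case follows. -/
theorem norm_det_prod_erase_sq (ζ : Fin m → ℂ) {y : Fin m → ℂ} (hy : Function.Injective y) :
    ‖(Matrix.of fun b l => ∏ l' ∈ Finset.univ.erase l, (ζ b - y l')).det‖ ^ 2 =
      discAbs ζ * discAbs y := by
  classical
  set P : Fin m → Polynomial ℂ := fun l => ∏ l' ∈ Finset.univ.erase l, (Polynomial.X - Polynomial.C (y l'))
    with hP
  set K : Matrix (Fin m) (Fin m) ℂ := Matrix.of fun c l => (P l).coeff c with hK
  have hdeg (l : Fin m) : (P l).natDegree < m := by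
    rw [hP, Polynomial.natDegree_prod_of_monic _ _ fun _ _ => Polynomial.monic_X_sub_C _]
    simp only [Polynomial.natDegree_X_sub_C, Finset.sum_const, Finset.card_erase_of_mem (Finset.mem_univ _),
      Finset.card_univ, Fintype.card_fin, smul_eq_mul, mul_one]
    have := l.pos
    omega
  have hev (x : Fin m → ℂ) : Matrix.vandermonde x * K =
      Matrix.of fun b l => ∏ l' ∈ Finset.univ.erase l, (x b - y l') := by
    ext b l
    rw [Matrix.mul_apply, Matrix.of_apply]
    have : (P l).eval (x b) = ∏ l' ∈ Finset.univ.erase l, (x b - y l') := by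
      simp [hP, Polynomial.eval_prod]
    rw [← this, Polynomial.eval_eq_sum_range' (hdeg l), Finset.sum_range]
    exact Finset.sum_congr rfl fun c _ => by
      rw [Matrix.vandermonde_apply, hK, Matrix.of_apply, mul_comm]
  have h2 : (Matrix.vandermonde y).det * K.det = ∏ l, ∏ l' ∈ Finset.univ.erase l, (y l - y l') := by
    rw [← Matrix.det_mul, hev, ← Matrix.det_diagonal]
    congr 1
    ext b l
    rw [Matrix.of_apply, Matrix.diagonal_apply]
    split_ifs with h
    · rw [h]
    · exact Finset.prod_eq_zero (Finset.mem_erase.2 ⟨h, Finset.mem_univ b⟩) (sub_self _)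
  have h3 := congrArg (fun x => ‖x‖ ^ 2) h2
  simp only [norm_mul, mul_pow, norm_det_vandermonde_sq, norm_prod, prod_prod_erase_eq_discAbs] at h3
  have h4 := discAbs_pos hy
  rw [← hev, Matrix.det_mul, norm_mul, mul_pow, norm_det_vandermonde_sq]
  congr 1
  rw [pow_two (discAbs y)] at h3
  exact mul_left_cancel₀ h4.ne' h3

/-- The leading coefficient `ρ` and the values at `ζ_b` of `ρ ∏_l (Y - y_l)`. -/
def rootMap (ζ : Fin m → ℂ) (x : Fin (m + 1) → ℂ) : Fin (m + 1) → ℂ :=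
  Fin.cons (x 0) fun b => x 0 * ∏ l, (ζ b - x (Fin.succ l))

/-- The Jacobian matrix of `rootMap`. -/
def rootMapMatrix (ζ : Fin m → ℂ) (x : Fin (m + 1) → ℂ) : Matrix (Fin (m + 1)) (Fin (m + 1)) ℂ :=
  Matrix.of (Fin.cons (Pi.single 0 1) fun b => Fin.cons (∏ l, (ζ b - x (Fin.succ l)))
    fun l => -x 0 * ∏ l' ∈ Finset.univ.erase l, (ζ b - x (Fin.succ l')))

/-- The derivative of `rootMap`. -/
def rootMapDeriv (ζ : Fin m → ℂ) (x : Fin (m + 1) → ℂ) : (Fin (m + 1) → ℂ) →L[ℝ] (Fin (m + 1) → ℂ) :=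
  (LinearMap.toContinuousLinearMap (Matrix.toLin' (rootMapMatrix ζ x))).restrictScalars ℝ

theorem hasFDerivAt_rootMap (ζ : Fin m → ℂ) (x : Fin (m + 1) → ℂ) :
    HasFDerivAt (rootMap ζ) (rootMapDeriv ζ x) x := by
  classical
  refine HasFDerivAt.restrictScalars ℝ ?_
  rw [hasFDerivAt_pi']
  refine Fin.cases ?_ fun b => ?_
  · refine (hasFDerivAt_apply (𝕜 := ℂ) (0 : Fin (m + 1)) x).congr_fderiv ?_
    ext v
    simp [rootMapMatrix, Matrix.mulVec, dotProduct, Pi.single_apply]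
  · have h1 : HasFDerivAt (𝕜 := ℂ) (fun x : Fin (m + 1) → ℂ => x 0) (ContinuousLinearMap.proj 0) x :=
      hasFDerivAt_apply _ _
    have h2 (l : Fin m) : HasFDerivAt (𝕜 := ℂ) (fun x : Fin (m + 1) → ℂ => ζ b - x (Fin.succ l))
        (-ContinuousLinearMap.proj (R := ℂ) (φ := fun _ : Fin (m + 1) => ℂ) (Fin.succ l)) x :=
      (hasFDerivAt_apply _ _).const_sub _
    have h3 := h1.mul (HasFDerivAt.finsetProd (u := Finset.univ) fun l _ => h2 l)
    refine h3.congr_fderiv ?_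
    ext v
    simp [rootMapMatrix, Matrix.mulVec, dotProduct, Fin.sum_univ_succ, Finset.mul_sum]
    ring_nf

/-- The real determinant of a complex linear map is the squared modulus of its complex determinant.
Expansion along the first row leaves -ρ times the matrix of `norm_det_prod_erase_sq`, whence the
factor |ρ|^{2m}. -/
theorem abs_det_rootMapDeriv (ζ : Fin m → ℂ) {x : Fin (m + 1) → ℂ} (hx : Function.Injective (Fin.tail x)) :
    |(rootMapDeriv ζ x).det| = ‖x 0‖ ^ (2 * m) * (discAbs ζ * discAbs (Fin.tail x)) := by
  have h1 : (rootMapDeriv ζ x).det = ‖(rootMapMatrix ζ x).det‖ ^ 2 := by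
    rw [rootMapDeriv, ContinuousLinearMap.det]
    have := LinearMap.det_restrictScalars (R := ℝ) (S := ℂ) (A := Fin (m + 1) → ℂ) (f := Matrix.toLin' (rootMapMatrix ζ x))
    rw [Algebra.norm_complex_eq, LinearMap.det_toLin'] at this
    rw [← Complex.normSq_eq_norm_sq]
    exact this
  rw [h1, abs_of_nonneg (by positivity), ← norm_det_prod_erase_sq ζ hx, Matrix.det_succ_row_zero,
    Fin.sum_univ_succ]
  have h2 : Matrix.of (fun b l => -x 0 * ∏ l' ∈ Finset.univ.erase l, (ζ b - x (Fin.succ l'))) =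
      -x 0 • Matrix.of fun b l => ∏ l' ∈ Finset.univ.erase l, (ζ b - Fin.tail x l') := by
    ext b l; simp [Fin.tail]
  have h3 : (rootMapMatrix ζ x).submatrix Fin.succ Fin.succ =
      Matrix.of (fun b l => -x 0 * ∏ l' ∈ Finset.univ.erase l, (ζ b - x (Fin.succ l'))) := by
    ext b l; simp [rootMapMatrix]
  have h4 (l : Fin m) : rootMapMatrix ζ x 0 (Fin.succ l) = 0 := by simp [rootMapMatrix]
  have h5 : rootMapMatrix ζ x 0 0 = 1 := by simp [rootMapMatrix]
  simp only [h4, h5, mul_zero, zero_mul, Finset.sum_const_zero, add_zero, Fin.succAbove_zero, h3, h2,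
    Fin.val_zero, pow_zero, one_mul, Matrix.det_smul, norm_mul, norm_pow, norm_neg, Fintype.card_fin]
  rw [mul_pow, ← pow_mul, mul_comm m 2]

theorem volume_coord_re_eq (a b : Fin m) (h : a ≠ b) :
    volume {x : Fin (m + 1) → ℂ | (x a.succ).re = (x b.succ).re} = 0 := by
  let L : (Fin (m + 1) → ℂ) →ₗ[ℝ] ℝ := Complex.reLm ∘ₗ LinearMap.proj a.succ - Complex.reLm ∘ₗ LinearMap.proj b.succ
  have : {x : Fin (m + 1) → ℂ | (x a.succ).re = (x b.succ).re} = LinearMap.ker L := by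
    ext x; simp [L, sub_eq_zero]
  rw [this]
  refine Measure.addHaar_submodule _ _ fun htop => ?_
  have h1 : Pi.single a.succ 1 ∈ LinearMap.ker L := by rw [htop]; trivial
  have h2 : b.succ ≠ a.succ := by simpa using h.symm
  simp [L, Pi.single_eq_of_ne h2] at h1

theorem volume_coord_eq_zero {ι : Type*} [Fintype ι] (a : ι) : volume {x : ι → ℂ | x a = 0} = 0 := by
  classical
  let L : (ι → ℂ) →ₗ[ℝ] ℂ := LinearMap.proj a
  have : {x : ι → ℂ | x a = 0} = LinearMap.ker L := by ext x; simp [L]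
  rw [this]
  refine Measure.addHaar_submodule _ _ fun htop => ?_
  have h1 : Pi.single a 1 ∈ LinearMap.ker L := by rw [htop]; trivial
  simp [L] at h1

/-- The points with ordered roots. -/
def rootSector (m : ℕ) : Set (Fin (m + 1) → ℂ) :=
  {x | x 0 ≠ 0 ∧ StrictMono fun l : Fin m => (x l.succ).re}

theorem measurableSet_rootSector : MeasurableSet (rootSector m) := by
  have : rootSector m = {x | x 0 = 0}ᶜ ∩ ⋂ a : Fin m, ⋂ b : Fin m, ⋂ _ : a < b,
      {x | (x a.succ).re < (x b.succ).re} := by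
    ext x; simp [rootSector, StrictMono]
  rw [this]
  refine (measurableSet_eq_fun (by fun_prop) (by fun_prop)).compl.inter
    (.iInter fun a => .iInter fun b => .iInter fun _ => measurableSet_lt (by fun_prop) (by fun_prop))

/-- Two monic polynomials of degree m that agree at the m points ζ_b are equal, since their
difference has degree below m; the ordering by real parts then fixes the labelling of the roots. -/
theorem injOn_rootMap {ζ : Fin m → ℂ} (hζ : Function.Injective ζ) :
    Set.InjOn (rootMap ζ) (rootSector m) := by
  classical
  intro x hx x' hx' hxx
  have h0 : x 0 = x' 0 := by simpa [rootMap] using congrFun hxx 0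
  have hb (b : Fin m) : ∏ l, (ζ b - x (Fin.succ l)) = ∏ l, (ζ b - x' (Fin.succ l)) := by
    have := congrFun hxx b.succ
    simp only [rootMap, Fin.cons_succ, ← h0] at this
    exact mul_left_cancel₀ hx.1 this
  have hmon (x : Fin (m + 1) → ℂ) : (∏ l : Fin m, (Polynomial.X - Polynomial.C (x l.succ))).Monic :=
    Polynomial.monic_prod_of_monic _ _ fun _ _ => Polynomial.monic_X_sub_C _
  have hdeg (x : Fin (m + 1) → ℂ) :
      (∏ l : Fin m, (Polynomial.X - Polynomial.C (x l.succ))).degree = (m : WithBot ℕ) := by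
    rw [Polynomial.degree_prod]; simp
  have hpoly : ∏ l : Fin m, (Polynomial.X - Polynomial.C (x l.succ)) =
      ∏ l : Fin m, (Polynomial.X - Polynomial.C (x' l.succ)) := by
    refine Polynomial.eq_of_degree_sub_lt_of_eval_index_eq Finset.univ (v := ζ) hζ.injOn ?_ ?_
    · have := Polynomial.degree_sub_lt_left (p := ∏ l : Fin m, (Polynomial.X - Polynomial.C (x l.succ)))
        (q := ∏ l : Fin m, (Polynomial.X - Polynomial.C (x' l.succ))) (by rw [hdeg, hdeg])
        (hmon x).ne_zero (by rw [hmon x, hmon x'])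
      rw [hdeg] at this
      simpa using this
    · intro b _
      simp [Polynomial.eval_prod, hb]
  have hmem (x x' : Fin (m + 1) → ℂ) (hp : ∏ l : Fin m, (Polynomial.X - Polynomial.C (x l.succ)) =
      ∏ l : Fin m, (Polynomial.X - Polynomial.C (x' l.succ))) (l : Fin m) :
      ∃ l' : Fin m, x' l'.succ = x l.succ := by
    have h1 := congrArg (Polynomial.eval (x l.succ)) hp
    simp only [Polynomial.eval_prod, Polynomial.eval_sub, Polynomial.eval_X, Polynomial.eval_C] at h1
    rw [Finset.prod_eq_zero (Finset.mem_univ l) (sub_self _), eq_comm, Finset.prod_eq_zero_iff] at h1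
    obtain ⟨l', -, h⟩ := h1
    exact ⟨l', (sub_eq_zero.1 h).symm⟩
  have hrange : (fun l : Fin m => (x l.succ).re) = fun l : Fin m => (x' l.succ).re := by
    rw [← StrictMono.range_inj hx.2 hx'.2]
    ext t
    constructor
    · rintro ⟨l, rfl⟩
      obtain ⟨l', h⟩ := hmem x x' hpoly l
      exact ⟨l', by simp [h]⟩
    · rintro ⟨l, rfl⟩
      obtain ⟨l', h⟩ := hmem x' x hpoly.symm l
      exact ⟨l', by simp [h]⟩
  funext a
  refine Fin.cases h0 (fun l => ?_) a
  obtain ⟨l', h⟩ := hmem x x' hpoly l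
  have h2 : (x' l'.succ).re = (x' l.succ).re := by rw [h]; exact congrFun hrange l
  rw [← h, hx'.2.injective h2]

theorem exists_eq_map_of_card_eq {α : Type*} (S : Multiset α) (h : S.card = m) :
    ∃ y : Fin m → α, S = Multiset.map y Finset.univ.val := by
  obtain ⟨l, rfl⟩ := Quot.exists_rep S
  obtain rfl : l.length = m := h
  exact ⟨l.get, by rw [Fin.univ_val_map, List.ofFn_get]; rfl⟩

/-- The polynomial with prescribed values is ∏(Y - ζ_b) plus a Lagrange interpolant of lower degree;
being monic over ℂ, it is the product over its roots. -/
theorem exists_rootMap_eq {ζ : Fin m → ℂ} (hζ : Function.Injective ζ) {p : Fin (m + 1) → ℂ}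
    (hp : p 0 ≠ 0) : ∃ x, rootMap ζ x = p := by
  classical
  set N := ∏ b : Fin m, (Polynomial.X - Polynomial.C (ζ b))
  set I := Lagrange.interpolate Finset.univ ζ fun b => p b.succ / p 0
  have hI : I.degree < m := by
    have := Lagrange.degree_interpolate_lt (s := Finset.univ) (fun b => p b.succ / p 0) hζ.injOn
    rwa [Finset.card_univ, Fintype.card_fin] at this
  have hN : N.degree = m := by rw [Polynomial.degree_prod]; simp
  have hNm : N.Monic := Polynomial.monic_prod_of_monic _ _ fun _ _ => Polynomial.monic_X_sub_C _
  have hM : (N + I).Monic := hNm.add_of_left (by rw [hN]; exact hI)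
  have hMd : (N + I).natDegree = m := by
    refine Polynomial.natDegree_eq_of_degree_eq_some ?_
    rw [Polynomial.degree_add_eq_left_of_degree_lt (by rw [hN]; exact hI), hN]
  have hsp := IsAlgClosed.splits (N + I)
  have hcard : (N + I).roots.card = m := by rw [← hsp.natDegree_eq_card_roots, hMd]
  obtain ⟨y, hy⟩ : ∃ y : Fin m → ℂ, (N + I).roots = Multiset.map y Finset.univ.val :=
    exists_eq_map_of_card_eq _ hcard
  have hprod := hsp.eq_prod_roots_of_monic hM
  refine ⟨Fin.cons (p 0) y, ?_⟩
  funext a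
  refine Fin.cases (by simp [rootMap]) (fun b => ?_) a
  have h1 : (N + I).eval (ζ b) = p b.succ / p 0 := by
    rw [Polynomial.eval_add, Polynomial.eval_prod, Finset.prod_eq_zero (Finset.mem_univ b) (by simp),
      zero_add, Lagrange.eval_interpolate_at_node _ hζ.injOn (Finset.mem_univ b)]
  have h2 : (N + I).eval (ζ b) = ∏ l, (ζ b - y l) := by
    rw [hprod, hy, Polynomial.eval_multiset_prod, Multiset.map_map, Multiset.map_map]
    simp [List.prod_ofFn]
  simp only [rootMap, Fin.cons_succ, Fin.cons_zero]
  rw [← h2, h1]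
  field_simp

/-- Only p_0 = 0 and the polynomials with two roots of equal real part are missed; the latter are
the image of a null set under a differentiable map. -/
theorem ae_mem_image_rootMap {ζ : Fin m → ℂ} (hζ : Function.Injective ζ) :
    ∀ᵐ p, p ∈ rootMap ζ '' rootSector m := by
  have hnull : volume (rootMap ζ '' ⋃ a : Fin m, ⋃ b : Fin m, ⋃ _ : a ≠ b,
      {x : Fin (m + 1) → ℂ | (x a.succ).re = (x b.succ).re}) = 0 := by
    refine addHaar_image_eq_zero_of_differentiableOn_of_addHaar_eq_zero _
      (fun x _ => (hasFDerivAt_rootMap ζ x).differentiableAt.differentiableWithinAt) ?_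
    simp only [measure_iUnion_null_iff]
    exact fun a b h => volume_coord_re_eq a b h
  have h0 := volume_coord_eq_zero (0 : Fin (m + 1))
  filter_upwards [compl_mem_ae_iff.2 hnull, compl_mem_ae_iff.2 h0] with p hp hp0
  obtain ⟨x, rfl⟩ := exists_rootMap_eq hζ hp0
  have hinj : Function.Injective fun l : Fin m => (x l.succ).re := by
    intro a b hab
    by_contra hne
    exact hp ⟨x, by simp only [Set.mem_iUnion]; exact ⟨a, b, hne, hab⟩, rfl⟩
  set σ := Tuple.sort fun l : Fin m => (x l.succ).re
  refine ⟨Fin.cons (x 0) fun l => x (σ l).succ, ⟨by simpa [rootMap] using hp0, ?_⟩, ?_⟩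
  · simp only [Fin.cons_succ]
    exact (Tuple.monotone_sort fun l : Fin m => (x l.succ).re).strictMono_of_injective
      (hinj.comp σ.injective)
  · funext a
    refine Fin.cases (by simp [rootMap]) (fun b => ?_) a
    simp only [rootMap, Fin.cons_succ, Fin.cons_zero]
    rw [Equiv.prod_comp σ fun l => ζ b - x l.succ]

/-- The integrand obtained by pulling back `h` along `rootMap`. -/
def rootPullback (ζ : Fin m → ℂ) (h : (Fin (m + 1) → ℂ) → ℂ) (x : Fin (m + 1) → ℂ) : ℂ :=
  (‖x 0‖ ^ (2 * m) * discAbs (Fin.tail x) : ℝ) • h (rootMap ζ x)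

/-- The m! permutations of the sector are disjoint and cover almost everything, and each contributes
the same integral. -/
theorem setIntegral_rootSector (G : (Fin (m + 1) → ℂ) → ℂ) (hG : Integrable G)
    (hsym : ∀ x (σ : Equiv.Perm (Fin m)), G (Fin.cons (x 0) (Fin.tail x ∘ σ)) = G x) :
    ∫ x, G x = (m.factorial : ℂ) * ∫ x in rootSector m, G x := by
  classical
  let τ (σ : Equiv.Perm (Fin m)) (x : Fin (m + 1) → ℂ) : Fin (m + 1) → ℂ :=
    Fin.cons (x 0) (Fin.tail x ∘ σ)
  have hτ (σ : Equiv.Perm (Fin m)) : MeasurePreserving (τ σ) ∧ MeasurableEmbedding (τ σ) := by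
    -- The permutation of the roots is extended to all m + 1 coordinates by fixing the coordinate 0,
    -- so that it acts by a relabelling of coordinates, which preserves the measure.
    let f := (Equiv.Perm.decomposeFin.symm (0, σ)).symm
    have h := volume_measurePreserving_piCongrLeft (fun _ : Fin (m + 1) => ℂ) f
    have e : ⇑(MeasurableEquiv.piCongrLeft (fun _ : Fin (m + 1) => ℂ) f) = τ σ := by
      funext x a
      obtain ⟨b, rfl⟩ := f.surjective a
      rw [MeasurableEquiv.piCongrLeft_apply_apply (β := fun _ => ℂ)]
      have : b = (Equiv.Perm.decomposeFin.symm (0, σ)) (f b) := by simp [f]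
      conv_lhs => rw [this]
      generalize f b = c
      refine Fin.cases ?_ (fun l => ?_) c
      · simp [τ, Equiv.Perm.decomposeFin_symm_apply_zero]
      · simp [τ, Equiv.Perm.decomposeFin_symm_apply_succ, Fin.tail]
    rw [← e]
    exact ⟨h, MeasurableEquiv.measurableEmbedding _⟩
  have hsplit : ∀ᵐ x, G x = ∑ σ : Equiv.Perm (Fin m), (rootSector m).indicator G (τ σ x) := by
    have hnull : volume (⋃ a : Fin m, ⋃ b : Fin m, ⋃ _ : a ≠ b,
        {x : Fin (m + 1) → ℂ | (x a.succ).re = (x b.succ).re}) = 0 := by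
      simp only [measure_iUnion_null_iff]
      exact fun a b h => volume_coord_re_eq a b h
    filter_upwards [compl_mem_ae_iff.2 hnull, compl_mem_ae_iff.2 (volume_coord_eq_zero (0 : Fin (m + 1)))]
      with x hx hx0
    have hinj : Function.Injective fun l : Fin m => (x l.succ).re := by
      intro a b hab
      by_contra hne
      exact hx (by simp only [Set.mem_iUnion]; exact ⟨a, b, hne, hab⟩)
    have hmono := (Tuple.monotone_sort fun l : Fin m => (x l.succ).re).strictMono_of_injective
      (hinj.comp (Equiv.injective _))
    rw [Finset.sum_eq_single (Tuple.sort fun l : Fin m => (x l.succ).re), Set.indicator_of_mem, hsym]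
    · exact ⟨hx0, hmono⟩
    · intro σ _ hσ
      refine Set.indicator_of_notMem (fun hmem => hσ ?_) _
      have h1 : StrictMono ((fun l : Fin m => (x l.succ).re) ∘ σ) := hmem.2
      have h2 := (StrictMono.range_inj h1 hmono).1 (by
        rw [Set.range_comp, Set.range_comp, Equiv.range_eq_univ, Equiv.range_eq_univ])
      ext l
      exact congrArg Fin.val (hinj (congrFun h2 l))
    · simp
  have hint := hG.indicator (measurableSet_rootSector (m := m))
  rw [integral_congr_ae hsplit, integral_finsetSum (f := fun σ x => (rootSector m).indicator G (τ σ x)) _ fun σ _ =>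
    ((hτ σ).1.integrable_comp_emb (hτ σ).2).2 hint]
  simp only [(hτ _).1.integral_comp (hτ _).2, Finset.sum_const, Finset.card_univ, Fintype.card_perm,
    Fintype.card_fin, nsmul_eq_mul, integral_indicator measurableSet_rootSector]

theorem rootPullback_perm (ζ : Fin m → ℂ) (h : (Fin (m + 1) → ℂ) → ℂ) (x : Fin (m + 1) → ℂ)
    (σ : Equiv.Perm (Fin m)) : rootPullback ζ h (Fin.cons (x 0) (Fin.tail x ∘ σ)) = rootPullback ζ h x := by
  have : rootMap ζ (Fin.cons (x 0) (Fin.tail x ∘ σ)) = rootMap ζ x := by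
    funext a
    refine Fin.cases (by simp [rootMap]) (fun b => ?_) a
    simp only [rootMap, Fin.cons_succ, Fin.cons_zero, Function.comp_apply, Fin.tail]
    rw [Equiv.prod_comp σ fun l => ζ b - x l.succ]
  rw [rootPullback, rootPullback, this, Fin.tail_cons, discAbs_comp_equiv, Fin.cons_zero]

theorem integral_eq_rootPullback {ζ : Fin m → ℂ} (hζ : Function.Injective ζ)
    {h : (Fin (m + 1) → ℂ) → ℂ} (hG : Integrable (rootPullback ζ h)) :
    Integrable h ∧ ∫ p, h p = (discAbs ζ / m.factorial : ℂ) * ∫ x, rootPullback ζ h x := by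
  have hd (x : Fin (m + 1) → ℂ) (hx : x ∈ rootSector m) :
      |(rootMapDeriv ζ x).det| • h (rootMap ζ x) = discAbs ζ • rootPullback ζ h x := by
    have : Function.Injective (Fin.tail x) := fun a b hab =>
      hx.2.injective (congrArg Complex.re hab)
    rw [abs_det_rootMapDeriv ζ this, rootPullback, smul_smul]
    ring_nf
  have hr : (volume : Measure (Fin (m + 1) → ℂ)).restrict (rootMap ζ '' rootSector m) = volume :=
    Measure.restrict_eq_self_of_ae_mem (ae_mem_image_rootMap hζ)
  constructor
  · have := (integrableOn_image_iff_integrableOn_abs_det_fderiv_smul volume measurableSet_rootSector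
      (fun x _ => (hasFDerivAt_rootMap ζ x).hasFDerivWithinAt) (injOn_rootMap hζ) h).2
      ((integrableOn_congr_fun hd measurableSet_rootSector).2 (hG.integrableOn.smul (discAbs ζ)))
    rwa [IntegrableOn, hr] at this
  · rw [setIntegral_rootSector _ hG (rootPullback_perm ζ h)]
    conv_lhs => rw [← hr]
    rw [integral_image_eq_integral_abs_det_fderiv_smul volume measurableSet_rootSector
      (fun x _ => (hasFDerivAt_rootMap ζ x).hasFDerivWithinAt) (injOn_rootMap hζ),
      setIntegral_congr_fun measurableSet_rootSector hd, integral_smul]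
    have : (m.factorial : ℂ) ≠ 0 := by exact_mod_cast m.factorial_ne_zero
    rw [Complex.real_smul]
    field_simp

end RootMap

section SeparatedVariables

variable {n : ℕ}

/-! ### Separated variables -/

variable {m i : ℕ} {z : Fin n → ℂ}

/-- The denominator `∏_{s ≠ r} (z_r - z_s)`. -/
def nodeDen (z : Fin n → ℂ) (r : Fin n) : ℂ := ∏ s ∈ Finset.univ.erase r, (z r - z s)

theorem nodeDen_ne_zero (hz : Function.Injective z) (r : Fin n) : nodeDen z r ≠ 0 :=
  Finset.prod_ne_zero_iff.2 fun _ hs => sub_ne_zero.2 fun h => Finset.ne_of_mem_erase hs (hz h).symm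

/-- The point `k` with separated variables `ρ` and `y`. -/
def sepPoint (z : Fin n → ℂ) (ρ : ℂ) (y : Fin m → ℂ) : Fin n → ℂ := fun r =>
  ρ * (∏ l, (z r - y l)) / nodeDen z r

theorem sum_eval_div_nodeDen (hz : Function.Injective z) {P : Polynomial ℂ}
    (hP : P.degree < n) : ∑ r, P.eval (z r) / nodeDen z r = P.coeff (n - 1) := by
  have := Lagrange.coeff_eq_sum (s := Finset.univ) (v := z) hz.injOn (P := P) (by simpa using hP)
  simpa [nodeDen] using this.symm

theorem sum_pow_mul_eval_div (hz : Function.Injective z) {P : Polynomial ℂ} (hP : P.natDegree ≤ m)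
    (a : ℕ) (ha : a + m + 1 ≤ n) :
    ∑ r, z r ^ a * (P.eval (z r) / nodeDen z r) = if a + m + 1 = n then P.coeff m else 0 := by
  have hd : (Polynomial.X ^ a * P).natDegree ≤ a + m :=
    Polynomial.natDegree_mul_le.trans (add_le_add (by simp) hP)
  have h1 := sum_eval_div_nodeDen hz (P := Polynomial.X ^ a * P)
    (Polynomial.degree_le_natDegree.trans_lt (by exact_mod_cast lt_of_le_of_lt hd (by omega)))
  simp only [Polynomial.eval_mul, Polynomial.eval_pow, Polynomial.eval_X, mul_div_assoc] at h1
  rw [h1]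
  split_ifs with h
  · rw [show n - 1 = m + a by omega, mul_comm, Polynomial.coeff_mul_X_pow]
  · exact Polynomial.coeff_eq_zero_of_natDegree_lt (by omega)

theorem exists_sepPoint_eq_eval (z : Fin n → ℂ) (ρ : ℂ) (y : Fin m → ℂ) :
    ∃ P : Polynomial ℂ, P.natDegree ≤ m ∧ P.coeff m = ρ ∧ (∀ w, P.eval w = ρ * ∏ l, (w - y l)) ∧
      ∀ r, sepPoint z ρ y r = P.eval (z r) / nodeDen z r := by
  set N := ∏ l : Fin m, (Polynomial.X - Polynomial.C (y l))
  have hN : N.natDegree = m := by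
    rw [Polynomial.natDegree_prod_of_monic _ _ fun _ _ => Polynomial.monic_X_sub_C _]; simp
  have hNm : N.Monic := Polynomial.monic_prod_of_monic _ _ fun _ _ => Polynomial.monic_X_sub_C _
  have hev (w : ℂ) : (Polynomial.C ρ * N).eval w = ρ * ∏ l, (w - y l) := by
    simp [N, Polynomial.eval_prod]
  refine ⟨Polynomial.C ρ * N, (Polynomial.natDegree_C_mul_le _ _).trans hN.le, ?_, hev, fun r => ?_⟩
  · rw [Polynomial.coeff_C_mul]
    have : N.coeff m = 1 := by rw [← hN]; exact hNm
    rw [this, mul_one]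
  · rw [hev, sepPoint]

/-- Here k_r = P(z_r)/∏_{s≠r}(z_r - z_s) with deg P ≤ m, and such sums extract the coefficient of
degree n - 1. For m = n - 2 - i the moments of order up to i vanish, as the delta-distributions
demand, and the next moment is the leading coefficient ρ. -/
theorem sum_pow_mul_sepPoint (hz : Function.Injective z) (ρ : ℂ) (y : Fin m → ℂ)
    (a : ℕ) (ha : a + m + 1 ≤ n) :
    ∑ r, z r ^ a * sepPoint z ρ y r = if a + m + 1 = n then ρ else 0 := by
  obtain ⟨P, h1, h2, -, h3⟩ := exists_sepPoint_eq_eval z ρ y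
  simp only [h3]
  rw [sum_pow_mul_eval_div hz h1 a ha, h2]

theorem rhoHat_sepPoint (hz : Function.Injective z) (hn : n = m + i + 2) (ρ : ℂ) (y : Fin m → ℂ) :
    rhoHat i z (sepPoint z ρ y) = ρ := by
  rw [rhoHat, sum_pow_mul_sepPoint hz ρ y _ (by omega), if_pos (by omega)]

/-- `sepVars` is an arbitrary choice and recovers y only up to a permutation, so only symmetric
expressions are determined; the polynomial ∏(Y - y_l), known at all the nodes, fixes the multiset of
roots. -/
theorem prod_sepVars (hz : Function.Injective z) (hn : n = m + i + 2) {ρ : ℂ} (hρ : ρ ≠ 0)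
    (y : Fin m → ℂ) (f : ℂ → ℂ) :
    ∏ l, f (sepVars i z (sepPoint z ρ y) l) = ∏ l, f (y l) := by
  obtain rfl : m = n - 2 - i := by omega
  have hspec := Classical.epsilon_spec (p := fun y' : Fin (n - 2 - i) → ℂ => ∀ r,
    sepPoint z ρ y r = rhoHat i z (sepPoint z ρ y) * (∏ l, (z r - y' l)) /
      ∏ s ∈ Finset.univ.erase r, (z r - z s)) ⟨y, fun r => by
        rw [rhoHat_sepPoint hz hn]; rfl⟩
  change ∀ r, _ = _ * (∏ l, (z r - sepVars i z (sepPoint z ρ y) l)) / nodeDen z r at hspec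
  set y' := sepVars i z (sepPoint z ρ y)
  rw [rhoHat_sepPoint hz hn] at hspec
  have hb (r : Fin n) : ∏ l, (z r - y' l) = ∏ l, (z r - y l) := by
    have := hspec r
    rw [sepPoint, div_left_inj' (nodeDen_ne_zero hz r)] at this
    exact (mul_left_cancel₀ hρ this).symm
  have hdeg (x : Fin (n - 2 - i) → ℂ) :
      (∏ l, (Polynomial.X - Polynomial.C (x l))).degree = ((n - 2 - i : ℕ) : WithBot ℕ) := by
    rw [Polynomial.degree_prod]; simp
  have hlt (x : Fin (n - 2 - i) → ℂ) :
      (∏ l, (Polynomial.X - Polynomial.C (x l))).degree < (((Finset.univ : Finset (Fin n)).card : ℕ) : WithBot ℕ) := by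
    rw [hdeg, Finset.card_univ, Fintype.card_fin]
    exact_mod_cast (by omega : n - 2 - i < n)
  have hpoly : ∏ l, (Polynomial.X - Polynomial.C (y' l)) = ∏ l, (Polynomial.X - Polynomial.C (y l)) :=
    Polynomial.eq_of_degrees_lt_of_eval_index_eq Finset.univ (v := z) hz.injOn (hlt y') (hlt y)
      fun r _ => by simp [Polynomial.eval_prod, hb]
  have hroots := congrArg Polynomial.roots hpoly
  have hr (x : Fin (n - 2 - i) → ℂ) :
      (∏ l, (Polynomial.X - Polynomial.C (x l))).roots = Finset.univ.val.map x := by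
    have := Polynomial.roots_multiset_prod_X_sub_C (Finset.univ.val.map x)
    rw [Multiset.map_map] at this
    exact this
  rw [hr, hr] at hroots
  have := congrArg (fun S => (Multiset.map f S).prod) hroots
  simp only [Multiset.map_map] at this
  exact this

theorem ofMoments_extendMoments (hz : Function.Injective z) {k : Fin n → ℂ}
    (hk : ∀ a, a ≤ i → ∑ r, z r ^ a * k r = 0) :
    ofMoments z (extendMoments i fun a : Fin (n - (i + 1)) => ∑ r, z r ^ ((a : ℕ) + (i + 1)) * k r) = k := by
  have hu : IsUnit (Matrix.vandermonde z).det :=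
    isUnit_iff_ne_zero.mpr (Matrix.det_vandermonde_ne_zero_iff.mpr hz)
  have : (extendMoments i fun a : Fin (n - (i + 1)) => ∑ r, z r ^ ((a : ℕ) + (i + 1)) * k r) =
      Matrix.vecMul k (Matrix.vandermonde z) := by
    ext a
    simp only [extendMoments, Matrix.vecMul, dotProduct, Matrix.vandermonde_apply]
    split_ifs with h
    · refine Finset.sum_congr rfl fun r _ => ?_
      rw [Nat.sub_add_cancel h, mul_comm]
    · rw [← hk a (by omega)]
      exact Finset.sum_congr rfl fun r _ => mul_comm _ _
  rw [ofMoments, this, Matrix.vecMul_vecMul, Matrix.mul_nonsing_inv _ hu, Matrix.vecMul_one]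

/-- The parametrization of the subspace of vanishing moments. -/
def momentMap (i : ℕ) (z : Fin n → ℂ) : (Fin (n - (i + 1)) → ℂ) →ₗ[ℂ] (Fin n → ℂ) where
  toFun c := ofMoments z (extendMoments i c)
  map_add' c c' := by
    rw [ofMoments, ofMoments, ofMoments, ← Matrix.add_vecMul]
    congr 1
    ext a
    simp only [extendMoments, Pi.add_apply]
    split_ifs <;> simp
  map_smul' t c := by
    rw [ofMoments, ofMoments, RingHom.id_apply, ← Matrix.smul_vecMul]
    congr 1
    ext a
    simp only [extendMoments, Pi.smul_apply]
    split_ifs <;> simp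

theorem momentMap_injective (hz : Function.Injective z) : Function.Injective (momentMap i z) := by
  intro c c' h
  ext a
  have h1 (c : Fin (n - (i + 1)) → ℂ) : extendMoments i c ⟨a + (i + 1), by omega⟩ = c a := by
    simp [extendMoments]
  rw [← h1 c, ← h1 c', ← moment_ofMoments hz (extendMoments i c),
    ← moment_ofMoments hz (extendMoments i c')]
  change ∑ r, _ * momentMap i z c r = ∑ r, _ * momentMap i z c' r
  rw [h]

/-- The leading coefficient and the first values of the polynomial attached to a moment vector. -/
def valueMap (i : ℕ) (z : Fin n → ℂ) (hm : m ≤ n) :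
    (Fin (n - (i + 1)) → ℂ) →ₗ[ℂ] (Fin (m + 1) → ℂ) where
  toFun c := Fin.cons (rhoHat i z (momentMap i z c))
    fun b : Fin m => nodeDen z (b.castLE hm) * momentMap i z c (b.castLE hm)
  map_add' c c' := by
    funext a
    refine Fin.cases ?_ (fun b => ?_) a
    · simp [rhoHat, mul_add, Finset.sum_add_distrib]
    · simp [mul_add]
  map_smul' t c := by
    funext a
    refine Fin.cases ?_ (fun b => ?_) a
    · simp [rhoHat, Finset.mul_sum, mul_left_comm]
    · simp [mul_left_comm]

theorem exists_momentMap_eq (hz : Function.Injective z) (hn : n = m + i + 2) {P : Polynomial ℂ}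
    (hP : P.natDegree ≤ m) : ∃ c, (∀ r, momentMap i z c r = P.eval (z r) / nodeDen z r) ∧
      valueMap i z (m := m) (by omega) c =
        Fin.cons (P.coeff m) fun b => P.eval (z (b.castLE (by omega))) := by
  have h1 := ofMoments_extendMoments hz (i := i) (k := fun r => P.eval (z r) / nodeDen z r)
    fun a ha => by rw [sum_pow_mul_eval_div hz hP a (by omega), if_neg (by omega)]
  have h2 : ∀ r, momentMap i z _ r = P.eval (z r) / nodeDen z r := fun r => congrFun h1 r
  refine ⟨_, h2, ?_⟩
  funext a
  refine Fin.cases ?_ (fun b => ?_) a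
  · simp only [valueMap, LinearMap.coe_mk, AddHom.coe_mk, Fin.cons_zero, rhoHat, h2]
    rw [sum_pow_mul_eval_div hz hP _ (by omega), if_pos (by omega)]
  · simp only [valueMap, LinearMap.coe_mk, AddHom.coe_mk, Fin.cons_succ, h2]
    rw [mul_div_cancel₀ _ (nodeDen_ne_zero hz _)]

/-- Interpolation produces a polynomial with any given leading coefficient and values; injectivity
follows by dimension, since n - (i + 1) = m + 1. -/
theorem valueMap_bijective (hz : Function.Injective z) (hn : n = m + i + 2) :
    Function.Bijective (valueMap i z (m := m) (by omega)) := by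
  classical
  have hsurj : Function.Surjective (valueMap i z (m := m) (by omega)) := by
    intro p
    have hζ : Function.Injective fun b : Fin m => z (b.castLE (by omega)) :=
      hz.comp (Fin.castLE_injective _)
    set N := ∏ b : Fin m, (Polynomial.X - Polynomial.C (z (b.castLE (by omega)))) with hNdef
    have hN : N.natDegree = m := by
      rw [Polynomial.natDegree_prod_of_monic _ _ fun _ _ => Polynomial.monic_X_sub_C _]; simp
    have hNm : N.Monic := Polynomial.monic_prod_of_monic _ _ fun _ _ => Polynomial.monic_X_sub_C _
    set I := Lagrange.interpolate Finset.univ (fun b : Fin m => z (b.castLE (by omega)))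
      fun b => p b.succ
    have hI : I.degree < m := by
      have := Lagrange.degree_interpolate_lt (s := Finset.univ) (fun b => p b.succ) hζ.injOn
      rwa [Finset.card_univ, Fintype.card_fin] at this
    have hNc : N.coeff m = 1 := by rw [← hN]; exact hNm
    have hdeg : (Polynomial.C (p 0) * N + I).natDegree ≤ m :=
      Polynomial.natDegree_add_le_of_degree_le ((Polynomial.natDegree_C_mul_le _ _).trans hN.le)
        (Polynomial.natDegree_le_of_degree_le hI.le)
    obtain ⟨c, -, hc⟩ := exists_momentMap_eq hz hn hdeg
    refine ⟨c, hc.trans ?_⟩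
    funext a
    refine Fin.cases ?_ (fun b => ?_) a
    · simp [hNc, Polynomial.coeff_eq_zero_of_degree_lt hI]
    · have hN0 : N.eval (z (b.castLE (by omega))) = 0 := by
        rw [hNdef, Polynomial.eval_prod]
        exact Finset.prod_eq_zero (Finset.mem_univ b) (by simp)
      rw [Fin.cons_succ, Polynomial.eval_add, Polynomial.eval_mul, hN0, mul_zero, zero_add]
      exact Lagrange.eval_interpolate_at_node (fun b : Fin m => p b.succ) hζ.injOn (Finset.mem_univ b)
  refine ⟨(LinearMap.injective_iff_surjective_of_finrank_eq_finrank ?_).2 hsurj, hsurj⟩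
  simp
  omega

/-- Integration with respect to `deltaMeasure` in separated variables. -/
theorem exists_integral_deltaMeasure (hz : Function.Injective z) (hn : n = m + i + 2) :
    ∃ C : ℂ, ∀ g : (Fin n → ℂ) → ℂ,
      Integrable (fun x : ℂ × (Fin m → ℂ) =>
        ((‖x.1‖ ^ (2 * m) * discAbs x.2 : ℝ) : ℂ) * g (sepPoint z x.1 x.2)) →
      Integrable g (deltaMeasure i z) ∧ ∫ k, g k ∂(deltaMeasure i z) =
        C * ∫ x : ℂ × (Fin m → ℂ), ((‖x.1‖ ^ (2 * m) * discAbs x.2 : ℝ) : ℂ) * g (sepPoint z x.1 x.2) := by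
  have hm : m ≤ n := by omega
  set ζ : Fin m → ℂ := fun b => z (b.castLE hm) with hζdef
  have hζ : Function.Injective ζ := hz.comp (Fin.castLE_injective _)
  let e := (LinearEquiv.ofBijective (valueMap i z hm) (valueMap_bijective hz hn)).toContinuousLinearEquiv
  have hmom : MeasurableEmbedding (momentMap i z) :=
    (LinearMap.isClosedEmbedding_of_injective (LinearMap.ker_eq_bot.2 (momentMap_injective hz))).measurableEmbedding
  let eR : (Fin (n - (i + 1)) → ℂ) ≃L[ℝ] (Fin (m + 1) → ℂ) :=
    { e with map_smul' := fun t c => (e.toLinearMap.restrictScalars ℝ).map_smul t c }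
  have heE : MeasurableEmbedding eR := eR.toHomeomorph.measurableEmbedding
  have hHaar : (Measure.map eR volume).IsAddHaarMeasure := inferInstance
  -- By uniqueness of Haar measure the linear change of variables contributes only a constant. Its
  -- value is irrelevant, as all the equations are linear in Θ.
  obtain ⟨κ, hκ⟩ : ∃ κ : NNReal, Measure.map eR volume = κ • (volume : Measure (Fin (m + 1) → ℂ)) :=
    ⟨_, Measure.isAddLeftInvariant_eq_smul _ _⟩
  have hD : deltaMeasure i z = ENNReal.ofReal ((‖(Matrix.vandermonde z).det‖ ^ 2)⁻¹) •
    Measure.map (momentMap i z) volume := rfl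
  have hroot (x : Fin (m + 1) → ℂ) :
      momentMap i z (eR.symm (rootMap ζ x)) = sepPoint z (x 0) (Fin.tail x) := by
    obtain ⟨P, h1, h2, h3, h4⟩ := exists_sepPoint_eq_eval z (x 0) (Fin.tail x)
    obtain ⟨c, hc1, hc2⟩ := exists_momentMap_eq hz hn h1
    have : eR c = rootMap ζ x := by
      refine Eq.trans hc2 ?_
      simp only [h2, h3, rootMap, Fin.tail, hζdef]
    rw [← this, eR.symm_apply_apply]
    ext r
    rw [hc1, h4]
  have hprod := volume_preserving_piFinSuccAbove (fun _ : Fin (m + 1) => ℂ) 0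
  have hprodE := (MeasurableEquiv.piFinSuccAbove (fun _ : Fin (m + 1) => ℂ) 0).measurableEmbedding
  refine ⟨(ENNReal.ofReal ((‖(Matrix.vandermonde z).det‖ ^ 2)⁻¹)).toReal * (κ * (discAbs ζ / m.factorial)),
    fun g hg => ?_⟩
  have hg' : Integrable (rootPullback ζ fun p => g (momentMap i z (eR.symm p))) := by
    refine ((hprod.integrable_comp_emb hprodE).2 hg).congr (.of_forall fun x => ?_)
    simp only [rootPullback, hroot, Complex.real_smul]
    rfl
  obtain ⟨h1, h2⟩ := integral_eq_rootPullback hζ hg'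
  have h3 : ∫ x, rootPullback ζ (fun p => g (momentMap i z (eR.symm p))) x =
      ∫ x : ℂ × (Fin m → ℂ), ((‖x.1‖ ^ (2 * m) * discAbs x.2 : ℝ) : ℂ) * g (sepPoint z x.1 x.2) := by
    rw [← hprod.integral_comp hprodE]
    refine integral_congr_ae (.of_forall fun x => ?_)
    simp only [rootPullback, hroot, Complex.real_smul]
    rfl
  have hsm : ∀ p, g (momentMap i z (eR.symm (eR p))) = g (momentMap i z p) := fun p => by
    rw [eR.symm_apply_apply]
  have h4 : Integrable (fun c => g (momentMap i z c)) := by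
    have : Integrable (fun p => g (momentMap i z (eR.symm p))) (Measure.map eR volume) := by
      rw [hκ]; exact h1.smul_measure_nnreal
    refine ((heE.integrable_map_iff).1 this).congr (.of_forall hsm)
  have h5 : ∫ c, g (momentMap i z c) = κ * ∫ p, g (momentMap i z (eR.symm p)) := by
    have := heE.integral_map (μ := volume) fun p => g (momentMap i z (eR.symm p))
    simp only [hsm] at this
    rw [← this, hκ, integral_smul_nnreal_measure]
    rfl
  rw [hD]
  constructor
  · exact ((hmom.integrable_map_iff).2 h4).smul_measure ENNReal.ofReal_ne_top
  · rw [integral_smul_measure, hmom.integral_map, h5, h2, h3, Complex.real_smul]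
    ring

end SeparatedVariables

/-! ### Absolute convergence in separated variables. -/

section Integrability

variable {n : ℕ}

/-! ### Integrability in separated variables -/

variable {m i : ℕ} {z : Fin n → ℂ}

theorem integrable_norm_rpow_mul {a e : ℝ} (ha : -2 < a) (hae : a + e < -2) :
    Integrable fun y : ℂ => ‖y‖ ^ a * (1 + ‖y‖) ^ e := by
  have h := (integrable_fun_norm_addHaar (volume : Measure ℂ) (f := fun r : ℝ => r ^ a * (1 + r) ^ e)).2
  refine h ?_
  simp only [Complex.finrank_real_complex, Nat.add_one_sub_one, pow_one, smul_eq_mul]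
  rw [← Set.Ioc_union_Ioi_eq_Ioi zero_le_one]
  refine IntegrableOn.union ?_ ?_
  · have h1 : IntegrableOn (fun r : ℝ => r ^ (a + 1)) (Set.Ioc 0 1) := by
      rw [← intervalIntegrable_iff_integrableOn_Ioc_of_le zero_le_one]
      exact intervalIntegral.intervalIntegrable_rpow' (by linarith)
    rw [← integrableOn_Icc_iff_integrableOn_Ioc] at h1 ⊢
    have h2 : ContinuousOn (fun r : ℝ => (1 + r) ^ e) (Set.Icc 0 1) := by
      refine ContinuousOn.rpow_const (by fun_prop) fun r hr => Or.inl ?_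
      have := hr.1
      positivity
    have h3 := h1.mul_continuousOn h2 isCompact_Icc
    rw [integrableOn_Icc_iff_integrableOn_Ioc] at h3 ⊢
    refine h3.congr_fun (fun r hr => ?_) measurableSet_Ioc
    simp only
    rw [Real.rpow_add hr.1, Real.rpow_one]
    ring
  · have h1 : IntegrableOn (fun r : ℝ => (2 : ℝ) ^ |e| * r ^ (a + e + 1)) (Set.Ioi 1) :=
      (integrableOn_Ioi_rpow_of_lt (by linarith) one_pos).const_mul _
    refine h1.mono' ?_ ?_
    · exact (Measurable.aestronglyMeasurable (by fun_prop))
    · filter_upwards [ae_restrict_mem measurableSet_Ioi] with r hr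
      have hr1 : (1 : ℝ) < r := hr
      have hr0 : 0 < r := one_pos.trans hr1
      rw [Real.norm_of_nonneg (by positivity), Real.rpow_add hr0, Real.rpow_add hr0, Real.rpow_one]
      have h2 : (1 + r) ^ e ≤ 2 ^ |e| * r ^ e := by
        rcases le_total 0 e with he | he
        · rw [abs_of_nonneg he, ← Real.mul_rpow (by norm_num) hr0.le]
          exact Real.rpow_le_rpow (by positivity) (by linarith) he
        · have h3 : (1 + r) ^ e ≤ r ^ e := Real.rpow_le_rpow_of_nonpos hr0 (by linarith) he
          have h4 : (1 : ℝ) ≤ 2 ^ |e| := Real.one_le_rpow (by norm_num) (abs_nonneg e)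
          nlinarith [Real.rpow_pos_of_pos hr0 e]
      calc r * (r ^ a * (1 + r) ^ e) ≤ r * (r ^ a * (2 ^ |e| * r ^ e)) := by gcongr
        _ = _ := by ring

theorem one_add_norm_le_mul (y w : ℂ) : 1 + ‖y‖ ≤ (1 + ‖w‖) * (1 + ‖y - w‖) := by
  have := norm_le_insert' y w
  nlinarith [norm_nonneg w, norm_nonneg (y - w)]

theorem integrable_norm_sub_rpow_mul {a e : ℝ} (ha : -2 < a) (hae : a + e < -2) (w : ℂ) :
    Integrable fun y : ℂ => ‖y - w‖ ^ a * (1 + ‖y‖) ^ e := by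
  have h := ((integrable_norm_rpow_mul ha hae).comp_sub_right w).const_mul ((1 + ‖w‖) ^ |e|)
  refine h.mono' (Measurable.aestronglyMeasurable (by fun_prop)) (.of_forall fun y => ?_)
  rw [Real.norm_of_nonneg (by positivity)]
  have h2 : (1 + ‖y‖) ^ e ≤ (1 + ‖w‖) ^ |e| * (1 + ‖y - w‖) ^ e := by
    rcases le_total 0 e with he | he
    · rw [abs_of_nonneg he, ← Real.mul_rpow (by positivity) (by positivity)]
      exact Real.rpow_le_rpow (by positivity) (one_add_norm_le_mul y w) he
    · have h3 : 1 + ‖y - w‖ ≤ (1 + ‖w‖) * (1 + ‖y‖) := by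
        have := norm_sub_le y w
        nlinarith [norm_nonneg w, norm_nonneg y]
      have h4 := Real.rpow_le_rpow_of_nonpos (by positivity) h3 he
      rw [Real.mul_rpow (by positivity) (by positivity)] at h4
      rw [abs_of_nonpos he, Real.rpow_neg (by positivity), inv_mul_eq_div, le_div_iff₀ (by positivity),
        mul_comm]
      exact h4
  calc ‖y - w‖ ^ a * (1 + ‖y‖) ^ e ≤ ‖y - w‖ ^ a * ((1 + ‖w‖) ^ |e| * (1 + ‖y - w‖) ^ e) := by gcongr
    _ = _ := by ring

/-- A point can be close to at most one of the nodes. -/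
theorem exists_node_separation (hz : Function.Injective z) :
    ∃ c, 0 < c ∧ ∀ y r s, r ≠ s → c * (1 + ‖y‖) ≤ ‖y - z r‖ ∨ c * (1 + ‖y‖) ≤ ‖y - z s‖ := by
  suffices h : ∀ᶠ c : ℝ in 𝓝[>] 0, ∀ r s, r ≠ s → ∀ y,
      c * (1 + ‖y‖) ≤ ‖y - z r‖ ∨ c * (1 + ‖y‖) ≤ ‖y - z s‖ by
    obtain ⟨c, hc, hc0⟩ := (h.and self_mem_nhdsWithin).exists
    exact ⟨c, hc0, fun y r s hrs => hc r s hrs y⟩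
  simp only [eventually_all]
  intro r s hrs
  set δ := ‖z r - z s‖ / 2 with hδ
  have hδ0 : 0 < δ := half_pos (norm_pos_iff.2 (sub_ne_zero.2 fun h => hrs (hz h)))
  set M := max ‖z r‖ ‖z s‖
  have hM0 : 0 ≤ M := (norm_nonneg _).trans (le_max_left _ _)
  filter_upwards [Ioo_mem_nhdsGT (show (0 : ℝ) < ((1 + M) / δ + 1)⁻¹ by positivity)] with c hc y
  have key (w : ℂ) (hw : ‖w‖ ≤ M) (hy : δ ≤ ‖y - w‖) : c * (1 + ‖y‖) ≤ ‖y - w‖ := by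
    have h1 := norm_le_insert' y w
    have h2 : 1 + M ≤ (1 + M) / δ * ‖y - w‖ := by
      rw [div_mul_eq_mul_div, le_div_iff₀ hδ0]
      gcongr
    calc c * (1 + ‖y‖) ≤ ((1 + M) / δ + 1)⁻¹ * (1 + ‖y‖) := by gcongr; exact hc.2.le
      _ ≤ _ := by rw [inv_mul_le_iff₀ (by positivity)]; linarith
  by_cases h : δ ≤ ‖y - z r‖
  · exact Or.inl (key _ (le_max_left _ _) h)
  · refine Or.inr (key _ (le_max_right _ _) ?_)
    have := norm_sub_le_norm_sub_add_norm_sub (z r) y (z s)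
    rw [norm_sub_rev (z r) y] at this
    linarith [not_le.1 h]

/-- If z_r is the node nearest to y, every other distance is at least of size 1 + |y| up to a
constant, so the product behaves like |y - z_r|(1 + |y|)^{n-1}; the sum over r avoids naming the
nearest node. -/
theorem exists_nodeDist_rpow_le (hz : Function.Injective z) [NeZero n] {a : ℝ} (ha : a ≤ 0) :
    ∃ C, 0 ≤ C ∧ ∀ y ∉ Set.range z,
      nodeDist z y ^ a ≤ C * ∑ r, ‖y - z r‖ ^ a * (1 + ‖y‖) ^ ((n - 1) * a : ℝ) := by
  obtain ⟨c, hc, h⟩ := exists_node_separation hz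
  refine ⟨c ^ ((n - 1) * a), by positivity, fun y hy => ?_⟩
  obtain ⟨r, hr⟩ := Finite.exists_min fun r => ‖y - z r‖
  have hpos (s : Fin n) : 0 < ‖y - z s‖ := norm_pos_iff.2 (sub_ne_zero.2 fun e => hy ⟨s, e.symm⟩)
  have h1 : ‖y - z r‖ * (c * (1 + ‖y‖)) ^ (n - 1) ≤ nodeDist z y := by
    rw [nodeDist, ← Finset.mul_prod_erase _ _ (Finset.mem_univ r)]
    have h2 : (c * (1 + ‖y‖)) ^ (n - 1) ≤ ∏ s ∈ Finset.univ.erase r, ‖y - z s‖ := by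
      have hcard : (Finset.univ.erase r).card = n - 1 := by
        rw [Finset.card_erase_of_mem (Finset.mem_univ r), Finset.card_univ, Fintype.card_fin]
      rw [← hcard, ← Finset.prod_const]
      refine Finset.prod_le_prod (fun _ _ => by positivity) fun s hs => ?_
      rcases h y r s (Finset.ne_of_mem_erase hs).symm with h3 | h3
      · exact h3.trans (hr s)
      · exact h3
    gcongr
  have h2 := Real.rpow_le_rpow_of_nonpos (mul_pos (hpos r) (by positivity)) h1 ha
  have hn : ((n - 1 : ℕ) : ℝ) = n - 1 := by
    rw [Nat.cast_sub (Nat.one_le_iff_ne_zero.2 (NeZero.ne n)), Nat.cast_one]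
  rw [Real.mul_rpow (norm_nonneg _) (by positivity), ← Real.rpow_natCast, ← Real.rpow_mul (by positivity),
    hn, Real.mul_rpow hc.le (by positivity)] at h2
  refine h2.trans ?_
  have h3 := Finset.single_le_sum (f := fun r => ‖y - z r‖ ^ a * (1 + ‖y‖) ^ ((n - 1) * a : ℝ))
    (fun _ _ => by positivity) (Finset.mem_univ r)
  calc _ = c ^ ((n - 1) * a) * (‖y - z r‖ ^ a * (1 + ‖y‖) ^ ((n - 1) * a : ℝ)) := by ring
    _ ≤ _ := mul_le_mul_of_nonneg_left h3 (by positivity)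

theorem ae_notMem_range (z : Fin n → ℂ) : ∀ᵐ y : ℂ, y ∉ Set.range z :=
  compl_mem_ae_iff.2 ((Set.finite_range z).measure_zero _)

theorem measurable_nodeDist (z : Fin n → ℂ) : Measurable (nodeDist z) :=
  (continuous_nodeDist z).measurable

theorem integrable_nodeDist_rpow_mul (hz : Function.Injective z) [NeZero n] {a e : ℝ} (ha : -2 < a)
    (ha0 : a ≤ 0) (hae : n * a + e < -2) :
    Integrable fun y : ℂ => nodeDist z y ^ a * (1 + ‖y‖) ^ e := by
  obtain ⟨C, hC, h⟩ := exists_nodeDist_rpow_le hz ha0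
  have h1 : Integrable fun y : ℂ => ∑ r, C * (‖y - z r‖ ^ a * (1 + ‖y‖) ^ ((n - 1) * a + e : ℝ)) :=
    integrable_finsetSum _ fun r _ => (integrable_norm_sub_rpow_mul ha (by linarith) (z r)).const_mul C
  refine h1.mono' ?_ ?_
  · have := measurable_nodeDist z
    exact (Measurable.aestronglyMeasurable (by fun_prop))
  · filter_upwards [ae_notMem_range z] with y hy
    have := nodeDist_nonneg z y
    rw [Real.norm_of_nonneg (by positivity)]
    calc _ ≤ (C * ∑ r, ‖y - z r‖ ^ a * (1 + ‖y‖) ^ ((n - 1) * a : ℝ)) * (1 + ‖y‖) ^ e := by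
          gcongr; exact h y hy
      _ = _ := by
          rw [mul_assoc, Finset.sum_mul, Finset.mul_sum]
          refine Finset.sum_congr rfl fun r _ => ?_
          rw [Real.rpow_add (by positivity)]
          ring

/-- A scaled version of `integrable_norm_rpow_mul`. -/
theorem integrable_norm_rpow_mul_scaled {p K : ℝ} (hp : -2 < p) (hK : p + 2 < K) {Y : ℝ} (hY : 0 < Y) :
    Integrable (fun ρ : ℂ => ‖ρ‖ ^ p * (1 + ‖ρ‖ * Y) ^ (-K)) ∧
    ∫ ρ : ℂ, ‖ρ‖ ^ p * (1 + ‖ρ‖ * Y) ^ (-K) =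
      (∫ ρ : ℂ, ‖ρ‖ ^ p * (1 + ‖ρ‖) ^ (-K)) * Y ^ (-p - 2) := by
  have hint := integrable_norm_rpow_mul (e := -K) hp (by linarith)
  have e (ρ : ℂ) : ‖ρ‖ ^ p * (1 + ‖ρ‖ * Y) ^ (-K) =
      Y ^ (-p) * (‖Y • ρ‖ ^ p * (1 + ‖Y • ρ‖) ^ (-K)) := by
    rw [norm_smul, Real.norm_of_nonneg hY.le, Real.mul_rpow hY.le (norm_nonneg _), Real.rpow_neg hY.le p,
      mul_comm Y ‖ρ‖]
    have := (Real.rpow_pos_of_pos hY p).ne'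
    field_simp
  simp only [e]
  constructor
  · exact ((integrable_comp_smul_iff volume (fun ρ : ℂ => ‖ρ‖ ^ p * (1 + ‖ρ‖) ^ (-K)) hY.ne').2
      hint).const_mul _
  · rw [integral_const_mul, Measure.integral_comp_smul_of_nonneg volume
      (fun ρ : ℂ => ‖ρ‖ ^ p * (1 + ‖ρ‖) ^ (-K)) Y (hR := hY.le), Complex.finrank_real_complex, smul_eq_mul,
      Real.rpow_sub hY, Real.rpow_two]
    field_simp

/-- The product of the brackets `1 + |y_l|`. -/
def bracketProd (y : Fin m → ℂ) : ℝ := ∏ l, (1 + ‖y l‖)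

theorem bracketProd_pos (y : Fin m → ℂ) : 0 < bracketProd y :=
  Finset.prod_pos fun _ _ => by positivity

theorem continuous_bracketProd : Continuous (bracketProd (m := m)) := by
  unfold bracketProd; fun_prop

/-- The weight `∏_l P(y_l)^{-1/2} (1 + |y_l|)^{e_l}`. -/
def sepWeight (z : Fin n → ℂ) (e : Fin m → ℝ) (y : Fin m → ℂ) : ℝ :=
  ∏ l, nodeDist z (y l) ^ (-1 / 2 : ℝ) * (1 + ‖y l‖) ^ (e l)

theorem sepWeight_nonneg (z : Fin n → ℂ) (e : Fin m → ℝ) (y : Fin m → ℂ) : 0 ≤ sepWeight z e y :=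
  Finset.prod_nonneg fun l _ => by
    have := nodeDist_nonneg z (y l)
    positivity

theorem measurable_sepWeight (z : Fin n → ℂ) (e : Fin m → ℝ) : Measurable (sepWeight z e) := by
  have := measurable_nodeDist z
  unfold sepWeight
  fun_prop

/-- Rescaling ρ by the product B of the brackets 1 + |y_l| turns the ρ-integral into a constant
times B^{-p-2}, after which the y-integrals factorize. The condition on e_l is the convergence of
each of them at infinity, -n/2 + e_l - p - 2 < -2. -/
theorem integrable_sepBound (hz : Function.Injective z) [NeZero n] {p K : ℝ} (hp : -2 < p)
    (hK : p + 2 < K) {e : Fin m → ℝ} (he : ∀ l, e l < p + n / 2) :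
    Integrable fun x : ℂ × (Fin m → ℂ) =>
      ‖x.1‖ ^ p * (1 + ‖x.1‖ * bracketProd x.2) ^ (-K) * sepWeight z e x.2 := by
  have hm1 := measurable_sepWeight z e
  have hm2 := (continuous_bracketProd (m := m)).measurable
  have hmeas : AEStronglyMeasurable (fun x : ℂ × (Fin m → ℂ) =>
      ‖x.1‖ ^ p * (1 + ‖x.1‖ * bracketProd x.2) ^ (-K) * sepWeight z e x.2) (volume.prod volume) :=
    Measurable.aestronglyMeasurable (by fun_prop)
  rw [Measure.volume_eq_prod]
  refine (integrable_prod_iff' hmeas).2 ⟨.of_forall fun y => ?_, ?_⟩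
  · exact (integrable_norm_rpow_mul_scaled hp hK (bracketProd_pos y)).1.mul_const (sepWeight z e y)
  · have h1 (y : Fin m → ℂ) : ∫ ρ : ℂ, ‖‖ρ‖ ^ p * (1 + ‖ρ‖ * bracketProd y) ^ (-K) * sepWeight z e y‖ =
        (∫ ρ : ℂ, ‖ρ‖ ^ p * (1 + ‖ρ‖) ^ (-K)) *
          ∏ l, nodeDist z (y l) ^ (-1 / 2 : ℝ) * (1 + ‖y l‖) ^ (e l + (-p - 2)) := by
      have h2 (ρ : ℂ) : ‖‖ρ‖ ^ p * (1 + ‖ρ‖ * bracketProd y) ^ (-K) * sepWeight z e y‖ =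
          ‖ρ‖ ^ p * (1 + ‖ρ‖ * bracketProd y) ^ (-K) * sepWeight z e y := by
        have := bracketProd_pos y
        have := sepWeight_nonneg z e y
        exact Real.norm_of_nonneg (by positivity)
      simp only [h2]
      rw [integral_mul_const, (integrable_norm_rpow_mul_scaled hp hK (bracketProd_pos y)).2, mul_assoc]
      congr 1
      rw [bracketProd, ← Real.finsetProd_rpow _ _ fun _ _ => by positivity, sepWeight,
        ← Finset.prod_mul_distrib]
      refine Finset.prod_congr rfl fun l _ => ?_
      rw [Real.rpow_add (by positivity)]
      ring
    simp only [h1]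
    refine (Integrable.fintype_prod (f := fun l (y : ℂ) =>
      nodeDist z y ^ (-1 / 2 : ℝ) * (1 + ‖y‖) ^ (e l + (-p - 2))) fun l => ?_).const_mul _
    exact integrable_nodeDist_rpow_mul hz (by norm_num) (by norm_num) (by linarith [he l])

/-- The separated variables are controlled by `k`. -/
theorem exists_le_norm_sepPoint (hz : Function.Injective z) (hmn : m < n) :
    ∃ c, 0 < c ∧ ∀ (ρ : ℂ) (y : Fin m → ℂ), c * (‖ρ‖ * bracketProd y) ≤ ‖sepPoint z ρ y‖ := by
  obtain ⟨c, hc, h⟩ := exists_node_separation hz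
  have hn : 0 < n := by omega
  set D := ∑ r, ‖nodeDen z r‖ with hD
  have hDr (r : Fin n) : ‖nodeDen z r‖ ≤ D :=
    Finset.single_le_sum (f := fun r => ‖nodeDen z r‖) (fun _ _ => norm_nonneg _) (Finset.mem_univ r)
  have hD0 : 0 < D := (norm_pos_iff.2 (nodeDen_ne_zero hz ⟨0, hn⟩)).trans_le (hDr _)
  refine ⟨c ^ m / D, by positivity, fun ρ y => ?_⟩
  -- Pigeonhole: every y_l is close to at most one node and there are fewer variables than nodes, so
  -- some node is far from all of them, and its component k_r is large.
  obtain ⟨r, hr⟩ : ∃ r, ∀ l, c * (1 + ‖y l‖) ≤ ‖y l - z r‖ := by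
    by_contra hcon
    push Not at hcon
    choose f hf using hcon
    obtain ⟨r, s, hrs, hfrs⟩ := Fintype.exists_ne_map_eq_of_card_lt f (by simpa using hmn)
    rcases h (y (f r)) r s hrs with h1 | h1
    · exact absurd h1 (not_le.2 (hf r))
    · rw [hfrs] at h1
      exact absurd h1 (not_le.2 (hf s))
  refine le_trans ?_ (norm_le_pi_norm _ r)
  rw [sepPoint, norm_div, norm_mul, norm_prod]
  have h1 : c ^ m * bracketProd y ≤ ∏ l, ‖z r - y l‖ := by
    have : c ^ m * bracketProd y = ∏ l : Fin m, c * (1 + ‖y l‖) := by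
      rw [Finset.prod_mul_distrib, Finset.prod_const, Finset.card_univ, Fintype.card_fin, bracketProd]
    rw [this]
    exact Finset.prod_le_prod (fun _ _ => by positivity) fun l _ => by
      rw [norm_sub_rev]; exact hr l
  calc c ^ m / D * (‖ρ‖ * bracketProd y) = ‖ρ‖ * (c ^ m * bracketProd y) / D := by ring
    _ ≤ ‖ρ‖ * (∏ l, ‖z r - y l‖) / ‖nodeDen z r‖ := by
        have := norm_pos_iff.2 (nodeDen_ne_zero hz r)
        gcongr
        exact hDr r

theorem continuous_sepPoint (z : Fin n → ℂ) :
    Continuous fun x : ℂ × (Fin m → ℂ) => sepPoint z x.1 x.2 := by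
  unfold sepPoint
  fun_prop

/-- Plane wave pairings decay rapidly in separated variables. -/
theorem exists_norm_planeWavePairing_sepPoint_le (hz : Function.Injective z) (hmn : m < n) (K : ℕ) :
    ∃ C, 0 ≤ C ∧ ∀ (ψ : 𝓢(Fin n → ℂ, ℂ)) (ρ : ℂ) (y : Fin m → ℂ),
      ‖planeWavePairing ψ (sepPoint z ρ y)‖ ≤
        C * waveGauge K ψ * (1 + ‖ρ‖ * bracketProd y) ^ (-K : ℝ) := by
  obtain ⟨c, hc, h⟩ := exists_le_norm_sepPoint hz hmn
  refine ⟨((min 1 c) ^ K)⁻¹, by positivity, fun ψ ρ y => ?_⟩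
  have hb := bracketProd_pos y
  have h1 : min 1 c * (1 + ‖ρ‖ * bracketProd y) ≤ 1 + ‖sepPoint z ρ y‖ := by
    rw [mul_add, mul_one]
    refine add_le_add (min_le_left _ _) (le_trans ?_ (h ρ y))
    gcongr
    exact min_le_right _ _
  have h2 := waveGauge_nonneg K ψ
  have h3 : 0 < min 1 c := lt_min one_pos hc
  refine (norm_planeWavePairing_le_div K ψ _).trans ?_
  rw [Real.rpow_neg (by positivity), Real.rpow_natCast]
  calc _ ≤ waveGauge K ψ / (min 1 c * (1 + ‖ρ‖ * bracketProd y)) ^ K := by gcongr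
    _ = _ := by rw [mul_pow]; field_simp

/-- The bound by `waveGauge`, uniform in the test function, is what later makes Θ continuous and
hence tempered. -/
theorem exists_integral_norm_mul_planeWavePairing_le (hz : Function.Injective z) (hmn : m < n) {p : ℝ}
    (hp : -2 < p) {e : Fin m → ℝ} (he : ∀ l, e l < p + n / 2) {f : ℂ × (Fin m → ℂ) → ℂ}
    (hf : AEStronglyMeasurable f) {C : ℝ}
    (hb : ∀ᵐ x, ‖f x‖ ≤ C * (‖x.1‖ ^ p * sepWeight z e x.2)) :
    ∃ (M : ℝ) (K : ℕ), ∀ ψ : 𝓢(Fin n → ℂ, ℂ),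
      Integrable (fun x => f x * planeWavePairing ψ (sepPoint z x.1 x.2)) ∧
      ‖∫ x, f x * planeWavePairing ψ (sepPoint z x.1 x.2)‖ ≤ M * waveGauge K ψ := by
  have : NeZero n := ⟨by omega⟩
  obtain ⟨K, hK⟩ := exists_nat_gt (p + 2)
  obtain ⟨A, hA, h⟩ := exists_norm_planeWavePairing_sepPoint_le hz hmn K
  have hint := integrable_sepBound (m := m) hz hp hK he
  refine ⟨C * A * ∫ x : ℂ × (Fin m → ℂ),
    ‖x.1‖ ^ p * (1 + ‖x.1‖ * bracketProd x.2) ^ (-K : ℝ) * sepWeight z e x.2, K, fun ψ => ?_⟩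
  have hdom : ∀ᵐ x : ℂ × (Fin m → ℂ), ‖f x * planeWavePairing ψ (sepPoint z x.1 x.2)‖ ≤
      C * A * waveGauge K ψ *
        (‖x.1‖ ^ p * (1 + ‖x.1‖ * bracketProd x.2) ^ (-K : ℝ) * sepWeight z e x.2) := by
    filter_upwards [hb] with x hx
    rw [norm_mul]
    calc _ ≤ C * (‖x.1‖ ^ p * sepWeight z e x.2) *
          (A * waveGauge K ψ * (1 + ‖x.1‖ * bracketProd x.2) ^ (-K : ℝ)) :=
          mul_le_mul hx (h ψ _ _) (norm_nonneg _) ((norm_nonneg _).trans hx)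
      _ = _ := by ring
  have hmeas : AEStronglyMeasurable (fun x : ℂ × (Fin m → ℂ) =>
      f x * planeWavePairing ψ (sepPoint z x.1 x.2)) :=
    hf.mul ((continuous_planeWavePairing ψ).comp (continuous_sepPoint z)).aestronglyMeasurable
  refine ⟨(hint.const_mul _).mono' hmeas hdom, ?_⟩
  refine (norm_integral_le_of_norm_le (hint.const_mul _) hdom).trans_eq ?_
  rw [integral_const_mul]
  ring

theorem integrable_mul_planeWavePairing_sepPoint (hz : Function.Injective z) (hmn : m < n) {p : ℝ}
    (hp : -2 < p) {e : Fin m → ℝ} (he : ∀ l, e l < p + n / 2) {f : ℂ × (Fin m → ℂ) → ℂ}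
    (hf : AEStronglyMeasurable f) {C : ℝ}
    (hb : ∀ᵐ x, ‖f x‖ ≤ C * (‖x.1‖ ^ p * sepWeight z e x.2)) (ψ : 𝓢(Fin n → ℂ, ℂ)) :
    Integrable fun x => f x * planeWavePairing ψ (sepPoint z x.1 x.2) := by
  obtain ⟨M, K, h⟩ := exists_integral_norm_mul_planeWavePairing_le hz hmn hp he hf hb
  exact (h ψ).1

end Integrability

section Density

variable {n : ℕ}

/-! ### The amplitude in separated variables -/

variable {m i : ℕ} {z j E : Fin n → ℂ} {χ : ℂ → ℂ}

theorem prod_cpow_eq {ι : Type*} (s : Finset ι) {x : ℂ} (hx : x ≠ 0) (a : ι → ℂ) :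
    ∏ r ∈ s, x ^ a r = x ^ ∑ r ∈ s, a r := by
  classical
  induction s using Finset.induction_on with
  | empty => simp
  | insert r s hr ih => rw [Finset.prod_insert hr, Finset.sum_insert hr, Complex.cpow_add _ _ hx, ih]

theorem prod_norm_cpow {ι : Type*} (s : Finset ι) (x : ι → ℂ) (c : ℂ) :
    ((∏ r ∈ s, ‖x r‖ : ℝ) : ℂ) ^ c = ∏ r ∈ s, (‖x r‖ : ℂ) ^ c := by
  classical
  induction s using Finset.induction_on with
  | empty => simp
  | insert r s hr ih =>
    rw [Finset.prod_insert hr, Finset.prod_insert hr, Complex.ofReal_mul,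
      Complex.mul_cpow_ofReal_nonneg (norm_nonneg _) (Finset.prod_nonneg fun _ _ => norm_nonneg _), ih]

theorem norm_ofReal_norm_cpow {x : ℂ} (hx : x ≠ 0) (c : ℂ) : ‖(‖x‖ : ℂ) ^ c‖ = ‖x‖ ^ c.re :=
  Complex.norm_cpow_eq_rpow_re_of_pos (norm_pos_iff.2 hx) c

/-- The weight `χ(y) ∏_r |y - z_r|^{-2 j_r - 2}` of a separated variable. -/
def solutionWeight (z j : Fin n → ℂ) (χ : ℂ → ℂ) (y : ℂ) : ℂ :=
  χ y * ∏ r, (‖y - z r‖ : ℂ) ^ (-(2 * j r + 2))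

/-- The density `|ρ|^s ∏_l u(y_l) ∏_{a ≠ b} |y_a - y_b|`. -/
def sepDensity (z j : Fin n → ℂ) (χ : ℂ → ℂ) (s : ℂ) (x : ℂ × (Fin m → ℂ)) : ℂ :=
  (‖x.1‖ : ℂ) ^ s * ((∏ l, solutionWeight z j χ (x.2 l)) * (discAbs x.2 : ℂ))

/-- The exponent of `|ρ|`. -/
def rhoExponent (m : ℕ) (j : Fin n → ℂ) : ℂ := 2 * m + 2 - ∑ r, (2 * j r + 2)

theorem rhoExponent_eq (m : ℕ) (j : Fin n → ℂ) (hn : n = m + i + 2) :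
    rhoExponent m j = -2 * (1 + i + ∑ r, j r) := by
  have : (n : ℂ) = m + i + 2 := by exact_mod_cast hn
  simp only [rhoExponent, Finset.sum_add_distrib, ← Finset.mul_sum, Finset.sum_const, Finset.card_univ,
    Fintype.card_fin, nsmul_eq_mul, this]
  ring

theorem rhoExponent_re (hj : ∀ r, (j r).re = -1 / 2) (hn : n = m + i + 2) :
    (rhoExponent m j).re = m - i := by
  rw [rhoExponent_eq m j hn]
  have : (n : ℝ) = m + i + 2 := by exact_mod_cast hn
  simp [hj, this]
  ring

/-- Since |k_r| = |ρ| ∏_l |y_l - z_r| / |∏_{s≠r}(z_r - z_s)|, the amplitude factorizes. The exponent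
of |ρ| collects 2m from the Jacobian, 2 from |ρ̂|², and -(2 j_r + 2) from each |k_r|; the node
denominators go into the constant. -/
theorem amplitude_sepPoint (hz : Function.Injective z) (hn : n = m + i + 2) :
    ∃ c : ℂ, ∀ x : ℂ × (Fin m → ℂ), x.1 ≠ 0 →
      ((‖x.1‖ ^ (2 * m) * discAbs x.2 : ℝ) : ℂ) * amplitude i z j χ (sepPoint z x.1 x.2) =
        c * sepDensity z j χ (rhoExponent m j) x := by
  refine ⟨1 / (Real.pi : ℂ) ^ n * (∏ r, (‖nodeDen z r‖ : ℂ) ^ (2 * j r + 2)), ?_⟩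
  rintro ⟨ρ, y⟩ hρ
  simp only at hρ
  have hρ' : (‖ρ‖ : ℂ) ≠ 0 := by simpa using hρ
  have hk (r : Fin n) : (‖sepPoint z ρ y r‖ : ℂ) ^ (-(2 * j r + 2)) =
      (‖ρ‖ : ℂ) ^ (-(2 * j r + 2)) * (∏ l, (‖y l - z r‖ : ℂ) ^ (-(2 * j r + 2))) *
        (‖nodeDen z r‖ : ℂ) ^ (2 * j r + 2) := by
    have h1 : ‖sepPoint z ρ y r‖ = ‖ρ‖ * ((∏ l, ‖y l - z r‖) * ‖nodeDen z r‖⁻¹) := by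
      rw [sepPoint, norm_div, norm_mul, norm_prod, div_eq_mul_inv, mul_assoc]
      simp only [norm_sub_rev]
    rw [h1, Complex.ofReal_mul, Complex.mul_cpow_ofReal_nonneg (norm_nonneg _) (by positivity),
      Complex.ofReal_mul, Complex.mul_cpow_ofReal_nonneg (by positivity) (by positivity), prod_norm_cpow,
      mul_assoc]
    congr 2
    rw [Complex.ofReal_inv, Complex.inv_cpow _ _ ?_, Complex.cpow_neg, inv_inv]
    rw [Complex.arg_ofReal_of_nonneg (norm_nonneg _)]
    exact Real.pi_pos.ne
  have h2 : (‖ρ‖ : ℂ) ^ rhoExponent m j =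
      (‖ρ‖ : ℂ) ^ (2 * m) * (‖ρ‖ : ℂ) ^ 2 * ∏ r, (‖ρ‖ : ℂ) ^ (-(2 * j r + 2)) := by
    rw [prod_cpow_eq _ hρ', Finset.sum_neg_distrib, rhoExponent, sub_eq_add_neg, Complex.cpow_add _ _ hρ',
      Complex.cpow_add _ _ hρ']
    congr 2
    · rw [← Complex.cpow_natCast]; push_cast; rfl
    · rw [← Complex.cpow_natCast]; push_cast; rfl
  have h3 : ∏ l, solutionWeight z j χ (y l) =
      (∏ l, χ (y l)) * ∏ r, ∏ l, (‖y l - z r‖ : ℂ) ^ (-(2 * j r + 2)) := by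
    simp only [solutionWeight, Finset.prod_mul_distrib]
    rw [Finset.prod_comm]
  simp only [amplitude, sepDensity, rhoHat_sepPoint hz hn, prod_sepVars hz hn hρ, hk, h2, h3,
    Finset.prod_mul_distrib]
  push_cast
  ring

theorem IsOperSolution.exists_norm_solutionWeight_le (h : IsOperSolution z j E χ) (ho : IsOper z j E)
    (hz : Function.Injective z) (hj : ∀ r, (j r).re = -1 / 2) :
    ∃ C, 0 ≤ C ∧ ∀ y ∉ Set.range z, ‖solutionWeight z j χ y‖ ≤
      C * (nodeDist z y ^ (-1 / 2 : ℝ) * (1 + ‖y‖) ^ (2 - n / 2 : ℝ)) := by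
  obtain ⟨C, hC, hb⟩ := h.exists_global_bounds ho hz hj
  refine ⟨C, hC, fun y hy => ?_⟩
  have hP := nodeDist_pos hy
  have h1 : ‖∏ r, (‖y - z r‖ : ℂ) ^ (-(2 * j r + 2))‖ = nodeDist z y ^ (-1 : ℝ) := by
    rw [norm_prod, nodeDist, ← Real.finsetProd_rpow _ _ fun _ _ => norm_nonneg _]
    refine Finset.prod_congr rfl fun r _ => ?_
    rw [norm_ofReal_norm_cpow (sub_ne_zero.2 fun e => hy ⟨r, e.symm⟩)]
    congr 1
    simp [hj]
    norm_num
  rw [solutionWeight, norm_mul, h1]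
  calc _ ≤ C * (nodeDist z y ^ (1 / 2 : ℝ) * (1 + ‖y‖) ^ (2 - n * (1 / 2) : ℝ)) * nodeDist z y ^ (-1 : ℝ) := by
        gcongr
        exact (hb y hy).1
    _ = C * ((nodeDist z y ^ (1 / 2 : ℝ) * nodeDist z y ^ (-1 : ℝ)) * (1 + ‖y‖) ^ (2 - n / 2 : ℝ)) := by ring_nf
    _ = _ := by rw [← Real.rpow_add hP]; norm_num

theorem IsOperSolution.measurable_solutionWeight (h : IsOperSolution z j E χ)
    (hj : ∀ r, (j r).re = -1 / 2) : Measurable (solutionWeight z j χ) := by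
  have hop : IsOpen (Set.range z)ᶜ := isOpen_compl_range z
  have h1 : solutionWeight z j χ = fun y => (Set.range z)ᶜ.indicator χ y *
      ∏ r, (‖y - z r‖ : ℂ) ^ (-(2 * j r + 2)) := by
    funext y
    by_cases hy : y ∈ Set.range z
    · obtain ⟨r, rfl⟩ := hy
      -- Nothing is known about χ at the nodes, but there the weight contains 0 to a nonzero complex
      -- power, which is 0 by convention.
      have : ∏ s, (‖z r - z s‖ : ℂ) ^ (-(2 * j s + 2)) = 0 := by
        refine Finset.prod_eq_zero (Finset.mem_univ r) ?_
        rw [sub_self, norm_zero, Complex.ofReal_zero, Complex.zero_cpow]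
        intro h0
        have := congrArg Complex.re h0
        simp [hj] at this
        norm_num at this
      rw [solutionWeight, this, mul_zero, mul_zero]
    · rw [solutionWeight, Set.indicator_of_mem (by exact hy)]
  rw [h1]
  have h2 : Measurable ((Set.range z)ᶜ.indicator χ) := by
    classical
    have := h.smooth.continuousOn.measurable_piecewise (g := 0) continuousOn_const
      hop.measurableSet
    rwa [Set.piecewise_eq_indicator] at this
  fun_prop

theorem discAbs_le (y : Fin m → ℂ) : discAbs y ≤ ∏ l, (1 + ‖y l‖) ^ (2 * (m - 1) : ℝ) := by
  have h1 : discAbs y ≤ ∏ a, ∏ b ∈ Finset.univ.erase a, (1 + ‖y a‖) * (1 + ‖y b‖) := by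
    rw [← prod_prod_erase_eq_discAbs]
    refine Finset.prod_le_prod (fun _ _ => by positivity) fun a _ =>
      Finset.prod_le_prod (fun _ _ => by positivity) fun b _ => ?_
    have := norm_sub_le (y a) (y b)
    nlinarith [norm_nonneg (y a), norm_nonneg (y b)]
  refine h1.trans_eq ?_
  have hcard (a : Fin m) : ((Finset.univ.erase a).card : ℝ) = m - 1 := by
    rw [Finset.card_erase_of_mem (Finset.mem_univ a), Finset.card_univ, Fintype.card_fin,
      Nat.cast_sub a.pos, Nat.cast_one]
  have h2 : ∏ a, ∏ b ∈ Finset.univ.erase a, (1 + ‖y b‖) = ∏ b, ∏ a ∈ Finset.univ.erase b, (1 + ‖y b‖) :=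
    Finset.prod_comm' fun a b => by simp [eq_comm]
  simp only [Finset.prod_mul_distrib]
  rw [h2, ← Finset.prod_mul_distrib]
  refine Finset.prod_congr rfl fun a _ => ?_
  rw [Finset.prod_const, ← Real.rpow_natCast, hcard, ← Real.rpow_add (by positivity)]
  ring_nf

theorem sepWeight_mul (z : Fin n → ℂ) (e τ : Fin m → ℝ) (y : Fin m → ℂ) :
    sepWeight z e y * ∏ l, (1 + ‖y l‖) ^ τ l = sepWeight z (e + τ) y := by
  rw [sepWeight, ← Finset.prod_mul_distrib]
  refine Finset.prod_congr rfl fun l _ => ?_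
  rw [Pi.add_apply, Real.rpow_add (by positivity)]
  ring

theorem ae_notMem_range_pi (z : Fin n → ℂ) :
    ∀ᵐ x : ℂ × (Fin m → ℂ), x.1 ≠ 0 ∧ ∀ l, x.2 l ∉ Set.range z := by
  have h1 : ∀ᵐ x : ℂ × (Fin m → ℂ), x.1 ≠ 0 :=
    Measure.quasiMeasurePreserving_fst.ae (Measure.ae_ne volume 0)
  have h2 (l : Fin m) : ∀ᵐ x : ℂ × (Fin m → ℂ), x.2 l ∉ Set.range z :=
    (Measure.quasiMeasurePreserving_snd.ae
      ((Measure.quasiMeasurePreserving_eval (fun _ : Fin m => (volume : Measure ℂ)) l).ae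
        (ae_notMem_range z)))
  filter_upwards [h1, ae_all_iff.2 h2] with x hx1 hx2 using ⟨hx1, hx2⟩

theorem IsOperSolution.exists_norm_prod_solutionWeight_le (h : IsOperSolution z j E χ) (ho : IsOper z j E)
    (hz : Function.Injective z) (hj : ∀ r, (j r).re = -1 / 2) (m : ℕ) :
    ∃ C, 0 ≤ C ∧ ∀ y : Fin m → ℂ, (∀ l, y l ∉ Set.range z) →
      ‖∏ l, solutionWeight z j χ (y l)‖ ≤ C * sepWeight z (fun _ => 2 - n / 2) y := by
  obtain ⟨C, hC, hb⟩ := h.exists_norm_solutionWeight_le ho hz hj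
  refine ⟨C ^ m, by positivity, fun y hy => ?_⟩
  have : C ^ m * sepWeight z (fun _ => 2 - n / 2) y = ∏ l, C * (nodeDist z (y l) ^ (-1 / 2 : ℝ) *
      (1 + ‖y l‖) ^ (2 - n / 2 : ℝ)) := by
    rw [Finset.prod_mul_distrib, Finset.prod_const, Finset.card_univ, Fintype.card_fin, sepWeight]
  rw [this, norm_prod]
  exact Finset.prod_le_prod (fun _ _ => norm_nonneg _) fun l _ => hb _ (hy l)

theorem IsOperSolution.measurable_sepDensity (h : IsOperSolution z j E χ)
    (hj : ∀ r, (j r).re = -1 / 2) (s : ℂ) : Measurable (sepDensity (m := m) z j χ s) := by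
  have h1 := h.measurable_solutionWeight hj
  have h2 := (continuous_discAbs (m := m)).measurable
  unfold sepDensity
  fun_prop

/-- A criterion for integrability against the density. -/
theorem IsOperSolution.exists_norm_sepDensity_mul_le (h : IsOperSolution z j E χ) (ho : IsOper z j E)
    (hz : Function.Injective z) (hj : ∀ r, (j r).re = -1 / 2) {f : (Fin m → ℂ) → ℂ} {τ : Fin m → ℝ}
    {A : ℝ} (hf : ∀ y, discAbs y * ‖f y‖ ≤ A * ∏ l, (1 + ‖y l‖) ^ τ l) :
    ∃ C, 0 ≤ C ∧ ∀ (s : ℂ) (b : ℕ), ∀ᵐ x : ℂ × (Fin m → ℂ),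
      ‖sepDensity z j χ s x * (x.1⁻¹ ^ b * f x.2)‖ ≤
        C * (‖x.1‖ ^ (s.re - b) * sepWeight z (fun l => 2 - n / 2 + τ l) x.2) := by
  obtain ⟨C, hC, hb⟩ := h.exists_norm_prod_solutionWeight_le ho hz hj m
  have hA : 0 ≤ A := by
    have := hf 0
    have h0 := mul_nonneg (discAbs_nonneg (0 : Fin m → ℂ)) (norm_nonneg (f 0))
    refine nonneg_of_mul_nonneg_left (h0.trans this) (Finset.prod_pos fun _ _ => by positivity)
  refine ⟨C * A, by positivity, fun s b => ?_⟩
  filter_upwards [ae_notMem_range_pi z] with x hx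
  have hx0 : 0 < ‖x.1‖ := norm_pos_iff.2 hx.1
  have h1 := hb x.2 hx.2
  have h3 := sepWeight_nonneg z (fun _ => 2 - n / 2) x.2
  rw [show (fun l => 2 - (n : ℝ) / 2 + τ l) = (fun _ => 2 - (n : ℝ) / 2) + τ from rfl, ← sepWeight_mul,
    sepDensity, norm_mul, norm_mul, norm_mul, norm_mul, norm_pow, norm_inv, norm_ofReal_norm_cpow hx.1,
    Complex.norm_real, Real.norm_of_nonneg (discAbs_nonneg _), Real.rpow_sub hx0, Real.rpow_natCast]
  calc _ = ‖∏ l, solutionWeight z j χ (x.2 l)‖ * (discAbs x.2 * ‖f x.2‖) * (‖x.1‖ ^ s.re * (‖x.1‖⁻¹ ^ b)) := by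
        ring
    _ ≤ (C * sepWeight z (fun _ => 2 - n / 2) x.2) * (A * ∏ l, (1 + ‖x.2 l‖) ^ τ l) *
        (‖x.1‖ ^ s.re * (‖x.1‖⁻¹ ^ b)) := by
        refine mul_le_mul_of_nonneg_right (mul_le_mul h1 (hf x.2) ?_ (by positivity)) (by positivity)
        exact mul_nonneg (discAbs_nonneg x.2) (norm_nonneg (f x.2))
    _ = _ := by rw [inv_pow]; ring

/-- The densities are integrable against rapidly decreasing functions. -/
theorem IsOperSolution.integrable_sepDensity_mul (h : IsOperSolution z j E χ) (ho : IsOper z j E)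
    (hz : Function.Injective z) (hj : ∀ r, (j r).re = -1 / 2) (hmn : m < n) {f : (Fin m → ℂ) → ℂ}
    (hfm : Measurable f) {τ : Fin m → ℝ} {A : ℝ}
    (hf : ∀ y, discAbs y * ‖f y‖ ≤ A * ∏ l, (1 + ‖y l‖) ^ τ l) {s : ℂ} {b : ℕ} (hs : -2 < s.re - b)
    (hτ : ∀ l, 2 - n + τ l < s.re - b) (ψ : 𝓢(Fin n → ℂ, ℂ)) :
    Integrable fun x : ℂ × (Fin m → ℂ) => sepDensity z j χ s x * (x.1⁻¹ ^ b * f x.2) *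
      planeWavePairing ψ (sepPoint z x.1 x.2) := by
  obtain ⟨C, hC, hb⟩ := h.exists_norm_sepDensity_mul_le ho hz hj hf
  refine integrable_mul_planeWavePairing_sepPoint hz hmn hs (fun l => ?_) ?_ (hb s b) ψ
  · linarith [hτ l]
  · have := h.measurable_sepDensity (m := m) hj s
    exact (Measurable.aestronglyMeasurable (by fun_prop))

end Density

/-! ### Integration by parts in ρ and in one separated variable. -/

section IntegrationByParts

variable {n : ℕ}

/-! ### Integration by parts -/

variable {m i : ℕ} {z j E : Fin n → ℂ} {χ : ℂ → ℂ}

theorem integral_eq_zero_of_hasDerivAt_fst {G D : ℝ × ℝ → ℂ} (hG : Integrable G) (hD : Integrable D)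
    (h : ∀ᵐ y : ℝ, ∀ x, HasDerivAt (fun x => G (x, y)) (D (x, y)) x) : ∫ v, D v = 0 := by
  rw [Measure.volume_eq_prod] at *
  rw [integral_prod_symm _ hD]
  refine integral_eq_zero_of_ae ?_
  filter_upwards [h, hG.prod_left_ae, hD.prod_left_ae] with y hy h1 h2
  exact integral_eq_zero_of_hasDerivAt_of_integrable hy h2 h1

/-- The integral of a Wirtinger derivative vanishes, even if finitely many points are excepted. -/
theorem integral_eq_zero_of_hasWirtingerAt {Z : Set ℂ} (hZ : Z.Finite) {g p q : ℂ → ℂ}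
    (h : ∀ y ∉ Z, HasWirtingerAt g (p y) (q y) y) (hg : Integrable g) (hp : Integrable p)
    (hq : Integrable q) : ∫ y, p y = 0 := by
  have hM := Complex.volume_preserving_equiv_real_prod.symm
  have hE := Complex.measurableEquivRealProd.symm.measurableEmbedding
  have hint {f : ℂ → ℂ} (hf : Integrable f) :
      Integrable (fun v : ℝ × ℝ => f (Complex.measurableEquivRealProd.symm v)) :=
    (hM.integrable_comp_emb hE).2 hf
  have hline (w θ : ℂ) (hw : ∀ r : ℝ, w + r * θ ∉ Z) (r : ℝ) := (h _ (hw r)).hasDerivAt_line w θ r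
  -- All but finitely many horizontal lines avoid `Z`, and along these the derivative is ∂ + ∂̄.
  have h1 : ∫ y, p y + q y = 0 := by
    rw [← hM.integral_comp hE]
    refine integral_eq_zero_of_hasDerivAt_fst (hint hg) (hint (hp.add hq)) ?_
    filter_upwards [compl_mem_ae_iff.2 ((hZ.image Complex.im).measure_zero volume)] with b hb a
    have := hline (b * Complex.I) 1 (fun r hr => hb ⟨_, hr, by simp⟩) a
    simp only [map_one, mul_one] at this
    have e (a : ℝ) : Complex.measurableEquivRealProd.symm (a, b) = b * Complex.I + a := by
      apply Complex.ext <;> simp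
    simp only [e]
    exact this
  -- Along vertical lines the derivative is i(∂ - ∂̄); together with the horizontal lines this
  -- separates ∫ p from ∫ q.
  have h2 : ∫ y, p y * Complex.I + q y * -Complex.I = 0 := by
    rw [← hM.integral_comp hE, Measure.volume_eq_prod, ← integral_prod_swap, ← Measure.volume_eq_prod]
    have hs {f : ℂ → ℂ} (hf : Integrable f) : Integrable (fun v : ℝ × ℝ =>
        f (Complex.measurableEquivRealProd.symm v.swap)) := by
      have := hint hf
      rw [Measure.volume_eq_prod] at this
      exact this.swap
    refine integral_eq_zero_of_hasDerivAt_fst (hs hg) (hs ((hp.mul_const _).add (hq.mul_const _))) ?_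
    filter_upwards [compl_mem_ae_iff.2 ((hZ.image Complex.re).measure_zero volume)] with a ha b
    have := hline a Complex.I (fun r hr => ha ⟨_, hr, by simp⟩) b
    rw [Complex.conj_I] at this
    have e (b : ℝ) : Complex.measurableEquivRealProd.symm (Prod.swap (b, a)) = a + b * Complex.I := by
      apply Complex.ext <;> simp
    simp only [e]
    exact this
  rw [integral_add hp hq] at h1
  rw [integral_add (hp.mul_const _) (hq.mul_const _), integral_mul_const, integral_mul_const] at h2
  have h3 : (∫ y, p y) = ∫ y, q y := by
    have : ((∫ y, p y) - ∫ y, q y) * Complex.I = 0 := by linear_combination h2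
    rcases mul_eq_zero.1 this with h | h
    · exact sub_eq_zero.1 h
    · exact absurd h Complex.I_ne_zero
  rw [← h3] at h1
  simpa using h1

theorem HasWirtingerAt.comp_hasDerivAt {f h : ℂ → ℂ} {p q h' y : ℂ} (hh : HasDerivAt h h' (f y))
    (hf : HasWirtingerAt f p q y) : HasWirtingerAt (fun x => h (f x)) (h' * p) (h' * q) y := by
  refine of_clm ((hh.hasFDerivAt.restrictScalars ℝ).comp y hf) ?_ ?_ <;> simp <;> ring

theorem norm_cpow_eq_mul_conj_cpow (x s : ℂ) (hx : x ≠ 0) : (‖x‖ : ℂ) ^ s = (x * conj x) ^ (s / 2) := by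
  have h1 : (‖x‖ : ℂ) ≠ 0 := by simpa using hx
  rw [Complex.mul_conj, Complex.normSq_eq_norm_sq, pow_two, Complex.ofReal_mul,
    Complex.mul_cpow_ofReal_nonneg (norm_nonneg _) (norm_nonneg _), ← Complex.cpow_add _ _ h1, add_halves]

theorem hasWirtingerAt_norm_cpow (s w : ℂ) {y : ℂ} (hy : y ≠ w) :
    HasWirtingerAt (fun y => (‖y - w‖ : ℂ) ^ s) (s / 2 * (‖y - w‖ : ℂ) ^ s * (y - w)⁻¹)
      (s / 2 * (‖y - w‖ : ℂ) ^ s * (conj (y - w))⁻¹) y := by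
  have hy0 : y - w ≠ 0 := sub_ne_zero.2 hy
  have hyc : conj (y - w) ≠ 0 := by rwa [Ne, map_eq_zero]
  have hid := HasWirtingerAt.of_hasDerivAt ((hasDerivAt_id y).sub_const w)
  have hu : (y - w) * conj (y - w) ∈ Complex.slitPlane := by
    rw [Complex.mul_conj]
    exact Complex.ofReal_mem_slitPlane.2 (Complex.normSq_pos.2 hy0)
  have h1 := HasWirtingerAt.comp_hasDerivAt (f := fun y => (y - w) * conj (y - w))
    ((hasDerivAt_id ((y - w) * conj (y - w))).cpow_const (c := s / 2) hu) (hid.mul hid.star)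
  refine (h1.congr_of_eventuallyEq ?_).congr_deriv ?_ ?_
  · filter_upwards [isOpen_ne.mem_nhds hy] with x hx
    exact norm_cpow_eq_mul_conj_cpow _ _ (sub_ne_zero.2 hx)
  all_goals
    rw [norm_cpow_eq_mul_conj_cpow _ _ hy0]
    simp only [id, map_one, map_zero]
    rw [Complex.cpow_sub _ _ (mul_ne_zero hy0 hyc), Complex.cpow_one]
    field_simp
    try ring

/-- Plane wave pairings along a complex line. -/
theorem hasWirtingerAt_planeWavePairing_line (ψ : 𝓢(Fin n → ℂ, ℂ)) (w e : Fin n → ℂ) (ρ : ℂ) :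
    HasWirtingerAt (fun ρ => planeWavePairing ψ (w + ρ • e))
      (∑ r, e r * planeWavePairing (coordMul r ψ) (w + ρ • e))
      (∑ r, conj (e r) * planeWavePairing (conjCoordMul r ψ) (w + ρ • e)) ρ := by
  obtain ⟨D, hD, hDv⟩ := hasFDerivAt_planeWavePairing ψ (w + ρ • e)
  have h1 : HasFDerivAt (fun ρ : ℂ => w + ρ • e)
      ((ContinuousLinearMap.toSpanSingleton ℂ e).restrictScalars ℝ) ρ :=
    (((ContinuousLinearMap.toSpanSingleton ℂ e).hasFDerivAt (x := ρ)).restrictScalars ℝ).const_add w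
  refine HasWirtingerAt.of_clm (HasFDerivAt.comp (g := planeWavePairing ψ) ρ hD h1) ?_ ?_
  · simp [hDv, Finset.sum_add_distrib]
  · simp [hDv, Finset.sum_add_distrib, Finset.sum_mul]
    rw [sub_eq_add_neg]
    congr 1
    · exact Finset.sum_congr rfl fun r _ => by ring
    · exact congrArg Neg.neg (Finset.sum_congr rfl fun r _ => by ring)

theorem exists_norm_planeWavePairing_line_le (ψ : 𝓢(Fin n → ℂ, ℂ)) (w : Fin n → ℂ) {e : Fin n → ℂ}
    (he : e ≠ 0) (K : ℕ) :
    ∃ C, 0 ≤ C ∧ ∀ ρ : ℂ, ‖planeWavePairing ψ (w + ρ • e)‖ ≤ C * (1 + ‖ρ‖) ^ (-K : ℝ) := by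
  have he0 : 0 < ‖e‖ := norm_pos_iff.2 he
  set A := 1 + (1 + ‖w‖) / ‖e‖ with hA
  have hA0 : 0 < A := by positivity
  refine ⟨waveGauge K ψ * A ^ K, mul_nonneg (waveGauge_nonneg K ψ) (by positivity), fun ρ => ?_⟩
  have h1 : 1 + ‖ρ‖ ≤ A * (1 + ‖w + ρ • e‖) := by
    have h2 := norm_sub_le (w + ρ • e) w
    rw [add_sub_cancel_left, norm_smul] at h2
    have h3 : ‖ρ‖ ≤ (‖w + ρ • e‖ + ‖w‖) / ‖e‖ := by rwa [le_div_iff₀ he0]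
    have h4 : A * (1 + ‖w + ρ • e‖) = 1 + (‖w + ρ • e‖ + ‖w‖) / ‖e‖ + ‖w + ρ • e‖ + 1 / ‖e‖ +
        ‖w‖ * ‖w + ρ • e‖ / ‖e‖ := by rw [hA]; field_simp; ring
    rw [h4]
    have : 0 ≤ ‖w + ρ • e‖ + 1 / ‖e‖ + ‖w‖ * ‖w + ρ • e‖ / ‖e‖ := by positivity
    linarith
  have h2 := waveGauge_nonneg K ψ
  refine (norm_planeWavePairing_le_div K ψ _).trans ?_
  rw [Real.rpow_neg (by positivity), Real.rpow_natCast]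
  have h3 : (1 + ‖ρ‖) ^ K ≤ A ^ K * (1 + ‖w + ρ • e‖) ^ K := by
    rw [← mul_pow]; gcongr
  rw [div_le_iff₀ (by positivity), mul_assoc, mul_assoc]
  refine le_mul_of_one_le_right h2 ?_
  rw [mul_left_comm, inv_mul_eq_div, le_div_iff₀ (by positivity), one_mul]
  exact h3

/-- The transpose of the Euler operator `∑_r x_r ∂_{x_r}`. -/
def eulerTranspose (ψ : 𝓢(Fin n → ℂ, ℂ)) : 𝓢(Fin n → ℂ, ℂ) := -∑ r, coordDeriv r (coordMul r ψ)

theorem planeWavePairing_eulerTranspose (ψ : 𝓢(Fin n → ℂ, ℂ)) (k : Fin n → ℂ) :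
    planeWavePairing (eulerTranspose ψ) k = ∑ r, k r * planeWavePairing (coordMul r ψ) k := by
  rw [← waveLM_apply, eulerTranspose, map_neg, map_sum, ← Finset.sum_neg_distrib]
  refine Finset.sum_congr rfl fun r _ => ?_
  rw [waveLM_apply, planeWavePairing_coordDeriv]
  ring

theorem integrable_norm_cpow_mul_line {f : ℂ → ℂ} (hf : AEStronglyMeasurable f) {C p : ℝ} (hp : -2 < p)
    (hb : ∀ ρ ≠ 0, ‖f ρ‖ ≤ C * ‖ρ‖ ^ p) (ψ : 𝓢(Fin n → ℂ, ℂ)) {e : Fin n → ℂ} (he : e ≠ 0) :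
    Integrable fun ρ : ℂ => f ρ * planeWavePairing ψ (ρ • e) := by
  obtain ⟨K, hK⟩ := exists_nat_gt (p + 2)
  obtain ⟨A, hA, h⟩ := exists_norm_planeWavePairing_line_le ψ 0 he K
  refine ((integrable_norm_rpow_mul (e := -K) hp (by linarith)).const_mul (C * A)).mono' ?_ ?_
  · exact hf.mul ((continuous_planeWavePairing ψ).comp (by fun_prop)).aestronglyMeasurable
  · filter_upwards [Measure.ae_ne volume (0 : ℂ)] with ρ hρ
    have := h ρ
    rw [zero_add] at this
    rw [norm_mul]
    calc _ ≤ (C * ‖ρ‖ ^ p) * (A * (1 + ‖ρ‖) ^ (-K : ℝ)) :=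
          mul_le_mul (hb ρ hρ) this (norm_nonneg _) ((norm_nonneg _).trans (hb ρ hρ))
      _ = _ := by ring

/-- Integration by parts in the radial variable. -/
theorem integral_norm_cpow_euler (ψ : 𝓢(Fin n → ℂ, ℂ)) {e : Fin n → ℂ} (he : e ≠ 0) {s : ℂ} {b : ℕ}
    (hs : -2 < s.re - b) :
    ∫ ρ : ℂ, (‖ρ‖ : ℂ) ^ s * ρ⁻¹ ^ b *
      planeWavePairing (eulerTranspose ψ + (s / 2 + 1 - b) • ψ) (ρ • e) = 0 := by
  have hm : Measurable fun ρ : ℂ => (‖ρ‖ : ℂ) ^ s := by fun_prop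
  have hnorm (ρ : ℂ) (hρ : ρ ≠ 0) : ‖(‖ρ‖ : ℂ) ^ s * ρ⁻¹ ^ b‖ = ‖ρ‖ ^ (s.re - b) := by
    rw [norm_mul, norm_ofReal_norm_cpow hρ, norm_pow, norm_inv, Real.rpow_sub (norm_pos_iff.2 hρ),
      Real.rpow_natCast, inv_pow, div_eq_mul_inv]
  have hnorm1 (ρ : ℂ) (hρ : ρ ≠ 0) : ‖(‖ρ‖ : ℂ) ^ s * ρ⁻¹ ^ b * ρ‖ = ‖ρ‖ ^ (s.re - b + 1) := by
    rw [norm_mul, hnorm ρ hρ, Real.rpow_add (norm_pos_iff.2 hρ), Real.rpow_one]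
  have hmain (ψ : 𝓢(Fin n → ℂ, ℂ)) : Integrable fun ρ : ℂ => (‖ρ‖ : ℂ) ^ s * ρ⁻¹ ^ b *
      planeWavePairing ψ (ρ • e) :=
    integrable_norm_cpow_mul_line (C := 1) (Measurable.aestronglyMeasurable (by fun_prop)) hs
      (fun ρ hρ => by rw [hnorm ρ hρ, one_mul]) ψ he
  have hmain1 (ψ : 𝓢(Fin n → ℂ, ℂ)) : Integrable fun ρ : ℂ => (‖ρ‖ : ℂ) ^ s * ρ⁻¹ ^ b * ρ *
      planeWavePairing ψ (ρ • e) :=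
    integrable_norm_cpow_mul_line (C := 1) (p := s.re - b + 1)
      (Measurable.aestronglyMeasurable (by fun_prop)) (by linarith) (fun ρ hρ => by rw [hnorm1 ρ hρ, one_mul]) ψ he
  -- The holomorphic derivative of |ρ|^s ρ^{1-b} is (s/2 + 1 - b)|ρ|^s ρ^{-b}, while ρ times the
  -- derivative of the pairing along the ray direction is the Euler operator. The antiholomorphic
  -- derivative enters only through its integrability.
  refine integral_eq_zero_of_hasWirtingerAt (Set.finite_singleton (0 : ℂ))
    (g := fun ρ : ℂ => (‖ρ‖ : ℂ) ^ s * ρ⁻¹ ^ b * ρ * planeWavePairing ψ (ρ • e))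
    (q := fun ρ : ℂ => (s / 2 * (‖ρ‖ : ℂ) ^ s * (conj ρ)⁻¹ * ρ⁻¹ ^ b * ρ) * planeWavePairing ψ (ρ • e) +
      ∑ r, conj (e r) * ((‖ρ‖ : ℂ) ^ s * ρ⁻¹ ^ b * ρ * planeWavePairing (conjCoordMul r ψ) (ρ • e)))
    ?_ (hmain1 ψ) (hmain _) ?_
  · intro ρ hρ
    have hρ0 : ρ ≠ 0 := hρ
    have h1 := hasWirtingerAt_norm_cpow s 0 hρ0
    simp only [sub_zero] at h1
    have h2 : HasWirtingerAt (fun ρ : ℂ => ρ⁻¹ ^ b * ρ) ((1 - b) * ρ⁻¹ ^ b) 0 ρ := by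
      refine HasWirtingerAt.of_hasDerivAt
        ((((hasDerivAt_inv hρ0).pow b).mul (hasDerivAt_id ρ)).congr_deriv ?_)
      simp only [Pi.pow_apply, id]
      cases b with
      | zero => simp
      | succ b =>
        have h5 : ρ⁻¹ * ρ = 1 := inv_mul_cancel₀ hρ0
        rw [Nat.add_sub_cancel, ← inv_pow]
        push_cast
        linear_combination (-((b : ℂ) + 1) * ρ⁻¹ ^ (b + 1)) * h5
    have h3 := hasWirtingerAt_planeWavePairing_line ψ 0 e ρ
    simp only [zero_add] at h3
    have h4 := (h1.mul h2).mul h3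
    refine (h4.congr_of_eventuallyEq (.of_forall fun x => ?_)).congr_deriv ?_ ?_
    · simp [mul_assoc]
    · have h5 : planeWavePairing (eulerTranspose ψ) (ρ • e) =
          ρ * ∑ r, e r * planeWavePairing (coordMul r ψ) (ρ • e) := by
        rw [planeWavePairing_eulerTranspose, Finset.mul_sum]
        exact Finset.sum_congr rfl fun r _ => by rw [Pi.smul_apply, smul_eq_mul, mul_assoc]
      rw [planeWavePairing_add, planeWavePairing_smul, h5]
      field_simp
      ring
    · simp only [Finset.mul_sum]
      congr 1
      · ring
      · exact Finset.sum_congr rfl fun r _ => by ring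
  · refine Integrable.add ?_ (integrable_finsetSum _ fun r _ => (hmain1 _).const_mul _)
    refine integrable_norm_cpow_mul_line (C := ‖s / 2‖) (Measurable.aestronglyMeasurable (by fun_prop)) hs
      (fun ρ hρ => ?_) ψ he
    have : s / 2 * (‖ρ‖ : ℂ) ^ s * (conj ρ)⁻¹ * ρ⁻¹ ^ b * ρ =
        s / 2 * ((‖ρ‖ : ℂ) ^ s * ρ⁻¹ ^ b) * ((conj ρ)⁻¹ * ρ) := by ring
    rw [this, norm_mul, norm_mul, hnorm ρ hρ, norm_mul, norm_inv, RCLike.norm_conj,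
      inv_mul_cancel₀ (norm_ne_zero_iff.2 hρ), mul_one]

theorem sepPoint_eq_smul (z : Fin n → ℂ) (ρ : ℂ) (y : Fin m → ℂ) :
    sepPoint z ρ y = ρ • sepPoint z 1 y := by
  ext r; simp [sepPoint, mul_div_assoc]

theorem sepPoint_one_ne_zero (hz : Function.Injective z) (hmn : m < n) (y : Fin m → ℂ) :
    sepPoint z 1 y ≠ 0 := by
  obtain ⟨c, hc, h⟩ := exists_le_norm_sepPoint hz hmn
  have h1 := h 1 y
  have := bracketProd_pos y
  intro h0
  rw [h0, norm_zero, norm_one, one_mul] at h1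
  have : 0 < c * bracketProd y := by positivity
  linarith

/-- At fixed y the point k = ρ · `sepPoint z 1 y` runs over a complex line through the origin, so
the claim is `integral_norm_cpow_euler` on each such line. -/
theorem integral_sepDensity_euler (hz : Function.Injective z) (hmn : m < n)
    (f : (Fin m → ℂ) → ℂ) {s : ℂ} {b : ℕ} (hs : -2 < s.re - b) (ψ : 𝓢(Fin n → ℂ, ℂ))
    (hint : Integrable fun x : ℂ × (Fin m → ℂ) => sepDensity z j χ s x * (x.1⁻¹ ^ b * f x.2) *
      planeWavePairing (eulerTranspose ψ + (s / 2 + 1 - b) • ψ) (sepPoint z x.1 x.2)) :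
    ∫ x : ℂ × (Fin m → ℂ), sepDensity z j χ s x * (x.1⁻¹ ^ b * f x.2) *
      planeWavePairing (eulerTranspose ψ + (s / 2 + 1 - b) • ψ) (sepPoint z x.1 x.2) = 0 := by
  rw [Measure.volume_eq_prod] at *
  rw [integral_prod_symm _ hint]
  refine integral_eq_zero_of_ae (.of_forall fun y => ?_)
  have h := integral_norm_cpow_euler ψ (sepPoint_one_ne_zero hz hmn y) hs
  have h2 (ρ : ℂ) : sepDensity z j χ s (ρ, y) * (ρ⁻¹ ^ b * f y) *
      planeWavePairing (eulerTranspose ψ + (s / 2 + 1 - b) • ψ) (sepPoint z ρ y) =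
      ((∏ l, solutionWeight z j χ (y l)) * (discAbs y : ℂ) * f y) * ((‖ρ‖ : ℂ) ^ s * ρ⁻¹ ^ b *
      planeWavePairing (eulerTranspose ψ + (s / 2 + 1 - b) • ψ) (ρ • sepPoint z 1 y)) := by
    rw [← sepPoint_eq_smul, sepDensity]
    ring
  simp only [h2, Pi.zero_apply]
  rw [integral_const_mul, h, mul_zero]

end IntegrationByParts

section SymbolCalculus

variable {n : ℕ}

/-! ### Functions of symbol type -/

variable {m i : ℕ} {z j E : Fin n → ℂ} {χ : ℂ → ℂ}

/-- `f` is bounded by `P^a` up to powers of `1 + |y|`. -/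
def SymbolBound (z : Fin n → ℂ) (a : ℝ) (f : ℂ → ℂ) : Prop :=
  ∃ C K : ℝ, 0 ≤ C ∧ ∀ y ∉ Set.range z, ‖f y‖ ≤ C * (nodeDist z y ^ a * (1 + ‖y‖) ^ K)

theorem nodeDist_le (z : Fin n → ℂ) : ∃ A, 0 < A ∧ ∀ y, nodeDist z y ≤ A * (1 + ‖y‖) ^ (n : ℝ) := by
  refine ⟨∏ r, (1 + ‖z r‖), Finset.prod_pos fun _ _ => by positivity, fun y => ?_⟩
  rw [Real.rpow_natCast, nodeDist]
  have : (1 + ‖y‖) ^ n = ∏ _r : Fin n, (1 + ‖y‖) := by simp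
  rw [this, ← Finset.prod_mul_distrib]
  refine Finset.prod_le_prod (fun _ _ => norm_nonneg _) fun r _ => ?_
  have := norm_sub_le y (z r)
  nlinarith [norm_nonneg y, norm_nonneg (z r)]

namespace SymbolBound

variable {a b : ℝ} {f g : ℂ → ℂ}

theorem mul (hf : SymbolBound z a f) (hg : SymbolBound z b g) :
    SymbolBound z (a + b) fun y => f y * g y := by
  obtain ⟨C, K, hC, h⟩ := hf
  obtain ⟨C', K', hC', h'⟩ := hg
  refine ⟨C * C', K + K', by positivity, fun y hy => ?_⟩
  have hP := nodeDist_pos hy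
  rw [norm_mul, Real.rpow_add hP, Real.rpow_add (by positivity)]
  calc _ ≤ (C * (nodeDist z y ^ a * (1 + ‖y‖) ^ K)) * (C' * (nodeDist z y ^ b * (1 + ‖y‖) ^ K')) :=
        mul_le_mul (h y hy) (h' y hy) (norm_nonneg _) (by positivity)
    _ = _ := by ring

theorem add (hf : SymbolBound z a f) (hg : SymbolBound z a g) :
    SymbolBound z a fun y => f y + g y := by
  obtain ⟨C, K, hC, h⟩ := hf
  obtain ⟨C', K', hC', h'⟩ := hg
  refine ⟨C + C', max K K', by positivity, fun y hy => ?_⟩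
  have hP := nodeDist_pos hy
  have h1 : 1 ≤ 1 + ‖y‖ := by linarith [norm_nonneg y]
  calc _ ≤ _ := norm_add_le _ _
    _ ≤ C * (nodeDist z y ^ a * (1 + ‖y‖) ^ K) + C' * (nodeDist z y ^ a * (1 + ‖y‖) ^ K') :=
        add_le_add (h y hy) (h' y hy)
    _ ≤ C * (nodeDist z y ^ a * (1 + ‖y‖) ^ max K K') + C' * (nodeDist z y ^ a * (1 + ‖y‖) ^ max K K') := by
        gcongr <;> first | exact h1 | exact le_max_left _ _ | exact le_max_right _ _
    _ = _ := by ring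

/-- Since P is at most a constant times (1 + |y|)^n, lowering the exponent of P costs only powers of
1 + |y|, which `SymbolBound` leaves free and the plane wave pairings absorb. -/
theorem mono (hf : SymbolBound z a f) (hab : b ≤ a) : SymbolBound z b f := by
  obtain ⟨C, K, hC, h⟩ := hf
  obtain ⟨A, hA, hP'⟩ := nodeDist_le z
  refine ⟨C * A ^ (a - b), n * (a - b) + K, by positivity, fun y hy => (h y hy).trans ?_⟩
  have hP := nodeDist_pos hy
  have h1 : nodeDist z y ^ (a - b) ≤ A ^ (a - b) * (1 + ‖y‖) ^ (n * (a - b) : ℝ) := by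
    rw [Real.rpow_mul (by positivity), ← Real.mul_rpow hA.le (by positivity)]
    exact Real.rpow_le_rpow hP.le (hP' y) (sub_nonneg.2 hab)
  have h2 : nodeDist z y ^ a = nodeDist z y ^ b * nodeDist z y ^ (a - b) := by
    rw [← Real.rpow_add hP, add_sub_cancel]
  rw [h2, Real.rpow_add (by positivity)]
  calc _ ≤ C * (nodeDist z y ^ b * (A ^ (a - b) * (1 + ‖y‖) ^ (n * (a - b) : ℝ)) * (1 + ‖y‖) ^ K) := by
        gcongr
    _ = _ := by ring

theorem of_le {C K : ℝ} (h : ∀ y ∉ Set.range z, ‖f y‖ ≤ C * (1 + ‖y‖) ^ K) : SymbolBound z 0 f := by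
  refine ⟨|C|, K, abs_nonneg _, fun y hy => (h y hy).trans ?_⟩
  rw [Real.rpow_zero, one_mul]
  gcongr
  exact le_abs_self C

theorem const (c : ℂ) : SymbolBound z 0 fun _ => c :=
  of_le (C := ‖c‖) (K := 0) fun y _ => by rw [Real.rpow_zero, mul_one]

theorem const_mul (c : ℂ) (hf : SymbolBound z a f) : SymbolBound z a fun y => c * f y := by
  simpa using (const c).mul hf

theorem neg (hf : SymbolBound z a f) : SymbolBound z a fun y => -f y := by
  simpa using hf.const_mul (-1)

theorem congr (hf : SymbolBound z a f) (h : ∀ y ∉ Set.range z, g y = f y) : SymbolBound z a g := by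
  obtain ⟨C, K, hC, h'⟩ := hf
  exact ⟨C, K, hC, fun y hy => by rw [h y hy]; exact h' y hy⟩

theorem sum {ι : Type*} {s : Finset ι} {F : ι → ℂ → ℂ} (h : ∀ r ∈ s, SymbolBound z a (F r)) :
    SymbolBound z a fun y => ∑ r ∈ s, F r y := by
  classical
  induction s using Finset.induction_on with
  | empty =>
    refine ⟨0, 0, le_rfl, fun y _ => ?_⟩
    simp
  | insert r s hr ih =>
    simp only [Finset.sum_insert hr]
    exact (h r (by simp)).add (ih fun r' hr' => h r' (by simp [hr']))

theorem star (hf : SymbolBound z a f) : SymbolBound z a fun y => conj (f y) := by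
  obtain ⟨C, K, hC, h⟩ := hf
  exact ⟨C, K, hC, fun y hy => by rw [RCLike.norm_conj]; exact h y hy⟩

theorem inv_sub (r : Fin n) : SymbolBound z (-1) fun y => (y - z r)⁻¹ := by
  refine ⟨∏ s ∈ Finset.univ.erase r, (1 + ‖z s‖), (n - 1 : ℕ), Finset.prod_nonneg fun _ _ => by positivity,
    fun y hy => ?_⟩
  have h1 : ∏ s ∈ Finset.univ.erase r, ‖y - z s‖ ≤
      (∏ s ∈ Finset.univ.erase r, (1 + ‖z s‖)) * (1 + ‖y‖) ^ (n - 1) := by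
    have hcard : (Finset.univ.erase r).card = n - 1 := by
      rw [Finset.card_erase_of_mem (Finset.mem_univ r), Finset.card_univ, Fintype.card_fin]
    rw [← hcard, ← Finset.prod_const, ← Finset.prod_mul_distrib]
    refine Finset.prod_le_prod (fun _ _ => norm_nonneg _) fun s _ => ?_
    have := norm_sub_le y (z s)
    nlinarith [norm_nonneg y, norm_nonneg (z s)]
  have hP := nodeDist_pos hy
  have h2 : nodeDist z y = ‖y - z r‖ * ∏ s ∈ Finset.univ.erase r, ‖y - z s‖ :=
    (Finset.mul_prod_erase _ (fun s => ‖y - z s‖) (Finset.mem_univ r)).symm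
  have hr : 0 < ‖y - z r‖ := norm_pos_iff.2 (sub_ne_zero.2 fun e => hy ⟨r, e.symm⟩)
  rw [norm_inv, Real.rpow_neg_one, Real.rpow_natCast, mul_left_comm, inv_mul_eq_div, le_div_iff₀ hP, h2,
    ← mul_assoc, inv_mul_cancel₀ hr.ne', one_mul]
  exact h1

/-- Symbols of order above `-2` are integrable against rapidly decreasing functions. -/
theorem integrable_mul_planeWavePairing (hz : Function.Injective z) [NeZero n] (hf : SymbolBound z a f)
    (hm : AEStronglyMeasurable f) (ha : -2 < a) (ha0 : a ≤ 0) (ψ : 𝓢(Fin n → ℂ, ℂ)) (w : Fin n → ℂ)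
    {e : Fin n → ℂ} (he : e ≠ 0) : Integrable fun y => f y * planeWavePairing ψ (w + y • e) := by
  obtain ⟨C, K, hC, h⟩ := hf
  obtain ⟨N, hN⟩ := exists_nat_gt (n * a + K + 2)
  obtain ⟨A, hA, h'⟩ := exists_norm_planeWavePairing_line_le ψ w he N
  refine ((integrable_nodeDist_rpow_mul hz (e := K + -N) ha ha0 (by linarith)).const_mul (C * A)).mono' ?_ ?_
  · exact hm.mul ((continuous_planeWavePairing ψ).comp (by fun_prop)).aestronglyMeasurable
  · filter_upwards [ae_notMem_range z] with y hy
    have hP := nodeDist_pos hy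
    rw [norm_mul, Real.rpow_add (by positivity)]
    calc _ ≤ (C * (nodeDist z y ^ a * (1 + ‖y‖) ^ K)) * (A * (1 + ‖y‖) ^ (-N : ℝ)) :=
          mul_le_mul (h y hy) (h' y) (norm_nonneg _) (by positivity)
      _ = _ := by ring

end SymbolBound

/-- A function of symbol type together with its Wirtinger derivatives. -/
structure IsSymbol (z : Fin n → ℂ) (a : ℝ) (f p q : ℂ → ℂ) : Prop where
  deriv : ∀ y ∉ Set.range z, HasWirtingerAt f (p y) (q y) y
  bound : SymbolBound z a f
  bound_p : SymbolBound z (a - 1) p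
  bound_q : SymbolBound z (a - 1) q

namespace IsSymbol

variable {a b : ℝ} {f p q g p' q' : ℂ → ℂ}

theorem mul (hf : IsSymbol z a f p q) (hg : IsSymbol z b g p' q') :
    IsSymbol z (a + b) (fun y => f y * g y) (fun y => p y * g y + f y * p' y)
      (fun y => q y * g y + f y * q' y) where
  deriv y hy := (hf.deriv y hy).mul (hg.deriv y hy)
  bound := hf.bound.mul hg.bound
  bound_p := ((hf.bound_p.mul hg.bound).mono (by linarith)).add ((hf.bound.mul hg.bound_p).mono (by linarith))
  bound_q := ((hf.bound_q.mul hg.bound).mono (by linarith)).add ((hf.bound.mul hg.bound_q).mono (by linarith))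

theorem add (hf : IsSymbol z a f p q) (hg : IsSymbol z a g p' q') :
    IsSymbol z a (fun y => f y + g y) (fun y => p y + p' y) (fun y => q y + q' y) where
  deriv y hy := (hf.deriv y hy).add (hg.deriv y hy)
  bound := hf.bound.add hg.bound
  bound_p := hf.bound_p.add hg.bound_p
  bound_q := hf.bound_q.add hg.bound_q

theorem mono (hf : IsSymbol z a f p q) (hab : b ≤ a) : IsSymbol z b f p q :=
  ⟨hf.deriv, hf.bound.mono hab, hf.bound_p.mono (by linarith), hf.bound_q.mono (by linarith)⟩

theorem congr_deriv (hf : IsSymbol z a f p q) (hp : ∀ y ∉ Set.range z, p' y = p y)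
    (hq : ∀ y ∉ Set.range z, q' y = q y) : IsSymbol z a f p' q' :=
  ⟨fun y hy => by rw [hp y hy, hq y hy]; exact hf.deriv y hy, hf.bound, hf.bound_p.congr hp,
    hf.bound_q.congr hq⟩

theorem star (hf : IsSymbol z a f p q) :
    IsSymbol z a (fun y => conj (f y)) (fun y => conj (q y)) (fun y => conj (p y)) :=
  ⟨fun y hy => (hf.deriv y hy).star, hf.bound.star, hf.bound_q.star, hf.bound_p.star⟩

theorem const (c : ℂ) : IsSymbol z 0 (fun _ => c) (fun _ => 0) (fun _ => 0) :=
  ⟨fun _ _ => .const c, .const c, (SymbolBound.const 0).mono (by norm_num),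
    (SymbolBound.const 0).mono (by norm_num)⟩

theorem const_mul (c : ℂ) (hf : IsSymbol z a f p q) :
    IsSymbol z a (fun y => c * f y) (fun y => c * p y) (fun y => c * q y) :=
  ⟨fun y hy => (hf.deriv y hy).const_mul c, hf.bound.const_mul c, hf.bound_p.const_mul c,
    hf.bound_q.const_mul c⟩

theorem sum {ι : Type*} {s : Finset ι} {F P Q : ι → ℂ → ℂ} (h : ∀ r ∈ s, IsSymbol z a (F r) (P r) (Q r)) :
    IsSymbol z a (fun y => ∑ r ∈ s, F r y) (fun y => ∑ r ∈ s, P r y) (fun y => ∑ r ∈ s, Q r y) :=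
  ⟨fun y hy => .sum fun r hr => (h r hr).deriv y hy, .sum fun r hr => (h r hr).bound,
    .sum fun r hr => (h r hr).bound_p, .sum fun r hr => (h r hr).bound_q⟩

theorem sub_const (w : ℂ) : IsSymbol z 0 (fun y => y - w) (fun _ => 1) (fun _ => 0) := by
  refine ⟨fun y _ => .of_hasDerivAt ((hasDerivAt_id y).sub_const w), ?_,
    (SymbolBound.const 1).mono (by norm_num), (SymbolBound.const 0).mono (by norm_num)⟩
  refine .of_le (C := 1 + ‖w‖) (K := 1) fun y _ => ?_
  rw [Real.rpow_one]
  have := norm_sub_le y w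
  nlinarith [norm_nonneg y, norm_nonneg w]

theorem exists_prod_sub {ι : Type*} (s : Finset ι) (w : ι → ℂ) :
    ∃ p, IsSymbol z 0 (fun y => ∏ l ∈ s, (y - w l)) p (fun _ => 0) := by
  classical
  induction s using Finset.induction_on with
  | empty => exact ⟨_, by simpa using const 1⟩
  | insert l s hl ih =>
    obtain ⟨p, hp⟩ := ih
    have h := (sub_const (z := z) (w l)).mul hp
    simp only [add_zero, zero_mul, mul_zero] at h
    simp only [Finset.prod_insert hl]
    exact ⟨_, h⟩

theorem inv_sub (r : Fin n) :
    IsSymbol z (-1) (fun y => (y - z r)⁻¹) (fun y => -((y - z r)⁻¹ * (y - z r)⁻¹)) (fun _ => 0) := by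
  refine ⟨fun y hy => ?_, .inv_sub r, (((SymbolBound.inv_sub r).mul (.inv_sub r)).neg).mono (by norm_num),
    (SymbolBound.const 0).mono (by norm_num)⟩
  have h0 : y - z r ≠ 0 := sub_ne_zero.2 fun e => hy ⟨r, e.symm⟩
  refine .of_hasDerivAt ((((hasDerivAt_id y).sub_const (z r)).fun_inv h0).congr_deriv ?_)
  simp only [id]
  field_simp

/-- Products of powers of the distances. -/
theorem prod_of_logDeriv {N : Fin n → ℂ → ℂ} {α β : Fin n → ℂ}
    (h : ∀ r, ∀ y ∉ Set.range z, HasWirtingerAt (N r) (α r * (y - z r)⁻¹ * N r y)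
      (β r * conj (y - z r)⁻¹ * N r y) y)
    (hN : ∀ y ∉ Set.range z, ‖∏ r, N r y‖ = nodeDist z y ^ a) :
    IsSymbol z a (fun y => ∏ r, N r y) (fun y => (∑ r, α r * (y - z r)⁻¹) * ∏ r, N r y)
      (fun y => (∑ r, β r * conj (y - z r)⁻¹) * ∏ r, N r y) := by
  have hb : SymbolBound z a fun y => ∏ r, N r y :=
    ⟨1, 0, zero_le_one, fun y hy => by rw [hN y hy, Real.rpow_zero, mul_one, one_mul]⟩
  refine ⟨fun y hy => ?_, hb, ?_, ?_⟩
  · have key (s : Finset (Fin n)) : HasWirtingerAt (fun y => ∏ r ∈ s, N r y)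
        ((∑ r ∈ s, α r * (y - z r)⁻¹) * ∏ r ∈ s, N r y)
        ((∑ r ∈ s, β r * conj (y - z r)⁻¹) * ∏ r ∈ s, N r y) y := by
      classical
      induction s using Finset.induction_on with
      | empty => simpa using HasWirtingerAt.const 1
      | insert r s hr ih =>
        simp only [Finset.prod_insert hr, Finset.sum_insert hr]
        exact ((h r y hy).mul ih).congr_deriv (by ring) (by ring)
    exact key Finset.univ
  · exact ((SymbolBound.sum fun r _ => (SymbolBound.inv_sub r).const_mul (α r)).mul hb).mono (by linarith)
  · exact ((SymbolBound.sum fun r _ => ((SymbolBound.inv_sub r).star).const_mul (β r)).mul hb).mono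
      (by linarith)

theorem aestronglyMeasurable (hf : IsSymbol z a f p q) :
    AEStronglyMeasurable f ∧ AEStronglyMeasurable p ∧ AEStronglyMeasurable q := by
  have h1 : Measurable fun y => wirtinger f y := by
    have h2 (v : ℂ) : Measurable fun y => fderiv ℝ f y v := measurable_fderiv_apply_const ℝ f v
    have := h2 1
    have := h2 Complex.I
    unfold wirtinger
    fun_prop
  have h1' : Measurable fun y => wirtingerBar f y := by
    have h2 (v : ℂ) : Measurable fun y => fderiv ℝ f y v := measurable_fderiv_apply_const ℝ f v
    have := h2 1
    have := h2 Complex.I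
    unfold wirtingerBar
    fun_prop
  refine ⟨?_, h1.aestronglyMeasurable.congr ?_, h1'.aestronglyMeasurable.congr ?_⟩
  · have hc : ContinuousOn f (Set.range z)ᶜ := fun y hy => (hf.deriv y hy).continuousAt.continuousWithinAt
    have := hc.aestronglyMeasurable (μ := volume) (isOpen_compl_range z).measurableSet
    have hr : (volume : Measure ℂ).restrict (Set.range z)ᶜ = volume :=
      Measure.restrict_eq_self_of_ae_mem (ae_notMem_range z)
    rwa [hr] at this
  · filter_upwards [ae_notMem_range z] with y hy using (hf.deriv y hy).wirtinger_eq
  · filter_upwards [ae_notMem_range z] with y hy using (hf.deriv y hy).wirtingerBar_eq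

/-- Integration by parts for symbols against plane wave pairings along a line. -/
theorem integral_deriv_eq_zero (hz : Function.Injective z) [NeZero n] (hf : IsSymbol z a f p q)
    (ha : -1 < a) (ha0 : a ≤ 0) (ψ : 𝓢(Fin n → ℂ, ℂ)) (w : Fin n → ℂ) {e : Fin n → ℂ} (he : e ≠ 0) :
    Integrable (fun y => p y * planeWavePairing ψ (w + y • e) +
      f y * planeWavePairing (∑ r, e r • coordMul r ψ) (w + y • e)) ∧
    ∫ y, (p y * planeWavePairing ψ (w + y • e) +
      f y * planeWavePairing (∑ r, e r • coordMul r ψ) (w + y • e)) = 0 := by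
  obtain ⟨m1, m2, m3⟩ := hf.aestronglyMeasurable
  have i1 (ψ : 𝓢(Fin n → ℂ, ℂ)) := hf.bound.integrable_mul_planeWavePairing hz m1 (by linarith) ha0 ψ w he
  -- With a > -1 the derivatives have order a - 1 > -2, still locally integrable in the plane.
  have i2 (ψ : 𝓢(Fin n → ℂ, ℂ)) :=
    hf.bound_p.integrable_mul_planeWavePairing hz m2 (by linarith) (by linarith) ψ w he
  have i3 (ψ : 𝓢(Fin n → ℂ, ℂ)) :=
    hf.bound_q.integrable_mul_planeWavePairing hz m3 (by linarith) (by linarith) ψ w he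
  have hint := (i2 ψ).add (i1 (∑ r, e r • coordMul r ψ))
  refine ⟨hint, integral_eq_zero_of_hasWirtingerAt (Set.finite_range z) (fun y hy =>
    ((hf.deriv y hy).mul (hasWirtingerAt_planeWavePairing_line ψ w e y)).congr_deriv ?_ rfl) (i1 ψ) hint
    ((i3 ψ).add (?_ : Integrable fun y => f y * _))⟩
  · congr 2
    rw [← waveLM_apply, map_sum]
    exact Finset.sum_congr rfl fun r _ => by rw [map_smul, waveLM_apply, smul_eq_mul]
  · simp only [Finset.mul_sum]
    refine integrable_finsetSum _ fun r _ => ?_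
    refine ((i1 (conjCoordMul r ψ)).const_mul (conj (e r))).congr (.of_forall fun y => ?_)
    simp only
    ring

end IsSymbol

end SymbolCalculus

section OperIdentity

variable {n : ℕ}

/-! ### Integration by parts in a separated variable -/

variable {m i : ℕ} {z j E : Fin n → ℂ} {χ : ℂ → ℂ}

/-- `J(y) = ∑_r j_r / (y - z_r)`. -/
def spinPotential (z j : Fin n → ℂ) (y : ℂ) : ℂ := ∑ r, j r * (y - z r)⁻¹

/-- `-J'(y) = ∑_r j_r / (y - z_r)²`. -/
def spinPotentialSq (z j : Fin n → ℂ) (y : ℂ) : ℂ := ∑ r, j r * ((y - z r)⁻¹ * (y - z r)⁻¹)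

theorem isSymbol_spinPotential (z j : Fin n → ℂ) :
    IsSymbol z (-1) (spinPotential z j) (fun y => -spinPotentialSq z j y) (fun _ => 0) := by
  have := IsSymbol.sum (s := Finset.univ) fun r _ => (IsSymbol.inv_sub (z := z) r).const_mul (j r)
  exact this.congr_deriv (fun y _ => by simp [spinPotentialSq]) fun y _ => by simp

theorem isSymbol_prod_norm_cpow (hj : ∀ r, (j r).re = -1 / 2) :
    IsSymbol z 1 (fun y => ∏ r, (‖y - z r‖ : ℂ) ^ (-2 * j r))
      (fun y => -spinPotential z j y * ∏ r, (‖y - z r‖ : ℂ) ^ (-2 * j r))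
      (fun y => (∑ r, -j r * conj (y - z r)⁻¹) * ∏ r, (‖y - z r‖ : ℂ) ^ (-2 * j r)) := by
  have hne {r : Fin n} {y : ℂ} (hy : y ∉ Set.range z) : y ≠ z r := fun e => hy ⟨r, e.symm⟩
  have := IsSymbol.prod_of_logDeriv (z := z) (a := 1) (N := fun r y => (‖y - z r‖ : ℂ) ^ (-2 * j r))
    (α := fun r => -j r) (β := fun r => -j r) (fun r y hy =>
      (hasWirtingerAt_norm_cpow _ _ (hne hy)).congr_deriv (by ring) (by rw [map_inv₀]; ring)) ?_
  · exact this.congr_deriv (fun y _ => by simp [spinPotential]) fun y _ => rfl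
  · intro y hy
    rw [norm_prod, Real.rpow_one, nodeDist]
    refine Finset.prod_congr rfl fun r _ => ?_
    rw [norm_ofReal_norm_cpow (sub_ne_zero.2 (hne hy))]
    have : (-2 * j r).re = 1 := by simp [hj]; norm_num
    rw [this, Real.rpow_one]

theorem exists_isSymbol_prod_inv (z : Fin n → ℂ) :
    ∃ p, IsSymbol z (-1) (fun y => ∏ r, (y - z r)⁻¹) p (fun _ => 0) := by
  have := IsSymbol.prod_of_logDeriv (z := z) (a := -1) (N := fun r y => (y - z r)⁻¹)
    (α := fun r => -1) (β := fun r => 0) (fun r y hy => ?_) ?_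
  · exact ⟨_, this.congr_deriv (fun y _ => rfl) fun y _ => by simp⟩
  · have h0 : y - z r ≠ 0 := sub_ne_zero.2 fun e => hy ⟨r, e.symm⟩
    exact ((IsSymbol.inv_sub (z := z) r).deriv y hy).congr_deriv (by ring) (by ring)
  · intro y hy
    rw [norm_prod, nodeDist, Real.rpow_neg_one, ← Finset.prod_inv_distrib]
    exact Finset.prod_congr rfl fun r _ => norm_inv _

theorem symbolBound_operPotential (z j E : Fin n → ℂ) : SymbolBound z (-2) (operPotential z j E) := by
  have h (r : Fin n) := SymbolBound.inv_sub (z := z) r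
  have h1 : SymbolBound z (-2) fun y => ∑ r, (-(j r * (j r + 1)) * ((y - z r)⁻¹ * (y - z r)⁻¹) +
      E r * (y - z r)⁻¹) := SymbolBound.sum fun r _ =>
    ((((h r).mul (h r)).const_mul _).mono (by norm_num)).add (((h r).const_mul _).mono (by norm_num))
  refine h1.congr fun y _ => Finset.sum_congr rfl fun r _ => ?_
  simp only [div_eq_mul_inv, sq, mul_inv]

theorem IsOperSolution.isSymbol (h : IsOperSolution z j E χ) (ho : IsOper z j E)
    (hz : Function.Injective z) (hj : ∀ r, (j r).re = -1 / 2) :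
    IsSymbol z (1 / 2) χ (wirtinger χ) (wirtingerBar χ) ∧
    IsSymbol z (-1 / 2) (wirtinger χ) (fun y => -(operPotential z j E y * χ y))
      (wirtingerBar (wirtinger χ)) := by
  obtain ⟨C, hC, hb⟩ := h.exists_global_bounds ho hz hj
  have b0 : SymbolBound z (1 / 2) χ := ⟨C, _, hC, fun y hy => (hb y hy).1⟩
  have b1 : SymbolBound z (-1 / 2) (wirtinger χ) := ⟨C, _, hC, fun y hy => (hb y hy).2.1⟩
  have b2 : SymbolBound z (-1 / 2) (wirtingerBar χ) := ⟨C, _, hC, fun y hy => (hb y hy).2.2.1⟩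
  have b3 : SymbolBound z (-3 / 2) (wirtingerBar (wirtinger χ)) :=
    ⟨C, _, hC, fun y hy => (hb y hy).2.2.2⟩
  refine ⟨⟨fun y hy => (h.wirtingerSystem hy).d0, b0, b1.mono (by norm_num), b2.mono (by norm_num)⟩,
    ⟨fun y hy => (h.wirtingerSystem hy).d1, b1, ?_, b3.mono (by norm_num)⟩⟩
  exact (((symbolBound_operPotential z j E).mul b0).neg).mono (by norm_num)

/-- The oper equation, integrated against plane wave pairings along a line. -/
theorem IsOperSolution.integral_oper_eq_zero (h : IsOperSolution z j E χ) (ho : IsOper z j E)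
    (hz : Function.Injective z) [NeZero n] (hj : ∀ r, (j r).re = -1 / 2) {ι : Type*} [Fintype ι] (u : ι → ℂ)
    (ψ ψ₁ ψ₂ : 𝓢(Fin n → ℂ, ℂ)) (w : Fin n → ℂ) {e : Fin n → ℂ} (he : e ≠ 0)
    (h₁ : ψ₁ = ∑ r, e r • coordMul r ψ) (h₂ : ψ₂ = ∑ r, e r • coordMul r ψ₁) :
    ∫ y, solutionWeight z j χ y * conj (∏ l, (y - u l)) * ((∏ r, (y - z r)) *
      (planeWavePairing ψ₂ (w + y • e) - 2 * spinPotential z j y * planeWavePairing ψ₁ (w + y • e) +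
        (spinPotential z j y ^ 2 + spinPotentialSq z j y + operPotential z j E y) *
          planeWavePairing ψ (w + y • e))) = 0 := by
  obtain ⟨s0, s1⟩ := h.isSymbol ho hz hj
  obtain ⟨p, hp⟩ := IsSymbol.exists_prod_sub (z := z) Finset.univ u
  obtain ⟨p', hp'⟩ := exists_isSymbol_prod_inv z
  have sJ := isSymbol_spinPotential z j
  set J := spinPotential z j
  set J' := spinPotentialSq z j
  set t := operPotential z j E
  have hG := (isSymbol_prod_norm_cpow (z := z) hj).mul (hp.star.mul hp'.star)
  simp only [map_zero, zero_mul, mul_zero, add_zero] at hG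
  -- Multiplying the weight |y - z_r|^{-2j_r-2} by y - z_r leaves |y - z_r|^{-2j_r}/conj(y - z_r).
  -- Apart from the powers |y - z_r|^{-2j_r}, G is antiholomorphic, so ∂G = -J G with J =
  -- `spinPotential z j`.
  set G : ℂ → ℂ := fun y => (∏ r, (‖y - z r‖ : ℂ) ^ (-2 * j r)) *
    (conj (∏ l, (y - u l)) * conj (∏ r, (y - z r)⁻¹)) with hGdef
  -- With W, W₁, W₂ the pairings of ψ, ψ₁, ψ₂, the integrand is ∂(G χ W₁) - ∂(G (∂χ + J χ) W),
  -- because ∂W = W₁, ∂W₁ = W₂ and ∂²χ = -tχ. The two symbols have orders 1/2, lowered to 0 to fit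
  -- the lemma, and -1/2.
  have hA := (hG.mul s0).mono (b := 0) (by norm_num)
  have hB := (((hG.mul (s1.add ((sJ.mul s0).mono (by norm_num)))).const_mul (-1))).mono
    (b := -1 / 2) (by norm_num)
  obtain ⟨iA, eA⟩ := hA.integral_deriv_eq_zero hz (by norm_num) le_rfl ψ₁ w he
  obtain ⟨iB, eB⟩ := hB.integral_deriv_eq_zero hz (by norm_num) (by norm_num) ψ w he
  rw [← h₂] at iA eA
  rw [← h₁] at iB eB
  have := integral_add iA iB
  rw [eA, eB, add_zero] at this
  rw [← this]
  refine integral_congr_ae ?_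
  filter_upwards [ae_notMem_range z] with y hy
  have hne (r : Fin n) : y - z r ≠ 0 := sub_ne_zero.2 fun e => hy ⟨r, e.symm⟩
  have hw : solutionWeight z j χ y * conj (∏ l, (y - u l)) * (∏ r, (y - z r)) = G y * χ y := by
    have h1 (r : Fin n) : (‖y - z r‖ : ℂ) ^ (-(2 * j r + 2)) * (y - z r) =
        (‖y - z r‖ : ℂ) ^ (-2 * j r) * conj (y - z r)⁻¹ := by
      have h0 : (‖y - z r‖ : ℂ) ≠ 0 := by simpa using hne r
      have h3 : conj (y - z r) ≠ 0 := by rw [Ne, map_eq_zero]; exact hne r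
      have h2 : (‖y - z r‖ : ℂ) ^ (2 : ℂ) = (y - z r) * conj (y - z r) := by
        rw [Complex.mul_conj, Complex.normSq_eq_norm_sq]
        norm_cast
      rw [neg_add, Complex.cpow_add _ _ h0, Complex.cpow_neg _ 2, h2, neg_mul, map_inv₀]
      field_simp [hne r]
    rw [hGdef, solutionWeight]
    simp only
    rw [map_prod conj (fun r => (y - z r)⁻¹), mul_right_comm, mul_assoc (χ y), ← Finset.prod_mul_distrib,
      Finset.prod_congr rfl fun r _ => h1 r, Finset.prod_mul_distrib]
    ring
  rw [← mul_assoc, hw]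
  simp only [hGdef]
  ring

end OperIdentity

/-! ### Algebra of the Hamiltonians: symbols, generating function, interpolation. -/

section Symbols

variable {n : ℕ}

/-! ### The Gaudin Hamiltonians in momentum space -/

variable {m i : ℕ} {z j E : Fin n → ℂ} {χ : ℂ → ℂ}

/-- The symbol of the Casimir operators, for a function with value `a`, first derivatives `b`, and second
derivatives `c`. -/
def casimirSymbol (j k : Fin n → ℂ) (a : ℂ) (b : Fin n → ℂ) (c : Fin n → Fin n → ℂ) (r s : Fin n) : ℂ :=
  -(1 / 2) * k r * k s * (c r r - 2 * c r s + c s s) + (j r * k s - j s * k r) * (b r - b s) + j r * j s * a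

/-- The symbol of `H_s - E_s`. -/
def hamSymbol (z j E k : Fin n → ℂ) (a : ℂ) (b : Fin n → ℂ) (c : Fin n → Fin n → ℂ) (s : Fin n) : ℂ :=
  -2 * ∑ r ∈ Finset.univ.erase s, 1 / (z s - z r) * casimirSymbol j k a b c s r - E s * a

section symbols

variable {k : Fin n → ℂ} {a : ℂ} {b : Fin n → ℂ} {c : Fin n → Fin n → ℂ}

theorem casimirSymbol_comm (hc : ∀ r s, c r s = c s r) (r s : Fin n) :
    casimirSymbol j k a b c r s = casimirSymbol j k a b c s r := by
  rw [casimirSymbol, casimirSymbol, hc r s]; ring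

theorem sum_casimirSymbol (hk : ∑ r, k r = 0) (r : Fin n) :
    ∑ s, casimirSymbol j k a b c r s = k r * ∑ s, k s * c r s - 1 / 2 * k r * ∑ s, k s * c s s -
      j r * ∑ s, k s * b s - k r * b r * ∑ s, j s + k r * ∑ s, j s * b s + j r * a * ∑ s, j s := by
  have h (s : Fin n) : casimirSymbol j k a b c r s =
      (-(1 / 2) * k r * c r r + j r * b r) * k s + k r * (k s * c r s) + (-(1 / 2) * k r) * (k s * c s s) +
        (-j r) * (k s * b s) + (-(k r * b r)) * j s + k r * (j s * b s) + (j r * a) * j s := by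
    rw [casimirSymbol]; ring
  simp only [h, Finset.sum_add_distrib, ← Finset.mul_sum, hk]
  ring

theorem sum_mul_sum_casimirSymbol (hk : ∑ r, k r = 0) (w : Fin n → ℂ) :
    ∑ r, w r * ∑ s, casimirSymbol j k a b c r s =
      ∑ r, w r * k r * ∑ s, k s * c r s - 1 / 2 * (∑ r, w r * k r) * ∑ s, k s * c s s -
      (∑ r, w r * j r) * ∑ s, k s * b s - (∑ r, w r * k r * b r) * ∑ s, j s +
      (∑ r, w r * k r) * ∑ s, j s * b s + (∑ r, w r * j r) * a * ∑ s, j s := by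
  have h (r : Fin n) : w r * ∑ s, casimirSymbol j k a b c r s = w r * k r * ∑ s, k s * c r s +
      (-(1 / 2) * ∑ s, k s * c s s + ∑ s, j s * b s) * (w r * k r) +
      (a * ∑ s, j s - ∑ s, k s * b s) * (w r * j r) - (∑ s, j s) * (w r * k r * b r) := by
    rw [sum_casimirSymbol hk]; ring
  simp only [h, Finset.sum_add_distrib, Finset.sum_sub_distrib, ← Finset.mul_sum]
  ring

/-- Weighted sums of the Hamiltonians, in terms of divided differences of the weight. -/
theorem sum_mul_hamSymbol (hc : ∀ r s, c r s = c s r) (hz : Function.Injective z) {f : Fin n → ℂ}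
    {g : Fin n → Fin n → ℂ} (hg : ∀ r s, f r - f s = (z r - z s) * g r s) :
    ∑ s, f s * hamSymbol z j E k a b c s =
      -∑ r, ∑ s, g r s * casimirSymbol j k a b c r s + (∑ r, g r r * j r ^ 2) * a - ∑ s, f s * E s * a := by
  have h0 (s : Fin n) : ∑ r, (z s - z r)⁻¹ * casimirSymbol j k a b c s r =
      ∑ r ∈ Finset.univ.erase s, 1 / (z s - z r) * casimirSymbol j k a b c s r := by
    rw [← Finset.add_sum_erase _ _ (Finset.mem_univ s)]
    simp
  have h1 : ∑ s, f s * hamSymbol z j E k a b c s =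
      -2 * (∑ s, ∑ r, f s * (z s - z r)⁻¹ * casimirSymbol j k a b c s r) - ∑ s, f s * E s * a := by
    rw [Finset.mul_sum, ← Finset.sum_sub_distrib]
    refine Finset.sum_congr rfl fun s _ => ?_
    simp only [mul_assoc (f s), ← Finset.mul_sum]
    rw [hamSymbol, h0]
    ring
  -- The Casimir symbol is symmetric and 1/(z_s - z_r) antisymmetric, so symmetrization turns the
  -- weight into divided differences. The diagonal terms j_r² a are absent from the Hamiltonians and
  -- reappear as the separate sum of `g r r * j r ^ 2`.
  have h2 : ∑ s, ∑ r, f s * (z s - z r)⁻¹ * casimirSymbol j k a b c s r =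
      -∑ s, ∑ r, f r * (z s - z r)⁻¹ * casimirSymbol j k a b c s r := by
    rw [Finset.sum_comm]
    simp only [← Finset.sum_neg_distrib]
    refine Finset.sum_congr rfl fun s _ => Finset.sum_congr rfl fun r _ => ?_
    rw [casimirSymbol_comm hc, ← neg_sub (z s), inv_neg]
    ring
  have h3 : 2 * ∑ s, ∑ r, f s * (z s - z r)⁻¹ * casimirSymbol j k a b c s r =
      ∑ r, ∑ s, g r s * casimirSymbol j k a b c r s - (∑ r, g r r * j r ^ 2) * a := by
    rw [two_mul]
    nth_rewrite 2 [h2]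
    rw [← sub_eq_add_neg, Finset.sum_mul]
    simp only [← Finset.sum_sub_distrib]
    refine Finset.sum_congr rfl fun s _ => ?_
    rw [← Finset.add_sum_erase _ _ (Finset.mem_univ s),
      ← Finset.add_sum_erase _ (fun r => g s r * _) (Finset.mem_univ s)]
    have h4 : g s s * casimirSymbol j k a b c s s = g s s * j s ^ 2 * a := by
      rw [casimirSymbol]; ring
    rw [h4, sub_self, zero_add, add_sub_cancel_left]
    refine Finset.sum_congr rfl fun r hr => ?_
    have h5 : z s - z r ≠ 0 := sub_ne_zero.2 fun e => Finset.ne_of_mem_erase hr (hz e).symm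
    rw [← sub_mul, ← sub_mul, hg s r, mul_right_comm (z s - z r), mul_inv_cancel₀ h5, one_mul]
  rw [h1]
  linear_combination -h3

theorem sum_hamSymbol (hc : ∀ r s, c r s = c s r) (hz : Function.Injective z) (ho : IsOper z j E) :
    ∑ s, hamSymbol z j E k a b c s = 0 := by
  have := sum_mul_hamSymbol (j := j) (E := E) (k := k) (a := a) (b := b) hc hz (f := fun _ => 1) (g := fun _ _ => 0)
    (by simp)
  simp only [one_mul, zero_mul, Finset.sum_const_zero, neg_zero, zero_add, zero_sub] at this
  rw [this, ← Finset.sum_mul, ho.sum_eq_zero, zero_mul, neg_zero]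

/-- For the weight z the divided differences are 1, so the total Casimir appears; on ∑ k_r = 0 it
depends only on the Euler operator. The oper condition on ∑ z_r E_r cancels the terms j_r² against
the eigenvalues. -/
theorem sum_node_mul_hamSymbol (hc : ∀ r s, c r s = c s r) (hz : Function.Injective z) (ho : IsOper z j E)
    (hk : ∑ r, k r = 0) :
    ∑ s, z s * hamSymbol z j E k a b c s = -(∑ r, k r * ∑ s, k s * c r s -
      2 * (∑ r, j r) * ∑ r, k r * b r + ((∑ r, j r) ^ 2 + ∑ r, j r) * a) := by
  have h := sum_mul_hamSymbol (j := j) (E := E) (k := k) (a := a) (b := b) hc hz (f := z) (g := fun _ _ => 1)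
    (by simp)
  have h2 := sum_mul_sum_casimirSymbol (j := j) (a := a) (b := b) (c := c) hk (fun _ => 1)
  simp only [one_mul, hk] at h h2
  rw [h, h2, ← Finset.sum_mul, ho.sum_mul_eq]
  simp only [mul_add, mul_one, Finset.sum_add_distrib, ← sq]
  ring

/-- The divided differences of z² are z_r + z_s. The last summand is ∑ z_r k_r times the symbol of
D⁻: for i = 0 it yields the equation for D⁻, for i = 1 it is absent. -/
theorem sum_node_sq_mul_hamSymbol (hc : ∀ r s, c r s = c s r) (hz : Function.Injective z) (ho : IsOper z j E)
    (hk : ∑ r, k r = 0) :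
    ∑ s, z s ^ 2 * hamSymbol z j E k a b c s =
      -2 * (∑ r, z r * k r * ∑ s, k s * c r s - (∑ r, z r * j r) * ∑ r, k r * b r -
        (∑ r, j r) * (∑ r, z r * k r * b r) + (∑ r, z r * j r) * (∑ r, j r) * a + (∑ r, z r * j r) * a) +
      (∑ r, z r * k r) * (∑ s, k s * c s s - 2 * ∑ s, j s * b s) := by
  have h := sum_mul_hamSymbol (j := j) (E := E) (k := k) (a := a) (b := b) hc hz (f := fun r => z r ^ 2)
    (g := fun r s => z r + z s) (fun r s => by ring)
  have h2 := sum_mul_sum_casimirSymbol (j := j) (a := a) (b := b) (c := c) hk z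
  have h3 : ∑ r, ∑ s, (z r + z s) * casimirSymbol j k a b c r s =
      2 * ∑ r, z r * ∑ s, casimirSymbol j k a b c r s := by
    simp only [add_mul, Finset.sum_add_distrib, ← Finset.mul_sum]
    rw [two_mul]
    congr 1
    rw [Finset.sum_comm]
    refine Finset.sum_congr rfl fun r _ => ?_
    rw [Finset.mul_sum]
    exact Finset.sum_congr rfl fun s _ => by rw [casimirSymbol_comm hc]
  rw [h, h3, h2, ← Finset.sum_mul, ho.sum_sq_mul_eq]
  have h4 : ∑ r, (z r + z r) * j r ^ 2 = 2 * ∑ r, z r * j r ^ 2 := by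
    rw [Finset.mul_sum]; exact Finset.sum_congr rfl fun r _ => by ring
  have h5 : ∑ r, z r * (j r * (j r + 1)) = ∑ r, z r * j r ^ 2 + ∑ r, z r * j r := by
    rw [← Finset.sum_add_distrib]; exact Finset.sum_congr rfl fun r _ => by ring
  rw [h4, h5]
  ring

/-- The generating function of the Hamiltonians at a separated variable. -/
theorem sum_hamSymbol_div (hc : ∀ r s, c r s = c s r) (hz : Function.Injective z) {v : ℂ}
    (hv : v ∉ Set.range z) {e : Fin n → ℂ} (he : ∑ r, e r = 0) (hk : ∀ r, k r = e r * (v - z r)) :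
    ∑ s, (v - z s)⁻¹ * hamSymbol z j E k a b c s = -(∑ r, e r * ∑ s, e s * c r s -
      2 * spinPotential z j v * ∑ r, e r * b r +
      (spinPotential z j v ^ 2 + spinPotentialSq z j v + operPotential z j E v) * a) := by
  have hne (r : Fin n) : v - z r ≠ 0 := sub_ne_zero.2 fun h => hv ⟨r, h.symm⟩
  have h := sum_mul_hamSymbol (j := j) (E := E) (k := k) (a := a) (b := b) hc hz (f := fun r => (v - z r)⁻¹)
    (g := fun r s => (v - z r)⁻¹ * (v - z s)⁻¹)
    (fun r s => by
      have h1 := hne r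
      have h2 := hne s
      field_simp
      ring)
  -- For k_r = e_r (v - z_r) the factors of the divided difference turn the Casimir into one with
  -- momenta e_r and spins j_r/(v - z_r). As ∑ e_r = 0, the formula for the total Casimir applies
  -- with these data.
  have h1 (r s : Fin n) : (v - z r)⁻¹ * (v - z s)⁻¹ * casimirSymbol j k a b c r s =
      casimirSymbol (fun r => j r * (v - z r)⁻¹) e a b c r s := by
    have h1 := hne r
    have h2 := hne s
    rw [casimirSymbol, casimirSymbol, hk r, hk s]
    field_simp
  have h2 := sum_mul_sum_casimirSymbol (j := fun r => j r * (v - z r)⁻¹) (a := a) (b := b) (c := c) he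
    (fun _ => 1)
  simp only [one_mul, he] at h2
  simp only [h1] at h
  rw [h, h2]
  have h3 : operPotential z j E v = -∑ r, (v - z r)⁻¹ * (v - z r)⁻¹ * j r ^ 2 - spinPotentialSq z j v +
      ∑ r, (v - z r)⁻¹ * E r := by
    rw [operPotential, spinPotentialSq, ← Finset.sum_neg_distrib, ← Finset.sum_sub_distrib,
      ← Finset.sum_add_distrib]
    refine Finset.sum_congr rfl fun r _ => ?_
    have h1 := hne r
    field_simp
    ring
  rw [h3, ← Finset.sum_mul]
  simp only [spinPotential]
  ring

end symbols

/-! ### Transposed operators -/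

/-- The transpose of `∂_{x_r}`. -/
def plusT (r : Fin n) (φ : 𝓢(Fin n → ℂ, ℂ)) : 𝓢(Fin n → ℂ, ℂ) := -coordDeriv r φ

/-- The transpose of `x_r ∂_{x_r} - j_r`. -/
def zeroT (j : Fin n → ℂ) (r : Fin n) (φ : 𝓢(Fin n → ℂ, ℂ)) : 𝓢(Fin n → ℂ, ℂ) :=
  -coordDeriv r (coordMul r φ) - j r • φ

/-- The transpose of `x_r² ∂_{x_r} - 2 j_r x_r`. -/
def minusT (j : Fin n → ℂ) (r : Fin n) (φ : 𝓢(Fin n → ℂ, ℂ)) : 𝓢(Fin n → ℂ, ℂ) :=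
  -coordDeriv r (coordMul r (coordMul r φ)) - (2 * j r) • coordMul r φ

/-- The transpose of the Casimir operator. -/
def casimirT (j : Fin n → ℂ) (r s : Fin n) (φ : 𝓢(Fin n → ℂ, ℂ)) : 𝓢(Fin n → ℂ, ℂ) :=
  zeroT j s (zeroT j r φ) - (1 / 2 : ℂ) • (minusT j s (plusT r φ) + plusT s (minusT j r φ))

/-- The transpose of `H_r - E_r`. -/
def hamT (z j E : Fin n → ℂ) (r : Fin n) (φ : 𝓢(Fin n → ℂ, ℂ)) : 𝓢(Fin n → ℂ, ℂ) :=
  (-2 : ℂ) • ∑ s ∈ Finset.univ.erase r, (1 / (z r - z s)) • casimirT j r s φ - E r • φ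

section pairings

variable (φ : 𝓢(Fin n → ℂ, ℂ)) (k : Fin n → ℂ)

theorem planeWavePairing_neg : planeWavePairing (-φ) k = -planeWavePairing φ k := by
  rw [← waveLM_apply, map_neg, waveLM_apply]

theorem planeWavePairing_sub (φ' : 𝓢(Fin n → ℂ, ℂ)) :
    planeWavePairing (φ - φ') k = planeWavePairing φ k - planeWavePairing φ' k := by
  rw [← waveLM_apply, map_sub, waveLM_apply, waveLM_apply]

theorem planeWavePairing_sum {ι : Type*} (s : Finset ι) (φ : ι → 𝓢(Fin n → ℂ, ℂ)) :
    planeWavePairing (∑ l ∈ s, φ l) k = ∑ l ∈ s, planeWavePairing (φ l) k := by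
  rw [← waveLM_apply, map_sum]; rfl

theorem planeWavePairing_plusT (r : Fin n) : planeWavePairing (plusT r φ) k = k r * planeWavePairing φ k := by
  rw [plusT, planeWavePairing_neg, planeWavePairing_coordDeriv]; ring

theorem planeWavePairing_zeroT (r : Fin n) : planeWavePairing (zeroT j r φ) k =
    k r * planeWavePairing (coordMul r φ) k - j r * planeWavePairing φ k := by
  rw [zeroT, planeWavePairing_sub, planeWavePairing_neg, planeWavePairing_coordDeriv, planeWavePairing_smul]
  ring

theorem planeWavePairing_minusT (r : Fin n) : planeWavePairing (minusT j r φ) k =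
    k r * planeWavePairing (coordMul r (coordMul r φ)) k - 2 * j r * planeWavePairing (coordMul r φ) k := by
  rw [minusT, planeWavePairing_sub, planeWavePairing_neg, planeWavePairing_coordDeriv, planeWavePairing_smul]
  ring

theorem planeWavePairing_casimirT {r s : Fin n} (h : r ≠ s) : planeWavePairing (casimirT j r s φ) k =
    casimirSymbol j k (planeWavePairing φ k) (fun r => planeWavePairing (coordMul r φ) k)
      (fun r s => planeWavePairing (coordMul r (coordMul s φ)) k) r s := by
  have h1 : coordMul s (zeroT j r φ) = zeroT j r (coordMul s φ) := by
    rw [zeroT, zeroT, map_sub, map_neg, map_smul, coordMul_coordDeriv h.symm, coordMul_comm s r]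
  have h2 : coordMul s (plusT r φ) = plusT r (coordMul s φ) := by
    rw [plusT, plusT, map_neg, coordMul_coordDeriv h.symm]
  have h3 : coordMul s (plusT r (coordMul s φ)) = plusT r (coordMul s (coordMul s φ)) := by
    rw [plusT, plusT, map_neg, coordMul_coordDeriv h.symm]
  rw [casimirT, planeWavePairing_sub, planeWavePairing_smul, planeWavePairing_add, planeWavePairing_zeroT,
    planeWavePairing_minusT, planeWavePairing_plusT, h1, h2, h3, planeWavePairing_plusT,
    planeWavePairing_plusT, planeWavePairing_zeroT, planeWavePairing_zeroT, planeWavePairing_minusT,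
    casimirSymbol]
  ring

theorem planeWavePairing_hamT (r : Fin n) : planeWavePairing (hamT z j E r φ) k =
    hamSymbol z j E k (planeWavePairing φ k) (fun r => planeWavePairing (coordMul r φ) k)
      (fun r s => planeWavePairing (coordMul r (coordMul s φ)) k) r := by
  rw [hamT, planeWavePairing_sub, planeWavePairing_smul, planeWavePairing_smul, planeWavePairing_sum,
    hamSymbol]
  congr 2
  refine Finset.sum_congr rfl fun s hs => ?_
  rw [planeWavePairing_smul, planeWavePairing_casimirT _ _ (Finset.ne_of_mem_erase hs).symm]

theorem planeWavePairing_coordMul_comm (r s : Fin n) : planeWavePairing (coordMul r (coordMul s φ)) k =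
    planeWavePairing (coordMul s (coordMul r φ)) k := by rw [coordMul_comm]

variable {k}

theorem sum_planeWavePairing_hamT (hz : Function.Injective z) (ho : IsOper z j E) :
    ∑ s, planeWavePairing (hamT z j E s φ) k = 0 := by
  simp only [planeWavePairing_hamT]
  exact sum_hamSymbol (planeWavePairing_coordMul_comm φ k) hz ho

theorem coordMul_coordDeriv_self (r : Fin n) (φ : 𝓢(Fin n → ℂ, ℂ)) :
    coordMul r (coordDeriv r φ) = coordDeriv r (coordMul r φ) - φ := by
  ext x
  have h1 : HasFDerivAt (coordMul r φ : (Fin n → ℂ) → ℂ)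
      (x r • fderiv ℝ φ x + φ x • (ContinuousLinearMap.proj (R := ℝ) (φ := fun _ : Fin n => ℂ) r)) x := by
    have : (coordMul r φ : (Fin n → ℂ) → ℂ) = fun x => x r * φ x := by
      funext y; simp
    rw [this]
    exact ((ContinuousLinearMap.proj (R := ℝ) (φ := fun _ : Fin n => ℂ) r).hasFDerivAt).mul
      (φ.hasFDerivAt x)
  simp only [coordDeriv_apply, coordMul_apply, sub_apply, h1.fderiv]
  simp
  linear_combination (1 / 2 * φ x) * Complex.I_sq

theorem planeWavePairing_coordMul_coordDeriv (r s : Fin n) :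
    planeWavePairing (coordMul r (coordDeriv s φ)) k =
      -(k s * planeWavePairing (coordMul r φ) k) - if r = s then planeWavePairing φ k else 0 := by
  split_ifs with h
  · subst h
    rw [coordMul_coordDeriv_self, planeWavePairing_sub, planeWavePairing_coordDeriv]
    ring
  · rw [coordMul_coordDeriv h, planeWavePairing_coordDeriv]
    ring

theorem planeWavePairing_coordMul_eulerTranspose (r : Fin n) : planeWavePairing (coordMul r (eulerTranspose φ)) k =
    ∑ s, k s * planeWavePairing (coordMul r (coordMul s φ)) k + planeWavePairing (coordMul r φ) k := by
  rw [eulerTranspose, map_neg, map_sum, planeWavePairing_neg, planeWavePairing_sum]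
  simp only [planeWavePairing_coordMul_coordDeriv, Finset.sum_sub_distrib, Finset.sum_neg_distrib]
  simp
  ring

/-- In terms of the Euler operator and J = ∑ j_r the right side is -(Euler - J)(Euler - J - 1). In
each application one of the two factors matches the exponent of |ρ|. -/
theorem sum_node_planeWavePairing_hamT (hz : Function.Injective z) (ho : IsOper z j E)
    (hk : ∑ r, k r = 0) :
    ∑ s, z s * planeWavePairing (hamT z j E s φ) k =
      -planeWavePairing (eulerTranspose (eulerTranspose φ) - (2 * ∑ r, j r + 1) • eulerTranspose φ +
        ((∑ r, j r) * (∑ r, j r + 1)) • φ) k := by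
  simp only [planeWavePairing_hamT]
  rw [sum_node_mul_hamSymbol (planeWavePairing_coordMul_comm φ k) hz ho hk]
  simp only [planeWavePairing_sub, planeWavePairing_add, planeWavePairing_smul,
    planeWavePairing_eulerTranspose, planeWavePairing_coordMul_eulerTranspose, mul_add, Finset.sum_add_distrib]
  ring

/-- The transpose of `∑_r z_r D_r⁰`. -/
def hatZeroT (z j : Fin n → ℂ) (φ : 𝓢(Fin n → ℂ, ℂ)) : 𝓢(Fin n → ℂ, ℂ) := ∑ r, z r • zeroT j r φ

/-- Up to the D⁻ term, the sum is again an Euler factor, Euler - (1 + J), now applied to the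
transpose of ∑ z_r D_r⁰; the reordering of k_s and x_s produces the shift by 1. -/
theorem sum_node_sq_planeWavePairing_hamT (hz : Function.Injective z) (ho : IsOper z j E)
    (hk : ∑ r, k r = 0) :
    ∑ s, z s ^ 2 * planeWavePairing (hamT z j E s φ) k =
      -2 * planeWavePairing (eulerTranspose (hatZeroT z j φ) - (1 + ∑ r, j r) • hatZeroT z j φ) k +
        (∑ r, z r * k r) * planeWavePairing (∑ r, minusT j r φ) k := by
  simp only [planeWavePairing_hamT]
  rw [sum_node_sq_mul_hamSymbol (planeWavePairing_coordMul_comm φ k) hz ho hk]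
  have h1 (s : Fin n) : planeWavePairing (coordMul s (hatZeroT z j φ)) k =
      ∑ r, z r * k r * planeWavePairing (coordMul r (coordMul s φ)) k +
        z s * planeWavePairing (coordMul s φ) k - (∑ r, z r * j r) * planeWavePairing (coordMul s φ) k := by
    have h2 (r : Fin n) : planeWavePairing (coordMul s (z r • zeroT j r φ)) k =
        z r * k r * planeWavePairing (coordMul r (coordMul s φ)) k +
          (if s = r then z r * planeWavePairing (coordMul r φ) k else 0) -
          z r * j r * planeWavePairing (coordMul s φ) k := by
      rw [zeroT, map_smul, map_sub, map_neg, map_smul, planeWavePairing_smul, planeWavePairing_sub,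
        planeWavePairing_neg, planeWavePairing_coordMul_coordDeriv, planeWavePairing_smul, coordMul_comm s r]
      split_ifs <;> ring
    rw [hatZeroT, map_sum, planeWavePairing_sum]
    simp only [h2, Finset.sum_sub_distrib, Finset.sum_add_distrib, Finset.sum_mul]
    simp
  have h3 : planeWavePairing (hatZeroT z j φ) k =
      ∑ r, z r * k r * planeWavePairing (coordMul r φ) k - (∑ r, z r * j r) * planeWavePairing φ k := by
    rw [hatZeroT, planeWavePairing_sum, Finset.sum_mul, ← Finset.sum_sub_distrib]
    refine Finset.sum_congr rfl fun r _ => ?_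
    rw [planeWavePairing_smul, planeWavePairing_zeroT]
    ring
  have h4 : planeWavePairing (∑ r, minusT j r φ) k =
      ∑ r, k r * planeWavePairing (coordMul r (coordMul r φ)) k -
        2 * ∑ r, j r * planeWavePairing (coordMul r φ) k := by
    rw [planeWavePairing_sum, Finset.mul_sum, ← Finset.sum_sub_distrib]
    refine Finset.sum_congr rfl fun r _ => ?_
    rw [planeWavePairing_minusT]
    ring
  have h5 : ∑ s, k s * ∑ r, z r * k r * planeWavePairing (coordMul r (coordMul s φ)) k =
      ∑ r, z r * k r * ∑ s, k s * planeWavePairing (coordMul r (coordMul s φ)) k := by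
    simp only [Finset.mul_sum]
    rw [Finset.sum_comm]
    exact Finset.sum_congr rfl fun r _ => Finset.sum_congr rfl fun s _ => by ring
  have h6 : ∑ s, k s * (z s * planeWavePairing (coordMul s φ) k) =
      ∑ r, z r * k r * planeWavePairing (coordMul r φ) k :=
    Finset.sum_congr rfl fun r _ => by ring
  have h7 : ∑ s, k s * ((∑ r, z r * j r) * planeWavePairing (coordMul s φ) k) =
      (∑ r, z r * j r) * ∑ r, k r * planeWavePairing (coordMul r φ) k := by
    rw [Finset.mul_sum]; exact Finset.sum_congr rfl fun r _ => by ring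
  rw [planeWavePairing_sub, planeWavePairing_eulerTranspose, planeWavePairing_smul, h3, h4]
  simp only [h1, mul_add, mul_sub, Finset.sum_add_distrib, Finset.sum_sub_distrib]
  simp only [← mul_add, ← mul_sub] at *
  rw [h5, h6, h7]
  ring

end pairings

end Symbols

section Interpolation

variable {n : ℕ}

/-! ### Interpolation at the separated variables -/

variable {m i : ℕ} {z j E : Fin n → ℂ} {χ : ℂ → ℂ}

/-- `∏_r (v - z_r) ∑_s h_s / (v - z_s)`. -/
def nodeSum (z h : Fin n → ℂ) (v : ℂ) : ℂ := ∑ s, h s * ∏ s' ∈ Finset.univ.erase s, (v - z s')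

theorem eval_eq_sum_of_degree_lt {y : Fin m → ℂ} (hy : Function.Injective y) {P : Polynomial ℂ}
    (hP : P.degree < m) (v : ℂ) :
    P.eval v = ∑ l, P.eval (y l) * ∏ l' ∈ Finset.univ.erase l, ((v - y l') / (y l - y l')) := by
  have h := Lagrange.eq_interpolate (s := Finset.univ) (v := y) hy.injOn (f := P) (by simpa using hP)
  conv_lhs => rw [h]
  rw [Lagrange.interpolate_apply, Polynomial.eval_finsetSum]
  refine Finset.sum_congr rfl fun l _ => ?_
  rw [Polynomial.eval_mul, Polynomial.eval_C, Lagrange.basis, Polynomial.eval_prod]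
  congr 1
  refine Finset.prod_congr rfl fun l' _ => ?_
  simp [Lagrange.basisDivisor, div_eq_inv_mul]

theorem exists_monic_nodes (y : Fin m → ℂ) :
    ∃ P : Polynomial ℂ, P.Monic ∧ P.natDegree = m ∧ (∀ v, P.eval v = ∏ l, (v - y l)) ∧
      (1 ≤ m → P.coeff (m - 1) = -∑ l, y l) := by
  have hN : (∏ l : Fin m, (Polynomial.X - Polynomial.C (y l))).natDegree = m := by
    rw [Polynomial.natDegree_prod_of_monic _ _ fun _ _ => Polynomial.monic_X_sub_C _]; simp
  refine ⟨_, Polynomial.monic_prod_of_monic _ _ fun l _ => Polynomial.monic_X_sub_C (y l), hN, fun v => ?_,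
    fun hm => ?_⟩
  · simp [Polynomial.eval_prod]
  · have := Polynomial.prod_X_sub_C_coeff_card_pred (Finset.univ : Finset (Fin m)) y
      (by simpa using Nat.pos_of_ne_zero (by omega))
    simpa using this

/-- The coefficients are those of ∏(v - z_r) ∑_a v^{-a-1} ∑_s z_s^a h_s at infinity; the condition ∑
h_s = 0 removes the degree n - 1. They are read off by the Lagrange formula for the coefficient of
degree n - 1. -/
theorem exists_nodeSum_polynomial (hz : Function.Injective z) {h : Fin n → ℂ} (h0 : ∑ s, h s = 0)
    (hn : 3 ≤ n) :
    ∃ N : Polynomial ℂ, N.natDegree ≤ n - 2 ∧ (∀ v, N.eval v = nodeSum z h v) ∧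
      (∀ r, N.eval (z r) = nodeDen z r * h r) ∧ N.coeff (n - 2) = ∑ s, z s * h s ∧
      N.coeff (n - 3) = ∑ s, z s ^ 2 * h s - (∑ s, z s) * ∑ s, z s * h s := by
  set N : Polynomial ℂ := ∑ s, Polynomial.C (h s) * ∏ s' ∈ Finset.univ.erase s,
    (Polynomial.X - Polynomial.C (z s')) with hN
  have e1 (v : ℂ) : N.eval v = nodeSum z h v := by
    simp [hN, nodeSum, Polynomial.eval_finsetSum, Polynomial.eval_prod]
  have e2 (r : Fin n) : N.eval (z r) = nodeDen z r * h r := by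
    rw [e1, nodeSum, Finset.sum_eq_single r, nodeDen, mul_comm]
    · intro s _ hs
      rw [Finset.prod_eq_zero (Finset.mem_erase.2 ⟨hs.symm, Finset.mem_univ r⟩) (sub_self _), mul_zero]
    · simp
  have hd : N.natDegree ≤ n - 1 := by
    refine Polynomial.natDegree_sum_le_of_forall_le _ _ fun s _ => ?_
    refine (Polynomial.natDegree_C_mul_le _ _).trans ?_
    rw [Polynomial.natDegree_prod_of_monic _ _ fun _ _ => Polynomial.monic_X_sub_C _]
    simp
  have hmom (P : Polynomial ℂ) : ∑ r, P.eval (z r) * N.eval (z r) / nodeDen z r = ∑ r, P.eval (z r) * h r := by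
    refine Finset.sum_congr rfl fun r _ => ?_
    have := nodeDen_ne_zero hz r
    rw [e2]; field_simp
  have lt_of {P : Polynomial ℂ} (hP : P.natDegree ≤ n - 1) : P.degree < n :=
    Polynomial.degree_le_natDegree.trans_lt (by exact_mod_cast (by omega : P.natDegree < n))
  have c1 : N.coeff (n - 1) = 0 := by
    have h1 := sum_eval_div_nodeDen hz (lt_of hd)
    rw [← h1, ← h0]
    simpa using hmom 1
  have hd2 : N.natDegree ≤ n - 2 := by
    refine Polynomial.natDegree_le_iff_coeff_eq_zero.2 fun N' hN' => ?_
    rcases eq_or_ne N' (n - 1) with rfl | hne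
    · exact c1
    · exact Polynomial.coeff_eq_zero_of_natDegree_lt (by omega)
  have c2 : N.coeff (n - 2) = ∑ s, z s * h s := by
    have h1 := sum_eval_div_nodeDen hz (P := Polynomial.X * N)
      (lt_of (Polynomial.natDegree_mul_le.trans (by rw [Polynomial.natDegree_X]; omega)))
    rw [show n - 1 = n - 2 + 1 by omega, Polynomial.coeff_X_mul] at h1
    rw [← h1]
    simpa using hmom Polynomial.X
  refine ⟨N, hd2, e1, e2, c2, ?_⟩
  obtain ⟨P, hPm, hPd, hPe, hPc⟩ := exists_monic_nodes z
  have hX : (Polynomial.X ^ 2 * N).natDegree ≤ n :=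
    Polynomial.natDegree_mul_le.trans (by rw [Polynomial.natDegree_X_pow]; omega)
  -- X²N may have degree n, too large for the Lagrange formula; subtracting a multiple of the node
  -- polynomial lowers the degree without changing the values at the nodes.
  have hX2 : (Polynomial.X ^ 2 * N - Polynomial.C (N.coeff (n - 2)) * P).natDegree ≤ n - 1 := by
    refine Polynomial.natDegree_le_iff_coeff_eq_zero.2 fun N' hN' => ?_
    rcases eq_or_ne N' n with rfl | hne
    · have h1 : P.coeff N' = 1 := by
        have := hPm.coeff_natDegree
        rwa [hPd] at this
      have h2 : (Polynomial.X ^ 2 * N).coeff N' = N.coeff (N' - 2) := by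
        conv_lhs => rw [show N' = N' - 2 + 2 by omega]
        rw [mul_comm, Polynomial.coeff_mul_X_pow]
      rw [Polynomial.coeff_sub, Polynomial.coeff_C_mul, h1, h2, mul_one, sub_self]
    · refine Polynomial.coeff_eq_zero_of_natDegree_lt (lt_of_le_of_lt (Polynomial.natDegree_sub_le _ _)
        (max_lt (lt_of_le_of_lt hX (by omega)) (lt_of_le_of_lt (Polynomial.natDegree_C_mul_le _ _) (by omega))))
  have h1 := sum_eval_div_nodeDen hz (lt_of hX2)
  have hev (r : Fin n) : (Polynomial.X ^ 2 * N - Polynomial.C (N.coeff (n - 2)) * P).eval (z r) =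
      (Polynomial.X ^ 2 : Polynomial ℂ).eval (z r) * N.eval (z r) := by
    have : ∏ l, (z r - z l) = 0 := Finset.prod_eq_zero (Finset.mem_univ r) (sub_self _)
    rw [Polynomial.eval_sub, Polynomial.eval_mul, Polynomial.eval_mul, hPe, this, mul_zero, sub_zero]
  simp only [hev] at h1
  rw [hmom, Polynomial.coeff_sub, Polynomial.coeff_C_mul, hPc (by omega), c2] at h1
  have h2 : (Polynomial.X ^ 2 * N).coeff (n - 1) = N.coeff (n - 3) := by
    rw [show n - 1 = n - 3 + 2 by omega, mul_comm, Polynomial.coeff_mul_X_pow]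
  rw [h2] at h1
  simp only [Polynomial.eval_pow, Polynomial.eval_X] at h1
  rw [h1]
  ring

variable {h : Fin n → ℂ} {y : Fin m → ℂ}

theorem eval_eq_of_degree_sub_lt (hy : Function.Injective y) {N Q P : Polynomial ℂ}
    (hP : ∀ v, P.eval v = ∏ l, (v - y l)) (hd : (N - Q * P).degree < m) (v : ℂ) :
    N.eval v = Q.eval v * ∏ l, (v - y l) +
      ∑ l, N.eval (y l) * ∏ l' ∈ Finset.univ.erase l, ((v - y l') / (y l - y l')) := by
  have h1 := eval_eq_sum_of_degree_lt hy hd v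
  have h2 (l : Fin m) : (N - Q * P).eval (y l) = N.eval (y l) := by
    have : ∏ l', (y l - y l') = 0 := Finset.prod_eq_zero (Finset.mem_univ l) (sub_self _)
    simp [hP, this]
  simp only [h2] at h1
  rw [← h1, Polynomial.eval_sub, Polynomial.eval_mul, hP]
  ring

theorem sum_eval_of_degree_sub_lt (hy : Function.Injective y) {N Q P : Polynomial ℂ}
    (hP : ∀ v, P.eval v = ∏ l, (v - y l)) (hd : (N - Q * P).degree < m) :
    ∑ l, N.eval (y l) * ∏ l' ∈ Finset.univ.erase l, (1 / (y l - y l')) = (N - Q * P).coeff (m - 1) := by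
  rw [← sum_eval_div_nodeDen hy hd]
  refine Finset.sum_congr rfl fun l _ => ?_
  have : ∏ l', (y l - y l') = 0 := Finset.prod_eq_zero (Finset.mem_univ l) (sub_self _)
  simp [hP, this, nodeDen, div_eq_mul_inv]

/-- For i = 0, N has degree at most m; after subtraction of its leading coefficient times ∏(v - y_l)
it is determined by its values at the y_l. Evaluation at z_r gives the Hamiltonians, the coefficient
of v^{m-1} gives ∑ z_s² h_s. -/
theorem nodeDen_mul_eq_of_add_two (hz : Function.Injective z) (hn : n = m + 0 + 2) (hm : 1 ≤ m)
    (h0 : ∑ s, h s = 0) (hy : Function.Injective y) :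
    (∀ r, nodeDen z r * h r = (∑ s, z s * h s) * ∏ l, (z r - y l) +
      ∑ l, nodeSum z h (y l) * ∏ l' ∈ Finset.univ.erase l, ((z r - y l') / (y l - y l'))) ∧
    ∑ s, z s ^ 2 * h s = (∑ s, z s * h s) * (∑ s, z s - ∑ l, y l) +
      ∑ l, nodeSum z h (y l) * ∏ l' ∈ Finset.univ.erase l, (1 / (y l - y l')) := by
  obtain ⟨N, hd, he, hr, hc, hc'⟩ := exists_nodeSum_polynomial hz h0 (by omega)
  obtain ⟨P, hPm, hPd, hPe, hPc⟩ := exists_monic_nodes y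
  rw [show n - 2 = m by omega] at hd hc
  rw [show n - 3 = m - 1 by omega] at hc'
  have h1 : P.coeff m = 1 := by
    have := hPm.coeff_natDegree
    rwa [hPd] at this
  have hlt : (N - Polynomial.C (N.coeff m) * P).degree < m := by
    refine (Polynomial.degree_lt_iff_coeff_zero _ _).2 fun k hk => ?_
    rw [Polynomial.coeff_sub, Polynomial.coeff_C_mul]
    rcases hk.eq_or_lt with rfl | hk
    · rw [h1, mul_one, sub_self]
    · rw [Polynomial.coeff_eq_zero_of_natDegree_lt (hd.trans_lt hk),
        Polynomial.coeff_eq_zero_of_natDegree_lt (hPd.trans_lt hk), mul_zero, sub_zero]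
  refine ⟨fun r => ?_, ?_⟩
  · rw [← hr, eval_eq_of_degree_sub_lt hy hPe hlt]
    simp only [Polynomial.eval_C, he, hc]
  · have := sum_eval_of_degree_sub_lt hy hPe hlt
    simp only [he] at this
    rw [this, Polynomial.coeff_sub, Polynomial.coeff_C_mul, hPc hm, hc', hc]
    ring

/-- For i = 1, N has degree at most m + 1, one more than the number of roots. The quotient of N by
∏(v - y_l) is the linear polynomial N_{m+1}(v + ∑ y_l) + N_m; this is where the unbounded factor ∑
y_l comes from. -/
theorem nodeDen_mul_eq_of_add_three (hz : Function.Injective z) (hn : n = m + 1 + 2)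
    (h0 : ∑ s, h s = 0) (hy : Function.Injective y) (r : Fin n) :
    nodeDen z r * h r =
      ((∑ s, z s * h s) * (z r - ∑ s, z s + ∑ l, y l) + ∑ s, z s ^ 2 * h s) * ∏ l, (z r - y l) +
      ∑ l, nodeSum z h (y l) * ∏ l' ∈ Finset.univ.erase l, ((z r - y l') / (y l - y l')) := by
  obtain ⟨N, hd, he, hr, hc, hc'⟩ := exists_nodeSum_polynomial hz h0 (by omega)
  obtain ⟨P, hPm, hPd, hPe, hPc⟩ := exists_monic_nodes y
  rw [show n - 2 = m + 1 by omega] at hd hc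
  rw [show n - 3 = m by omega] at hc'
  have h1 : P.coeff m = 1 := by
    have := hPm.coeff_natDegree
    rwa [hPd] at this
  set Q : Polynomial ℂ := Polynomial.C (N.coeff (m + 1)) * (Polynomial.X + Polynomial.C (∑ l, y l)) +
    Polynomial.C (N.coeff m) with hQ
  have hQP (k : ℕ) : (Q * P).coeff (k + 1) = N.coeff (m + 1) * (P.coeff k + (∑ l, y l) * P.coeff (k + 1)) +
      N.coeff m * P.coeff (k + 1) := by
    rw [hQ, add_mul, mul_assoc, add_mul Polynomial.X, Polynomial.coeff_add, Polynomial.coeff_C_mul,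
      Polynomial.coeff_C_mul, Polynomial.coeff_add, Polynomial.coeff_X_mul, Polynomial.coeff_C_mul]
  have hP0 {k : ℕ} (hk : m < k) : P.coeff k = 0 := Polynomial.coeff_eq_zero_of_natDegree_lt (hPd.trans_lt hk)
  have hlt : (N - Q * P).degree < m := by
    refine (Polynomial.degree_lt_iff_coeff_zero _ _).2 fun k hk => ?_
    rw [Polynomial.coeff_sub]
    rcases hk.eq_or_lt with rfl | hk
    · rcases Nat.eq_zero_or_pos m with rfl | hm
      · have : P = 1 := by
          rw [Polynomial.eq_C_of_natDegree_eq_zero hPd, h1, map_one]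
        simp [hQ, this]
      · have := hQP (m - 1)
        rw [Nat.sub_add_cancel hm, h1, hPc hm] at this
        rw [this]
        ring
    · obtain ⟨k, rfl⟩ : ∃ k', k = k' + 1 := ⟨k - 1, by omega⟩
      rw [hQP, hP0 hk]
      rcases (Nat.lt_succ_iff.1 hk).eq_or_lt with rfl | hk'
      · rw [h1]; ring
      · rw [hP0 hk', Polynomial.coeff_eq_zero_of_natDegree_lt (by omega : N.natDegree < k + 1)]; ring
  rw [← hr, eval_eq_of_degree_sub_lt hy hPe hlt]
  simp only [he, hQ, hc, hc', Polynomial.eval_add, Polynomial.eval_mul, Polynomial.eval_C, Polynomial.eval_X]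
  ring

end Interpolation

/-! ### Vanishing of the separated Hamiltonians after integration over one variable. -/

section Slices

variable {n : ℕ}

/-! ### The oper equation in one of the separated variables -/

variable {m i : ℕ} {z j E : Fin n → ℂ} {χ : ℂ → ℂ}

theorem prod_erase_eq_prod_succAbove {M : Type*} [CommMonoid M] (l : Fin (m + 1)) (F : Fin (m + 1) → M) :
    ∏ l' ∈ Finset.univ.erase l, F l' = ∏ l', F (l.succAbove l') := by
  rw [Fin.univ_succAbove m l, Finset.erase_cons, Finset.prod_map]
  rfl

theorem discAbs_eq_succAbove (l : Fin (m + 1)) (y : Fin (m + 1) → ℂ) :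
    discAbs y = (∏ l', ‖y l - y (l.succAbove l')‖ ^ 2) * discAbs fun l' => y (l.succAbove l') := by
  rw [discAbs, Fin.prod_univ_succAbove _ l, Fin.prod_univ_succAbove _ l]
  simp only [Fin.prod_univ_succAbove _ l, if_true, one_mul, Fin.succAbove_ne, (Fin.succAbove_ne l _).symm,
    if_false, Fin.succAbove_right_inj]
  rw [Finset.prod_mul_distrib, ← mul_assoc, ← Finset.prod_mul_distrib, discAbs]
  congr 1
  refine Finset.prod_congr rfl fun l' _ => ?_
  rw [norm_sub_rev (y (l.succAbove l')), sq]

/-- The discriminant contains |y_l - y_a|² for every other root, and division by y_l - y_a leaves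
its conjugate. So the interpolation weights times the Jacobian are antiholomorphic in y_l and
commute with the integration by parts in that variable. -/
theorem discAbs_mul_prod_div (l : Fin (m + 1)) (y : Fin (m + 1) → ℂ) (g : ℂ → ℂ) :
    (discAbs y : ℂ) * ∏ l' ∈ Finset.univ.erase l, (g (y l') / (y l - y l')) =
      (∏ l', g (y (l.succAbove l'))) * conj (∏ l', (y l - y (l.succAbove l'))) *
        (discAbs fun l' => y (l.succAbove l') : ℝ) := by
  rw [prod_erase_eq_prod_succAbove, discAbs_eq_succAbove l]
  push_cast
  rw [map_prod, mul_right_comm, ← Finset.prod_mul_distrib, ← Finset.prod_mul_distrib]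
  congr 1
  refine Finset.prod_congr rfl fun l' _ => ?_
  have := Complex.mul_conj' (y l - y (l.succAbove l'))
  rw [← this]
  rcases eq_or_ne (y l - y (l.succAbove l')) 0 with h | h
  · simp [h]
  · field_simp

/-- Since ∑ h_s = 0, these monic products of degree n - 1 enter `nodeSum` only through their
differences, which grow by one power less; without this gain the slice integrals would not be
controlled. -/
theorem exists_norm_prod_erase_sub_le (z : Fin n) (w : Fin n → ℂ) :
    ∃ A, ∀ s v, ‖∏ s' ∈ Finset.univ.erase s, (v - w s') - ∏ s' ∈ Finset.univ.erase z, (v - w s')‖ ≤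
      A * (1 + ‖v‖) ^ (n - 2) := by
  refine ⟨∑ s, ‖w s - w z‖ * ∏ s' ∈ (Finset.univ.erase s).erase z, (1 + ‖w s'‖), fun s v => ?_⟩
  rcases eq_or_ne s z with rfl | hsz
  · rw [sub_self, norm_zero]
    positivity
  have h1 : ∏ s' ∈ Finset.univ.erase s, (v - w s') - ∏ s' ∈ Finset.univ.erase z, (v - w s') =
      (w s - w z) * ∏ s' ∈ (Finset.univ.erase s).erase z, (v - w s') := by
    rw [← Finset.mul_prod_erase _ _ (Finset.mem_erase.2 ⟨hsz.symm, Finset.mem_univ z⟩),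
      ← Finset.mul_prod_erase (Finset.univ.erase z) _ (Finset.mem_erase.2 ⟨hsz, Finset.mem_univ s⟩),
      Finset.erase_right_comm]
    ring
  have hcard : ((Finset.univ.erase s).erase z).card = n - 2 := by
    rw [Finset.card_erase_of_mem (Finset.mem_erase.2 ⟨hsz.symm, Finset.mem_univ z⟩),
      Finset.card_erase_of_mem (Finset.mem_univ s), Finset.card_univ, Fintype.card_fin, Nat.sub_sub]
  have h2 : ∏ s' ∈ (Finset.univ.erase s).erase z, ‖v - w s'‖ ≤
      (∏ s' ∈ (Finset.univ.erase s).erase z, (1 + ‖w s'‖)) * (1 + ‖v‖) ^ (n - 2) := by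
    rw [← hcard, ← Finset.prod_const, ← Finset.prod_mul_distrib]
    refine Finset.prod_le_prod (fun _ _ => norm_nonneg _) fun s' _ => ?_
    have := norm_sub_le v (w s')
    nlinarith [norm_nonneg v, norm_nonneg (w s')]
  rw [h1, norm_mul, norm_prod]
  calc _ ≤ ‖w s - w z‖ * ((∏ s' ∈ (Finset.univ.erase s).erase z, (1 + ‖w s'‖)) * (1 + ‖v‖) ^ (n - 2)) := by
        gcongr
    _ = (‖w s - w z‖ * ∏ s' ∈ (Finset.univ.erase s).erase z, (1 + ‖w s'‖)) * (1 + ‖v‖) ^ (n - 2) := by ring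
    _ ≤ _ := by
        gcongr
        exact Finset.single_le_sum
          (f := fun s => ‖w s - w z‖ * ∏ s' ∈ (Finset.univ.erase s).erase z, (1 + ‖w s'‖))
          (fun _ _ => by positivity) (Finset.mem_univ s)

/-- The growth exponents in a separated variable and in the remaining ones. -/
def sliceExponent (n m : ℕ) (l l' : Fin (m + 1)) : ℝ := if l' = l then m + n - 2 else 2 * m

theorem exists_discAbs_mul_slice_le (hn2 : 2 ≤ n) (l : Fin (m + 1)) {g : ℂ → ℂ} {A : ℝ}
    (hg : ∀ y, ‖g y‖ ≤ A * (1 + ‖y‖)) {p : ℂ → ℂ} {B : ℝ} (hp : ∀ v, ‖p v‖ ≤ B * (1 + ‖v‖) ^ (n - 2)) :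
    ∃ C, ∀ y : Fin (m + 1) → ℂ,
      discAbs y * ‖(∏ l' ∈ Finset.univ.erase l, (g (y l') / (y l - y l'))) * p (y l)‖ ≤
        C * ∏ l', (1 + ‖y l'‖) ^ sliceExponent n m l l' := by
  have hA : 0 ≤ A := by simpa using (norm_nonneg _).trans (hg 0)
  refine ⟨A ^ m * B, fun y => ?_⟩
  have h0 := discAbs_nonneg fun l' => y (l.succAbove l')
  have h1 := congrArg norm (discAbs_mul_prod_div l y g)
  rw [norm_mul, norm_mul, norm_mul, Complex.norm_real, Complex.norm_real, RCLike.norm_conj,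
    Real.norm_of_nonneg (discAbs_nonneg _), Real.norm_of_nonneg h0] at h1
  rw [norm_mul, ← mul_assoc, h1, Fin.prod_univ_succAbove _ l]
  simp only [sliceExponent, if_true, Fin.succAbove_ne, if_false]
  have h2 : ‖∏ l', g (y (l.succAbove l'))‖ ≤ A ^ m * ∏ l', (1 + ‖y (l.succAbove l')‖) := by
    have : A ^ m = ∏ _l' : Fin m, A := by simp
    rw [norm_prod, this, ← Finset.prod_mul_distrib]
    exact Finset.prod_le_prod (fun _ _ => norm_nonneg _) fun _ _ => hg _
  have h3 : ‖∏ l', (y l - y (l.succAbove l'))‖ ≤ (1 + ‖y l‖) ^ m * ∏ l', (1 + ‖y (l.succAbove l')‖) := by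
    have : (1 + ‖y l‖) ^ m = ∏ _l' : Fin m, (1 + ‖y l‖) := by simp
    rw [norm_prod, this, ← Finset.prod_mul_distrib]
    refine Finset.prod_le_prod (fun _ _ => norm_nonneg _) fun l' _ => ?_
    have := norm_sub_le (y l) (y (l.succAbove l'))
    nlinarith [norm_nonneg (y l), norm_nonneg (y (l.succAbove l'))]
  have h4 := discAbs_le fun l' => y (l.succAbove l')
  have h5 : (∏ l', (1 + ‖y (l.succAbove l')‖)) * (∏ l', (1 + ‖y (l.succAbove l')‖)) *
      ∏ l', (1 + ‖y (l.succAbove l')‖) ^ (2 * (m - 1) : ℝ) =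
      ∏ l', (1 + ‖y (l.succAbove l')‖) ^ (2 * m : ℝ) := by
    rw [← Finset.prod_mul_distrib, ← Finset.prod_mul_distrib]
    refine Finset.prod_congr rfl fun l' _ => ?_
    rw [← sq, ← Real.rpow_natCast, ← Real.rpow_add (by positivity)]
    congr 1
    push_cast; ring
  have h6 : (1 + ‖y l‖) ^ m * (1 + ‖y l‖) ^ (n - 2) = (1 + ‖y l‖) ^ (m + n - 2 : ℝ) := by
    rw [← pow_add, ← Real.rpow_natCast]
    congr 1
    push_cast [hn2]; ring
  have hp0 : 0 ≤ ∏ l', (1 + ‖y (l.succAbove l')‖) := Finset.prod_nonneg fun _ _ => by positivity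
  calc _ ≤ (A ^ m * ∏ l', (1 + ‖y (l.succAbove l')‖)) * ((1 + ‖y l‖) ^ m * ∏ l', (1 + ‖y (l.succAbove l')‖)) *
        (∏ l', (1 + ‖y (l.succAbove l')‖) ^ (2 * (m - 1) : ℝ)) * (B * (1 + ‖y l‖) ^ (n - 2)) := by
        refine mul_le_mul (mul_le_mul (mul_le_mul h2 h3 (norm_nonneg _) (by positivity)) h4 h0
          (by positivity)) (hp _) (norm_nonneg _) ?_
        exact mul_nonneg (by positivity) (Finset.prod_nonneg fun _ _ => by positivity)
    _ = A ^ m * B * (((1 + ‖y l‖) ^ m * (1 + ‖y l‖) ^ (n - 2)) *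
        ((∏ l', (1 + ‖y (l.succAbove l')‖)) * (∏ l', (1 + ‖y (l.succAbove l')‖)) *
      ∏ l', (1 + ‖y (l.succAbove l')‖) ^ (2 * (m - 1) : ℝ))) := by ring
    _ = _ := by rw [h5, h6]

theorem sepPoint_succAbove (ρ : ℂ) (l : Fin (m + 1)) (y : Fin (m + 1) → ℂ) (r : Fin n) :
    sepPoint z ρ y r = -sepPoint z ρ (fun l' => y (l.succAbove l')) r * (y l - z r) := by
  rw [sepPoint, sepPoint, Fin.prod_univ_succAbove _ l]
  ring

theorem nodeSum_eq (h : Fin n → ℂ) {v : ℂ} (hv : v ∉ Set.range z) :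
    nodeSum z h v = (∏ r, (v - z r)) * ∑ s, (v - z s)⁻¹ * h s := by
  rw [nodeSum, Finset.mul_sum]
  refine Finset.sum_congr rfl fun s _ => ?_
  have : v - z s ≠ 0 := sub_ne_zero.2 fun e => hv ⟨s, e.symm⟩
  rw [← Finset.mul_prod_erase _ _ (Finset.mem_univ s)]
  field_simp

/-- With ρ and the other roots fixed, k_r = e_r (v - z_r) with e = -`sepPoint z ρ y`, a complex line
in v. The vector e belongs to a polynomial with one root fewer, so ∑ e_r = 0, and
`sum_hamSymbol_div` turns the integrand into the one of `integral_oper_eq_zero`. -/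
theorem IsOperSolution.integral_nodeSum_line (h : IsOperSolution z j E χ) (ho : IsOper z j E)
    (hz : Function.Injective z) (hj : ∀ r, (j r).re = -1 / 2) (hn : m + 1 < n)
    (φ : 𝓢(Fin n → ℂ, ℂ)) {ρ : ℂ} (hρ : ρ ≠ 0) (l : Fin (m + 1)) (y : Fin m → ℂ) :
    ∫ v, solutionWeight z j χ v * conj (∏ l', (v - y l')) *
      nodeSum z (fun s => planeWavePairing (hamT z j E s φ) (sepPoint z ρ (l.insertNth v y))) v = 0 := by
  have : NeZero n := ⟨by omega⟩
  set e : Fin n → ℂ := -sepPoint z ρ y with he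
  have he0 : e ≠ 0 := by
    rw [he, neg_ne_zero, sepPoint_eq_smul]
    exact smul_ne_zero hρ (sepPoint_one_ne_zero hz (by omega) y)
  have hes : ∑ r, e r = 0 := by
    have := sum_pow_mul_sepPoint hz ρ y 0 (by omega)
    rw [if_neg (by omega)] at this
    simpa [he] using this
  have h1 := h.integral_oper_eq_zero ho hz hj y φ _ _ (fun r => -(e r * z r)) he0 rfl rfl
  rw [← neg_eq_zero, ← integral_neg, ← h1]
  refine integral_congr_ae ?_
  filter_upwards [ae_notMem_range z] with v hv
  have hk : sepPoint z ρ (l.insertNth v y) = (fun r => -(e r * z r)) + v • e := by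
    ext r
    rw [sepPoint_succAbove ρ l]
    simp [he]
    ring
  have hk' (r : Fin n) : sepPoint z ρ (l.insertNth v y) r = e r * (v - z r) := by
    rw [hk]; simp; ring
  rw [nodeSum_eq _ hv]
  simp only [planeWavePairing_hamT]
  rw [sum_hamSymbol_div (planeWavePairing_coordMul_comm φ _) hz hv hes hk', hk]
  have h2 (ψ : 𝓢(Fin n → ℂ, ℂ)) (k : Fin n → ℂ) : planeWavePairing (∑ r, e r • coordMul r ψ) k =
      ∑ r, e r * planeWavePairing (coordMul r ψ) k := by
    rw [planeWavePairing_sum]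
    exact Finset.sum_congr rfl fun r _ => planeWavePairing_smul _ _ _
  have h3 (r : Fin n) (k : Fin n → ℂ) : planeWavePairing (coordMul r (∑ s, e s • coordMul s φ)) k =
      ∑ s, e s * planeWavePairing (coordMul r (coordMul s φ)) k := by
    rw [map_sum, planeWavePairing_sum]
    exact Finset.sum_congr rfl fun s _ => by rw [map_smul, planeWavePairing_smul]
  rw [h2, h2]
  simp only [h3]
  ring

theorem nodeSum_eq_sum_sub {h : Fin n → ℂ} (h0 : ∑ s, h s = 0) (s₀ : Fin n) (v : ℂ) :
    nodeSum z h v = ∑ s, h s * (∏ s' ∈ Finset.univ.erase s, (v - z s') -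
      ∏ s' ∈ Finset.univ.erase s₀, (v - z s')) := by
  simp only [mul_sub, Finset.sum_sub_distrib, ← Finset.sum_mul, h0, zero_mul, sub_zero]
  rfl

/-- At the unregularized exponent, Re s = m + 1 - i, the condition m < Re s - b reads i + b < 1. In
the borderline cases i + b = 1 it holds only after |ρ|^η has been inserted. -/
theorem IsOperSolution.integral_sepDensity_slice (h : IsOperSolution z j E χ) (ho : IsOper z j E)
    (hz : Function.Injective z) (hj : ∀ r, (j r).re = -1 / 2) (hn : n = m + 1 + i + 2)
    (φ : 𝓢(Fin n → ℂ, ℂ)) (l : Fin (m + 1)) {g : ℂ → ℂ} (hgm : Measurable g) {A : ℝ}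
    (hg : ∀ y, ‖g y‖ ≤ A * (1 + ‖y‖)) {s : ℂ} {b : ℕ} (hs : (m : ℝ) < s.re - b) :
    Integrable (fun x : ℂ × (Fin (m + 1) → ℂ) => sepDensity z j χ s x * (x.1⁻¹ ^ b *
      ∏ l' ∈ Finset.univ.erase l, (g (x.2 l') / (x.2 l - x.2 l'))) *
      nodeSum z (fun s => planeWavePairing (hamT z j E s φ) (sepPoint z x.1 x.2)) (x.2 l)) ∧
    ∫ x : ℂ × (Fin (m + 1) → ℂ), sepDensity z j χ s x * (x.1⁻¹ ^ b *
      ∏ l' ∈ Finset.univ.erase l, (g (x.2 l') / (x.2 l - x.2 l'))) *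
      nodeSum z (fun s => planeWavePairing (hamT z j E s φ) (sepPoint z x.1 x.2)) (x.2 l) = 0 := by
  have hm0 : (0 : ℝ) ≤ m := m.cast_nonneg
  have hnr : (n : ℝ) = m + 1 + i + 2 := by exact_mod_cast hn
  have hi0 : (0 : ℝ) ≤ i := i.cast_nonneg
  have hint : Integrable (fun x : ℂ × (Fin (m + 1) → ℂ) => sepDensity z j χ s x * (x.1⁻¹ ^ b *
      ∏ l' ∈ Finset.univ.erase l, (g (x.2 l') / (x.2 l - x.2 l'))) *
      nodeSum z (fun s => planeWavePairing (hamT z j E s φ) (sepPoint z x.1 x.2)) (x.2 l)) := by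
    set s₀ : Fin n := ⟨0, by omega⟩
    obtain ⟨B, hB⟩ := exists_norm_prod_erase_sub_le s₀ z
    choose C hC using fun r => exists_discAbs_mul_slice_le (n := n) (by omega) l hg (hB r)
    have h1 (r : Fin n) := by
      refine h.integrable_sepDensity_mul ho hz hj (by omega) ?_ (hC r) (s := s) (b := b) (by linarith)
        (fun l' => ?_) (hamT z j E r φ)
      · fun_prop
      · rw [sliceExponent]
        split_ifs
        · linarith
        · rw [hnr]; linarith
    refine (integrable_finsetSum Finset.univ fun r _ => h1 r).congr (.of_forall fun x => ?_)
    simp only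
    rw [nodeSum_eq_sum_sub (sum_planeWavePairing_hamT φ hz ho) s₀, Finset.mul_sum]
    exact Finset.sum_congr rfl fun r _ => by ring
  refine ⟨hint, ?_⟩
  rw [Measure.volume_eq_prod] at *
  rw [integral_prod _ hint]
  -- By Fubini the integral over the variable y_l is taken innermost; the remaining factors are
  -- constant or antiholomorphic in it.
  refine integral_eq_zero_of_ae ?_
  have hv := (volume_preserving_piFinSuccAbove (fun _ : Fin (m + 1) => ℂ) l).symm
  filter_upwards [hint.prod_right_ae, Measure.ae_ne volume (0 : ℂ)] with ρ h1 hρ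
  rw [← hv.integral_comp (MeasurableEquiv.measurableEmbedding _)]
  have h2 := (hv.integrable_comp_emb (MeasurableEquiv.measurableEmbedding _)).2 h1
  rw [Measure.volume_eq_prod] at *
  refine (integral_prod_symm _ h2).trans ?_
  refine integral_eq_zero_of_ae (.of_forall fun y => ?_)
  have h3 := h.integral_nodeSum_line ho hz hj (by omega) φ hρ l y
  have h4 (v : ℂ) : (MeasurableEquiv.piFinSuccAbove (fun _ : Fin (m + 1) => ℂ) l).symm (v, y) =
      l.insertNth v y := rfl
  simp only [h4, Pi.zero_apply, Function.comp_def]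
  rw [← mul_zero ((‖ρ‖ : ℂ) ^ s * ρ⁻¹ ^ b * (∏ l', solutionWeight z j χ (y l')) * (∏ l', g (y l')) *
    (discAbs y : ℂ)), ← h3, ← integral_const_mul]
  refine integral_congr_ae (.of_forall fun v => ?_)
  have h5 := discAbs_mul_prod_div l (l.insertNth v y) g
  simp only [Fin.insertNth_apply_same, Fin.insertNth_apply_succAbove] at h5
  simp only [sepDensity, Fin.insertNth_apply_same]
  rw [Fin.prod_univ_succAbove _ l]
  simp only [Fin.insertNth_apply_same, Fin.insertNth_apply_succAbove]
  linear_combination ((‖ρ‖ : ℂ) ^ s * ρ⁻¹ ^ b * (∏ l', solutionWeight z j χ (y l')) *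
    solutionWeight z j χ v *
    nodeSum z (fun s => planeWavePairing (hamT z j E s φ) (sepPoint z ρ (l.insertNth v y))) v) * h5

end Slices

/-! ### Borderline integrals and their cancellation under rotation. -/

section Asymptotics

variable {n : ℕ}

/-! ### Logarithmically divergent integrals -/

variable {m i : ℕ} {z j E : Fin n → ℂ} {χ : ℂ → ℂ}

theorem map_scale_fst {F : Type*} [MeasureSpace F] [SFinite (volume : Measure F)] {c : ℝ} (hc : 0 < c) :
    Measure.map (Prod.map (fun ρ : ℂ => c⁻¹ • ρ) id) (volume : Measure (ℂ × F)) =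
      ENNReal.ofReal (c ^ 2) • volume := by
  rw [Measure.volume_eq_prod, ← Measure.map_prod_map _ _ (by fun_prop) measurable_id,
    Measure.map_addHaar_smul _ (inv_ne_zero hc.ne'), Measure.map_id, Measure.prod_smul_left]
  congr 2
  rw [Complex.finrank_real_complex, abs_of_nonneg (by positivity), inv_pow, inv_inv]

theorem measurableEmbedding_scale_fst {F : Type*} [MeasureSpace F] {c : ℝ} (hc : 0 < c) :
    MeasurableEmbedding (Prod.map (fun ρ : ℂ => c⁻¹ • ρ) (id : F → F)) :=
  (Homeomorph.smulOfNeZero c⁻¹ (inv_ne_zero hc.ne')).measurableEmbedding.prodMap MeasurableEmbedding.id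

theorem integral_scale_fst {F : Type*} [MeasureSpace F] [SFinite (volume : Measure F)] {c : ℝ} (hc : 0 < c)
    (f : ℂ × F → ℝ) : ∫ x : ℂ × F, f (c⁻¹ • x.1, x.2) = c ^ 2 * ∫ x, f x := by
  have h := (measurableEmbedding_scale_fst (F := F) hc).integral_map (μ := volume) f
  rw [map_scale_fst hc, integral_smul_measure, ENNReal.toReal_ofReal (by positivity)] at h
  rw [← smul_eq_mul, h]
  rfl

/-- The model of a regularized logarithmic divergence: the integral has at most a simple pole in η,
with an explicit bound. -/
theorem integral_one_add_norm_rpow_le {η : ℝ} (hη : 0 < η) :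
    Integrable (fun v : ℂ => (1 + ‖v‖) ^ (-2 - η)) ∧
    η * ∫ v : ℂ, (1 + ‖v‖) ^ (-2 - η) ≤ 2 * Real.pi := by
  have hint : Integrable (fun v : ℂ => (1 + ‖v‖) ^ (-2 - η)) := by
    have := integrable_norm_rpow_mul (a := 0) (e := -2 - η) (by norm_num) (by linarith)
    simpa using this
  refine ⟨hint, ?_⟩
  have h1 (r : ℝ) (hr : r ∈ Set.Ioi (0 : ℝ)) :
      HasDerivAt (fun r : ℝ => -(1 + r) ^ (-η)) (η * (1 + r) ^ (-1 - η)) r := by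
    have h0 : 0 < 1 + r := by have : 0 < r := hr; linarith
    have := ((hasDerivAt_id r).const_add 1).rpow_const (p := -η) (Or.inl h0.ne')
    exact this.neg.congr_deriv (by simp only [id]; ring_nf)
  have hcont : ContinuousWithinAt (fun r : ℝ => -(1 + r) ^ (-η)) (Set.Ici 0) 0 := by
    refine ContinuousAt.continuousWithinAt ?_
    refine ((continuousAt_const.add continuousAt_id).rpow_const (Or.inl ?_)).neg
    simp
  have hlim : Tendsto (fun r : ℝ => -(1 + r) ^ (-η)) atTop (𝓝 0) := by
    have := (tendsto_rpow_neg_atTop hη).comp (tendsto_atTop_add_const_left atTop (1 : ℝ) tendsto_id)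
    simpa using this.neg
  have hpos (r : ℝ) (hr : r ∈ Set.Ioi (0 : ℝ)) : 0 ≤ η * (1 + r) ^ (-1 - η) := by
    have : 0 < r := hr
    positivity
  have h2 := integral_Ioi_of_hasDerivAt_of_nonneg hcont h1 hpos hlim
  have h3 := integrableOn_Ioi_deriv_of_nonneg hcont h1 hpos hlim
  rw [integral_fun_norm_addHaar (volume : Measure ℂ) (fun r : ℝ => (1 + r) ^ (-2 - η))]
  have hb : (volume : Measure ℂ).real (Metric.ball 0 1) = Real.pi := by
    rw [Measure.real, Complex.volume_ball]; simp
  rw [hb]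
  simp only [Complex.finrank_real_complex, Nat.add_one_sub_one, pow_one, smul_eq_mul, nsmul_eq_mul]
  have h4 : ∫ r in Set.Ioi (0 : ℝ), η * (r * (1 + r) ^ (-2 - η)) ≤
      ∫ r in Set.Ioi (0 : ℝ), η * (1 + r) ^ (-1 - η) := by
    refine integral_mono_of_nonneg ?_ h3 ?_
    · filter_upwards [self_mem_ae_restrict measurableSet_Ioi] with r hr
      have : 0 < r := hr
      simp only [Pi.zero_apply]
      positivity
    · filter_upwards [self_mem_ae_restrict measurableSet_Ioi] with r hr
      have : 0 < r := hr
      have h5 : (1 + r) ^ (-1 - η) = (1 + r) * (1 + r) ^ (-2 - η) := by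
        rw [← Real.rpow_one_add' (by positivity) (by linarith)]
        ring_nf
      rw [h5]
      gcongr
      linarith
  rw [h2, integral_const_mul] at h4
  have : (2 : ℝ) * (Real.pi * (η * ∫ r in Set.Ioi (0 : ℝ), r * (1 + r) ^ (-2 - η))) ≤ 2 * (Real.pi * (0 - -(1 + 0) ^ (-η))) := by
    gcongr
  simp at this ⊢
  linarith

/-- A borderline integral, regularized by a power, has no pole if its integrand decays faster than expected. -/
theorem tendsto_mul_integral_of_le {S : ℝ → ℂ → ℝ} {T : ℂ → ℝ} (hS0 : ∀ η v, 0 ≤ S η v)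
    (hS : ∀ η, 0 < η → η ≤ 1 → ∀ᵐ v, S η v ≤ (1 + ‖v‖) ^ (-η) * T v)
    (hloc : ∀ R, ∃ g : ℂ → ℝ, Integrable g ∧ (∀ v, 0 ≤ g v) ∧ ∀ᵐ v, ‖v‖ ≤ R → T v ≤ g v)
    (hT : Tendsto (fun v => (1 + ‖v‖) ^ 2 * T v) (Bornology.cobounded ℂ) (𝓝 0)) :
    Tendsto (fun η => η * ∫ v, S η v) (𝓝[>] 0) (𝓝 0) := by
  refine tendsto_order.2 ⟨fun a ha => ?_, fun a ha => ?_⟩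
  · filter_upwards [self_mem_nhdsWithin] with η hη
    exact ha.trans_le (mul_nonneg (le_of_lt hη) (integral_nonneg (hS0 η)))
  set ε := a / (2 * Real.pi + 1)
  have hε : 0 < ε := by positivity
  -- Beyond the radius R the integrand is at most ε times the model, which contributes at most 2π ε;
  -- the part inside has a fixed integrable bound and is killed by the factor η. The choice of ε
  -- makes the two parts add up to less than a.
  obtain ⟨R, hR⟩ : ∃ R, ∀ v : ℂ, R < ‖v‖ → (1 + ‖v‖) ^ 2 * T v < ε := by
    have := (hT.eventually (gt_mem_nhds hε))
    rw [← comap_norm_atTop, eventually_comap] at this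
    obtain ⟨R, hR⟩ := eventually_atTop.1 this
    exact ⟨R, fun v hv => hR _ hv.le v rfl⟩
  obtain ⟨g, hg, hg0, hgT⟩ := hloc R
  have hlim : Tendsto (fun η : ℝ => η * ∫ v, g v) (𝓝[>] 0) (𝓝 (0 * ∫ v, g v)) :=
    (tendsto_id.mono_left nhdsWithin_le_nhds).mul_const _
  rw [zero_mul] at hlim
  filter_upwards [self_mem_nhdsWithin, hlim.eventually (gt_mem_nhds hε),
    nhdsWithin_le_nhds (ge_mem_nhds zero_lt_one)] with η hη hη2 hη1
  have hη0 : 0 < η := hη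
  obtain ⟨hi, hle⟩ := integral_one_add_norm_rpow_le hη0
  have h1 : ∫ v, S η v ≤ ∫ v : ℂ, g v + ε * (1 + ‖v‖) ^ (-2 - η) := by
    refine integral_mono_of_nonneg (.of_forall (hS0 η)) (hg.add (hi.const_mul ε)) ?_
    filter_upwards [hS η hη0 hη1, hgT] with v hv1 hv2
    refine hv1.trans ?_
    rcases le_or_gt ‖v‖ R with hv | hv
    · have h2 : (1 + ‖v‖) ^ (-η) ≤ 1 := Real.rpow_le_one_of_one_le_of_nonpos (by simp) (by linarith)
      have h3 : 0 ≤ ε * (1 + ‖v‖) ^ (-2 - η) := by positivity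
      have h4 : (1 + ‖v‖) ^ (-η) * T v ≤ (1 + ‖v‖) ^ (-η) * g v :=
        mul_le_mul_of_nonneg_left (hv2 hv) (by positivity)
      nlinarith [hg0 v]
    · have h2 := hR v hv
      have h3 : T v ≤ ε * (1 + ‖v‖) ^ (-2 : ℝ) := by
        rw [Real.rpow_neg (by positivity), ← div_eq_mul_inv, le_div_iff₀ (by positivity), mul_comm]
        exact_mod_cast h2.le
      have h5 : (1 + ‖v‖) ^ (-2 - η) = (1 + ‖v‖) ^ (-2 : ℝ) * (1 + ‖v‖) ^ (-η) := by
        rw [← Real.rpow_add (by positivity)]; ring_nf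
      rw [h5]
      have h6 : 0 ≤ (1 + ‖v‖) ^ (-η) := by positivity
      nlinarith [hg0 v]
  rw [integral_add hg (hi.const_mul ε), integral_const_mul] at h1
  calc η * ∫ v, S η v ≤ η * ((∫ v, g v) + ε * ∫ v : ℂ, (1 + ‖v‖) ^ (-2 - η)) := by gcongr
    _ = (η * ∫ v, g v) + ε * (η * ∫ v : ℂ, (1 + ‖v‖) ^ (-2 - η)) := by ring
    _ < ε + ε * (2 * Real.pi) := by
        have : ε * (η * ∫ v : ℂ, (1 + ‖v‖) ^ (-2 - η)) ≤ ε * (2 * Real.pi) := by gcongr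
        linarith
    _ = a := by simp only [ε]; field_simp; ring

/-- Two bounded functions with the same behaviour at infinity. -/
def AsympEq (f g : ℂ → ℂ) : Prop :=
  (∃ C, ∀ᶠ v in Bornology.cobounded ℂ, ‖f v‖ ≤ C) ∧
    Tendsto (fun v => f v - g v) (Bornology.cobounded ℂ) (𝓝 0)

namespace AsympEq

variable {f g f' g' : ℂ → ℂ}

theorem bound_right (h : AsympEq f g) : ∃ C, ∀ᶠ v in Bornology.cobounded ℂ, ‖g v‖ ≤ C := by
  obtain ⟨⟨C, hC⟩, hd⟩ := h
  refine ⟨C + 1, ?_⟩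
  have h1 := (hd.norm).eventually (ge_mem_nhds (by simp : ‖(0 : ℂ)‖ < 1))
  filter_upwards [hC, h1] with v hv1 hv2
  have := norm_sub_norm_le (g v) (f v)
  rw [norm_sub_rev] at this
  linarith

theorem mul (h : AsympEq f g) (h' : AsympEq f' g') : AsympEq (fun v => f v * f' v) fun v => g v * g' v := by
  obtain ⟨C', hC'⟩ := h.bound_right
  obtain ⟨⟨C, hC⟩, hd⟩ := h
  obtain ⟨⟨D, hD⟩, hd'⟩ := h'
  refine ⟨⟨C * D, ?_⟩, ?_⟩
  · filter_upwards [hC, hD] with v hv1 hv2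
    rw [norm_mul]
    exact mul_le_mul hv1 hv2 (norm_nonneg _) ((norm_nonneg _).trans hv1)
  · have h1 : Tendsto (fun v => (f v - g v) * f' v) (Bornology.cobounded ℂ) (𝓝 0) :=
      hd.zero_mul_isBoundedUnder_le ⟨D, eventually_map.2 hD⟩
    have h2 : Tendsto (fun v => g v * (f' v - g' v)) (Bornology.cobounded ℂ) (𝓝 0) := by
      have := hd'.zero_mul_isBoundedUnder_le (g := g) ⟨C', eventually_map.2 hC'⟩
      simpa only [mul_comm] using this
    have := h1.add h2
    rw [add_zero] at this
    exact this.congr fun v => by ring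

theorem const (c : ℂ) : AsympEq (fun _ => c) fun _ => c :=
  ⟨⟨‖c‖, .of_forall fun _ => le_rfl⟩, by simp⟩

theorem prod {ι : Type*} {s : Finset ι} {F G : ι → ℂ → ℂ} (h : ∀ l ∈ s, AsympEq (F l) (G l)) :
    AsympEq (fun v => ∏ l ∈ s, F l v) fun v => ∏ l ∈ s, G l v := by
  classical
  induction s using Finset.induction_on with
  | empty => simpa using const 1
  | insert l s hl ih =>
    simp only [Finset.prod_insert hl]
    exact (h l (by simp)).mul (ih fun l' hl' => h l' (by simp [hl']))

theorem of_tendsto {c : ℂ} (hf : Tendsto f (Bornology.cobounded ℂ) (𝓝 c))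
    (hg : Tendsto g (Bornology.cobounded ℂ) (𝓝 c)) : AsympEq f g := by
  refine ⟨⟨‖c‖ + 1, hf.norm.eventually (ge_mem_nhds (by simp))⟩, ?_⟩
  simpa using hf.sub hg

end AsympEq

end Asymptotics

section SliceAsymptotics

variable {n : ℕ}

/-! ### Behaviour of the density for a large separated variable -/

variable {m i : ℕ} {z j E : Fin n → ℂ} {χ : ℂ → ℂ}

theorem tendsto_I_mul_cobounded :
    Tendsto (fun v : ℂ => Complex.I * v) (Bornology.cobounded ℂ) (Bornology.cobounded ℂ) := by
  rw [← tendsto_norm_atTop_iff_cobounded]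
  simpa using tendsto_norm_cobounded_atTop (E := ℂ)

theorem eventually_notMem_range (z : Fin n → ℂ) : ∀ᶠ v in Bornology.cobounded ℂ, v ∉ Set.range z :=
  (eventually_ne_cobounded_fin z).mono fun v hv ⟨r, hr⟩ => hv r (by rw [hr, sub_self])

/-- The complex power oscillates with |v| and has no limit, but |i v - w|/|v - w| tends to 1, so the
oscillations at v and at i v agree asymptotically. This is why `AsympEq` compares functions rather
than limits. -/
theorem asympEq_norm_cpow (w c : ℂ) (hc : c.re = -1) :
    AsympEq (fun v => (1 + ‖v‖ : ℝ) * (‖v - w‖ : ℂ) ^ c)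
      fun v => (1 + ‖v‖ : ℝ) * (‖Complex.I * v - w‖ : ℂ) ^ c := by
  have h1 := tendsto_norm_sub_div w
  have h2 : Tendsto (fun v : ℂ => ‖Complex.I * v - w‖ / (1 + ‖v‖)) (Bornology.cobounded ℂ) (𝓝 1) := by
    simpa [Function.comp_def] using h1.comp tendsto_I_mul_cobounded
  have hne : ∀ᶠ v in Bornology.cobounded ℂ, v - w ≠ 0 :=
    (Bornology.eventually_ne_cobounded w).mono fun _ h => sub_ne_zero.2 h
  have hb : ∀ᶠ v in Bornology.cobounded ℂ, ‖((1 + ‖v‖ : ℝ) : ℂ) * (‖v - w‖ : ℂ) ^ c‖ ≤ 2 := by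
    filter_upwards [h1.eventually (le_mem_nhds (by norm_num : (1 / 2 : ℝ) < 1)), hne] with v hv hv0
    have hp : 0 < ‖v - w‖ := norm_pos_iff.2 hv0
    rw [norm_mul, norm_ofReal_norm_cpow hv0, hc, Real.rpow_neg_one, Complex.norm_real,
      Real.norm_of_nonneg (by positivity), ← div_eq_mul_inv, div_le_iff₀ hp]
    rw [le_div_iff₀ (by positivity)] at hv
    linarith
  refine ⟨⟨2, hb⟩, ?_⟩
  have h3 : Tendsto (fun v : ℂ => (((‖Complex.I * v - w‖ / ‖v - w‖ : ℝ) : ℂ)) ^ c)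
      (Bornology.cobounded ℂ) (𝓝 1) := by
    have h4 : Tendsto (fun v : ℂ => ‖Complex.I * v - w‖ / ‖v - w‖) (Bornology.cobounded ℂ) (𝓝 1) := by
      have := h2.div h1 one_ne_zero
      rw [div_one] at this
      refine this.congr fun v => ?_
      have : (1 + ‖v‖) ≠ 0 := by positivity
      simp only [Pi.div_apply]
      field_simp
    have h5 : ContinuousAt (fun x : ℝ => (x : ℂ) ^ c) 1 :=
      Complex.continuous_ofReal.continuousAt.cpow continuousAt_const (by simp)
    have := h5.tendsto.comp h4
    simpa [Function.comp_def] using this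
  have h6 := h3.const_sub 1
  rw [sub_self] at h6
  refine (h6.zero_mul_isBoundedUnder_le ⟨2, eventually_map.2 hb⟩).congr' ?_
  filter_upwards [hne] with v hv
  have hp : 0 < ‖v - w‖ := norm_pos_iff.2 hv
  have h7 : (‖v - w‖ : ℂ) ^ c ≠ 0 := by
    rw [Ne, Complex.cpow_eq_zero_iff]
    exact fun h => hp.ne' (by exact_mod_cast h.1)
  have h8 : (‖Complex.I * v - w‖ : ℂ) ^ c =
      (((‖Complex.I * v - w‖ / ‖v - w‖ : ℝ) : ℂ)) ^ c * (‖v - w‖ : ℂ) ^ c := by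
    rw [← Complex.mul_cpow_ofReal_nonneg (by positivity) hp.le, ← Complex.ofReal_mul,
      div_mul_cancel₀ _ hp.ne']
  rw [h8]
  ring

theorem IsOperSolution.asympEq_div_sq (h : IsOperSolution z j E χ) (ho : IsOper z j E)
    (hz : Function.Injective z) (hj : ∀ r, (j r).re = -1 / 2) :
    AsympEq (fun v => χ v / (1 + ‖v‖ : ℝ) ^ 2) fun v => χ (Complex.I * v) / (1 + ‖v‖ : ℝ) ^ 2 := by
  obtain ⟨C, hC, hb⟩ := h.exists_global_bounds ho hz hj
  obtain ⟨A, hA, hP⟩ := nodeDist_le z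
  refine ⟨⟨C * A ^ (1 / 2 : ℝ), ?_⟩, ?_⟩
  · filter_upwards [eventually_notMem_range z] with v hv
    have h1 := (hb v hv).1
    have h2 : nodeDist z v ^ (1 / 2 : ℝ) ≤ A ^ (1 / 2 : ℝ) * (1 + ‖v‖) ^ (n * (1 / 2) : ℝ) := by
      rw [Real.rpow_mul (by positivity), ← Real.mul_rpow hA.le (by positivity)]
      exact Real.rpow_le_rpow (nodeDist_nonneg z v) (hP v) (by norm_num)
    rw [norm_div, norm_pow, Complex.norm_real, Real.norm_of_nonneg (by positivity),
      div_le_iff₀ (by positivity)]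
    calc _ ≤ C * (A ^ (1 / 2 : ℝ) * (1 + ‖v‖) ^ (n * (1 / 2) : ℝ) * (1 + ‖v‖) ^ (2 - n * (1 / 2) : ℝ)) := by
          refine h1.trans ?_
          gcongr
      _ = _ := by
          rw [mul_assoc (A ^ _), ← Real.rpow_add (by positivity), add_sub_cancel, ← mul_assoc]
          norm_cast
  · have h1 := h.tendsto_rotate_sub ho
    have h2 : Tendsto (fun v : ℂ => -(χ (Complex.I * v) / ‖v‖ ^ 2 - χ v / ‖v‖ ^ 2) *
        ((‖v‖ : ℂ) ^ 2 / ((1 + ‖v‖ : ℝ) : ℂ) ^ 2)) (Bornology.cobounded ℂ) (𝓝 0) := by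
      have h0 := h1.neg
      rw [neg_zero] at h0
      refine h0.zero_mul_isBoundedUnder_le ⟨1, eventually_map.2 (.of_forall fun v => ?_)⟩
      simp only [Function.comp_apply]
      rw [← div_pow, norm_pow, norm_div, Complex.norm_real, Complex.norm_real,
        Real.norm_of_nonneg (norm_nonneg v), Real.norm_of_nonneg (by positivity)]
      exact pow_le_one₀ (by positivity) ((div_le_one (by positivity)).2 (by linarith))
    refine h2.congr' ?_
    filter_upwards [Bornology.eventually_ne_cobounded (0 : ℂ)] with v hv
    have h3 : (‖v‖ : ℂ) ≠ 0 := by simpa using hv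
    have h4 : ((1 + ‖v‖ : ℝ) : ℂ) ≠ 0 := by exact_mod_cast (by positivity : (1 + ‖v‖) ≠ 0)
    field_simp
    ring

theorem uniformContinuous_planeWavePairing (ψ : 𝓢(Fin n → ℂ, ℂ)) : UniformContinuous (planeWavePairing ψ) := by
  refine (continuous_planeWavePairing ψ).uniformContinuous_of_tendsto_cocompact (x := 0) ?_
  rw [← Metric.cobounded_eq_cocompact]
  refine squeeze_zero_norm (norm_planeWavePairing_le_div 1 ψ) ?_
  refine Tendsto.const_div_atTop ?_ _
  simp only [pow_one]
  exact tendsto_atTop_add_const_left _ _ tendsto_norm_cobounded_atTop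

theorem asympEq_planeWavePairing (ψ : 𝓢(Fin n → ℂ, ℂ)) {a b : ℂ → Fin n → ℂ}
    (h : Tendsto (fun v => a v - b v) (Bornology.cobounded ℂ) (𝓝 0)) :
    AsympEq (fun v => planeWavePairing ψ (a v)) fun v => planeWavePairing ψ (b v) := by
  refine ⟨⟨∫ x, ‖ψ x‖, .of_forall fun v => norm_planeWavePairing_le _ _⟩, ?_⟩
  rw [tendsto_zero_iff_norm_tendsto_zero] at h ⊢
  rw [Metric.tendsto_nhds] at h ⊢
  intro ε hε
  obtain ⟨δ, hδ, hu⟩ := Metric.uniformContinuous_iff.1 (uniformContinuous_planeWavePairing ψ) ε hε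
  filter_upwards [h δ hδ] with v hv
  simp only [dist_zero_right, norm_norm] at hv ⊢
  rw [← dist_eq_norm] at hv ⊢
  exact hu hv

theorem asympEq_norm_sq (w : ℂ) :
    AsympEq (fun v => ((‖v - w‖ ^ 2 / (1 + ‖v‖) ^ 2 : ℝ) : ℂ))
      fun v => ((‖Complex.I * v - w‖ ^ 2 / (1 + ‖v‖) ^ 2 : ℝ) : ℂ) := by
  have h1 := tendsto_norm_sub_div w
  have h2 : Tendsto (fun v : ℂ => ‖Complex.I * v - w‖ / (1 + ‖v‖)) (Bornology.cobounded ℂ) (𝓝 1) := by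
    simpa [Function.comp_def] using h1.comp tendsto_I_mul_cobounded
  have h3 {f : ℂ → ℝ} (hf : Tendsto f (Bornology.cobounded ℂ) (𝓝 1)) :
      Tendsto (fun v => ((f v ^ 2 : ℝ) : ℂ)) (Bornology.cobounded ℂ) (𝓝 1) := by
    have := (Complex.continuous_ofReal.tendsto _).comp (hf.pow 2)
    simpa [Function.comp_def] using this
  simp only [← div_pow]
  exact .of_tendsto (h3 h1) (h3 h2)

/-- The point with the separated variables `v` and `y`. -/
def slicePoint (z : Fin n → ℂ) (ρ v : ℂ) (y : Fin m → ℂ) : Fin n → ℂ := fun r => sepPoint z ρ y r * (z r - v)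

theorem sepPoint_insertNth (ρ v : ℂ) (l : Fin (m + 1)) (y : Fin m → ℂ) :
    sepPoint z ρ (l.insertNth v y) = slicePoint z ρ v y := by
  ext r
  rw [sepPoint_succAbove ρ l, slicePoint]
  simp only [Fin.insertNth_apply_same, Fin.insertNth_apply_succAbove]
  ring

/-- The density without the powers of `ρ`, in terms of one separated variable `v` and the others. -/
def sliceDensity (z j : Fin n → ℂ) (χ : ℂ → ℂ) (ψ : 𝓢(Fin n → ℂ, ℂ)) (ρ v : ℂ) (y : Fin m → ℂ) : ℂ :=
  solutionWeight z j χ v * (∏ l, ((‖v - y l‖ ^ 2 : ℝ) : ℂ)) *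
    ((∏ l, solutionWeight z j χ (y l)) * (discAbs y : ℂ)) * planeWavePairing ψ (slicePoint z ρ v y)

theorem sepDensity_insertNth (s : ℂ) (ψ : 𝓢(Fin n → ℂ, ℂ)) (ρ v : ℂ) (l : Fin (m + 1)) (y : Fin m → ℂ) :
    sepDensity z j χ s (ρ, l.insertNth v y) * planeWavePairing ψ (sepPoint z ρ (l.insertNth v y)) =
      (‖ρ‖ : ℂ) ^ s * sliceDensity z j χ ψ ρ v y := by
  rw [sepPoint_insertNth, sliceDensity, sepDensity, Fin.prod_univ_succAbove _ l, discAbs_eq_succAbove l]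
  simp only [Fin.insertNth_apply_same, Fin.insertNth_apply_succAbove]
  push_cast
  ring

/-- The powers of x = 1 + |v| are distributed so that every factor stays bounded for v → ∞: x² goes
with χ, one x with each of the n node factors, and x² with each |v - y_l|². -/
theorem sliceDensity_eq (ψ : 𝓢(Fin n → ℂ, ℂ)) {x : ℝ} (hx : (x : ℂ) ≠ 0) (ρ v : ℂ) (y : Fin m → ℂ) :
    (x : ℂ) ^ n / ((x : ℂ) ^ 2 * (x : ℂ) ^ (2 * m)) * sliceDensity z j χ ψ ρ v y =
      χ v / (x : ℂ) ^ 2 * (∏ r, (x : ℂ) * (‖v - z r‖ : ℂ) ^ (-(2 * j r + 2))) *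
        (∏ l, ((‖v - y l‖ ^ 2 / x ^ 2 : ℝ) : ℂ)) *
        ((∏ l, solutionWeight z j χ (y l)) * (discAbs y : ℂ)) * planeWavePairing ψ (slicePoint z ρ v y) := by
  rw [sliceDensity, solutionWeight]
  simp only [Complex.ofReal_div, Finset.prod_mul_distrib, Finset.prod_div_distrib, Finset.prod_const,
    Finset.card_univ, Fintype.card_fin, Complex.ofReal_pow, pow_mul]
  field_simp

theorem AsympEq.congr {f g f' g' : ℂ → ℂ} (h : AsympEq f g) (hf : ∀ v, f' v = f v) (hg : ∀ v, g' v = g v) :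
    AsympEq f' g' := by
  rwa [funext hf, funext hg]

/-- The substitution v ↦ i v, ρ ↦ -i ρ preserves ρ v. At the scale ρ = μ/(1 + |v|) the two momenta
therefore differ only by terms ρ z_r, which tend to zero, and the pairing is uniformly continuous.
-/
theorem IsOperSolution.asympEq_sliceDensity (h : IsOperSolution z j E χ) (ho : IsOper z j E)
    (hz : Function.Injective z) (hj : ∀ r, (j r).re = -1 / 2) (ψ : 𝓢(Fin n → ℂ, ℂ)) (μ : ℂ)
    (y : Fin m → ℂ) :
    AsympEq (fun v => ((1 + ‖v‖ : ℝ) : ℂ) ^ n / (((1 + ‖v‖ : ℝ) : ℂ) ^ 2 * ((1 + ‖v‖ : ℝ) : ℂ) ^ (2 * m)) *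
        sliceDensity z j χ ψ ((1 + ‖v‖)⁻¹ • μ) v y)
      fun v => ((1 + ‖v‖ : ℝ) : ℂ) ^ n / (((1 + ‖v‖ : ℝ) : ℂ) ^ 2 * ((1 + ‖v‖ : ℝ) : ℂ) ^ (2 * m)) *
        sliceDensity z j χ ψ (-Complex.I * ((1 + ‖v‖)⁻¹ • μ)) (Complex.I * v) y := by
  have a1 := h.asympEq_div_sq ho hz hj
  have a2 := AsympEq.prod (s := Finset.univ) fun r _ => asympEq_norm_cpow (z r) (-(2 * j r + 2))
    (by simp [hj]; norm_num)
  have a3 := AsympEq.prod (s := Finset.univ) fun l _ => asympEq_norm_sq (y l)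
  have a4 := AsympEq.const ((∏ l, solutionWeight z j χ (y l)) * (discAbs y : ℂ))
  have a5 := asympEq_planeWavePairing ψ (a := fun v => slicePoint z ((1 + ‖v‖)⁻¹ • μ) v y)
    (b := fun v => slicePoint z (-Complex.I * ((1 + ‖v‖)⁻¹ • μ)) (Complex.I * v) y) ?_
  · have hx (v : ℂ) : ((1 + ‖v‖ : ℝ) : ℂ) ≠ 0 := by exact_mod_cast (by positivity : (1 + ‖v‖) ≠ 0)
    exact ((((a1.mul a2).mul a3).mul a4).mul a5).congr (fun v => sliceDensity_eq ψ (hx v) _ _ y)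
      fun v => sliceDensity_eq ψ (hx v) _ _ y
  · have h1 : Tendsto (fun v : ℂ => (1 + ‖v‖)⁻¹) (Bornology.cobounded ℂ) (𝓝 0) :=
      tendsto_inv_atTop_zero.comp (tendsto_atTop_add_const_left _ _ tendsto_norm_cobounded_atTop)
    have h2 := h1.smul_const (fun r => μ * sepPoint z 1 y r * (z r + Complex.I * z r))
    rw [zero_smul] at h2
    refine h2.congr fun v => ?_
    ext r
    have h3 (ρ : ℂ) : sepPoint z ρ y r = ρ * sepPoint z 1 y r := by
      rw [sepPoint_eq_smul, Pi.smul_apply, smul_eq_mul]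
    rw [Pi.sub_apply, slicePoint, slicePoint, h3, h3 (-Complex.I * _), Pi.smul_apply, Complex.real_smul,
      Complex.real_smul]
    linear_combination ((((1 + ‖v‖)⁻¹ : ℝ) : ℂ) * μ * sepPoint z 1 y r * v) * Complex.I_sq

end SliceAsymptotics

section SliceBounds

variable {n : ℕ}

/-! ### Vanishing of the anomaly -/

variable {m i : ℕ} {z j E : Fin n → ℂ} {χ : ℂ → ℂ}

/-- The bound of the density in the variable that is sent to infinity. -/
def edgeWeight (z : Fin n → ℂ) (m : ℕ) (v : ℂ) : ℝ :=
  nodeDist z v ^ (-1 / 2 : ℝ) * (1 + ‖v‖) ^ (2 - n / 2 + 2 * m : ℝ)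

/-- The scale 1/(1 + |v|) of ρ cancels the bracket of v in the decay of the pairing, so v decouples
into `edgeWeight`. The scale is a separate variable x so that the bound also applies at i v with the
scale of v. -/
theorem IsOperSolution.exists_norm_sliceDensity_le (h : IsOperSolution z j E χ) (ho : IsOper z j E)
    (hz : Function.Injective z) (hj : ∀ r, (j r).re = -1 / 2) (hmn : m + 1 < n) (ψ : 𝓢(Fin n → ℂ, ℂ)) (K : ℕ) :
    ∃ C, 0 ≤ C ∧ ∀ (x : ℝ) (ρ v : ℂ) (y : Fin m → ℂ), x = 1 + ‖v‖ → v ∉ Set.range z →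
      (∀ l, y l ∉ Set.range z) → ‖sliceDensity z j χ ψ (x⁻¹ • ρ) v y‖ ≤
        C * (edgeWeight z m v * ((1 + ‖ρ‖ * bracketProd y) ^ (-K : ℝ) *
          sepWeight z (fun _ => 2 - n / 2 + 2 * m) y)) := by
  obtain ⟨C₁, h₁, b₁⟩ := h.exists_norm_solutionWeight_le ho hz hj
  obtain ⟨C₂, h₂, b₂⟩ := h.exists_norm_prod_solutionWeight_le ho hz hj m
  obtain ⟨C₃, h₃, b₃⟩ := exists_norm_planeWavePairing_sepPoint_le (m := m + 1) hz hmn K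
  have hw := waveGauge_nonneg K ψ
  refine ⟨C₁ * C₂ * (C₃ * waveGauge K ψ), by positivity, fun x ρ v y hx hv hy => ?_⟩
  have hx0 : 0 < x := by rw [hx]; positivity
  have hP := nodeDist_pos hv
  have hb0 := bracketProd_pos y
  have e1 := b₁ v hv
  have e2 := b₂ y hy
  have e3 : ‖planeWavePairing ψ (slicePoint z (x⁻¹ • ρ) v y)‖ ≤
      C₃ * waveGauge K ψ * (1 + ‖ρ‖ * bracketProd y) ^ (-K : ℝ) := by
    have := b₃ ψ (x⁻¹ • ρ) ((0 : Fin (m + 1)).insertNth v y)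
    rw [sepPoint_insertNth, bracketProd, Fin.prod_univ_succAbove _ 0] at this
    simp only [Fin.insertNth_apply_same, Fin.insertNth_apply_succAbove] at this
    rw [norm_smul, Real.norm_of_nonneg (by positivity), ← hx] at this
    refine this.trans_eq ?_
    congr 3
    rw [bracketProd]
    field_simp
  have e4 : ∏ l, ‖v - y l‖ ^ 2 ≤ (1 + ‖v‖) ^ (2 * m : ℝ) * ∏ l, (1 + ‖y l‖) ^ (2 : ℝ) := by
    have : (1 + ‖v‖) ^ (2 * m : ℝ) = ∏ _l : Fin m, (1 + ‖v‖) ^ 2 := by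
      rw [Finset.prod_const, Finset.card_univ, Fintype.card_fin, ← pow_mul, ← Real.rpow_natCast]
      push_cast; rfl
    rw [this, ← Finset.prod_mul_distrib]
    refine Finset.prod_le_prod (fun _ _ => by positivity) fun l _ => ?_
    rw [Real.rpow_two, ← mul_pow]
    have := norm_sub_le v (y l)
    gcongr
    nlinarith [norm_nonneg v, norm_nonneg (y l)]
  have e5 := discAbs_le y
  have h0 := discAbs_nonneg y
  have h6 := sepWeight_nonneg z (fun _ => 2 - n / 2) y
  have e7 : sepWeight z (fun _ => 2 - n / 2) y * ((∏ l, (1 + ‖y l‖) ^ (2 : ℝ)) *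
      ∏ l, (1 + ‖y l‖) ^ (2 * (m - 1) : ℝ)) = sepWeight z (fun _ => 2 - n / 2 + 2 * m) y := by
    rw [← Finset.prod_mul_distrib]
    have : ∏ l, ((1 + ‖y l‖) ^ (2 : ℝ) * (1 + ‖y l‖) ^ (2 * (m - 1) : ℝ)) =
        ∏ l, (1 + ‖y l‖) ^ ((fun _ => 2 * m : Fin m → ℝ) l) := by
      refine Finset.prod_congr rfl fun l _ => ?_
      rw [← Real.rpow_add (by positivity)]
      ring_nf
    rw [this, sepWeight_mul]
    rfl
  have hp1 : 0 ≤ ∏ l, (1 + ‖y l‖) ^ (2 : ℝ) := Finset.prod_nonneg fun _ _ => by positivity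
  rw [sliceDensity, norm_mul, norm_mul, norm_mul, norm_mul, norm_prod, Complex.norm_real,
    Real.norm_of_nonneg h0]
  have e8 : ∏ l, ‖((‖v - y l‖ ^ 2 : ℝ) : ℂ)‖ = ∏ l, ‖v - y l‖ ^ 2 :=
    Finset.prod_congr rfl fun l _ => by rw [Complex.norm_real, Real.norm_of_nonneg (by positivity)]
  rw [e8]
  calc _ ≤ (C₁ * (nodeDist z v ^ (-1 / 2 : ℝ) * (1 + ‖v‖) ^ (2 - n / 2 : ℝ))) *
        ((1 + ‖v‖) ^ (2 * m : ℝ) * ∏ l, (1 + ‖y l‖) ^ (2 : ℝ)) *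
        ((C₂ * sepWeight z (fun _ => 2 - n / 2) y) * ∏ l, (1 + ‖y l‖) ^ (2 * (m - 1) : ℝ)) *
        (C₃ * waveGauge K ψ * (1 + ‖ρ‖ * bracketProd y) ^ (-K : ℝ)) := by
        have hq1 : 0 ≤ ∏ l, ‖v - y l‖ ^ 2 := Finset.prod_nonneg fun _ _ => by positivity
        have t1 := mul_le_mul e1 e4 hq1 ((norm_nonneg _).trans e1)
        have t2 := mul_le_mul e2 e5 h0 ((norm_nonneg _).trans e2)
        have t3 := mul_le_mul t1 t2 (by positivity) ((by positivity : (0:ℝ) ≤ _).trans t1)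
        exact mul_le_mul t3 e3 (norm_nonneg _) ((by positivity : (0:ℝ) ≤ _).trans t3)
    _ = C₁ * C₂ * (C₃ * waveGauge K ψ) * (nodeDist z v ^ (-1 / 2 : ℝ) *
        ((1 + ‖v‖) ^ (2 - n / 2 : ℝ) * (1 + ‖v‖) ^ (2 * m : ℝ)) * ((1 + ‖ρ‖ * bracketProd y) ^ (-K : ℝ) *
        (sepWeight z (fun _ => 2 - n / 2) y * ((∏ l, (1 + ‖y l‖) ^ (2 : ℝ)) *
          ∏ l, (1 + ‖y l‖) ^ (2 * (m - 1) : ℝ))))) := by ring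
    _ = _ := by rw [e7, ← Real.rpow_add (by positivity), edgeWeight]

/-- The coordinates `(v, ρ, y)` where `v` is the separated variable with index `l`. -/
def sliceEquiv (l : Fin (m + 1)) : ℂ × ℂ × (Fin m → ℂ) ≃ᵐ ℂ × (Fin (m + 1) → ℂ) :=
  (MeasurableEquiv.prodAssoc.symm.trans
    ((MeasurableEquiv.prodComm.prodCongr (MeasurableEquiv.refl _)).trans MeasurableEquiv.prodAssoc)).trans
      ((MeasurableEquiv.refl ℂ).prodCongr (MeasurableEquiv.piFinSuccAbove (fun _ => ℂ) l).symm)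

theorem sliceEquiv_apply (l : Fin (m + 1)) (x : ℂ × ℂ × (Fin m → ℂ)) :
    sliceEquiv l x = (x.2.1, l.insertNth x.1 x.2.2) := rfl

theorem measurePreserving_sliceEquiv (l : Fin (m + 1)) : MeasurePreserving (sliceEquiv (m := m) l) := by
  have h1 : MeasurePreserving (MeasurableEquiv.prodAssoc : (ℂ × ℂ) × (Fin m → ℂ) ≃ᵐ ℂ × ℂ × (Fin m → ℂ)) :=
    measurePreserving_prodAssoc volume volume volume
  have h2 : MeasurePreserving (MeasurableEquiv.prodComm.prodCongr (MeasurableEquiv.refl _) :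
      (ℂ × ℂ) × (Fin m → ℂ) ≃ᵐ (ℂ × ℂ) × (Fin m → ℂ)) :=
    (Measure.measurePreserving_swap (μ := (volume : Measure ℂ)) (ν := (volume : Measure ℂ))).prod
      (MeasurePreserving.id _)
  have h3 : MeasurePreserving ((MeasurableEquiv.refl ℂ).prodCongr
      (MeasurableEquiv.piFinSuccAbove (fun _ : Fin (m + 1) => ℂ) l).symm) :=
    (MeasurePreserving.id (volume : Measure ℂ)).prod
      (volume_preserving_piFinSuccAbove (fun _ : Fin (m + 1) => ℂ) l).symm
  exact h3.comp (h1.comp (h2.comp h1.symm))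

/-- The rotation `(v, ρ, y) ↦ (i v, -i ρ, y)`. -/
def rotateEquiv (m : ℕ) : ℂ × ℂ × (Fin m → ℂ) ≃ᵐ ℂ × ℂ × (Fin m → ℂ) :=
  (rotation ⟨Complex.I, by simp [Submonoid.unitSphere]⟩).toMeasurableEquiv.prodCongr
    ((rotation ⟨-Complex.I, by simp [Submonoid.unitSphere]⟩).toMeasurableEquiv.prodCongr (MeasurableEquiv.refl _))

theorem rotateEquiv_apply (x : ℂ × ℂ × (Fin m → ℂ)) :
    rotateEquiv m x = (Complex.I * x.1, -Complex.I * x.2.1, x.2.2) := rfl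

theorem measurePreserving_rotateEquiv (m : ℕ) : MeasurePreserving (rotateEquiv m) :=
  (rotation ⟨Complex.I, by simp [Submonoid.unitSphere]⟩).measurePreserving.prod
    ((rotation ⟨-Complex.I, by simp [Submonoid.unitSphere]⟩).measurePreserving.prod (MeasurePreserving.id _))

end SliceBounds

/-! ### Bounds for the defect of the density under rotation. -/

section RotationDefect

variable {n : ℕ}

variable {m i : ℕ} {z j E : Fin n → ℂ} {χ : ℂ → ℂ}

theorem IsOperSolution.measurable_sliceDensity (h : IsOperSolution z j E χ) (hj : ∀ r, (j r).re = -1 / 2)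
    (ψ : 𝓢(Fin n → ℂ, ℂ)) :
    Measurable fun x : ℂ × ℂ × (Fin m → ℂ) => sliceDensity z j χ ψ x.2.1 x.1 x.2.2 := by
  have h1 := h.measurable_solutionWeight hj
  have h2 := (continuous_discAbs (m := m)).measurable
  have h3 : Measurable fun x : ℂ × ℂ × (Fin m → ℂ) => planeWavePairing ψ (slicePoint z x.2.1 x.1 x.2.2) := by
    refine ((continuous_planeWavePairing ψ).comp ?_).measurable
    unfold slicePoint sepPoint
    fun_prop
  unfold sliceDensity
  fun_prop

/-- The defect of the density under the rotation `(v, ρ, y) ↦ (i v, -i ρ, y)`. -/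
def rotationDefect (z j : Fin n → ℂ) (χ : ℂ → ℂ) (ψ : 𝓢(Fin n → ℂ, ℂ)) (v : ℂ) (x : ℂ × (Fin m → ℂ)) : ℝ :=
  ‖sliceDensity z j χ ψ x.1 v x.2 - sliceDensity z j χ ψ (-Complex.I * x.1) (Complex.I * v) x.2‖

/-- The integrable majorant in the variables other than `v`. -/
def edgeMajorant (z : Fin n → ℂ) (p K : ℝ) (x : ℂ × (Fin m → ℂ)) : ℝ :=
  -- The two powers together dominate |ρ|^{p+η} uniformly in 0 ≤ η ≤ 1.
  (‖x.1‖ ^ p + ‖x.1‖ ^ (p + 1)) * ((1 + ‖x.1‖ * bracketProd x.2) ^ (-K) *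
    sepWeight z (fun _ => 2 - n / 2 + 2 * m) x.2)

theorem edgeMajorant_nonneg (z : Fin n → ℂ) (p K : ℝ) (x : ℂ × (Fin m → ℂ)) : 0 ≤ edgeMajorant z p K x := by
  have h1 := bracketProd_pos x.2
  have h2 := sepWeight_nonneg z (fun _ => 2 - n / 2 + 2 * m) x.2
  unfold edgeMajorant
  positivity

theorem integrable_edgeMajorant (hz : Function.Injective z) [NeZero n] {p K : ℝ} (hp : -2 < p) (hK : p + 3 < K)
    (hpm : 2 * (m : ℝ) + 2 < n + p) : Integrable (edgeMajorant (m := m) z p K) := by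
  have h1 := integrable_sepBound (m := m) hz (K := K) hp (by linarith) (e := fun _ => 2 - n / 2 + 2 * m)
    fun _ => by linarith
  have h2 := integrable_sepBound (m := m) hz (K := K) (p := p + 1) (by linarith) (by linarith)
    (e := fun _ => 2 - n / 2 + 2 * m) fun _ => by linarith
  refine (h1.add h2).congr (.of_forall fun x => ?_)
  simp only [Pi.add_apply, edgeMajorant]
  ring

theorem edgeWeight_nonneg (z : Fin n → ℂ) (m : ℕ) (v : ℂ) : 0 ≤ edgeWeight z m v := by
  have := nodeDist_nonneg z v
  unfold edgeWeight; positivity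

theorem IsOperSolution.exists_rotationDefect_le (h : IsOperSolution z j E χ) (ho : IsOper z j E)
    (hz : Function.Injective z) (hj : ∀ r, (j r).re = -1 / 2) (hmn : m + 1 < n) (ψ : 𝓢(Fin n → ℂ, ℂ)) (p : ℝ)
    (K : ℕ) :
    ∃ C, 0 ≤ C ∧ ∀ v, v ∉ Set.range z → Complex.I * v ∉ Set.range z →
      ∀ᵐ x : ℂ × (Fin m → ℂ), (‖x.1‖ ^ p + ‖x.1‖ ^ (p + 1)) *
        rotationDefect z j χ ψ v ((1 + ‖v‖)⁻¹ • x.1, x.2) ≤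
          C * (edgeWeight z m v + edgeWeight z m (Complex.I * v)) * edgeMajorant z p K x := by
  obtain ⟨C, hC, hb⟩ := h.exists_norm_sliceDensity_le ho hz hj hmn ψ K
  refine ⟨C, hC, fun v hv hv' => ?_⟩
  filter_upwards [ae_notMem_range_pi z] with x hx
  have h1 := hb _ x.1 v x.2 rfl hv hx.2
  have h2 := hb (1 + ‖v‖) (-Complex.I * x.1) (Complex.I * v) x.2 (by simp) hv' hx.2
  rw [norm_mul, norm_neg, Complex.norm_I, one_mul] at h2
  have h3 : rotationDefect z j χ ψ v ((1 + ‖v‖)⁻¹ • x.1, x.2) ≤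
      C * (edgeWeight z m v + edgeWeight z m (Complex.I * v)) * ((1 + ‖x.1‖ * bracketProd x.2) ^ (-K : ℝ) *
          sepWeight z (fun _ => 2 - n / 2 + 2 * m) x.2) := by
    refine (norm_sub_le _ _).trans ?_
    simp only
    rw [mul_smul_comm]
    linarith
  calc _ ≤ (‖x.1‖ ^ p + ‖x.1‖ ^ (p + 1)) * _ := mul_le_mul_of_nonneg_left h3 (by positivity)
    _ = _ := by rw [edgeMajorant]; ring

theorem eventually_edgeWeight_le (z : Fin n → ℂ) (m : ℕ) :
    ∀ᶠ v in Bornology.cobounded ℂ, (1 + ‖v‖) ^ (n - 2 - 2 * m : ℝ) * edgeWeight z m v ≤ 2 := by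
  have h1 := tendsto_nodeDist_div z
  filter_upwards [h1.eventually (le_mem_nhds (by norm_num : (1 / 4 : ℝ) < 1)), eventually_notMem_range z]
    with v hv hv0
  have hP := nodeDist_pos hv0
  rw [le_div_iff₀ (by positivity)] at hv
  have h2 : (1 + ‖v‖) ^ (n - 2 - 2 * m : ℝ) * (1 + ‖v‖) ^ (2 - n / 2 + 2 * m : ℝ) =
      ((1 + ‖v‖) ^ n) ^ (1 / 2 : ℝ) := by
    rw [← Real.rpow_add (by positivity), ← Real.rpow_natCast, ← Real.rpow_mul (by positivity)]
    ring_nf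
  rw [edgeWeight, mul_left_comm, h2, neg_div, Real.rpow_neg hP.le, inv_mul_eq_div, div_le_iff₀ (by positivity)]
  rw [← Real.sqrt_eq_rpow, ← Real.sqrt_eq_rpow]
  rw [Real.sqrt_le_left (by positivity), mul_pow, Real.sq_sqrt hP.le]
  linarith

theorem exists_integrable_edgeWeight_le (hz : Function.Injective z) [NeZero n] (m : ℕ) (e R : ℝ) :
    ∃ g : ℂ → ℝ, Integrable g ∧ (∀ v, 0 ≤ g v) ∧ ∀ v, ‖v‖ ≤ R →
      (1 + ‖v‖) ^ e * (edgeWeight z m v + edgeWeight z m (Complex.I * v)) ≤ g v := by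
  set N : ℝ := n + |e| + |(2 - n / 2 + 2 * m : ℝ)| + 2 with hN
  have h1 : Integrable fun v : ℂ => nodeDist z v ^ (-1 / 2 : ℝ) * (1 + ‖v‖) ^ (-N) := by
    refine integrable_nodeDist_rpow_mul hz (by norm_num) (by norm_num) ?_
    have := abs_nonneg e
    have := abs_nonneg (2 - n / 2 + 2 * m : ℝ)
    have : (0 : ℝ) < n := by exact_mod_cast Nat.pos_of_ne_zero (NeZero.ne n)
    linarith
  have h2 : Integrable fun v : ℂ => nodeDist z (Complex.I * v) ^ (-1 / 2 : ℝ) * (1 + ‖Complex.I * v‖) ^ (-N) :=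
    ((rotation ⟨Complex.I, by simp [Submonoid.unitSphere]⟩).measurePreserving.integrable_comp_emb
      (rotation ⟨Complex.I, by simp [Submonoid.unitSphere]⟩).toMeasurableEquiv.measurableEmbedding).2 h1
  have hR : ∀ v : ℂ, ‖v‖ ≤ R → (1 + ‖v‖) ^ e * (1 + ‖v‖) ^ (2 - n / 2 + 2 * m : ℝ) ≤
      (1 + |R|) ^ (e + (2 - n / 2 + 2 * m) + N) * (1 + ‖v‖) ^ (-N) := by
    intro v hv
    have : (1 + ‖v‖) ^ e * (1 + ‖v‖) ^ (2 - n / 2 + 2 * m : ℝ) =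
        (1 + ‖v‖) ^ (e + (2 - n / 2 + 2 * m) + N) * (1 + ‖v‖) ^ (-N) := by
      rw [← Real.rpow_add (by positivity), ← Real.rpow_add (by positivity)]
      ring_nf
    rw [this]
    gcongr
    · have h1 := neg_abs_le e
      have h2 := neg_abs_le (2 - n / 2 + 2 * m : ℝ)
      have h3 : (0 : ℝ) ≤ n := n.cast_nonneg
      linarith
    · exact hv.trans (le_abs_self R)
  refine ⟨_, (h1.add h2).const_mul ((1 + |R|) ^ (e + (2 - n / 2 + 2 * m) + N)), fun v => ?_, fun v hv => ?_⟩
  · have := nodeDist_nonneg z v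
    have := nodeDist_nonneg z (Complex.I * v)
    simp only [Pi.add_apply]
    positivity
  · have h3 := hR v hv
    have h4 := Real.rpow_nonneg (nodeDist_nonneg z v) (-1 / 2)
    have h5 := Real.rpow_nonneg (nodeDist_nonneg z (Complex.I * v)) (-1 / 2)
    simp only [edgeWeight, Pi.add_apply, norm_mul, Complex.norm_I, one_mul]
    have h6 := mul_le_mul_of_nonneg_left h3 h4
    have h7 := mul_le_mul_of_nonneg_left h3 h5
    linarith

end RotationDefect

/-! ### The regularized integral of y_l/ρ has no pole. -/

section Anomaly

variable {n : ℕ}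

variable {m i : ℕ} {z j E : Fin n → ℂ} {χ : ℂ → ℂ}

theorem rotationDefect_nonneg (ψ : 𝓢(Fin n → ℂ, ℂ)) (v : ℂ) (x : ℂ × (Fin m → ℂ)) :
    0 ≤ rotationDefect z j χ ψ v x := norm_nonneg _

theorem IsOperSolution.measurable_rotationDefect (h : IsOperSolution z j E χ) (hj : ∀ r, (j r).re = -1 / 2)
    (ψ : 𝓢(Fin n → ℂ, ℂ)) (v : ℂ) (c : ℝ) :
    Measurable fun x : ℂ × (Fin m → ℂ) => rotationDefect z j χ ψ v (c • x.1, x.2) := by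
  have h1 := h.measurable_sliceDensity (m := m) hj ψ
  unfold rotationDefect
  refine Measurable.norm (Measurable.sub ?_ ?_)
  · exact h1.comp (f := fun x : ℂ × (Fin m → ℂ) => (v, c • x.1, x.2)) (by fun_prop)
  · exact h1.comp (f := fun x : ℂ × (Fin m → ℂ) => (Complex.I * v, -Complex.I * (c • x.1), x.2)) (by fun_prop)

/-- The rotation defect at scale `1 / (1 + |v|)`, integrated over the variables other than `v`. -/
def edgeDefect (z j : Fin n → ℂ) (χ : ℂ → ℂ) (ψ : 𝓢(Fin n → ℂ, ℂ)) (m : ℕ) (p : ℝ) (v : ℂ) : ℝ :=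
  ∫ x : ℂ × (Fin m → ℂ), (‖x.1‖ ^ p + ‖x.1‖ ^ (p + 1)) *
    rotationDefect z j χ ψ v ((1 + ‖v‖)⁻¹ • x.1, x.2)

theorem ae_notMem_range_rotate (z : Fin n → ℂ) : ∀ᵐ v : ℂ, v ∉ Set.range z ∧ Complex.I * v ∉ Set.range z := by
  have h1 := ((rotation ⟨Complex.I, by simp [Submonoid.unitSphere]⟩).measurePreserving.quasiMeasurePreserving.ae
    (ae_notMem_range z))
  filter_upwards [ae_notMem_range z, h1] with v hv hv' using ⟨hv, hv'⟩

section defect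

variable {p : ℝ}

theorem IsOperSolution.integrable_rotationDefect (h : IsOperSolution z j E χ) (ho : IsOper z j E)
    (hz : Function.Injective z) (hj : ∀ r, (j r).re = -1 / 2) (hmn : m + 1 < n) (ψ : 𝓢(Fin n → ℂ, ℂ))
    (hp : -2 < p) (hpm : 2 * (m : ℝ) + 2 < n + p) :
    ∃ C, 0 ≤ C ∧ ∀ v, v ∉ Set.range z → Complex.I * v ∉ Set.range z →
      Integrable (fun x : ℂ × (Fin m → ℂ) => (‖x.1‖ ^ p + ‖x.1‖ ^ (p + 1)) *
        rotationDefect z j χ ψ v ((1 + ‖v‖)⁻¹ • x.1, x.2)) ∧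
      edgeDefect z j χ ψ m p v ≤ C * (edgeWeight z m v + edgeWeight z m (Complex.I * v)) := by
  have : NeZero n := ⟨by omega⟩
  obtain ⟨K, hK⟩ := exists_nat_gt (p + 3)
  obtain ⟨C, hC, hb⟩ := h.exists_rotationDefect_le (m := m) ho hz hj hmn ψ p K
  have hM := integrable_edgeMajorant hz hp hK hpm
  refine ⟨C * ∫ x, edgeMajorant (m := m) z p K x,
    mul_nonneg hC (integral_nonneg (edgeMajorant_nonneg z p K)), fun v hv hv' => ?_⟩
  have hm := h.measurable_rotationDefect (m := m) hj ψ v (1 + ‖v‖)⁻¹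
  have hint : Integrable (fun x : ℂ × (Fin m → ℂ) => (‖x.1‖ ^ p + ‖x.1‖ ^ (p + 1)) *
        rotationDefect z j χ ψ v ((1 + ‖v‖)⁻¹ • x.1, x.2)) := by
    refine (hM.const_mul (C * (edgeWeight z m v + edgeWeight z m (Complex.I * v)))).mono'
      (Measurable.aestronglyMeasurable (by fun_prop)) ?_
    filter_upwards [hb v hv hv'] with x hx
    rw [Real.norm_of_nonneg (mul_nonneg (by positivity) (rotationDefect_nonneg ψ v _))]
    exact hx
  refine ⟨hint, ?_⟩
  refine (integral_mono_ae hint (hM.const_mul _) (hb v hv hv')).trans_eq ?_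
  rw [integral_const_mul]
  ring

/-- For large `v` the rotation defect is smaller than its bound. -/
theorem IsOperSolution.tendsto_edgeDefect (h : IsOperSolution z j E χ) (ho : IsOper z j E)
    (hz : Function.Injective z) (hj : ∀ r, (j r).re = -1 / 2) (hmn : m + 1 < n) (ψ : 𝓢(Fin n → ℂ, ℂ))
    (hp : -2 < p) (hpm : 2 * (m : ℝ) + 2 < n + p) :
    Tendsto (fun v => (1 + ‖v‖) ^ (n - 2 - 2 * m : ℝ) * edgeDefect z j χ ψ m p v)
      (Bornology.cobounded ℂ) (𝓝 0) := by
  have : NeZero n := ⟨by omega⟩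
  obtain ⟨K, hK⟩ := exists_nat_gt (p + 3)
  obtain ⟨C, hC, hb⟩ := h.exists_rotationDefect_le (m := m) ho hz hj hmn ψ p K
  have hM := integrable_edgeMajorant hz hp hK hpm
  have : (Bornology.cobounded ℂ).IsCountablyGenerated := by
    rw [← comap_norm_atTop]; infer_instance
  have hdct := tendsto_integral_filter_of_dominated_convergence (l := Bornology.cobounded ℂ) (μ := volume)
    (F := fun v (x : ℂ × (Fin m → ℂ)) => (1 + ‖v‖) ^ (n - 2 - 2 * m : ℝ) *
      ((‖x.1‖ ^ p + ‖x.1‖ ^ (p + 1)) * rotationDefect z j χ ψ v ((1 + ‖v‖)⁻¹ • x.1, x.2)))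
    (f := fun _ => 0) (fun x => C * 4 * edgeMajorant z p K x) ?_ ?_ (hM.const_mul _) ?_
  · simp only [integral_const_mul, integral_zero] at hdct
    exact hdct
  · refine .of_forall fun v => ?_
    have hm := h.measurable_rotationDefect (m := m) hj ψ v (1 + ‖v‖)⁻¹
    exact Measurable.aestronglyMeasurable (by fun_prop)
  · have hr : ∀ᶠ v in Bornology.cobounded ℂ, (1 + ‖v‖) ^ (n - 2 - 2 * m : ℝ) * edgeWeight z m (Complex.I * v) ≤ 2 := by
      have := tendsto_I_mul_cobounded.eventually (eventually_edgeWeight_le z m)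
      simpa using this
    filter_upwards [eventually_edgeWeight_le z m, hr, eventually_notMem_range z,
      tendsto_I_mul_cobounded.eventually (eventually_notMem_range z)] with v hv1 hv2 hv hv'
    filter_upwards [hb v hv hv'] with x hx
    have h0 := rotationDefect_nonneg (z := z) (j := j) (χ := χ) ψ v ((1 + ‖v‖)⁻¹ • x.1, x.2)
    rw [Real.norm_of_nonneg (by positivity)]
    have h1 := edgeMajorant_nonneg z p K x
    calc _ ≤ (1 + ‖v‖) ^ (n - 2 - 2 * m : ℝ) *
          (C * (edgeWeight z m v + edgeWeight z m (Complex.I * v)) * edgeMajorant z p K x) := by gcongr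
      _ = C * ((1 + ‖v‖) ^ (n - 2 - 2 * m : ℝ) * edgeWeight z m v +
          (1 + ‖v‖) ^ (n - 2 - 2 * m : ℝ) * edgeWeight z m (Complex.I * v)) * edgeMajorant z p K x := by ring
      _ ≤ C * (2 + 2) * edgeMajorant z p K x := by gcongr
      _ = _ := by ring
  · refine .of_forall fun x => ?_
    -- Pointwise in (ρ, y) the rescaled defect tends to zero by the asymptotic invariance; dominated
    -- convergence carries this over to the integral.
    have h1 := (h.asympEq_sliceDensity ho hz hj ψ x.1 x.2).2.norm
    rw [norm_zero] at h1
    have h2 := h1.const_mul (‖x.1‖ ^ p + ‖x.1‖ ^ (p + 1))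
    rw [mul_zero] at h2
    refine h2.congr fun v => ?_
    have h3 : (1 + ‖v‖) ^ (n - 2 - 2 * m : ℝ) = (1 + ‖v‖) ^ n / ((1 + ‖v‖) ^ 2 * (1 + ‖v‖) ^ (2 * m)) := by
      rw [← pow_add, Real.rpow_sub (by positivity), Real.rpow_sub (by positivity), Real.rpow_natCast,
        pow_add, div_div]
      norm_cast
    rw [← mul_sub, norm_mul, rotationDefect, h3]
    have h4 : ‖((1 + ‖v‖ : ℝ) : ℂ) ^ n / (((1 + ‖v‖ : ℝ) : ℂ) ^ 2 * ((1 + ‖v‖ : ℝ) : ℂ) ^ (2 * m))‖ =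
        (1 + ‖v‖) ^ n / ((1 + ‖v‖) ^ 2 * (1 + ‖v‖) ^ (2 * m)) := by
      rw [norm_div, norm_mul, norm_pow, norm_pow, norm_pow, Complex.norm_real,
        Real.norm_of_nonneg (by positivity)]
    rw [h4]
    ring

end defect

/-- At the unregularized exponent, Re s - 1 = m - i, the strict inequality becomes an equality: the
divergence at large y_l is exactly logarithmic, and any η > 0 removes it. -/
theorem IsOperSolution.integrable_anomaly (h : IsOperSolution z j E χ) (ho : IsOper z j E)
    (hz : Function.Injective z) (hj : ∀ r, (j r).re = -1 / 2) (hn : n = m + 1 + i + 2)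
    (ψ : 𝓢(Fin n → ℂ, ℂ)) (l : Fin (m + 1)) {s : ℂ} (hs : (m : ℝ) - i < s.re - 1) (hs2 : -2 < s.re - 1) :
    Integrable fun x : ℂ × (Fin (m + 1) → ℂ) => sepDensity z j χ s x * (x.1⁻¹ ^ 1 * x.2 l) *
      planeWavePairing ψ (sepPoint z x.1 x.2) := by
  have hnr : (n : ℝ) = m + 1 + i + 2 := by exact_mod_cast hn
  refine h.integrable_sepDensity_mul ho hz hj (by omega) (f := fun y => y l) (by fun_prop)
    (τ := fun l' => 2 * m + if l' = l then 1 else 0) (A := 1) (fun y => ?_) (by simpa using hs2) (fun l' => ?_) ψ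
  · have h1 := discAbs_le y
    have h2 : ∏ l', (1 + ‖y l'‖) ^ (2 * m + if l' = l then 1 else 0 : ℝ) =
        (∏ l', (1 + ‖y l'‖) ^ (2 * (((m + 1 : ℕ) : ℝ) - 1) : ℝ)) * (1 + ‖y l‖) := by
      have h3 : ∏ l', (1 + ‖y l'‖) ^ (if l' = l then 1 else 0 : ℝ) = 1 + ‖y l‖ := by
        rw [Finset.prod_eq_single l]
        · simp
        · intro b _ hb; simp [hb]
        · simp
      rw [← h3, ← Finset.prod_mul_distrib]
      refine Finset.prod_congr rfl fun l' _ => ?_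
      rw [← Real.rpow_add (by positivity)]
      push_cast
      ring_nf
    rw [h2, one_mul]
    refine mul_le_mul h1 (by linarith) (norm_nonneg _) (Finset.prod_nonneg fun _ _ => by positivity)
  · rw [hnr]
    push_cast
    split_ifs <;> linarith

/-- The integral is averaged with its image under (v, ρ) ↦ (i v, -i ρ), where v = y_l. The factor
v/ρ changes sign, so the average contains the difference of the densities at the two points, and
this is of smaller order for v → ∞. The regularized integral is then o(1/η) rather than O(1/η). -/
theorem IsOperSolution.tendsto_anomaly (h : IsOperSolution z j E χ) (ho : IsOper z j E)
    (hz : Function.Injective z) (hj : ∀ r, (j r).re = -1 / 2) (hn : n = m + 1 + i + 2) (hi : i ≤ 1)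
    (ψ : 𝓢(Fin n → ℂ, ℂ)) (l : Fin (m + 1)) :
    Tendsto (fun η : ℝ => (η : ℂ) * ∫ x : ℂ × (Fin (m + 1) → ℂ),
      sepDensity z j χ (rhoExponent (m + 1) j + η) x * (x.1⁻¹ ^ 1 * x.2 l) *
        planeWavePairing ψ (sepPoint z x.1 x.2)) (𝓝[>] 0) (𝓝 0) := by
  have : NeZero n := ⟨by omega⟩
  have hnr : (n : ℝ) = m + 1 + i + 2 := by exact_mod_cast hn
  have hir : (i : ℝ) ≤ 1 := by exact_mod_cast hi
  have hm0 : (0 : ℝ) ≤ m := m.cast_nonneg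
  have hγ := rhoExponent_re hj hn
  push_cast at hγ
  set γ := rhoExponent (m + 1) j
  -- p is the exponent Re γ - 1 of |ρ| once the factor ρ⁻¹ is included.
  set p : ℝ := m - i with hp
  have hp2 : -2 < p := by rw [hp]; linarith
  have hpm : 2 * (m : ℝ) + 2 < n + p := by rw [hp, hnr]; linarith
  set S : ℝ → ℂ → ℝ := fun η v => 1 / 2 * ∫ x : ℂ × (Fin m → ℂ),
    ‖x.1‖ ^ (p + η) * ‖v‖ * rotationDefect z j χ ψ v x with hS
  have hS0 (η : ℝ) (v : ℂ) : 0 ≤ S η v :=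
    mul_nonneg (by norm_num) (integral_nonneg fun x =>
      mul_nonneg (by positivity) (rotationDefect_nonneg ψ v x))
  obtain ⟨C, hC, hb⟩ := h.integrable_rotationDefect (m := m) ho hz hj (by omega) ψ hp2 hpm
  have hle (η : ℝ) (hη : 0 < η) : ‖(η : ℂ) * ∫ x : ℂ × (Fin (m + 1) → ℂ),
      sepDensity z j χ (γ + η) x * (x.1⁻¹ ^ 1 * x.2 l) *
        planeWavePairing ψ (sepPoint z x.1 x.2)‖ ≤ η * ∫ v, S η v := by
    rw [norm_mul, Complex.norm_real, Real.norm_of_nonneg hη.le]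
    refine mul_le_mul_of_nonneg_left ?_ hη.le
    have hint := h.integrable_anomaly ho hz hj hn ψ l (s := γ + η)
      (by simp only [Complex.add_re, Complex.ofReal_re]; linarith)
      (by simp only [Complex.add_re, Complex.ofReal_re]; linarith)
    set F := fun x : ℂ × (Fin (m + 1) → ℂ) =>
      sepDensity z j χ (γ + η) x * (x.1⁻¹ ^ 1 * x.2 l) * planeWavePairing ψ (sepPoint z x.1 x.2) with hF
    set A := fun x : ℂ × ℂ × (Fin m → ℂ) => F (sliceEquiv l x) with hA
    have hAv (x : ℂ × ℂ × (Fin m → ℂ)) : A x =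
        (‖x.2.1‖ : ℂ) ^ (γ + η) * x.2.1⁻¹ * x.1 * sliceDensity z j χ ψ x.2.1 x.1 x.2.2 := by
      have := sepDensity_insertNth (z := z) (j := j) (χ := χ) (γ + η) ψ x.2.1 x.1 l x.2.2
      simp only [hA, hF, sliceEquiv_apply, Fin.insertNth_apply_same, pow_one]
      rw [mul_right_comm, this]; ring
    have hAint : Integrable A :=
      ((measurePreserving_sliceEquiv l).integrable_comp_emb (sliceEquiv l).measurableEmbedding).2 hint
    have hRint : Integrable fun x => A (rotateEquiv m x) :=
      ((measurePreserving_rotateEquiv m).integrable_comp_emb (rotateEquiv m).measurableEmbedding).2 hAint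
    have e1 : ∫ x, F x = ∫ x, A x :=
      ((measurePreserving_sliceEquiv l).integral_comp (sliceEquiv l).measurableEmbedding F).symm
    have e2 : ∫ x, A (rotateEquiv m x) = ∫ x, A x :=
      (measurePreserving_rotateEquiv m).integral_comp (rotateEquiv m).measurableEmbedding A
    have e3 : ∫ x, F x = 1 / 2 * ∫ x, (A x + A (rotateEquiv m x)) := by
      rw [integral_add hAint hRint, e2, e1]; ring
    -- The sum becomes a difference of densities because i/(-i) = -1.
    have e4 (x : ℂ × ℂ × (Fin m → ℂ)) : A x + A (rotateEquiv m x) =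
        (‖x.2.1‖ : ℂ) ^ (γ + η) * x.2.1⁻¹ * x.1 * (sliceDensity z j χ ψ x.2.1 x.1 x.2.2 -
          sliceDensity z j χ ψ (-Complex.I * x.2.1) (Complex.I * x.1) x.2.2) := by
      rw [hAv, hAv, rotateEquiv_apply]
      simp only [norm_mul, norm_neg, Complex.norm_I, one_mul, mul_inv, Complex.inv_I, inv_neg, neg_neg]
      have := Complex.I_mul_I
      linear_combination ((‖x.2.1‖ : ℂ) ^ (γ + η) * x.2.1⁻¹ * x.1 *
        sliceDensity z j χ ψ (-Complex.I * x.2.1) (Complex.I * x.1) x.2.2) * this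
    have e5 : ∀ᵐ x : ℂ × ℂ × (Fin m → ℂ), ‖A x + A (rotateEquiv m x)‖ =
        ‖x.2.1‖ ^ (p + η) * ‖x.1‖ * rotationDefect z j χ ψ x.1 x.2 := by
      have h0 : ∀ᵐ x : ℂ × ℂ × (Fin m → ℂ), x.2.1 ≠ 0 := by
        have h1 : ∀ᵐ x : ℂ × (Fin m → ℂ), x.1 ≠ 0 := by
          filter_upwards [ae_notMem_range_pi (m := m) z] with x hx using hx.1
        exact Measure.quasiMeasurePreserving_snd.ae h1
      filter_upwards [h0] with x hx
      have hx' : 0 < ‖x.2.1‖ := norm_pos_iff.2 hx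
      rw [e4, norm_mul, norm_mul, norm_mul, norm_inv, Complex.norm_cpow_eq_rpow_re_of_pos hx',
        ← Real.rpow_neg_one, ← Real.rpow_add hx', rotationDefect]
      congr 3
      simp only [Complex.add_re, Complex.ofReal_re, hγ, hp]
      ring
    have e6 : Integrable fun x : ℂ × ℂ × (Fin m → ℂ) =>
        ‖x.2.1‖ ^ (p + η) * ‖x.1‖ * rotationDefect z j χ ψ x.1 x.2 :=
      ((hAint.add hRint).norm).congr e5
    rw [e3, norm_mul]
    have e7 : ‖(1 / 2 : ℂ)‖ = 1 / 2 := by norm_num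
    rw [e7]
    simp only [hS]
    rw [integral_const_mul, ← integral_prod _ e6]
    refine mul_le_mul_of_nonneg_left ?_ (by norm_num)
    exact (norm_integral_le_integral_norm _).trans_eq (integral_congr_ae e5)
  refine squeeze_zero_norm' (a := fun η => η * ∫ v, S η v) ?_ ?_
  · filter_upwards [self_mem_nhdsWithin] with η hη using hle η hη
  -- Rescaling ρ by 1 + |v| yields (1 + |v|)^{-2-p-η}: the 2 from the area element, the rest from
  -- |ρ|^{p+η}. The η-dependence in v is thereby isolated as the factor (1 + |v|)^{-η} of the model
  -- integral.
  refine tendsto_mul_integral_of_le (T := fun v => 1 / 2 * (‖v‖ * (1 + ‖v‖) ^ (-2 - p)) *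
    edgeDefect z j χ ψ m p v) hS0 ?_ ?_ ?_
  · intro η hη hη1
    filter_upwards [ae_notMem_range_rotate z] with v hv
    have hx : 0 < 1 + ‖v‖ := by positivity
    have h1 := integral_scale_fst hx fun x : ℂ × (Fin m → ℂ) =>
      ‖x.1‖ ^ (p + η) * ‖v‖ * rotationDefect z j χ ψ v x
    have h2 : ∫ x : ℂ × (Fin m → ℂ), ‖(1 + ‖v‖)⁻¹ • x.1‖ ^ (p + η) * ‖v‖ *
        rotationDefect z j χ ψ v ((1 + ‖v‖)⁻¹ • x.1, x.2) ≤
        ((1 + ‖v‖) ^ (-(p + η)) * ‖v‖) * edgeDefect z j χ ψ m p v := by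
      rw [edgeDefect, ← integral_const_mul]
      refine integral_mono_of_nonneg (.of_forall fun x => mul_nonneg (by positivity)
        (rotationDefect_nonneg ψ v _)) ((hb v hv.1 hv.2).1.const_mul _) ?_
      filter_upwards [ae_notMem_range_pi z] with x hx0
      have hx1 : 0 < ‖x.1‖ := norm_pos_iff.2 hx0.1
      have h3 : ‖x.1‖ ^ (p + η) ≤ ‖x.1‖ ^ p + ‖x.1‖ ^ (p + 1) := by
        rcases le_total ‖x.1‖ 1 with h4 | h4
        · have := Real.rpow_le_rpow_of_exponent_ge hx1 h4 (by linarith : p ≤ p + η)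
          have : 0 ≤ ‖x.1‖ ^ (p + 1) := by positivity
          linarith
        · have := Real.rpow_le_rpow_of_exponent_le h4 (by linarith : p + η ≤ p + 1)
          have : 0 ≤ ‖x.1‖ ^ p := by positivity
          linarith
      rw [norm_smul, Real.norm_of_nonneg (by positivity), Real.mul_rpow (by positivity) (by positivity),
        Real.inv_rpow (by positivity), ← Real.rpow_neg (by positivity)]
      have h5 := rotationDefect_nonneg (z := z) (j := j) (χ := χ) ψ v ((1 + ‖v‖)⁻¹ • x.1, x.2)
      calc _ = ((1 + ‖v‖) ^ (-(p + η)) * ‖v‖) * (‖x.1‖ ^ (p + η) *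
            rotationDefect z j χ ψ v ((1 + ‖v‖)⁻¹ • x.1, x.2)) := by ring
        _ ≤ _ := by gcongr
    rw [h1] at h2
    simp only [hS]
    have h6 : ∫ x : ℂ × (Fin m → ℂ), ‖x.1‖ ^ (p + η) * ‖v‖ * rotationDefect z j χ ψ v x ≤
        (1 + ‖v‖) ^ (-2 : ℝ) * (((1 + ‖v‖) ^ (-(p + η)) * ‖v‖) * edgeDefect z j χ ψ m p v) := by
      rw [Real.rpow_neg hx.le, Real.rpow_two, inv_mul_eq_div, le_div_iff₀ (by positivity), mul_comm]
      exact h2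
    have h7 : (1 + ‖v‖) ^ (-2 : ℝ) * (1 + ‖v‖) ^ (-(p + η)) =
        (1 + ‖v‖) ^ (-η) * (1 + ‖v‖) ^ (-2 - p) := by
      rw [← Real.rpow_add hx, ← Real.rpow_add hx]; ring_nf
    calc _ ≤ 1 / 2 * ((1 + ‖v‖) ^ (-2 : ℝ) * (((1 + ‖v‖) ^ (-(p + η)) * ‖v‖) * edgeDefect z j χ ψ m p v)) := by
          gcongr
      _ = 1 / 2 * (((1 + ‖v‖) ^ (-2 : ℝ) * (1 + ‖v‖) ^ (-(p + η))) * ‖v‖ * edgeDefect z j χ ψ m p v) := by ring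
      _ = _ := by rw [h7]; ring
  · intro R
    obtain ⟨g, hg, hg0, hgb⟩ := exists_integrable_edgeWeight_le hz m (-1 - p) R
    refine ⟨fun v => C * g v, hg.const_mul C, fun v => mul_nonneg hC (hg0 v), ?_⟩
    filter_upwards [ae_notMem_range_rotate z] with v hv hvR
    have h1 := (hb v hv.1 hv.2).2
    have h2 := hgb v hvR
    have h3 := edgeWeight_nonneg z m v
    have h4 := edgeWeight_nonneg z m (Complex.I * v)
    have h5 : ‖v‖ * (1 + ‖v‖) ^ (-2 - p) ≤ (1 + ‖v‖) ^ (-1 - p) := by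
      have : (1 + ‖v‖) ^ (-1 - p) = (1 + ‖v‖) * (1 + ‖v‖) ^ (-2 - p) := by
        have h6 := Real.rpow_add (by positivity : 0 < 1 + ‖v‖) 1 (-2 - p)
        rw [Real.rpow_one] at h6
        rw [← h6]; ring_nf
      rw [this]
      gcongr
      linarith
    have h6 : 0 ≤ edgeDefect z j χ ψ m p v := integral_nonneg fun x =>
      mul_nonneg (by positivity) (rotationDefect_nonneg ψ v _)
    calc _ ≤ 1 / 2 * (1 + ‖v‖) ^ (-1 - p) * (C * (edgeWeight z m v + edgeWeight z m (Complex.I * v))) := by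
          gcongr
      _ = 1 / 2 * (C * ((1 + ‖v‖) ^ (-1 - p) * (edgeWeight z m v + edgeWeight z m (Complex.I * v)))) := by ring
      _ ≤ 1 * (C * g v) := by
          have := mul_nonneg hC (hg0 v)
          gcongr
          norm_num
      _ = _ := one_mul _
  · have h1 := h.tendsto_edgeDefect (m := m) ho hz hj (by omega) ψ hp2 hpm
    have h2 := h1.zero_mul_isBoundedUnder_le (g := fun v => 1 / 2 * (‖v‖ / (1 + ‖v‖)))
      ⟨1, eventually_map.2 (.of_forall fun v => ?_)⟩
    · refine h2.congr fun v => ?_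
      -- The count is exactly critical: n = m + 1 + i + 2 gives n - 2 - 2m = 1 - p, so the decay of
      -- the edge defect is precisely what the hypothesis (1 + |v|)² T → 0 requires.
      have h3 : (1 + ‖v‖) ^ (n - 2 - 2 * m : ℝ) = (1 + ‖v‖) ^ 2 * (1 + ‖v‖) * (1 + ‖v‖) ^ (-2 - p) := by
        rw [← pow_succ, ← Real.rpow_natCast, ← Real.rpow_add (by positivity), hp, hnr]
        push_cast; ring_nf
      rw [h3]
      field_simp
    · simp only [Function.comp_apply]
      rw [Real.norm_of_nonneg (by positivity)]
      have : ‖v‖ / (1 + ‖v‖) ≤ 1 := (div_le_one (by positivity)).2 (by linarith)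
      linarith

end Anomaly

/-! ### Regularized equations and their limit. -/

section Regulator

variable {n : ℕ}

/-! ### Removal of the regulator -/

variable {m i b : ℕ} {z j E : Fin n → ℂ} {χ : ℂ → ℂ} {s : ℂ} {G G' : ℂ × (Fin m → ℂ) → ℂ}

theorem sepDensity_add_ofReal (s : ℂ) (η : ℝ) {x : ℂ × (Fin m → ℂ)} (hx : x.1 ≠ 0) :
    sepDensity z j χ (s + η) x = (‖x.1‖ : ℂ) ^ (η : ℂ) * sepDensity z j χ s x := by
  have : (‖x.1‖ : ℂ) ≠ 0 := by simpa using hx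
  rw [sepDensity, sepDensity, Complex.cpow_add _ _ this]
  ring

theorem norm_sepDensity_add_mul_le (s : ℂ) {η : ℝ} (h0 : 0 ≤ η) (h1 : η ≤ 1) {x : ℂ × (Fin m → ℂ)}
    (hx : x.1 ≠ 0) (g : ℂ) : ‖sepDensity z j χ (s + η) x * g‖ ≤
      ‖sepDensity z j χ s x * g‖ + ‖sepDensity z j χ (s + (1 : ℝ)) x * g‖ := by
  have hx0 : 0 < ‖x.1‖ := norm_pos_iff.2 hx
  rw [sepDensity_add_ofReal s η hx, sepDensity_add_ofReal s 1 hx, mul_assoc, mul_assoc, norm_mul,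
    norm_mul ((‖x.1‖ : ℂ) ^ _), norm_ofReal_norm_cpow hx, norm_ofReal_norm_cpow hx, Complex.ofReal_re,
    Complex.ofReal_re, Real.rpow_one]
  have : ‖x.1‖ ^ η ≤ 1 + ‖x.1‖ := by
    rcases le_total ‖x.1‖ 1 with h2 | h2
    · have := Real.rpow_le_one hx0.le h2 h0
      linarith
    · have := Real.rpow_le_rpow_of_exponent_le h2 h1
      rw [Real.rpow_one] at this
      linarith
  have h3 := mul_le_mul_of_nonneg_right this (norm_nonneg (sepDensity z j χ s x * g))
  linarith

/-- Dominated convergence, with |ρ|^η ≤ 1 + |ρ| for 0 ≤ η ≤ 1; this is why integrability at both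
exponents s and s + 1 is assumed. -/
theorem tendsto_integral_sepDensity (h0 : Integrable fun x => sepDensity z j χ s x * G x)
    (h1 : Integrable fun x => sepDensity z j χ (s + (1 : ℝ)) x * G x) :
    (∀ η : ℝ, 0 < η → η ≤ 1 → Integrable fun x => sepDensity z j χ (s + η) x * G x) ∧
    Tendsto (fun η : ℝ => ∫ x, sepDensity z j χ (s + η) x * G x) (𝓝[>] 0)
      (𝓝 (∫ x, sepDensity z j χ s x * G x)) := by
  have hne : ∀ᵐ x : ℂ × (Fin m → ℂ), x.1 ≠ 0 := by
    filter_upwards [ae_notMem_range_pi (m := m) z] with x hx using hx.1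
  have hmeas (η : ℝ) : AEStronglyMeasurable fun x => sepDensity z j χ (s + η) x * G x := by
    have h2 : AEStronglyMeasurable fun x : ℂ × (Fin m → ℂ) => (‖x.1‖ : ℂ) ^ (η : ℂ) :=
      Measurable.aestronglyMeasurable (by fun_prop)
    refine (h2.mul h0.aestronglyMeasurable).congr ?_
    filter_upwards [hne] with x hx
    rw [sepDensity_add_ofReal s η hx]
    simp only [Pi.mul_apply]
    ring
  have hle (η : ℝ) (hη : 0 < η) (hη1 : η ≤ 1) : ∀ᵐ x : ℂ × (Fin m → ℂ),
      ‖sepDensity z j χ (s + η) x * G x‖ ≤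
        ‖sepDensity z j χ s x * G x‖ + ‖sepDensity z j χ (s + (1 : ℝ)) x * G x‖ := by
    filter_upwards [hne] with x hx using norm_sepDensity_add_mul_le s hη.le hη1 hx _
  refine ⟨fun η hη hη1 => (h0.norm.add h1.norm).mono' (hmeas η) (hle η hη hη1), ?_⟩
  refine tendsto_integral_filter_of_dominated_convergence _ (.of_forall hmeas) ?_ (h0.norm.add h1.norm) ?_
  · filter_upwards [Ioc_mem_nhdsGT (zero_lt_one' ℝ)] with η hη using hle η hη.1 hη.2
  · filter_upwards [hne] with x hx
    refine Tendsto.mul_const _ ?_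
    have h2 : (‖x.1‖ : ℂ) ≠ 0 := by simpa using hx
    have h3 : Continuous fun η : ℝ => sepDensity z j χ (s + η) x := by
      unfold sepDensity
      refine Continuous.mul ?_ continuous_const
      exact (by fun_prop : Continuous fun η : ℝ => s + (η : ℂ)).const_cpow (Or.inl h2)
    have h4 := h3.tendsto 0
    rw [Complex.ofReal_zero, add_zero] at h4
    exact h4.mono_left nhdsWithin_le_nhds

/-- The integral of `G` against the density with exponent `γ + η` tends to zero for `η → 0+`. -/
def VanishesInLimit (z j : Fin n → ℂ) (χ : ℂ → ℂ) (G : ℂ × (Fin m → ℂ) → ℂ) : Prop :=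
  (∀ η : ℝ, 0 < η → η ≤ 1 → Integrable fun x => sepDensity z j χ (rhoExponent m j + η) x * G x) ∧
    Tendsto (fun η : ℝ => ∫ x, sepDensity z j χ (rhoExponent m j + η) x * G x) (𝓝[>] 0) (𝓝 0)

theorem VanishesInLimit.add (h : VanishesInLimit z j χ G) (h' : VanishesInLimit z j χ G') :
    VanishesInLimit z j χ fun x => G x + G' x := by
  refine ⟨fun η h0 h1 => ?_, ?_⟩
  · simp only [mul_add]
    exact (h.1 η h0 h1).add (h'.1 η h0 h1)
  · have := h.2.add h'.2
    rw [add_zero] at this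
    refine this.congr' ?_
    filter_upwards [Ioc_mem_nhdsGT (zero_lt_one' ℝ)] with η hη
    simp only [mul_add]
    rw [integral_add (h.1 η hη.1 hη.2) (h'.1 η hη.1 hη.2)]

theorem VanishesInLimit.const_mul (c : ℂ) (h : VanishesInLimit z j χ G) :
    VanishesInLimit z j χ fun x => c * G x := by
  refine ⟨fun η h0 h1 => ?_, ?_⟩
  · simp only [mul_left_comm _ c]
    exact (h.1 η h0 h1).const_mul c
  · have := h.2.const_mul c
    rw [mul_zero] at this
    refine this.congr fun η => ?_
    simp only [mul_left_comm _ c]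
    rw [integral_const_mul]

theorem VanishesInLimit.sum {ι : Type*} (t : Finset ι) {G : ι → ℂ × (Fin m → ℂ) → ℂ}
    (h : ∀ l ∈ t, VanishesInLimit z j χ (G l)) : VanishesInLimit z j χ fun x => ∑ l ∈ t, G l x := by
  classical
  induction t using Finset.induction_on with
  | empty => simp [VanishesInLimit]
  | insert a t ha ih =>
    simp only [Finset.sum_insert ha]
    exact (h a (Finset.mem_insert_self a t)).add (ih fun l hl => h l (Finset.mem_insert_of_mem hl))

/-- Coinciding roots may be ignored because `discAbs` vanishes there; the interpolation identities
hold only for distinct y_l. -/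
theorem VanishesInLimit.congr (h : VanishesInLimit z j χ G)
    (hG : ∀ x : ℂ × (Fin m → ℂ), x.1 ≠ 0 → Function.Injective x.2 → G x = G' x) : VanishesInLimit z j χ G' := by
  have key (η : ℝ) : (fun x => sepDensity z j χ (rhoExponent m j + η) x * G x) =ᵐ[volume]
      fun x => sepDensity z j χ (rhoExponent m j + η) x * G' x := by
    filter_upwards [ae_notMem_range_pi (m := m) z] with x hx
    by_cases hy : Function.Injective x.2
    · rw [hG x hx.1 hy]
    · have : discAbs x.2 = 0 := by
        obtain ⟨a, c, hac, hne⟩ := Function.not_injective_iff.1 hy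
        refine Finset.prod_eq_zero (Finset.mem_univ a) (Finset.prod_eq_zero (Finset.mem_univ c) ?_)
        rw [if_neg hne, hac, sub_self, norm_zero]
      simp [sepDensity, this]
  refine ⟨fun η h0 h1 => (h.1 η h0 h1).congr (key η), h.2.congr fun η => integral_congr_ae (key η)⟩

theorem VanishesInLimit.integral_eq_zero (h : VanishesInLimit z j χ G)
    (h0 : Integrable fun x => sepDensity z j χ (rhoExponent m j) x * G x) :
    ∫ x, sepDensity z j χ (rhoExponent m j) x * G x = 0 :=
  tendsto_nhds_unique (tendsto_integral_sepDensity h0 (h.1 1 one_pos le_rfl)).2 h.2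

/-- The regulated integrals against `ρ⁻ᵇ f(y)` grow more slowly than `1 / η` for `η → 0+`. -/
def IsNegligible (z j : Fin n → ℂ) (χ : ℂ → ℂ) (b : ℕ) (f : (Fin m → ℂ) → ℂ) : Prop :=
  ∀ ψ : 𝓢(Fin n → ℂ, ℂ),
    (∀ η : ℝ, 0 < η → η ≤ 1 → Integrable fun x : ℂ × (Fin m → ℂ) =>
      sepDensity z j χ (rhoExponent m j + η) x * (x.1⁻¹ ^ b * f x.2) * planeWavePairing ψ (sepPoint z x.1 x.2)) ∧
    Tendsto (fun η : ℝ => (η : ℂ) * ∫ x : ℂ × (Fin m → ℂ), sepDensity z j χ (rhoExponent m j + η) x *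
      (x.1⁻¹ ^ b * f x.2) * planeWavePairing ψ (sepPoint z x.1 x.2)) (𝓝[>] 0) (𝓝 0)

/-- At the exponent γ + η, integration by parts in ρ annihilates Euler + (γ + η)/2 + 1 - b, which is
Euler - (∑ j_r + i + b) + η/2. What remains of the unregularized factor is -η/2 times the
regularized integral, and negligibility is exactly the statement that this tends to zero. -/
theorem IsNegligible.vanishesInLimit {f : (Fin m → ℂ) → ℂ} (hf : IsNegligible z j χ b f)
    (hz : Function.Injective z) (hj : ∀ r, (j r).re = -1 / 2) (hn : n = m + i + 2) (hib : i + b ≤ 1)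
    (ψ : 𝓢(Fin n → ℂ, ℂ)) : VanishesInLimit z j χ fun x => (x.1⁻¹ ^ b * f x.2) *
      planeWavePairing (eulerTranspose ψ - (∑ r, j r + i + b) • ψ) (sepPoint z x.1 x.2) := by
  have hibr : (i : ℝ) + b ≤ 1 := by exact_mod_cast hib
  have hm0 : (0 : ℝ) ≤ m := m.cast_nonneg
  have hγ := rhoExponent_re hj hn
  refine ⟨fun η h0 h1 => ?_, ?_⟩
  · simpa only [mul_assoc] using (hf (eulerTranspose ψ - (∑ r, j r + i + b) • ψ)).1 η h0 h1
  have h2 := (hf ψ).2.const_mul (-1 / 2)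
  rw [mul_zero] at h2
  refine h2.congr' ?_
  filter_upwards [Ioc_mem_nhdsGT (zero_lt_one' ℝ)] with η hη
  have h3 := integral_sepDensity_euler (χ := χ) hz (by omega) f (s := rhoExponent m j + η) (b := b)
    (by rw [Complex.add_re, Complex.ofReal_re, hγ]; linarith [hη.1]) ψ ((hf _).1 η hη.1 hη.2)
  have h4 : (rhoExponent m j + η) / 2 + 1 - b = -(∑ r, j r + i + b) + (η : ℂ) / 2 := by
    rw [rhoExponent_eq m j hn]; ring
  rw [h4] at h3
  have h5 (x : ℂ × (Fin m → ℂ)) : sepDensity z j χ (rhoExponent m j + η) x * (x.1⁻¹ ^ b * f x.2) *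
      planeWavePairing (eulerTranspose ψ + (-(∑ r, j r + i + b) + (η : ℂ) / 2) • ψ) (sepPoint z x.1 x.2) =
      sepDensity z j χ (rhoExponent m j + η) x * ((x.1⁻¹ ^ b * f x.2) *
        planeWavePairing (eulerTranspose ψ - (∑ r, j r + i + b) • ψ) (sepPoint z x.1 x.2)) +
      (η : ℂ) / 2 * (sepDensity z j χ (rhoExponent m j + η) x * (x.1⁻¹ ^ b * f x.2) *
        planeWavePairing ψ (sepPoint z x.1 x.2)) := by
    simp only [planeWavePairing_add, planeWavePairing_sub, planeWavePairing_smul]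
    ring
  have h6 := (hf (eulerTranspose ψ - (∑ r, j r + i + b) • ψ)).1 η hη.1 hη.2
  simp only [mul_assoc (sepDensity _ _ _ _ _)] at h6
  have h7 := ((hf ψ).1 η hη.1 hη.2).const_mul ((η : ℂ) / 2)
  simp only [h5] at h3
  rw [integral_add h6 h7, integral_const_mul] at h3
  linear_combination (-1 : ℂ) * h3

theorem IsNegligible.add {f g : (Fin m → ℂ) → ℂ} (hf : IsNegligible z j χ b f) (hg : IsNegligible z j χ b g) :
    IsNegligible z j χ b fun y => f y + g y := by
  intro ψ
  have e (η : ℝ) (x : ℂ × (Fin m → ℂ)) : sepDensity z j χ (rhoExponent m j + η) x *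
      (x.1⁻¹ ^ b * (f x.2 + g x.2)) * planeWavePairing ψ (sepPoint z x.1 x.2) =
      sepDensity z j χ (rhoExponent m j + η) x * (x.1⁻¹ ^ b * f x.2) * planeWavePairing ψ (sepPoint z x.1 x.2) +
      sepDensity z j χ (rhoExponent m j + η) x * (x.1⁻¹ ^ b * g x.2) *
        planeWavePairing ψ (sepPoint z x.1 x.2) := by ring
  simp only [e]
  refine ⟨fun η h0 h1 => ((hf ψ).1 η h0 h1).add ((hg ψ).1 η h0 h1), ?_⟩
  have := (hf ψ).2.add (hg ψ).2
  rw [add_zero] at this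
  refine this.congr' ?_
  filter_upwards [Ioc_mem_nhdsGT (zero_lt_one' ℝ)] with η hη
  rw [integral_add ((hf ψ).1 η hη.1 hη.2) ((hg ψ).1 η hη.1 hη.2), mul_add]

theorem IsNegligible.const_mul {f : (Fin m → ℂ) → ℂ} (c : ℂ) (hf : IsNegligible z j χ b f) :
    IsNegligible z j χ b fun y => c * f y := by
  intro ψ
  have e (η : ℝ) (x : ℂ × (Fin m → ℂ)) : sepDensity z j χ (rhoExponent m j + η) x *
      (x.1⁻¹ ^ b * (c * f x.2)) * planeWavePairing ψ (sepPoint z x.1 x.2) =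
      c * (sepDensity z j χ (rhoExponent m j + η) x * (x.1⁻¹ ^ b * f x.2) *
        planeWavePairing ψ (sepPoint z x.1 x.2)) := by ring
  simp only [e]
  refine ⟨fun η h0 h1 => ((hf ψ).1 η h0 h1).const_mul c, ?_⟩
  have := (hf ψ).2.const_mul c
  rw [mul_zero] at this
  refine this.congr fun η => ?_
  rw [integral_const_mul]
  ring

theorem IsNegligible.sum {ι : Type*} (t : Finset ι) {f : ι → (Fin m → ℂ) → ℂ}
    (h : ∀ l ∈ t, IsNegligible z j χ b (f l)) : IsNegligible z j χ b fun y => ∑ l ∈ t, f l y := by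
  classical
  induction t using Finset.induction_on with
  | empty => simp [IsNegligible]
  | insert a t ha ih =>
    simp only [Finset.sum_insert ha]
    exact (h a (Finset.mem_insert_self a t)).add (ih fun l hl => h l (Finset.mem_insert_of_mem hl))

/-- The power 2m - 1 - b lies one below the critical power 2m - b, so the integral converges without
a regulator and the factor η kills it. The function y_l with b = 1 reaches the critical power and
needs `isNegligible_coord` instead. -/
theorem IsOperSolution.isNegligible_of_le (h : IsOperSolution z j E χ) (ho : IsOper z j E)
    (hz : Function.Injective z) (hj : ∀ r, (j r).re = -1 / 2) (hn : n = m + i + 2) (hib : i + b ≤ 1)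
    {f : (Fin m → ℂ) → ℂ} (hfm : Measurable f) {A : ℝ}
    (hf : ∀ y, discAbs y * ‖f y‖ ≤ A * ∏ l, (1 + ‖y l‖) ^ (2 * m - 1 - b : ℝ)) : IsNegligible z j χ b f := by
  have hibr : (i : ℝ) + b ≤ 1 := by exact_mod_cast hib
  have hnr : (n : ℝ) = m + i + 2 := by exact_mod_cast hn
  have hm0 : (0 : ℝ) ≤ m := m.cast_nonneg
  have hγ := rhoExponent_re hj hn
  intro ψ
  have h0 := h.integrable_sepDensity_mul ho hz hj (by omega) hfm (τ := fun _ => 2 * m - 1 - b) hf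
    (s := rhoExponent m j) (b := b) (by linarith) (fun _ => by linarith) ψ
  have h1 := h.integrable_sepDensity_mul ho hz hj (by omega) hfm (τ := fun _ => 2 * m - 1 - b) hf
    (s := rhoExponent m j + (1 : ℝ)) (b := b) (by rw [Complex.add_re, Complex.ofReal_re]; linarith)
    (fun _ => by rw [Complex.add_re, Complex.ofReal_re]; linarith) ψ
  simp only [mul_assoc (sepDensity _ _ _ _ _)] at h0 h1 ⊢
  obtain ⟨h2, h3⟩ := tendsto_integral_sepDensity h0 h1
  refine ⟨h2, ?_⟩
  have h4 : Tendsto (fun η : ℝ => (η : ℂ)) (𝓝[>] 0) (𝓝 0) :=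
    (Complex.continuous_ofReal.tendsto' 0 0 rfl).mono_left nhdsWithin_le_nhds
  simpa using h4.mul h3

end Regulator

section Equations

variable {n : ℕ}

/-! ### The eigenvalue equations in momentum space -/

variable {m i b : ℕ} {z j E : Fin n → ℂ} {χ : ℂ → ℂ}

section negligible

variable (h : IsOperSolution z j E χ) (ho : IsOper z j E) (hz : Function.Injective z)
  (hj : ∀ r, (j r).re = -1 / 2)
include h ho hz hj

theorem IsOperSolution.isNegligible_one (hn : n = m + i + 2) (hib : i + b ≤ 1) :
    IsNegligible (m := m) z j χ b fun _ => 1 := by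
  refine h.isNegligible_of_le ho hz hj hn hib measurable_const (A := 1) fun y => ?_
  rw [norm_one, mul_one, one_mul]
  refine (discAbs_le y).trans (Finset.prod_le_prod (fun _ _ => by positivity) fun l _ => ?_)
  refine Real.rpow_le_rpow_of_exponent_le (by linarith [norm_nonneg (y l)]) ?_
  have : (b : ℝ) ≤ 1 := by exact_mod_cast (by omega : b ≤ 1)
  linarith

theorem IsOperSolution.isNegligible_prod (hn : n = m + i + 2) (hi : i ≤ 1) (r : Fin n) :
    IsNegligible (m := m) z j χ 0 fun y => ∏ l, (z r - y l) := by
  refine h.isNegligible_of_le ho hz hj hn hi (by fun_prop) (A := ∏ _l : Fin m, (1 + ‖z r‖)) fun y => ?_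
  rw [norm_prod, ← Finset.prod_mul_distrib]
  have h1 : ∏ l, ‖z r - y l‖ ≤ ∏ l, (1 + ‖z r‖) * (1 + ‖y l‖) :=
    Finset.prod_le_prod (fun _ _ => norm_nonneg _) fun l _ => by
      nlinarith [norm_sub_le (z r) (y l), norm_nonneg (z r), norm_nonneg (y l)]
  refine (mul_le_mul (discAbs_le y) h1 (Finset.prod_nonneg fun _ _ => norm_nonneg _)
    (Finset.prod_nonneg fun _ _ => by positivity)).trans_eq ?_
  rw [← Finset.prod_mul_distrib]
  refine Finset.prod_congr rfl fun l _ => ?_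
  rw [mul_left_comm]
  congr 1
  rw [← Real.rpow_add_one (by positivity)]
  push_cast
  ring_nf

theorem IsOperSolution.isNegligible_coord (hn : n = m + i + 2) (hi : i ≤ 1) (l : Fin m) :
    IsNegligible (m := m) z j χ 1 fun y => y l := by
  obtain _ | m := m
  · exact l.elim0
  have hir : (i : ℝ) ≤ 1 := by exact_mod_cast hi
  have hm0 : (0 : ℝ) ≤ m := m.cast_nonneg
  have hγ := rhoExponent_re hj hn
  push_cast at hγ
  exact fun ψ => ⟨fun η h0 _ => h.integrable_anomaly ho hz hj hn ψ l
    (by rw [Complex.add_re, Complex.ofReal_re]; linarith) (by rw [Complex.add_re, Complex.ofReal_re]; linarith),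
    h.tendsto_anomaly ho hz hj hn hi ψ l⟩

/-- The product ∏(z_r - y_l) equals k_r ∏_{s≠r}(z_r - z_s)/ρ, and k_r is absorbed into the test
function by `plusT`. The critical term for i = 1 thus reduces to y_l/ρ. -/
theorem IsOperSolution.isNegligible_coord_mul_prod (hn : n = m + i + 2) (hi : i ≤ 1) (l : Fin m) (r : Fin n) :
    IsNegligible (m := m) z j χ 0 fun y => y l * ∏ l', (z r - y l') := by
  intro ψ
  have h1 := h.isNegligible_coord ho hz hj hn hi l (plusT r ψ)
  have key (η : ℝ) : (fun x : ℂ × (Fin m → ℂ) => nodeDen z r * (sepDensity z j χ (rhoExponent m j + η) x *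
      (x.1⁻¹ ^ 1 * x.2 l) * planeWavePairing (plusT r ψ) (sepPoint z x.1 x.2))) =ᵐ[volume] fun x =>
      sepDensity z j χ (rhoExponent m j + η) x * (x.1⁻¹ ^ 0 * (x.2 l * ∏ l', (z r - x.2 l'))) *
        planeWavePairing ψ (sepPoint z x.1 x.2) := by
    filter_upwards [ae_notMem_range_pi (m := m) z] with x hx
    have h2 := hx.1
    have h3 := nodeDen_ne_zero hz r
    rw [planeWavePairing_plusT, sepPoint]
    field_simp
    try ring
  refine ⟨fun η h0 hη => ((h1.1 η h0 hη).const_mul _).congr (key η), ?_⟩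
  have h4 := h1.2.const_mul (nodeDen z r)
  rw [mul_zero] at h4
  refine h4.congr fun η => ?_
  rw [mul_left_comm, ← integral_const_mul, integral_congr_ae (key η)]

theorem IsOperSolution.vanishesInLimit_slice (hn : n = m + i + 2) (hib : i + b ≤ 1)
    (φ : 𝓢(Fin n → ℂ, ℂ)) (l : Fin m) {g : ℂ → ℂ} (hgm : Measurable g) {A : ℝ}
    (hg : ∀ y, ‖g y‖ ≤ A * (1 + ‖y‖)) :
    VanishesInLimit (m := m) z j χ fun x => x.1⁻¹ ^ b *
      (nodeSum z (fun s => planeWavePairing (hamT z j E s φ) (sepPoint z x.1 x.2)) (x.2 l) *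
        ∏ l' ∈ Finset.univ.erase l, (g (x.2 l') / (x.2 l - x.2 l'))) := by
  obtain _ | m := m
  · exact l.elim0
  have hibr : (i : ℝ) + b ≤ 1 := by exact_mod_cast hib
  have hγ := rhoExponent_re hj hn
  push_cast at hγ
  have key (η : ℝ) (hη : 0 < η) := h.integral_sepDensity_slice ho hz hj hn φ l hgm hg
    (s := rhoExponent (m + 1) j + η) (b := b) (by rw [Complex.add_re, Complex.ofReal_re]; linarith)
  have e (η : ℝ) (x : ℂ × (Fin (m + 1) → ℂ)) : sepDensity z j χ (rhoExponent (m + 1) j + η) x * (x.1⁻¹ ^ b *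
      (nodeSum z (fun s => planeWavePairing (hamT z j E s φ) (sepPoint z x.1 x.2)) (x.2 l) *
        ∏ l' ∈ Finset.univ.erase l, (g (x.2 l') / (x.2 l - x.2 l')))) =
      sepDensity z j χ (rhoExponent (m + 1) j + η) x * (x.1⁻¹ ^ b *
      ∏ l' ∈ Finset.univ.erase l, (g (x.2 l') / (x.2 l - x.2 l'))) *
      nodeSum z (fun s => planeWavePairing (hamT z j E s φ) (sepPoint z x.1 x.2)) (x.2 l) := by ring
  simp only [VanishesInLimit, e]
  refine ⟨fun η hη _ => (key η hη).1, ?_⟩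
  refine tendsto_const_nhds.congr' ?_
  filter_upwards [self_mem_nhdsWithin] with η hη using ((key η hη).2).symm

end negligible

variable (φ : 𝓢(Fin n → ℂ, ℂ))

theorem planeWavePairing_eulerTranspose_sub_smul (c : ℂ) (ψ : 𝓢(Fin n → ℂ, ℂ)) (k : Fin n → ℂ) :
    planeWavePairing (eulerTranspose (φ - c • ψ)) k =
      planeWavePairing (eulerTranspose φ) k - c * planeWavePairing (eulerTranspose ψ) k := by
  simp only [planeWavePairing_eulerTranspose, map_sub, map_smul, planeWavePairing_sub, planeWavePairing_smul,
    Finset.mul_sum, ← Finset.sum_sub_distrib]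
  exact Finset.sum_congr rfl fun _ _ => by ring

/-- The second order Euler operator factorizes. -/
theorem planeWavePairing_euler_factor (a a' : ℂ) (k : Fin n → ℂ) :
    planeWavePairing (eulerTranspose (eulerTranspose φ - a' • φ) - a • (eulerTranspose φ - a' • φ)) k =
      planeWavePairing (eulerTranspose (eulerTranspose φ) - (a + a') • eulerTranspose φ + (a * a') • φ) k := by
  simp only [planeWavePairing_add, planeWavePairing_sub, planeWavePairing_smul,
    planeWavePairing_eulerTranspose_sub_smul]
  ring

theorem norm_sub_le_mul_one_add (w y : ℂ) : ‖w - y‖ ≤ (1 + ‖w‖) * (1 + ‖y‖) := by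
  nlinarith [norm_sub_le w y, norm_nonneg w, norm_nonneg y]

theorem sum_sepPoint (hz : Function.Injective z) (hn : n = m + i + 2) (ρ : ℂ) (y : Fin m → ℂ) :
    ∑ r, sepPoint z ρ y r = 0 := by
  have := sum_pow_mul_sepPoint hz ρ y 0 (by omega)
  simpa [show m + 1 ≠ n by omega] using this

section equations

variable (h : IsOperSolution z j E χ) (ho : IsOper z j E) (hz : Function.Injective z)
  (hj : ∀ r, (j r).re = -1 / 2)
include h ho hz hj

/-- Interpolation writes the Hamiltonian as ∑ z_s h_s times ∏(z_r - y_l), plus slice terms, which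
vanish by the oper equation. The quantity ∑ z_s h_s contains the factor Euler - J, the one matched
to γ for i = b = 0. -/
theorem IsOperSolution.vanishesInLimit_ham_zero (hn : n = m + 0 + 2) (hm : 1 ≤ m) (r : Fin n) :
    VanishesInLimit (m := m) z j χ fun x =>
      nodeDen z r * planeWavePairing (hamT z j E r φ) (sepPoint z x.1 x.2) := by
  set J := ∑ r, j r with hJ
  -- The other Euler factor is put into the test function.
  set ψ := eulerTranspose φ - (J + 1) • φ with hψ
  have h1 := ((h.isNegligible_prod (i := 0) ho hz hj hn (by omega) r).vanishesInLimit (i := 0) hz hj hn (by omega) ψ).const_mul (-1)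
  have h2 := VanishesInLimit.sum Finset.univ fun l (_ : l ∈ Finset.univ) =>
    h.vanishesInLimit_slice (i := 0) ho hz hj hn (b := 0) (by omega) φ l (g := fun y => z r - y) (by fun_prop)
      (norm_sub_le_mul_one_add (z r))
  refine (h1.add h2).congr fun x _ hy => ?_
  have hk := sum_sepPoint (i := 0) hz hn x.1 x.2
  rw [(nodeDen_mul_eq_of_add_two hz hn hm (sum_planeWavePairing_hamT φ hz ho) hy).1 r,
    sum_node_planeWavePairing_hamT φ hz ho hk]
  have h3 := planeWavePairing_euler_factor φ J (J + 1) (sepPoint z x.1 x.2)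
  rw [show J + (J + 1) = 2 * J + 1 by ring] at h3
  rw [← h3]
  simp only [← hJ, Nat.cast_zero, add_zero, pow_zero, one_mul]
  ring

/-- For i = 0 one has ∑ z_r k_r = ρ, so the identity for ∑ z_s² h_s can be solved for D⁻ after
division by ρ. With b = 1 the matching Euler factor is Euler - J - 1, which both remaining terms
contain. The factor ∑ z_s - ∑ y_l over ρ is where the anomaly could arise. -/
theorem IsOperSolution.vanishesInLimit_minus (hn : n = m + 0 + 2) (hm : 1 ≤ m) :
    VanishesInLimit (m := m) z j χ fun x =>
      planeWavePairing (∑ r, minusT j r φ) (sepPoint z x.1 x.2) := by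
  set J := ∑ r, j r with hJ
  set ψ := eulerTranspose φ - J • φ with hψ
  have hf : IsNegligible (m := m) z j χ 1 fun y => (∑ s, z s) * 1 + (-1) * ∑ l, y l :=
    ((h.isNegligible_one (i := 0) ho hz hj hn (by omega)).const_mul _).add
      ((IsNegligible.sum _ fun l _ => h.isNegligible_coord (i := 0) ho hz hj hn (by omega) l).const_mul _)
  have h1 := (hf.vanishesInLimit (i := 0) hz hj hn (by omega) ψ).const_mul (-1)
  have h2 := VanishesInLimit.sum Finset.univ fun l (_ : l ∈ Finset.univ) =>
    h.vanishesInLimit_slice (i := 0) ho hz hj hn (b := 1) (by omega) φ l (g := fun _ => 1) (by fun_prop) (A := 1)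
      (fun y => by simp)
  have h3 := ((h.isNegligible_one (i := 0) ho hz hj (b := 1) hn (by omega)).vanishesInLimit (i := 0) hz hj hn (by omega)
    (hatZeroT z j φ)).const_mul 2
  refine ((h1.add h2).add h3).congr fun x hx hy => ?_
  have hk := sum_sepPoint (i := 0) hz hn x.1 x.2
  have hk1 : ∑ r, z r * sepPoint z x.1 x.2 r = x.1 := by
    have := sum_pow_mul_sepPoint hz x.1 x.2 1 (by omega)
    simpa [show 1 + m + 1 = n by omega] using this
  have h4 := (nodeDen_mul_eq_of_add_two hz hn hm (sum_planeWavePairing_hamT (k := sepPoint z x.1 x.2) φ hz ho) hy).2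
  have h5 := sum_node_sq_planeWavePairing_hamT (j := j) (E := E) φ hz ho hk
  rw [hk1] at h5
  rw [sum_node_planeWavePairing_hamT φ hz ho hk, h5] at h4
  have h6 := planeWavePairing_euler_factor φ (J + 1) J (sepPoint z x.1 x.2)
  rw [show J + 1 + J = 2 * J + 1 by ring, mul_comm (J + 1)] at h6
  rw [← h6] at h4
  simp only [← hJ, Nat.cast_zero, Nat.cast_one, add_zero, pow_one, mul_one, ← Finset.mul_sum]
  rw [add_comm (1 : ℂ) J] at h4
  have h7 : x.1⁻¹ * x.1 = 1 := inv_mul_cancel₀ hx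
  linear_combination (-x.1⁻¹) * h4 + planeWavePairing (∑ r, minusT j r φ) (sepPoint z x.1 x.2) * h7

/-- For i = 1 the matching Euler factor is Euler - J - 1, and it divides both ∑ z_s h_s and ∑ z_s²
h_s, because ∑ z_r k_r = 0 removes the D⁻ term. The factor ∑ y_l from the linear quotient is the
critical one. -/
theorem IsOperSolution.vanishesInLimit_ham_one (hn : n = m + 1 + 2) (r : Fin n) :
    VanishesInLimit (m := m) z j χ fun x =>
      nodeDen z r * planeWavePairing (hamT z j E r φ) (sepPoint z x.1 x.2) := by
  set J := ∑ r, j r with hJ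
  set ψ := eulerTranspose φ - J • φ with hψ
  have hp := h.isNegligible_prod (i := 1) ho hz hj hn (by omega) r
  have hf : IsNegligible (m := m) z j χ 0 fun y => (z r - ∑ s, z s) * ∏ l, (z r - y l) +
      ∑ l, y l * ∏ l', (z r - y l') :=
    (hp.const_mul _).add (IsNegligible.sum _ fun l _ => h.isNegligible_coord_mul_prod (i := 1) ho hz hj hn (by omega) l r)
  have h1 := (hf.vanishesInLimit (i := 1) hz hj hn (by omega) ψ).const_mul (-1)
  have h2 := VanishesInLimit.sum Finset.univ fun l (_ : l ∈ Finset.univ) =>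
    h.vanishesInLimit_slice (i := 1) ho hz hj hn (b := 0) (by omega) φ l (g := fun y => z r - y) (by fun_prop)
      (norm_sub_le_mul_one_add (z r))
  have h3 := (hp.vanishesInLimit (i := 1) hz hj hn (by omega) (hatZeroT z j φ)).const_mul (-2)
  refine ((h1.add h2).add h3).congr fun x hx hy => ?_
  have hk := sum_sepPoint (i := 1) hz hn x.1 x.2
  have hk1 : ∑ r, z r * sepPoint z x.1 x.2 r = 0 := by
    have := sum_pow_mul_sepPoint hz x.1 x.2 1 (by omega)
    simpa [show 1 + m + 1 ≠ n by omega] using this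
  have h5 := sum_node_sq_planeWavePairing_hamT (j := j) (E := E) φ hz ho hk
  rw [hk1, zero_mul, add_zero] at h5
  rw [nodeDen_mul_eq_of_add_three hz hn (sum_planeWavePairing_hamT φ hz ho) hy r,
    sum_node_planeWavePairing_hamT φ hz ho hk, h5]
  have h6 := planeWavePairing_euler_factor φ (J + 1) J (sepPoint z x.1 x.2)
  rw [show J + 1 + J = 2 * J + 1 by ring, mul_comm (J + 1)] at h6
  rw [← h6, add_comm (1 : ℂ) J]
  simp only [← hJ, Nat.cast_zero, Nat.cast_one, add_zero, pow_zero, one_mul, ← Finset.sum_mul]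
  ring

end equations

end Equations

/-! ### From momentum space to the distribution Θ. -/

section Distribution

variable {n : ℕ}

/-! ### Operators on distributions and their transposes -/

variable {m i : ℕ} {z j E : Fin n → ℂ} {χ : ℂ → ℂ} (Θ : 𝓢'(Fin n → ℂ, ℂ)) (φ : 𝓢(Fin n → ℂ, ℂ))

theorem mulX_apply_apply (r : Fin n) : mulX r Θ φ = Θ (coordMul r φ) := rfl

theorem partialX_apply_apply (r : Fin n) : partialX r Θ φ = Θ (-coordDeriv r φ) := by
  have h1 (v : Fin n → ℂ) : LineDeriv.lineDerivOpCLM ℂ 𝓢'(Fin n → ℂ, ℂ) v Θ φ =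
      -Θ (LineDeriv.lineDerivOpCLM ℂ 𝓢(Fin n → ℂ, ℂ) v φ) := by
    rw [← map_neg]; rfl
  have h2 : partialX r Θ φ = (1 / 2 : ℂ) *
      (LineDeriv.lineDerivOpCLM ℂ 𝓢'(Fin n → ℂ, ℂ) (Pi.single r 1 : Fin n → ℂ) Θ φ -
      Complex.I * LineDeriv.lineDerivOpCLM ℂ 𝓢'(Fin n → ℂ, ℂ) (Pi.single r Complex.I : Fin n → ℂ) Θ φ) := rfl
  have h3 : coordDeriv r φ = (1 / 2 : ℂ) •
      (LineDeriv.lineDerivOpCLM ℂ 𝓢(Fin n → ℂ, ℂ) (Pi.single r 1 : Fin n → ℂ) φ -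
      Complex.I • LineDeriv.lineDerivOpCLM ℂ 𝓢(Fin n → ℂ, ℂ) (Pi.single r Complex.I : Fin n → ℂ) φ) := rfl
  rw [h2, h1, h1, h3, map_neg, map_smul, map_sub, map_smul, smul_eq_mul, smul_eq_mul]
  ring

theorem localPlus_apply_apply (r : Fin n) : localPlus r Θ φ = Θ (plusT r φ) := partialX_apply_apply Θ φ r

theorem localZero_apply_apply (r : Fin n) : localZero j r Θ φ = Θ (zeroT j r φ) := by
  have h1 : localZero j r Θ φ = mulX r (partialX r Θ) φ - j r * Θ φ := rfl
  rw [h1, mulX_apply_apply, partialX_apply_apply, zeroT, map_sub, map_smul, smul_eq_mul]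

theorem localMinus_apply_apply (r : Fin n) : localMinus j r Θ φ = Θ (minusT j r φ) := by
  have h1 : localMinus j r Θ φ = mulX r (mulX r (partialX r Θ)) φ - 2 * j r * mulX r Θ φ := rfl
  rw [h1, mulX_apply_apply, mulX_apply_apply, mulX_apply_apply, partialX_apply_apply, minusT, map_sub, map_smul,
    smul_eq_mul]

/-- Transposition reverses products, which is why `casimirT` applies the operators with index r
before those with index s. -/
theorem casimir_apply_apply (r s : Fin n) : casimir j r s Θ φ = Θ (casimirT j r s φ) := by
  have h1 : casimir j r s Θ φ = localZero j r (localZero j s Θ) φ -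
      1 / 2 * (localPlus r (localMinus j s Θ) φ + localMinus j r (localPlus s Θ) φ) := rfl
  rw [h1, localZero_apply_apply, localZero_apply_apply, localPlus_apply_apply, localMinus_apply_apply,
    localMinus_apply_apply, localPlus_apply_apply, casimirT, map_sub, map_smul, map_add, smul_eq_mul]

theorem op_sum_apply_apply {ι : Type*} (s : Finset ι) (A : ι → Op n) :
    (∑ l ∈ s, A l) Θ φ = ∑ l ∈ s, A l Θ φ := by
  classical
  induction s using Finset.induction_on with
  | empty => simp
  | insert a t ha ih =>
    rw [Finset.sum_insert ha, Finset.sum_insert ha, ← ih]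
    rfl

theorem hamiltonian_sub_apply (r : Fin n) : hamiltonian z j r Θ φ - E r * Θ φ = Θ (hamT z j E r φ) := by
  have h1 : hamiltonian z j r Θ φ =
      -2 * (∑ s ∈ Finset.univ.erase r, (1 / (z r - z s)) • casimir j r s) Θ φ := rfl
  have h2 (s : Fin n) : ((1 / (z r - z s)) • casimir j r s) Θ φ = 1 / (z r - z s) * Θ (casimirT j r s φ) := by
    rw [← casimir_apply_apply]; rfl
  rw [h1, op_sum_apply_apply, hamT, map_sub, map_smul, map_smul, map_sum, smul_eq_mul, smul_eq_mul]
  congr 2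
  exact Finset.sum_congr rfl fun s _ => by rw [h2, map_smul, smul_eq_mul]

/-! ### The distribution -/

theorem IsOperSolution.exists_integral_amplitude (h : IsOperSolution z j E χ) (ho : IsOper z j E)
    (hz : Function.Injective z) (hj : ∀ r, (j r).re = -1 / 2) (hn : n = m + i + 2) (hi : i ≤ 1) :
    ∃ (C M : ℂ) (K : ℕ), ∀ ψ : 𝓢(Fin n → ℂ, ℂ),
      Integrable (fun x : ℂ × (Fin m → ℂ) => sepDensity z j χ (rhoExponent m j) x *
        planeWavePairing ψ (sepPoint z x.1 x.2)) ∧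
      Integrable (fun k => amplitude i z j χ k * planeWavePairing ψ k) (deltaMeasure i z) ∧
      ∫ k, amplitude i z j χ k * planeWavePairing ψ k ∂(deltaMeasure i z) =
        C * ∫ x : ℂ × (Fin m → ℂ), sepDensity z j χ (rhoExponent m j) x *
          planeWavePairing ψ (sepPoint z x.1 x.2) ∧
      ‖∫ x : ℂ × (Fin m → ℂ), sepDensity z j χ (rhoExponent m j) x *
          planeWavePairing ψ (sepPoint z x.1 x.2)‖ ≤ ‖M‖ * waveGauge K ψ := by
  have hnr : (n : ℝ) = m + i + 2 := by exact_mod_cast hn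
  have hir : (i : ℝ) ≤ 1 := by exact_mod_cast hi
  have hm0 : (0 : ℝ) ≤ m := m.cast_nonneg
  have hγ := rhoExponent_re hj hn
  obtain ⟨C, hC⟩ := exists_integral_deltaMeasure hz hn
  obtain ⟨c, hc⟩ := amplitude_sepPoint (j := j) (χ := χ) hz hn
  obtain ⟨A, hA, hb⟩ := h.exists_norm_sepDensity_mul_le ho hz hj (f := fun _ : Fin m → ℂ => 1)
    (τ := fun _ => 2 * (m - 1)) (A := 1) fun y => by simpa using discAbs_le y
  have hb0 := hb (rhoExponent m j) 0
  simp only [pow_zero, mul_one, Nat.cast_zero, sub_zero] at hb0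
  obtain ⟨M, K, hM⟩ := exists_integral_norm_mul_planeWavePairing_le hz (by omega) (p := (rhoExponent m j).re)
    (by linarith) (fun _ => by linarith) (h.measurable_sepDensity hj _).aestronglyMeasurable hb0
  refine ⟨C * c, (|M| : ℝ), K, fun ψ => ?_⟩
  have key : (fun x : ℂ × (Fin m → ℂ) => c * (sepDensity z j χ (rhoExponent m j) x *
      planeWavePairing ψ (sepPoint z x.1 x.2))) =ᵐ[volume] fun x =>
      ((‖x.1‖ ^ (2 * m) * discAbs x.2 : ℝ) : ℂ) * (amplitude i z j χ (sepPoint z x.1 x.2) *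
        planeWavePairing ψ (sepPoint z x.1 x.2)) := by
    filter_upwards [ae_notMem_range_pi (m := m) z] with x hx
    rw [← mul_assoc, ← mul_assoc, hc x hx.1]
  obtain ⟨h1, h2⟩ := hC (fun k => amplitude i z j χ k * planeWavePairing ψ k) (((hM ψ).1.const_mul c).congr key)
  refine ⟨(hM ψ).1, h1, ?_, ?_⟩
  · rw [h2, ← integral_congr_ae key, integral_const_mul, mul_assoc]
  · refine (hM ψ).2.trans (mul_le_mul_of_nonneg_right ?_ (waveGauge_nonneg K ψ))
    simpa using le_abs_self M

theorem exists_isTheta {D : ℂ × (Fin m → ℂ) → ℂ} {C M : ℂ} {K : ℕ}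
    (h : ∀ ψ : 𝓢(Fin n → ℂ, ℂ),
      Integrable (fun x => D x * planeWavePairing ψ (sepPoint z x.1 x.2)) ∧
      Integrable (fun k => amplitude i z j χ k * planeWavePairing ψ k) (deltaMeasure i z) ∧
      ∫ k, amplitude i z j χ k * planeWavePairing ψ k ∂(deltaMeasure i z) =
        C * ∫ x, D x * planeWavePairing ψ (sepPoint z x.1 x.2) ∧
      ‖∫ x, D x * planeWavePairing ψ (sepPoint z x.1 x.2)‖ ≤ ‖M‖ * waveGauge K ψ) :
    ∃ Θ : 𝓢'(Fin n → ℂ, ℂ), IsTheta i z j χ Θ ∧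
      ∀ ψ, Θ ψ = C * ∫ x, D x * planeWavePairing ψ (sepPoint z x.1 x.2) := by
  let L : 𝓢(Fin n → ℂ, ℂ) →ₗ[ℂ] ℂ :=
    { toFun := fun ψ => C * ∫ x, D x * planeWavePairing ψ (sepPoint z x.1 x.2)
      map_add' := fun ψ ψ' => by
        simp only [planeWavePairing_add, mul_add]
        rw [integral_add (h ψ).1 (h ψ').1, mul_add]
      map_smul' := fun c ψ => by
        simp only [planeWavePairing_smul, mul_left_comm _ c]
        rw [integral_const_mul, RingHom.id_apply, smul_eq_mul, mul_left_comm] }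
  have hL : Continuous L := by
    -- A linear functional need only be continuous at zero, where the continuous gauge `waveGauge K`
    -- vanishes and dominates it.
    refine continuous_of_continuousAt_zero L ?_
    rw [ContinuousAt, map_zero]
    refine squeeze_zero_norm (a := fun ψ => ‖C‖ * (‖M‖ * waveGauge K ψ)) (fun ψ => ?_) ?_
    · have : L ψ = C * ∫ x, D x * planeWavePairing ψ (sepPoint z x.1 x.2) := rfl
      rw [this, norm_mul]
      exact mul_le_mul_of_nonneg_left (h ψ).2.2.2 (norm_nonneg C)
    · have := ((continuous_waveGauge (n := n) K).tendsto' 0 0 (waveGauge_zero K)).const_mul ‖M‖ |>.const_mul ‖C‖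
      simpa using this
  refine ⟨ContinuousLinearMap.toPointwiseConvergenceCLM _ _ _ _ ⟨L, hL⟩, fun ψ => ⟨(h ψ).2.1, ?_⟩, fun ψ => rfl⟩
  rw [(h ψ).2.2.1]
  rfl

end Distribution

/-! ### The eigenvalue of D⁰. -/

section Euler

variable {n : ℕ}

variable {m i : ℕ} {z j E : Fin n → ℂ} {χ : ℂ → ℂ}

/-- The Euler equation determines the eigenvalue of `D⁰`. -/
theorem integral_sepDensity_zero (hz : Function.Injective z) (hj : ∀ r, (j r).re = -1 / 2) (hn : n = m + i + 2)
    (hi : i ≤ 1) (φ : 𝓢(Fin n → ℂ, ℂ))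
    (hint : ∀ ψ : 𝓢(Fin n → ℂ, ℂ), Integrable fun x : ℂ × (Fin m → ℂ) => sepDensity z j χ (rhoExponent m j) x *
      planeWavePairing ψ (sepPoint z x.1 x.2)) :
    ∫ x : ℂ × (Fin m → ℂ), sepDensity z j χ (rhoExponent m j) x *
      planeWavePairing (∑ r, zeroT j r φ) (sepPoint z x.1 x.2) =
    i * ∫ x : ℂ × (Fin m → ℂ), sepDensity z j χ (rhoExponent m j) x *
      planeWavePairing φ (sepPoint z x.1 x.2) := by
  have hir : (i : ℝ) ≤ 1 := by exact_mod_cast hi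
  have hm0 : (0 : ℝ) ≤ m := m.cast_nonneg
  have hγ := rhoExponent_re hj hn
  have h1 := integral_sepDensity_euler (χ := χ) hz (by omega : m < n) (fun _ => 1) (s := rhoExponent m j) (b := 0)
    (by rw [Nat.cast_zero]; linarith) φ (by simpa using hint _)
  simp only [pow_zero, mul_one] at h1
  have h2 (k : Fin n → ℂ) : planeWavePairing (eulerTranspose φ + (rhoExponent m j / 2 + 1 - (0 : ℕ)) • φ) k =
      planeWavePairing (∑ r, zeroT j r φ) k - i * planeWavePairing φ k := by
    rw [planeWavePairing_add, planeWavePairing_smul, planeWavePairing_eulerTranspose, planeWavePairing_sum,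
      rhoExponent_eq m j hn]
    simp only [planeWavePairing_zeroT, Finset.sum_sub_distrib, ← Finset.sum_mul]
    push_cast
    ring
  simp only [h2, mul_sub, mul_left_comm _ (i : ℂ)] at h1
  rw [integral_sub (hint _) ((hint _).const_mul _), integral_const_mul] at h1
  exact sub_eq_zero.1 h1

end Euler

end Gaudin

end

theorem mainTheorem11 (n : ℕ) (hn : 3 ≤ n) (i : ℕ) (hi : i ≤ 1)
    (z j E : Fin n → ℂ) (hz : Function.Injective z) (hj : ∀ r, (j r).re = -1 / 2)
    (hoper : Gaudin.IsOper z j E)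
    (χ : ℂ → ℂ) (hχ : Gaudin.IsOperSolution z j E χ) :
    ∃ Θ : TemperedDistribution (Fin n → ℂ) ℂ,
      Gaudin.IsTheta i z j χ Θ ∧
      (∀ r, Gaudin.hamiltonian z j r Θ = E r • Θ) ∧
      Gaudin.totalPlus n Θ = 0 ∧
      Gaudin.totalZero j Θ = (i : ℂ) • Θ ∧
      (i = 0 → Gaudin.totalMinus j Θ = 0) ∧
      (i = 1 → Gaudin.hatPlus z Θ = 0) := by
  -- m is the number of separated variables; for n = 3 and i = 1 there are none, and the identities
  -- for i = 1 include this case.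
  obtain ⟨m, hm⟩ : ∃ m, n = m + i + 2 := ⟨n - i - 2, by omega⟩
  obtain ⟨C, M, K, h⟩ := hχ.exists_integral_amplitude hoper hz hj hm hi
  obtain ⟨Θ, hΘ, hΘv⟩ := Gaudin.exists_isTheta h
  have hzero {φ : SchwartzMap (Fin n → ℂ) ℂ} (hφ : ∫ x : ℂ × (Fin m → ℂ),
      Gaudin.sepDensity z j χ (Gaudin.rhoExponent m j) x *
        Gaudin.planeWavePairing φ (Gaudin.sepPoint z x.1 x.2) = 0) : Θ φ = 0 := by
    rw [hΘv, hφ, mul_zero]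
  -- The moments of order at most i vanish identically on the support, without any integration; a =
  -- 0 gives D⁺ and, for i = 1, a = 1 gives D̂⁺.
  have hmoment (a : ℕ) (ha : a ≤ i) (φ : SchwartzMap (Fin n → ℂ) ℂ) :
      Θ (∑ r, z r ^ a • Gaudin.plusT r φ) = 0 := by
    refine hzero (integral_eq_zero_of_ae (.of_forall fun x => ?_))
    have h1 := Gaudin.sum_pow_mul_sepPoint hz x.1 x.2 a (by omega)
    rw [if_neg (by omega)] at h1
    simp only [Gaudin.planeWavePairing_sum, Gaudin.planeWavePairing_smul, Gaudin.planeWavePairing_plusT,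
      ← mul_assoc, ← Finset.sum_mul, h1, Pi.zero_apply, zero_mul, mul_zero]
  refine ⟨Θ, hΘ, fun r => ?_, ?_, ?_, fun h0 => ?_, fun h1 => ?_⟩
  · ext φ
    have key : Θ (Gaudin.hamT z j E r φ) = 0 := by
      refine hzero ?_
      have h2 : Gaudin.VanishesInLimit (m := m) z j χ fun x => Gaudin.nodeDen z r *
          Gaudin.planeWavePairing (Gaudin.hamT z j E r φ) (Gaudin.sepPoint z x.1 x.2) := by
        obtain rfl | rfl : i = 0 ∨ i = 1 := by omega
        · exact hχ.vanishesInLimit_ham_zero φ hoper hz hj hm (by omega) r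
        · exact hχ.vanishesInLimit_ham_one φ hoper hz hj hm r
      have h3 := h2.const_mul (Gaudin.nodeDen z r)⁻¹
      simp only [inv_mul_cancel_left₀ (Gaudin.nodeDen_ne_zero hz r)] at h3
      -- The unregularized integral converges absolutely, so it equals the limit of the regularized
      -- ones, which is zero.
      exact h3.integral_eq_zero (h _).1
    exact sub_eq_zero.1 ((Gaudin.hamiltonian_sub_apply Θ φ r).trans key)
  · ext φ
    have h1 := hmoment 0 (Nat.zero_le i) φ
    simp only [pow_zero, one_smul, map_sum] at h1
    rw [Gaudin.totalPlus, Gaudin.op_sum_apply_apply]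
    simp only [Gaudin.localPlus_apply_apply]
    exact h1
  · ext φ
    rw [Gaudin.totalZero, Gaudin.op_sum_apply_apply]
    simp only [Gaudin.localZero_apply_apply]
    rw [← map_sum]
    have h1 := Gaudin.integral_sepDensity_zero hz hj hm hi φ fun ψ => (h ψ).1
    have h2 : ((i : ℂ) • Θ) φ = i * Θ φ := rfl
    rw [h2, hΘv, hΘv, h1, mul_left_comm]
  · subst h0
    ext φ
    rw [Gaudin.totalMinus, Gaudin.op_sum_apply_apply]
    simp only [Gaudin.localMinus_apply_apply]
    rw [← map_sum]
    exact hzero ((hχ.vanishesInLimit_minus φ hoper hz hj hm (by omega)).integral_eq_zero (h _).1)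
  · ext φ
    have h2 := hmoment 1 h1.ge φ
    simp only [pow_one, map_sum, map_smul] at h2
    rw [Gaudin.hatPlus, Gaudin.op_sum_apply_apply]
    simp only [← Gaudin.localPlus_apply_apply] at h2
    exact h2
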